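/- Let $\beta\in\mathbb C^*$ with a chosen square root $\beta^{1/2}$, and put $\mathscr Q=\beta^{1/2}-\beta^{-1/2}$, $\epsilon_1=\hbar\beta^{1/2}$, $\epsilon_2=-\hbar\beta^{-1/2}$. Let $m\in\mathbb C^*$ and $\mu,\nu\in\mathbb C$. **Curves.** Let $\mathcal C\cong\mathbf P^1$ be the compactified double cover $y^2=Q(x)$, with $Q(x)=\frac{x^2}{4}-m$ (Weber curve) or $Q(x)=\frac{x+4m}{4x}$ (Whittaker curve), $\sigma$ its sheet involution, $\mathcal R$ the set of (two) ramification points of $x$, and $\infty_\pm$ the two poles of $y\,dx$, labelled so that $\operatorname{Res}_{\infty_\pm}y\,dx=\pm m$. Let $B=\frac{dz_1dz_2}{(z_1-z_2)^2}$ and $\eta_p(p_0)=\int_{\sigma(p)}^pB(p_0,\cdot)$. **Refined topological recursion.** For $2g,n\in\mathbb Z_{\ge0}$ define multidifferentials $\omega_{g,n+1}$ by $\omega_{0,1}=y\,dx$, $\omega_{0,2}(p_0,p_1)=-B(\sigma(p_0),p_1)$, $\omega_{\frac12,1}=\frac{\mathscr Q}{2}\left(-\frac{dy}{y}+\mu\,\eta_{\infty_+}\right)$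 and, for $2g-2+n\ge0$, with $J=(p_1,\dots,p_n)$ and $J_0=(p_0,J)$, $$\omega_{g,n+1}(p_0,J)=-\sum_{r\in\mathcal R\,\cup\,\sigma(J_0)\,\cup\,\{\infty_+\}}\operatorname*{Res}_{p=r}\frac{\eta_p(p_0)}{2\omega_{0,1}(p)}\operatorname{Rec}_{g,n+1}(p,J),$$ $$\operatorname{Rec}_{g,n+1}(p,J)=\sum_{i=1}^n\frac{dx(p)\,dx(p_i)}{(x(p)-x(p_i))^2}\,\omega_{g,n}(p,J\setminus p_i)+\sum^{*}_{\substack{g_1+g_2=g\\J_1\sqcup J_2=J}}\omega_{g_1,|J_1|+1}(p,J_1)\,\omega_{g_2,|J_2|+1}(p,J_2)+\omega_{g-1,n+2}(p,p,J)+\mathscr Q\,dx(p)\,d_p\!\left(\frac{\omega_{g-\frac12,n+1}(p,J)}{dx(p)}\right),$$ where $*$ means that terms containing $\omega_{0,1}$ are omitted, and terms with negative genus are zero. **Voros coefficient.** Let $\nu_\pm=\frac{1\pm\nu}{2}$ and $\int_{D(z)}\omega=\nu_+\int_{\infty_+}^z\omega+\nu_-\int_{\infty_-}^z\omega$. The wave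 function of the refined quantum curve is $$\psi=\exp\Big(\sum_{g\in\frac12\mathbb Z_{\ge0},\,n\ge1}\frac{\hbar^{2g-2+n}}{\beta^{n/2}n!}\int_{D(z)}\!\cdots\int_{D(z)}\omega_{g,n}\Big).$$ Let $T\,dz=d\log\psi$, let $T_{\rm odd}\,dz=\frac12(T\,dz-\sigma^*(T\,dz))$, let $T^{\ge1}_{\rm odd}$ be its part of order $\ge1$ in $\hbar$, and let $V(\nu)=V_\alpha(\nu)=\int_\alpha T^{\ge1}_{\rm odd}\,dz\in\hbar\,\mathbb C[[\hbar]]$ (termwise integral), where $\alpha$ is a path from $\infty_-$ to $\infty_+$ avoiding the ramification points. **Claim.** The termwise integrals converge, and the following identities of formal power series in $\hbar$ hold for all $\nu\in\mathbb C$ (each $\log(m+a\hbar)$ is expanded at $\hbar=0$ with one fixed value of $\log m$). * Weber curve: $$V(\nu+2\beta)-V(\nu)=-\log\left(m+\hbar\frac{\mathscr Q\mu}{2}+\frac{\epsilon_2}{2}\nu-\frac{\epsilon_1}{2}\right)+\log m;$$ in particular $V(\beta)-V(-\beta)=-\log\left(m+\hbar\frac{\mathscr Q\mu}{2}\right)+\log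 m$. * Whittaker curve: $$V(\nu-2\beta)-V(\nu)=\log\left(m+\hbar\frac{\mathscr Q\mu}{2}+\frac{\epsilon_2}{2}\nu+\frac{\epsilon_1}{2}+\frac{\epsilon_1+\epsilon_2}{2}\right)+\log\left(m+\hbar\frac{\mathscr Q\mu}{2}+\frac{\epsilon_2}{2}\nu+\frac{\epsilon_1}{2}-\frac{\epsilon_1+\epsilon_2}{2}\right)-2\log m;$$ in particular $$V(\beta)-V(-\beta)=-\log\left(m+\hbar\frac{\mathscr Q\mu}{2}+\frac{\hbar\mathscr Q}{2}\right)-\log\left(m+\hbar\frac{\mathscr Q\mu}{2}-\frac{\hbar\mathscr Q}{2}\right)+2\log m.$$ -/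

import Mathlib

/-!
Every curve below is parametrised by a global coordinate `z` on the compact Riemann surface
`C ≅ P¹`, normalised so that
  `σ z = 1 / z` is the involution exchanging the two sheets, the ramification points of `x` are
  `z = 1` and `z = -1`, and the two poles of `y dx` are `∞₊` (at `z = 0`) and `∞₋` (at `z = ∞`).
A multidifferential `f(z₀, …, zₙ) dz₀ ⋯ dzₙ` is represented by its coefficient `f`.
A half-integer genus `g` is represented by the natural number `h = 2g`.
-/

namespace RefinedTR

/-- The residue at `r` of `f(z) dz`: the value of `(2πi)⁻¹ ∮ f(z) dz` over small circles
around `r` (eventually constant in the radius when `r` is at most an isolated singularity). -/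
noncomputable def residue (f : ℂ → ℂ) (r : ℂ) : ℂ :=
  Filter.limUnder (nhdsWithin (0 : ℝ) (Set.Ioi 0))
    fun ε : ℝ => (2 * (Real.pi : ℂ) * Complex.I)⁻¹ * ∮ z in C(r, ε), f z

/-- The data of a genus zero degree two refined spectral curve in a normalised coordinate:
the functions `x`, `y`, and the divisor `D(μ) = μ [∞₊]`. -/
structure SpectralCurve where
  x : ℂ → ℂ
  y : ℂ → ℂ
  μ : ℂ

/-- The Weber curve `y² = x² / 4 - m`, where `s² = m`. -/
noncomputable def weber (s μ : ℂ) : SpectralCurve where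
  x z := s * (z + z⁻¹)
  y z := -(s / 2) * (z - z⁻¹)
  μ := μ

/-- The Whittaker curve `y² = (x + 4m) / (4x)`. -/
noncomputable def whittaker (m μ : ℂ) : SpectralCurve where
  x z := m * (z + z⁻¹ - 2)
  y z := (z + 1) / (2 * (z - 1))
  μ := μ

namespace SpectralCurve

variable (S : SpectralCurve)

/-- The coefficient of `dx`. -/
noncomputable def dx (z : ℂ) : ℂ := deriv S.x z

/-- `ω_{0,1} = y dx`. -/
noncomputable def ydx (z : ℂ) : ℂ := S.y z * S.dx z

/-- `η_p(z₀) = ∫_{σ p}^{p} B(z₀, ·)` for the bidifferential `B = dz₁ dz₂ / (z₁ - z₂)²`. -/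
noncomputable def eta (p z₀ : ℂ) : ℂ := 1 / (z₀ - p) - 1 / (z₀ - p⁻¹)

/-- `ω_{0,2}(z₀, z₁) = -B(σ z₀, z₁)`. Since `d(1 / z₀) = -dz₀ / z₀²`, its coefficient is
`(1 / z₀²) / (1 / z₀ - z₁)² = 1 / (1 - z₀ z₁)²`. -/
noncomputable def omega02 (z₀ z₁ : ℂ) : ℂ := 1 / (1 - z₀ * z₁) ^ 2

/-- `ω_{1/2,1} = (Q / 2) (- dy / y + μ η_{∞₊})`, where `η_{∞₊} = ∫_{∞}^{0} B(z₀, ·) = dz₀ / z₀`. -/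
noncomputable def omegaHalf1 (Q z₀ : ℂ) : ℂ :=
  Q / 2 * (-(deriv S.y z₀ / S.y z₀) + S.μ * (1 / z₀))

/-- The expression `Rec_{g,n+1}(p, J)` (a quadratic differential in `p`, with `h = 2g`), formed
from a family `W h' p J'` playing the role of `ω_{g',n'+1}(p, J')`.
The sum over `J.antidiagonal` runs over all ordered splittings `J = J₁ ⊔ J₂`;
the terms that involve `ω_{0,1}` are left out. -/
noncomputable def Rec (Q : ℂ) (W : ℕ → ℂ → Multiset ℂ → ℂ) (h : ℕ) (p : ℂ) (J : Multiset ℂ) : ℂ :=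
  (J.map fun a => S.dx p * S.dx a / (S.x p - S.x a) ^ 2 * W h p (J.erase a)).sum
  + ∑ g ∈ Finset.HasAntidiagonal.antidiagonal h, (J.antidiagonal.map fun K =>
      if (g.1 = 0 ∧ K.1 = 0) ∨ (g.2 = 0 ∧ K.2 = 0) then 0
      else W g.1 p K.1 * W g.2 p K.2).sum
  + (if 2 ≤ h then W (h - 2) p (p ::ₘ J) else 0)
  + (if 1 ≤ h then Q * S.dx p * deriv (fun q => W (h - 1) q J / S.dx q) p else 0)

/-- The points at which residues are taken: `R = {1, -1}`, `P'₊ = {∞₊} = {0}`, and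
`σ(z₀), σ(z₁), …, σ(zₙ)`. -/
noncomputable def residuePoints (z₀ : ℂ) (J : Multiset ℂ) : Finset ℂ :=
  {1, -1, 0} ∪ (insert z₀ J.toFinset).image fun z => z⁻¹

/-- The multidifferential `ω_{g,n+1}(z₀, J)` of the refined topological recursion, with `h = 2g`
and `J = (z₁, …, zₙ)`. The guard `h' + |J'| < h + |J|` only makes the recursion well-founded:
it holds in every term of `Rec` (see `omega_eq`). -/
noncomputable def omega (Q : ℂ) (h : ℕ) (z₀ : ℂ) (J : Multiset ℂ) : ℂ :=
  if h + J.card ≤ 1 then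
    if h = 1 then S.omegaHalf1 Q z₀
    else if J = 0 then S.ydx z₀
    else (J.map fun a => omega02 z₀ a).sum
  else
    -∑ r ∈ residuePoints z₀ J, residue (fun p => eta p z₀ / (2 * S.ydx p) *
      S.Rec Q (fun h' q J' =>
        if _hlt : h' + J'.card < h + J.card then omega Q h' q J' else 0) h p J) r
termination_by h + J.card

/-- One-variable integration along the divisor `D(z) = ν₊[∞₊] + ν₋[∞₋]`:
`ν₊ ∫_{∞₊}^{z} f + ν₋ ∫_{∞₋}^{z} f`, along the ray through `z` (from `0`, resp. from `∞`). -/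
noncomputable def divisorIntegral (ν z : ℂ) (f : ℂ → ℂ) : ℂ :=
  (1 + ν) / 2 * (∫ t in Set.Ioc (0 : ℝ) 1, f (t * z) * z)
  + (1 - ν) / 2 * (-∫ t in Set.Ioi (1 : ℝ), f (t * z) * z)

/-- The `n`-fold iterated integral along `D(z)`, starting with the last variable. -/
noncomputable def iteratedDivisorIntegral (ν z : ℂ) : ℕ → (Multiset ℂ → ℂ) → ℂ
  | 0, f => f 0
  | n + 1, f => divisorIntegral ν z fun a =>
      iteratedDivisorIntegral ν z n fun J => f (a ::ₘ J)

/-- `∫_{D(z)} ⋯ ∫_{D(z)} ω_{g,n+1}`, with `h = 2g`. -/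
noncomputable def omegaIntegral (Q ν : ℂ) (h n : ℕ) (z : ℂ) : ℂ :=
  divisorIntegral ν z fun z₀ => iteratedDivisorIntegral ν z n fun J => S.omega Q h z₀ J

/-- The parameter `Q = β^{1/2} - β^{-1/2}`, where `b = β^{1/2}`. -/
noncomputable def refinement (b : ℂ) : ℂ := b - b⁻¹

/-- For `k ≥ 1`, the coefficient of `ħ^k` in `log ψ`, as a function of `z`:
the sum of `(β^{n/2} n!)⁻¹ ∫_{D(z)} ⋯ ∫_{D(z)} ω_{g,n}` over `n ≥ 1`, `2g ≥ 0` with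
`2g - 2 + n = k`. -/
noncomputable def logPsi (b ν : ℂ) (k : ℕ) (z : ℂ) : ℂ :=
  ∑ n ∈ Finset.Icc 1 (k + 2),
    1 / (b ^ n * (n.factorial : ℂ)) *
      S.omegaIntegral (refinement b) ν (k + 2 - n) (n - 1) z

/-- For `k ≥ 1`, the coefficient of `ħ^k` in the logarithmic derivative `T(z, ħ)` of `ψ(x(z))`. -/
noncomputable def logDerivPsi (b ν : ℂ) (k : ℕ) (z : ℂ) : ℂ := deriv (S.logPsi b ν k) z

/-- The odd part `T_odd dz = (T dz - σ^* (T dz)) / 2`, where `σ^* dz = d(1 / z) = -dz / z²`. -/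
noncomputable def oddPart (b ν : ℂ) (k : ℕ) (z : ℂ) : ℂ :=
  (S.logDerivPsi b ν k z - S.logDerivPsi b ν k z⁻¹ * (-(z ^ 2)⁻¹)) / 2

/-- The Voros coefficient `V_α = ∫_α T_odd^{≥ 1} dz`, a formal power series in `ħ` without
constant term, for the path `α` running from `∞₋` (`z = ∞`) to `∞₊` (`z = 0`) along the ray
through `u`. -/
noncomputable def voros (u b ν : ℂ) : PowerSeries ℂ :=
  PowerSeries.mk fun k =>
    if k = 0 then 0 else -∫ t in Set.Ioi (0 : ℝ), S.oddPart b ν k (t * u) * u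

/-- All the integrals `∫_α T_odd^{(k)} dz`, `k ≥ 1`, that define `voros` converge absolutely. -/
def VorosConverges (u b ν : ℂ) : Prop :=
  ∀ k : ℕ, 1 ≤ k →
    MeasureTheory.IntegrableOn (fun t : ℝ => S.oddPart b ν k (t * u) * u) (Set.Ioi 0)

/-! ### Consistency of the definitions -/

/-- The guard in the definition of `omega` is harmless: `omega` satisfies the recursion itself. -/
theorem omega_eq (Q : ℂ) (h : ℕ) (z₀ : ℂ) (J : Multiset ℂ) (hJ : 2 ≤ h + J.card) :
    S.omega Q h z₀ J = -∑ r ∈ residuePoints z₀ J,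
      residue (fun p => eta p z₀ / (2 * S.ydx p) * S.Rec Q (S.omega Q) h p J) r := by
  rw [omega, if_neg (by omega)]
  congr 1
  refine Finset.sum_congr rfl fun r _ => ?_
  congr 1
  funext p
  congr 1
  have hW : ∀ h' q J', h' + J'.card < h + J.card →
      (fun (h' : ℕ) (q : ℂ) (J' : Multiset ℂ) =>
        if _hlt : h' + J'.card < h + J.card then S.omega Q h' q J' else 0) h' q J' =
        S.omega Q h' q J' := fun _ _ _ hlt => dif_pos hlt
  generalize (fun (h' : ℕ) (q : ℂ) (J' : Multiset ℂ) =>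
    if _hlt : h' + J'.card < h + J.card then S.omega Q h' q J' else 0) = W at hW ⊢
  unfold Rec
  congr 1
  · congr 1
    · congr 1
      · congr 1
        refine Multiset.map_congr rfl fun a ha => ?_
        have h1 := Multiset.card_erase_add_one ha
        rw [hW _ _ _ (by omega)]
      · refine Finset.sum_congr rfl fun g hg => ?_
        congr 1
        refine Multiset.map_congr rfl fun K hK => ?_
        split_ifs with hs
        · rfl
        · have h1 := Finset.HasAntidiagonal.mem_antidiagonal.1 hg
          have h2 := congrArg Multiset.card (Multiset.mem_antidiagonal.1 hK)
          rw [Multiset.card_add] at h2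
          rw [← Multiset.card_eq_zero, ← Multiset.card_eq_zero] at hs
          rw [hW _ _ _ (by omega), hW _ _ _ (by omega)]
    · split_ifs with h2
      · rw [hW _ _ _ (by rw [Multiset.card_cons]; omega)]
      · rfl
  · split_ifs with h2
    · congr 2
      funext q
      rw [hW _ _ _ (by omega)]
    · rfl

end SpectralCurve

theorem weber_equation (s μ z : ℂ) (hz : z ≠ 0) :
    (weber s μ).y z ^ 2 = (weber s μ).x z ^ 2 / 4 - s ^ 2 := by
  simp only [weber]
  field_simp
  ring

theorem whittaker_equation (m μ z : ℂ) (hm : m ≠ 0) (hz : z ≠ 0) (hz1 : z ≠ 1) :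
    (whittaker m μ).y z ^ 2 = ((whittaker m μ).x z + 4 * m) / (4 * (whittaker m μ).x z) := by
  have h1 : z - 1 ≠ 0 := sub_ne_zero.2 hz1
  have h2 : z + z⁻¹ - 2 = (z - 1) ^ 2 / z := by field_simp; ring
  simp only [whittaker, h2]
  field_simp
  ring

theorem weber_involution (s μ z : ℂ) :
    (weber s μ).x z⁻¹ = (weber s μ).x z ∧ (weber s μ).y z⁻¹ = -(weber s μ).y z := by
  simp only [weber, inv_inv]
  constructor <;> ring

theorem whittaker_involution (m μ z : ℂ) (hz : z ≠ 0) (hz1 : z ≠ 1) :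
    (whittaker m μ).x z⁻¹ = (whittaker m μ).x z ∧
      (whittaker m μ).y z⁻¹ = -(whittaker m μ).y z := by
  have h1 : z - 1 ≠ 0 := sub_ne_zero.2 hz1
  have h2 : 1 - z ≠ 0 := sub_ne_zero.2 (Ne.symm hz1)
  have h3 : z⁻¹ - 1 = (1 - z) / z := by field_simp
  have h4 : z - 1 = -(1 - z) := by ring
  simp only [whittaker, inv_inv, h3]
  refine ⟨by ring, ?_⟩
  rw [h4]
  field_simp
  ring

/-- `dx` vanishes exactly at `z = 1` and `z = -1`, and the residue of
`y dx = -(m / 2) (z - 2 / z + 1 / z³) dz` at `∞₊` (`z = 0`) is `m = s²`. -/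
theorem weber_ydx (s μ z : ℂ) (hz : z ≠ 0) :
    (weber s μ).dx z = s * (z - 1) * (z + 1) / z ^ 2 ∧
      (weber s μ).ydx z = -(s ^ 2 / 2) * (z - 2 / z + 1 / z ^ 3) := by
  have h : (weber s μ).dx z = s * (1 + -(z ^ 2)⁻¹) :=
    (((hasDerivAt_id z).add (hasDerivAt_inv hz)).const_mul s).deriv
  rw [SpectralCurve.ydx, h]
  simp only [weber]
  constructor <;> field_simp <;> ring

/-- `dx` vanishes exactly at `z = 1` and `z = -1`, and the residue of
`y dx = (m / 2) (1 + 2 / z + 1 / z²) dz` at `∞₊` (`z = 0`) is `m`. -/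
theorem whittaker_ydx (m μ z : ℂ) (hz : z ≠ 0) (hz1 : z ≠ 1) :
    (whittaker m μ).dx z = m * (z - 1) * (z + 1) / z ^ 2 ∧
      (whittaker m μ).ydx z = m / 2 * (1 + 2 / z + 1 / z ^ 2) := by
  have h1 : z - 1 ≠ 0 := sub_ne_zero.2 hz1
  have h : (whittaker m μ).dx z = m * (1 + -(z ^ 2)⁻¹) :=
    ((((hasDerivAt_id z).add (hasDerivAt_inv hz)).sub_const 2).const_mul m).deriv
  rw [SpectralCurve.ydx, h]
  simp only [whittaker]
  constructor <;> field_simp <;> ring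

/-- The expansion in powers of `ħ` of `log (m + a ħ)`, for `m ≠ 0`. -/
noncomputable def logSeries (m a : ℂ) : PowerSeries ℂ :=
  PowerSeries.mk fun k =>
    if k = 0 then Complex.log m else (-1) ^ (k + 1) * (a / m) ^ k / (k : ℂ)

/-- `ε₁ = ħ ε₁'` with `ε₁' = β^{1/2}`, where `b = β^{1/2}`. -/
noncomputable def eps₁ (b : ℂ) : ℂ := b

/-- `ε₂ = ħ ε₂'` with `ε₂' = -β^{-1/2}`, where `b = β^{1/2}`. -/
noncomputable def eps₂ (b : ℂ) : ℂ := -b⁻¹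

end RefinedTR

/-!
The idea is to find the wave function's Riccati equation, on which the shift of `ν` acts by a first
order differential operator, and to read off the Voros coefficients from that operator.

The curves are uniformised by `w = ξ(z) = (1 + z) / (1 - z)`, in which the involution is `w ↦ -w`
and `∞₊`, `∞₋` are `w = 1`, `w = -1`. With `X = w²`, both curves take the form `y dx = (c / 2) w (X
- 1)⁻ᵏ dX`, with `k = 3` (Weber) and `k = 2` (Whittaker).

*Loop equations.* Correlators `W` are defined by recursion through the loop equation, whose right
side has removable singularities at coincident arguments. They belong to an explicit ring of regular
functions (`reg_W`). A label is either a point or a divisor, where an argument has been integrated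
along `D(z)`; that the latter is a primitive of the former, correctly normalised, again follows from
the loop equations (`divDeriv`, `bdry_eq_zero`). The residue formula of the recursion has the
correlators as its solution (`omega_eq_W`): by the loop equation its integrand is the sum of a form
whose residues cancel under the involution and of the correlator itself.

*Symmetry.* The multidifferentials are symmetric (`W_symm`). Using the loop equation for the
argument `p` and then that for the argument `q`, the two-point function times an invertible series
becomes an expression that is symmetric in `p` and `q`, given symmetry in lower order (`exchange`,
`loop_sources_symm`). All labels are treated at once by generating series, ordered by weight.

*The Riccati equation.* By symmetry, the logarithmic derivative of the wave function is the
generating series `U` of the correlators all of whose further arguments are integrated along the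
divisor ending at the first one (`logDerivPsi_eq`). Restricting the one-point loop equation to this
diagonal gives a Riccati equation in which `ν` enters only through one constant (`riccati`). A
formal solution is determined by its leading coefficient (`riccati_unique`).

*The shift.* A first order operator multiplies the wave function by a factor `A` and turns it into a
solution for the shifted `ν`. Hence the logarithmic derivatives for the two values of `ν` differ by
that of `A` (`weber_shift_u`, `whittaker_shift_u`), and the Voros coefficients differ by the
difference of the values of `log A` at the two points at infinity (`voros_sub`), after a rescaling
of `A` by a factor independent of `ħ` that makes it regular and invertible there. Its values at
these points give the logarithms in the difference equations.
-/

namespace RefinedTR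

open Filter Topology
open Multiset (replicate)
open Finset.HasAntidiagonal (antidiagonal mem_antidiagonal)
open SpectralCurve (refinement divisorIntegral iteratedDivisorIntegral)

noncomputable section

/-! ### Regular functions of several points of the curve -/

/-- Configurations of points, in the coordinate `w`, none of which is the image of another one, or
of itself, under the involution `w ↦ -w`; for `e = true` they also avoid `w = ±1`, the points `∞₊`
and `∞₋`. -/
def Adm (e : Bool) {ι : Type} (v : ι → ℂ) : Prop :=
  (∀ i j, v i + v j ≠ 0) ∧ (e = true → ∀ i, v i ^ 2 - 1 ≠ 0)

/-- Regular functions on the configurations in `Adm e`: polynomials in the coordinates and the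
inverses of `v i + v j` and, for `e = true`, of `v i ^ 2 - 1`. There are no poles at `v i = v j`.
Values off `Adm e` are irrelevant. -/
inductive Reg (e : Bool) {ι : Type} : ((ι → ℂ) → ℂ) → Prop
  | const (c : ℂ) : Reg e fun _ => c
  | coord (i : ι) : Reg e fun v => v i
  | inv (i j : ι) : Reg e fun v => (v i + v j)⁻¹
  | pole (he : e = true) (i : ι) : Reg e fun v => (v i ^ 2 - 1)⁻¹
  | add {F G : (ι → ℂ) → ℂ} : Reg e F → Reg e G → Reg e fun v => F v + G v
  | mul {F G : (ι → ℂ) → ℂ} : Reg e F → Reg e G → Reg e fun v => F v * G v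
  | congr {F G : (ι → ℂ) → ℂ} : Reg e F → (∀ v, Adm e v → F v = G v) → Reg e G

section Reg

variable {e : Bool} {ι κ : Type} {F G : (ι → ℂ) → ℂ} {v : ι → ℂ}

theorem Adm.comp (h : Adm e v) (φ : κ → ι) : Adm e fun i => v (φ i) :=
  ⟨fun _ _ => h.1 _ _, fun he _ => h.2 he _⟩

theorem Adm.ne_zero (h : Adm e v) (i : ι) : v i ≠ 0 := fun h0 => h.1 i i (by simp [h0])

theorem Adm.to_false (h : Adm e v) : Adm false v := ⟨h.1, fun h => by simp at h⟩

theorem Reg.rename (h : Reg e F) (φ : ι → κ) : Reg e fun v => F fun i => v (φ i) := by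
  induction h with
  | const c => exact .const c
  | coord i => exact .coord (φ i)
  | inv i j => exact .inv (φ i) (φ j)
  | pole he i => exact .pole he (φ i)
  | add _ _ h1 h2 => exact h1.add h2
  | mul _ _ h1 h2 => exact h1.mul h2
  | congr _ h2 h1 => exact h1.congr fun v hv => h2 _ (hv.comp φ)

theorem Reg.mono (h : Reg false F) : Reg e F := by
  induction h with
  | const c => exact .const c
  | coord i => exact .coord i
  | inv i j => exact .inv i j
  | pole he i => simp at he
  | add _ _ h1 h2 => exact h1.add h2
  | mul _ _ h1 h2 => exact h1.mul h2
  | congr _ h2 h1 => exact h1.congr fun v hv => h2 _ hv.to_false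

theorem Reg.neg (h : Reg e F) : Reg e fun v => -F v :=
  ((Reg.const (-1)).mul h).congr fun v _ => by ring

theorem Reg.sub (h : Reg e F) (h' : Reg e G) : Reg e fun v => F v - G v :=
  (h.add h'.neg).congr fun v _ => by ring

theorem Reg.pow (h : Reg e F) (n : ℕ) : Reg e fun v => F v ^ n := by
  induction n with
  | zero => simpa using Reg.const 1
  | succ n ih => exact (ih.mul h).congr fun v _ => by ring

theorem Reg.coord_inv (i : ι) : Reg e fun v => (v i)⁻¹ :=
  ((Reg.const 2).mul (Reg.inv i i)).congr fun v hv => by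
    have := hv.ne_zero i
    field_simp
    norm_num

theorem Reg.multiset_sum {α : Type} (s : Multiset α) {F : α → (ι → ℂ) → ℂ}
    (h : ∀ a ∈ s, Reg e (F a)) : Reg e fun v => (s.map fun a => F a v).sum := by
  induction s using Multiset.induction with
  | empty => simpa using Reg.const 0
  | cons a s ih =>
    simp only [Multiset.map_cons, Multiset.sum_cons]
    exact (h a (by simp)).add (ih fun b hb => h b (by simp [hb]))

theorem Reg.sum {α : Type} (s : Finset α) {F : α → (ι → ℂ) → ℂ}
    (h : ∀ a ∈ s, Reg e (F a)) : Reg e fun v => ∑ a ∈ s, F a v :=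
  Reg.multiset_sum s.val h

open Classical in
/-- The quotient by `v i - v j` is again regular, so a singularity on a diagonal that is known to be
removable has been removed. -/
theorem Reg.exists_divided_difference (h : Reg e F) (i j : ι) :
    ∃ G : (ι → ℂ) → ℂ, Reg e G ∧ ∀ v, Adm e v →
      F v - F (fun l => v (if l = i then j else l)) = (v i - v j) * G v := by
  have hd : ∀ l, ∃ c : ℂ, ∀ v : ι → ℂ,
      v l - v (if l = i then j else l) = (v i - v j) * c := by
    intro l
    by_cases hl : l = i
    · exact ⟨1, fun v => by simp [hl]⟩
    · exact ⟨0, fun v => by simp [hl]⟩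
  induction h with
  | const c => exact ⟨_, .const 0, fun v _ => by simp⟩
  | coord l =>
    obtain ⟨c, hc⟩ := hd l
    exact ⟨_, .const c, fun v _ => hc v⟩
  | inv l k =>
    obtain ⟨c, hc⟩ := hd l
    obtain ⟨d, hd⟩ := hd k
    refine ⟨_, ((Reg.const (-(c + d))).mul (.inv l k)).mul
      ((Reg.inv l k).rename fun l => if l = i then j else l), fun v hv => ?_⟩
    have h1 := hv.1 l k
    have h2 := (hv.comp fun l => if l = i then j else l).1 l k
    rw [inv_sub_inv h1 h2]
    field_simp
    linear_combination -(hc v) - hd v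
  | pole he l =>
    obtain ⟨c, hc⟩ := hd l
    refine ⟨_, (((Reg.const (-c)).mul ((Reg.coord l).add
      ((Reg.coord l).rename fun l => if l = i then j else l))).mul (.pole he l)).mul
      ((Reg.pole he l).rename fun l => if l = i then j else l), fun v hv => ?_⟩
    have h1 := hv.2 he l
    have h2 := (hv.comp fun l => if l = i then j else l).2 he l
    rw [inv_sub_inv h1 h2]
    field_simp
    linear_combination -(v l + v (if l = i then j else l)) * (hc v)
  | add _ _ h1 h2 =>
    obtain ⟨G1, hG1, e1⟩ := h1
    obtain ⟨G2, hG2, e2⟩ := h2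
    exact ⟨_, hG1.add hG2, fun v hv => by linear_combination e1 v hv + e2 v hv⟩
  | @mul A B hA hB h1 h2 =>
    obtain ⟨G1, hG1, e1⟩ := h1
    obtain ⟨G2, hG2, e2⟩ := h2
    refine ⟨_, (hG1.mul hB).add ((hA.rename fun l => if l = i then j else l).mul hG2),
      fun v hv => ?_⟩
    linear_combination (B v) * e1 v hv + A (fun l => v (if l = i then j else l)) * e2 v hv
  | congr _ h2 h1 =>
    obtain ⟨G, hG, e⟩ := h1
    exact ⟨G, hG, fun v hv => by rw [← h2 v hv, ← h2 _ (hv.comp _), e v hv]⟩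

theorem Reg.exists_bound (h : Reg false F) (C δ : ℝ) (hδ : 0 < δ) :
    ∃ M : ℝ, ∀ v : ι → ℂ, (∀ i, ‖v i‖ ≤ C) → (∀ i j, δ ≤ ‖v i + v j‖) → ‖F v‖ ≤ M := by
  induction h with
  | const c => exact ⟨‖c‖, fun v _ _ => le_rfl⟩
  | coord i => exact ⟨C, fun v h _ => h i⟩
  | inv i j =>
    exact ⟨δ⁻¹, fun v _ h => by rw [norm_inv]; exact inv_anti₀ hδ (h i j)⟩
  | pole he i => simp at he
  | add _ _ h1 h2 =>
    obtain ⟨M, hM⟩ := h1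
    obtain ⟨N, hN⟩ := h2
    exact ⟨M + N, fun v h h' => (norm_add_le _ _).trans (add_le_add (hM v h h') (hN v h h'))⟩
  | mul _ _ h1 h2 =>
    obtain ⟨M, hM⟩ := h1
    obtain ⟨N, hN⟩ := h2
    refine ⟨M * N, fun v h h' => ?_⟩
    rw [norm_mul]
    exact mul_le_mul (hM v h h') (hN v h h') (norm_nonneg _) ((norm_nonneg _).trans (hM v h h'))
  | congr _ h2 h1 =>
    obtain ⟨M, hM⟩ := h1
    refine ⟨M, fun v h h' => ?_⟩
    rw [← h2 v ⟨fun i j h0 => ?_, by simp⟩]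
    · exact hM v h h'
    · have := h' i j
      rw [h0, norm_zero] at this
      linarith

theorem isOpen_adm [Finite ι] : IsOpen {v : ι → ℂ | Adm e v} := by
  have h1 : IsOpen {v : ι → ℂ | ∀ i j, v i + v j ≠ 0} := by
    simp only [Set.ofPred_forall]
    exact isOpen_iInter_of_finite fun i => isOpen_iInter_of_finite fun j =>
      isOpen_ne_fun (by fun_prop) continuous_const
  have h2 : IsOpen {v : ι → ℂ | e = true → ∀ i, v i ^ 2 - 1 ≠ 0} := by
    simp only [Set.ofPred_forall]
    by_cases he : e = true
    · simp only [he, Set.iInter_true]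
      exact isOpen_iInter_of_finite fun i => isOpen_ne_fun (by fun_prop) continuous_const
    · simp [he]
  exact h1.inter h2

theorem Adm.eventually [Finite ι] (hv : Adm e v) : ∀ᶠ v' in nhds v, Adm e v' :=
  isOpen_adm.mem_nhds hv

theorem Reg.contDiffAt [Fintype ι] (h : Reg e F) (hv : Adm e v) : ContDiffAt ℂ 3 F v := by
  have hc : ∀ i : ι, ContDiffAt ℂ 3 (fun v : ι → ℂ => v i) v := fun i =>
    (contDiff_apply ℂ ℂ i).contDiffAt
  induction h with
  | const c => exact contDiffAt_const
  | coord i => exact hc i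
  | inv i j => exact ((hc i).add (hc j)).inv (hv.1 i j)
  | pole he i => exact (((hc i).pow 2).sub contDiffAt_const).inv (hv.2 he i)
  | add _ _ h1 h2 => exact h1.add h2
  | mul _ _ h1 h2 => exact h1.mul h2
  | congr _ h2 h1 => exact h1.congr_of_eventuallyEq (hv.eventually.mono fun w hw => (h2 w hw).symm)

theorem Reg.differentiableAt [Fintype ι] (h : Reg e F) (hv : Adm e v) :
    DifferentiableAt ℂ F v := (h.contDiffAt hv).differentiableAt (by norm_num)

theorem Reg.fderiv [Fintype ι] (h : Reg e F) (x : ι → ℂ) :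
    Reg e fun v => fderiv ℂ F v x := by
  have hc : ∀ (i : ι) (v : ι → ℂ), HasFDerivAt (fun v : ι → ℂ => v i)
      (ContinuousLinearMap.proj (R := ℂ) (φ := fun _ : ι => ℂ) i) v := fun i v =>
    (ContinuousLinearMap.proj (R := ℂ) (φ := fun _ : ι => ℂ) i).hasFDerivAt
  induction h with
  | const c => exact (Reg.const 0).congr fun v _ => by simp
  | coord i => exact (Reg.const (x i)).congr fun v _ => by rw [(hc i v).fderiv]; rfl
  | inv i j =>
    refine ((Reg.const (-(x i + x j))).mul ((Reg.inv i j).pow 2)).congr fun v hv => ?_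
    have h1 := (hasDerivAt_inv (hv.1 i j)).comp_hasFDerivAt v ((hc i v).add (hc j v))
    have h2 : _root_.fderiv ℂ (fun v : ι → ℂ => (v i + v j)⁻¹) v = _ := h1.fderiv
    rw [h2]
    simp
    ring
  | pole he i =>
    refine (((Reg.const (-2 * x i)).mul (.coord i)).mul ((Reg.pole he i).pow 2)).congr
      fun v hv => ?_
    have h1 := (hasDerivAt_inv (hv.2 he i)).comp_hasFDerivAt v
      (((hc i v).pow 2).sub (hasFDerivAt_const 1 v))
    have h2 : _root_.fderiv ℂ (fun v : ι → ℂ => (v i ^ 2 - 1)⁻¹) v = _ := h1.fderiv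
    rw [h2]
    simp
    ring
  | @add A B hA hB h1 h2 =>
    refine (h1.add h2).congr fun v hv => ?_
    rw [fderiv_fun_add (hA.differentiableAt hv) (hB.differentiableAt hv)]
    rfl
  | @mul A B hA hB h1 h2 =>
    refine ((hA.mul h2).add (hB.mul h1)).congr fun v hv => ?_
    rw [fderiv_fun_mul (hA.differentiableAt hv) (hB.differentiableAt hv)]
    rfl
  | congr _ h2 h1 =>
    refine h1.congr fun v hv => ?_
    rw [Filter.EventuallyEq.fderiv_eq (hv.eventually.mono fun w hw => h2 w hw)]

theorem Reg.fderiv_comm [Fintype ι] (h : Reg e F) (hv : Adm e v) (x y : ι → ℂ) :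
    _root_.fderiv ℂ (fun v => _root_.fderiv ℂ F v x) v y =
      _root_.fderiv ℂ (fun v => _root_.fderiv ℂ F v y) v x := by
  have h1 := h.contDiffAt hv
  have h2 : DifferentiableAt ℂ (_root_.fderiv ℂ F) v :=
    (h1.fderiv_right (m := 1) (by norm_num)).differentiableAt (by norm_num)
  have h3 : IsSymmSndFDerivAt ℂ F v := h1.isSymmSndFDerivAt (by simp; norm_num)
  have h4 : ∀ x y : ι → ℂ, _root_.fderiv ℂ (fun v => _root_.fderiv ℂ F v x) v y =
      _root_.fderiv ℂ (_root_.fderiv ℂ F) v y x := fun x y => by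
    have := (h2.hasFDerivAt.clm_apply (hasFDerivAt_const x v)).fderiv
    rw [this]
    simp
  rw [h4, h4]
  exact h3 y x

end Reg

section OneVariable

variable {e : Bool} {ι κ : Type}

/-- The configuration `u` with a further point `p`, indexed by `none`. -/
def ins (p : ℂ) (u : ι → ℂ) : Option ι → ℂ := fun o => o.elim p u

theorem adm_ins {p : ℂ} {u : ι → ℂ} : Adm e (ins p u) ↔
    Adm e u ∧ p ≠ 0 ∧ (∀ i, p + u i ≠ 0) ∧ (e = true → p ^ 2 - 1 ≠ 0) := by
  constructor
  · intro h
    exact ⟨h.comp some, h.ne_zero none, fun i => h.1 none (some i), fun he => h.2 he none⟩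
  · rintro ⟨h1, h2, h3, h4⟩
    refine ⟨?_, ?_⟩
    · rintro (_ | i) (_ | j)
      · simpa [ins, ← two_mul] using h2
      · exact h3 j
      · simpa [ins, add_comm] using h3 i
      · exact h1.1 i j
    · rintro he (_ | i)
      · exact h4 he
      · exact h1.2 he i

/-- Regularity of a function of a distinguished point and a configuration. -/
def Reg1 (e : Bool) (F : ℂ → (ι → ℂ) → ℂ) : Prop :=
  Reg e fun v : Option ι → ℂ => F (v none) fun i => v (some i)

theorem Reg1.congr {F G : ℂ → (ι → ℂ) → ℂ} (h : Reg1 e F)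
    (h' : ∀ p u, Adm e (ins p u) → F p u = G p u) : Reg1 e G :=
  Reg.congr h fun v hv => h' _ _ (by
    convert hv using 1
    funext o
    cases o <;> rfl)

theorem Adm.eventually_ins [Finite ι] {p : ℂ} {u : ι → ℂ} (h : Adm e (ins p u)) :
    ∀ᶠ q in nhds p, Adm e (ins q u) := by
  have hc : Continuous fun q : ℂ => ins q u := by
    refine continuous_pi fun o => ?_
    cases o
    · exact continuous_id
    · exact continuous_const
  exact hc.continuousAt.eventually h.eventually

open Classical in
theorem Reg1.exists_hasDerivAt [Fintype ι] {F : ℂ → (ι → ℂ) → ℂ} (h : Reg1 e F) :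
    ∃ G : ℂ → (ι → ℂ) → ℂ, Reg1 e G ∧
      ∀ p u, Adm e (ins p u) → HasDerivAt (fun t => F t u) (G p u) p := by
  refine ⟨fun p u => fderiv ℂ (fun v : Option ι → ℂ => F (v none) fun i => v (some i)) (ins p u)
    (Pi.single none 1), ?_, fun p u hp => ?_⟩
  · refine (Reg.fderiv h (Pi.single none 1)).congr fun v _ => ?_
    congr 2
    funext o
    cases o <;> rfl
  · have h1 := (Reg.differentiableAt h hp).hasFDerivAt
    have h2 : HasDerivAt (fun t : ℂ => ins t u) (Pi.single none 1) p := by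
      refine hasDerivAt_pi.2 fun o => ?_
      cases o
      · exact hasDerivAt_id' p
      · simpa [ins] using hasDerivAt_const p _
    exact h1.comp_hasDerivAt p h2

theorem Reg1.differentiableAt [Fintype ι] {F : ℂ → (ι → ℂ) → ℂ} (h : Reg1 e F) {p : ℂ} {u : ι → ℂ}
    (hp : Adm e (ins p u)) : DifferentiableAt ℂ (fun t => F t u) p := by
  obtain ⟨G, -, hG⟩ := h.exists_hasDerivAt
  exact (hG p u hp).differentiableAt

theorem Reg1.deriv [Fintype ι] {F : ℂ → (ι → ℂ) → ℂ} (h : Reg1 e F) :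
    Reg1 e fun p u => deriv (fun t => F t u) p := by
  obtain ⟨G, h1, hG⟩ := h.exists_hasDerivAt
  exact h1.congr fun p u hp => ((hG p u hp).deriv).symm

theorem Reg1.eval {F : ℂ → (ι → ℂ) → ℂ} (h : Reg1 e F) (i : ι) : Reg e fun u => F (u i) u :=
  Reg.rename h fun o => o.elim i id

theorem Reg.const1 {F : (ι → ℂ) → ℂ} (h : Reg e F) : Reg1 e fun _ u => F u :=
  h.rename some

theorem Reg1.exists_divided_difference {F : ℂ → (ι → ℂ) → ℂ} (h : Reg1 e F) (i : ι) :
    ∃ G : ℂ → (ι → ℂ) → ℂ, Reg1 e G ∧ ∀ p u, Adm e (ins p u) →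
      F p u - F (u i) u = (p - u i) * G p u := by
  obtain ⟨G, hG, h1⟩ := Reg.exists_divided_difference h none (some i)
  refine ⟨fun p u => G (ins p u), hG.congr fun v _ => ?_, fun p u hp => ?_⟩
  · congr 1
    funext o
    cases o <;> rfl
  · simpa [ins] using h1 _ hp

theorem Reg1.add {F G : ℂ → (ι → ℂ) → ℂ} (h : Reg1 e F) (h' : Reg1 e G) :
    Reg1 e fun p u => F p u + G p u := Reg.add h h'

theorem Reg1.sub {F G : ℂ → (ι → ℂ) → ℂ} (h : Reg1 e F) (h' : Reg1 e G) :
    Reg1 e fun p u => F p u - G p u := Reg.sub h h'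

theorem Reg1.mul {F G : ℂ → (ι → ℂ) → ℂ} (h : Reg1 e F) (h' : Reg1 e G) :
    Reg1 e fun p u => F p u * G p u := Reg.mul h h'

theorem Reg1.const (c : ℂ) : Reg1 e fun (_ : ℂ) (_ : ι → ℂ) => c := Reg.const c

theorem Reg1.id : Reg1 e fun p (_ : ι → ℂ) => p := Reg.coord none

theorem Reg1.inv : Reg1 e fun p (_ : ι → ℂ) => p⁻¹ := Reg.coord_inv none

theorem Reg1.sqSubOnePow (n : ℕ) : Reg1 e fun p (_ : ι → ℂ) => (p ^ 2 - 1) ^ n :=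
  (((Reg.coord none).pow 2).sub (Reg.const 1)).pow n

end OneVariable

/-! ### Sums over the elements and over the splittings of a multiset -/

section MultisetSums

variable {α β A : Type} [CommRing A]

open Classical in
/-- The sum over the elements `a` of `J`, with multiplicity, of `φ a (J.erase a)`. -/
def eraseSum (φ : α → Multiset α → A) (J : Multiset α) : A :=
  (J.map fun a => φ a (J.erase a)).sum

@[simp] theorem eraseSum_zero (φ : α → Multiset α → A) : eraseSum φ 0 = 0 := rfl

open Classical in
theorem eraseSum_cons (φ : α → Multiset α → A) (a : α) (J : Multiset α) :
    eraseSum φ (a ::ₘ J) = φ a J + eraseSum (fun b K => φ b (a ::ₘ K)) J := by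
  simp only [eraseSum, Multiset.map_cons, Multiset.sum_cons, Multiset.erase_cons_head]
  congr 2
  refine Multiset.map_congr rfl fun b hb => ?_
  by_cases h : b = a
  · subst h
    rw [Multiset.erase_cons_head, Multiset.cons_erase hb]
  · rw [Multiset.erase_cons_tail _ (Ne.symm h)]

theorem eraseSum_congr {φ ψ : α → Multiset α → A} {J : Multiset α}
    (h : ∀ a K, J = a ::ₘ K → φ a K = ψ a K) : eraseSum φ J = eraseSum ψ J := by
  classical
  unfold eraseSum
  congr 1
  exact Multiset.map_congr rfl fun a ha => h a _ (by rw [Multiset.cons_erase ha])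

theorem eraseSum_map (f : α → β) (φ : β → Multiset β → A) (J : Multiset α) :
    eraseSum φ (J.map f) = eraseSum (fun a K => φ (f a) (K.map f)) J := by
  induction J using Multiset.induction generalizing φ with
  | empty => rfl
  | cons a J ih => rw [Multiset.map_cons, eraseSum_cons, eraseSum_cons, ih]; simp

/-- The sum over the splittings of `J` into two parts; this is the multiplication of exponential
generating series. -/
def conv (f g : Multiset α → A) (J : Multiset α) : A :=
  (J.antidiagonal.map fun K => f K.1 * g K.2).sum

@[simp] theorem conv_zero (f g : Multiset α → A) : conv f g 0 = f 0 * g 0 := by simp [conv]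

theorem conv_cons (f g : Multiset α → A) (a : α) (J : Multiset α) :
    conv f g (a ::ₘ J) = conv f (fun K => g (a ::ₘ K)) J + conv (fun K => f (a ::ₘ K)) g J := by
  simp [conv, Multiset.antidiagonal_cons, Multiset.map_map]

theorem conv_congr {f f' g g' : Multiset α → A} {J : Multiset α}
    (h : ∀ K L, K + L = J → f K * g L = f' K * g' L) : conv f g J = conv f' g' J := by
  unfold conv
  congr 1
  exact Multiset.map_congr rfl fun K hK => h _ _ (Multiset.mem_antidiagonal.1 hK)

theorem conv_map (φ : α → β) (f g : Multiset β → A) (J : Multiset α) :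
    conv f g (J.map φ) = conv (fun K => f (K.map φ)) (fun K => g (K.map φ)) J := by
  induction J using Multiset.induction generalizing f g with
  | empty => simp
  | cons a J ih => rw [Multiset.map_cons, conv_cons, conv_cons, ih, ih]; simp

theorem conv_comm (f g : Multiset α → A) (J : Multiset α) : conv f g J = conv g f J := by
  induction J using Multiset.induction generalizing f g with
  | empty => simp [mul_comm]
  | cons a J ih => rw [conv_cons, conv_cons, ih f, ih _ g, add_comm]

theorem conv_add (f g g' : Multiset α → A) (J : Multiset α) :
    conv f (fun K => g K + g' K) J = conv f g J + conv f g' J := by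
  simp [conv, mul_add, Multiset.sum_map_add]

theorem add_conv (f f' g : Multiset α → A) (J : Multiset α) :
    conv (fun K => f K + f' K) g J = conv f g J + conv f' g J := by
  simp [conv, add_mul, Multiset.sum_map_add]

theorem conv_assoc (f g h : Multiset α → A) (J : Multiset α) :
    conv (conv f g) h J = conv f (conv g h) J := by
  induction J using Multiset.induction generalizing f g h with
  | empty => simp [mul_assoc]
  | cons a J ih =>
    rw [conv_cons, conv_cons, funext (conv_cons f g a), funext (conv_cons g h a), conv_add,
      add_conv, ih, ih, ih, add_assoc]

end MultisetSums

/-! ### The recursion in the coordinate `w = (1 + z) / (1 - z)` -/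

/-- The label of an argument of a correlator: a point, or the divisor `D(z)` with end point `a =
ξ(z)`, along which the argument has been integrated. -/
inductive Slot (α : Type) : Type
  | point (a : α) : Slot α
  | divisor (a : α) : Slot α

def Slot.map {α β : Type} (f : α → β) : Slot α → Slot β
  | .point a => .point (f a)
  | .divisor a => .divisor (f a)

/-- The position of a label. -/
def Slot.pos {α : Type} : Slot α → α
  | .point a => a
  | .divisor a => a

/-- The data of the recursion in the coordinate `w`, in which `y dx = (c / 2) w (X - 1)⁻ᵏ dX` with
`X = w ^ 2`. The Weber curve has `k = 3` and the Whittaker curve has `k = 2`. The parameter `ν`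
fixes the weights of the divisors. -/
structure LoopData where
  k : ℕ
  c : ℂ
  Q : ℂ
  μ : ℂ
  ν : ℂ

namespace LoopData

variable (D : LoopData)

/-- The denominator of `y dx / dX`. -/
def P (t : ℂ) : ℂ := (t ^ 2 - 1) ^ D.k

/-- `ω_{1/2,1}`, divided by `dX`. -/
def half (p : ℂ) : ℂ :=
  D.Q / 2 * (-(1 / (2 * p ^ 2)) + ((D.k : ℂ) - 2) / (p ^ 2 - 1) + D.μ / (p * (p ^ 2 - 1)))

/-- `ω_{0,2}`, divided by `dX` for each point; for a divisor label, the second argument has been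
integrated. -/
def two (p : ℂ) : Slot ℂ → ℂ
  | .point a => 1 / (4 * p * a * (p + a) ^ 2)
  | .divisor a => 1 / (2 * p) * ((p - D.ν) / (p ^ 2 - 1) - 1 / (p + a))

/-- `dx(q) dx / (x(q) - x)²`, divided by `dX(q) ^ 2` and, for a point label, by its `dX`; for a
divisor label it has been integrated. -/
def ker (q : ℂ) : Slot ℂ → ℂ
  | .point a => 1 / (q ^ 2 - a ^ 2) ^ 2
  | .divisor a => 1 / (q ^ 2 - a ^ 2) - 1 / (q ^ 2 - 1)

/-- The source term of a label in the loop equation: it cancels the pole of the recursion terms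
where `q ^ 2` is the square of the position of the label. -/
def src (q : ℂ) (f : ℂ → ℂ) : Slot ℂ → ℂ
  | .point a => deriv (fun t => D.P t * f t / (q ^ 2 - t ^ 2)) a / (2 * a)
  | .divisor a => D.P a * f a / (q ^ 2 - a ^ 2)

/-- `Rec_{h/2,n+1}`, divided by `dX(q) ^ 2` and by `dX` for each point label. The last summand is
the derivative of `ω / dx`, as `dx / dX` is a multiple of `(X - 1)⁻²`. -/
def recTerm (W : ℕ → ℂ → Multiset (Slot ℂ) → ℂ) (h : ℕ) (J : Multiset (Slot ℂ))
    (q : ℂ) : ℂ :=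
  eraseSum (fun l K => ker q l * W h q K) J
  + ∑ g ∈ antidiagonal h, conv (W g.1 q) (W g.2 q) J
  + (if 2 ≤ h then W (h - 2) q (.point q ::ₘ J) else 0)
  + (if 1 ≤ h then D.Q * (deriv (fun t => W (h - 1) t J) q / (2 * q)
      + 2 / (q ^ 2 - 1) * W (h - 1) q J) else 0)

/-- The loop equation, solved for the correlator. -/
def step (W : ℕ → ℂ → Multiset (Slot ℂ) → ℂ) (h : ℕ) (J : Multiset (Slot ℂ))
    (q : ℂ) : ℂ :=
  (eraseSum (fun l K => D.src q (fun t => W h t K) l) J - D.P q * D.recTerm W h J q) / (D.c * q)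

/-- The correlators: `W h p J` is `ω_{h/2,|J|+1}` divided by `dX` for each point, except that `W 0 p
0 = 0`. They are defined by recursion on `h + |J|` through the loop equation; the limit extends its
right side over the coincidences of the arguments. -/
def W (h : ℕ) (p : ℂ) (J : Multiset (Slot ℂ)) : ℂ :=
  if h + J.card ≤ 1 then (if h = 1 then D.half p else (J.map (D.two p)).sum)
  else Filter.limUnder (nhdsWithin p {p}ᶜ) fun q => D.step (fun h' q' J' =>
    if _hlt : h' + J'.card < h + J.card then W h' q' J' else 0) h J q
termination_by h + J.card

@[simp] theorem W_zero (p : ℂ) : D.W 0 p 0 = 0 := by rw [W]; simp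

theorem W_one (p : ℂ) : D.W 1 p 0 = D.half p := by rw [W]; simp

theorem W_two (p : ℂ) (l : Slot ℂ) : D.W 0 p {l} = D.two p l := by rw [W]; simp

theorem W_eq (h : ℕ) (p : ℂ) (J : Multiset (Slot ℂ)) (hJ : 2 ≤ h + J.card) :
    D.W h p J = Filter.limUnder (nhdsWithin p {p}ᶜ) (D.step D.W h J) := by
  rw [W, if_neg (by omega)]
  congr 1
  funext q
  have hW : ∀ h' q J', h' + J'.card < h + J.card →
      (fun (h' : ℕ) (q : ℂ) (J' : Multiset (Slot ℂ)) =>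
        if _hlt : h' + J'.card < h + J.card then D.W h' q J' else 0) h' q J' =
        D.W h' q J' := fun _ _ _ hlt => dif_pos hlt
  have hW2 : ∀ h' q J', h + J.card ≤ h' + J'.card →
      (fun (h' : ℕ) (q : ℂ) (J' : Multiset (Slot ℂ)) =>
        if _hlt : h' + J'.card < h + J.card then D.W h' q J' else 0) h' q J' = 0 :=
    fun _ _ _ hlt => dif_neg (by omega)
  generalize (fun (h' : ℕ) (q : ℂ) (J' : Multiset (Slot ℂ)) =>
    if _hlt : h' + J'.card < h + J.card then D.W h' q J' else 0) = V at hW hW2 ⊢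
  unfold step recTerm
  have hc : ∀ l K, J = l ::ₘ K → J.card = K.card + 1 := fun l K hK => by simp [hK]
  congr 2
  · refine eraseSum_congr fun l K hK => ?_
    have := hc l K hK
    congr 1
    funext t
    exact hW _ _ _ (by omega)
  congr 1
  congr 1
  · congr 1
    · congr 1
      · refine eraseSum_congr fun l K hK => ?_
        have := hc l K hK
        rw [hW _ _ _ (by omega)]
      · refine Finset.sum_congr rfl fun g hg => conv_congr fun K L hKL => ?_
        have h1 := mem_antidiagonal.1 hg
        have h2 := congrArg Multiset.card hKL
        rw [Multiset.card_add] at h2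
        by_cases hK : g.1 + K.card = 0
        · have h3 : g.1 = 0 := by omega
          have h4 : K = 0 := Multiset.card_eq_zero.1 (by omega)
          rw [hW g.1 q K (by omega), h3, h4]
          simp
        by_cases hL : g.2 + L.card = 0
        · have h3 : g.2 = 0 := by omega
          have h4 : L = 0 := Multiset.card_eq_zero.1 (by omega)
          rw [hW g.2 q L (by omega), h3, h4]
          simp
        rw [hW _ _ _ (by omega), hW _ _ _ (by omega)]
    · split_ifs with h2
      · exact hW _ _ _ (by rw [Multiset.card_cons]; omega)
      · rfl
  · split_ifs with h2
    · rw [hW _ _ _ (by omega)]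
      congr 4
      funext t
      exact hW _ _ _ (by omega)
    · rfl

end LoopData

/-! ### Quasi-regularity of the multidifferentials -/

theorem eventually_notMem_of_finite {s : Set ℂ} (hs : s.Finite) (p : ℂ) :
    ∀ᶠ q in 𝓝[≠] p, q ∉ s :=
  nhdsNE_le_cofinite p hs.compl_mem_cofinite

theorem eventually_generic {ι : Type} [Finite ι] (p : ℂ) (u : ι → ℂ) :
    ∀ᶠ q in 𝓝[≠] p, q ^ 2 - 1 ≠ 0 ∧ ∀ i, q ≠ u i := by
  have h1 : ({1, -1} : Set ℂ).Finite := by simp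
  have h2 : (Set.range u).Finite := Set.finite_range u
  filter_upwards [eventually_notMem_of_finite h1 p, eventually_notMem_of_finite h2 p]
    with q hq1 hq2
  refine ⟨fun h => hq1 ?_, fun i h => hq2 ⟨i, h.symm⟩⟩
  have : (q - 1) * (q + 1) = 0 := by linear_combination h
  rcases mul_eq_zero.1 this with h | h
  · left; linear_combination h
  · right; show q = -1; linear_combination h

namespace LoopData

variable (D : LoopData) {ι : Type} [Fintype ι]

/-- The correlator is regular up to a simple pole at `p ^ 2 = 1`. -/
def QReg (h : ℕ) (J : Multiset (Slot ι)) : Prop :=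
  ∃ g : ℂ → (ι → ℂ) → ℂ, Reg1 false g ∧ ∀ p u, Adm false (ins p u) → p ^ 2 - 1 ≠ 0 →
    D.W h p (J.map (Slot.map u)) = g p u / (p ^ 2 - 1)

variable {D} {h : ℕ} {J : Multiset (Slot ι)}

omit [Fintype ι] in
theorem qreg_half : D.QReg 1 (0 : Multiset (Slot ι)) := by
  refine ⟨fun p _ => D.Q / 2 * (-((p ^ 2 - 1) ^ 1 * (2⁻¹ * (p⁻¹ * p⁻¹))) + (((D.k : ℂ) - 2)
    + D.μ * p⁻¹)), ?_, fun p u hp h1 => ?_⟩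
  · exact (Reg1.const _).mul ((Reg.neg ((Reg1.sqSubOnePow 1).mul ((Reg1.const _).mul
      (Reg1.inv.mul Reg1.inv)))).add ((Reg1.const _).add ((Reg1.const _).mul Reg1.inv)))
  · have hp := (adm_ins.1 hp).2.1
    rw [Multiset.map_zero, W_one, half]
    field_simp
    ring

omit [Fintype ι] in
theorem qreg_two (l : Slot ι) : D.QReg 0 {l} := by
  rcases l with i | i
  · refine ⟨fun p u => 4⁻¹ * (p ^ 2 - 1) ^ 1 * p⁻¹ * ((u i)⁻¹ * ((p + u i)⁻¹ * (p + u i)⁻¹)),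
      ?_, fun p u hp h1 => ?_⟩
    · exact (((Reg1.const _).mul (Reg1.sqSubOnePow 1)).mul Reg1.inv).mul
        ((Reg.coord_inv (some i)).mul ((Reg.inv none (some i)).mul (Reg.inv none (some i))))
    · have hp1 := (adm_ins.1 hp).2.1
      have hp2 := (adm_ins.1 hp).2.2.1 i
      have hp3 := (adm_ins.1 hp).1.ne_zero i
      rw [Multiset.map_singleton, W_two, Slot.map, two]
      field_simp
  · refine ⟨fun p u => 2⁻¹ * p⁻¹ * ((p - D.ν) - (p ^ 2 - 1) ^ 1 * (p + u i)⁻¹),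
      ?_, fun p u hp h1 => ?_⟩
    · exact ((Reg1.const _).mul Reg1.inv).mul ((Reg1.id.sub (Reg1.const _)).sub
        ((Reg1.sqSubOnePow 1).mul (Reg.inv none (some i))))
    · have hp1 := (adm_ins.1 hp).2.1
      have hp2 := (adm_ins.1 hp).2.2.1 i
      rw [Multiset.map_singleton, W_two, Slot.map, two]
      field_simp

omit [Fintype ι] in
theorem QReg.reg_P_mul (hk : 2 ≤ D.k) (hW : D.QReg h J) :
    Reg1 false fun p u => D.P p * D.W h p (J.map (Slot.map u)) := by
  obtain ⟨g, hg, e⟩ := hW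
  refine ((Reg1.sqSubOnePow (D.k - 1)).mul hg).congr fun p u hp => ?_
  by_cases h1 : p ^ 2 - 1 = 0
  · rw [P, h1, zero_pow (by omega), zero_pow (by omega)]
    simp
  · obtain ⟨n, hn⟩ := Nat.exists_eq_add_of_le' hk
    rw [e p u hp h1, P, hn, show n + 2 - 1 = n + 1 from rfl]
    field_simp
    ring

theorem Reg1.hasDerivAt_of_divided {F G : ℂ → (ι → ℂ) → ℂ} {e : Bool} (hG : Reg1 e G) {i : ι}
    (h : ∀ p u, Adm e (ins p u) → F p u - F (u i) u = (p - u i) * G p u) {u : ι → ℂ}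
    (hu : Adm e u) : HasDerivAt (fun t => F t u) (G (u i) u) (u i) := by
  have hi : Adm e (ins (u i) u) :=
    adm_ins.2 ⟨hu, hu.ne_zero i, fun j => hu.1 i j, fun he => hu.2 he i⟩
  have h1 : HasDerivAt (fun t => F (u i) u + (t - u i) * G t u)
      (1 * G (u i) u + (u i - u i) * deriv (fun t => G t u) (u i)) (u i) :=
    (((hasDerivAt_id' (u i)).sub_const (u i)).mul (hG.differentiableAt hi).hasDerivAt).const_add _
  rw [sub_self, zero_mul, add_zero, one_mul] at h1
  refine h1.congr_of_eventuallyEq ?_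
  filter_upwards [hi.eventually_ins] with t ht
  linear_combination h t u ht

/-- The source term of a label has the same singularity as the corresponding recursion term. -/
theorem QReg.slot_term (hk : 2 ≤ D.k) (hW : D.QReg h J) (l : Slot ι) :
    ∃ G : ℂ → (ι → ℂ) → ℂ, Reg1 false G ∧ ∀ p u, Adm false (ins p u) → p ^ 2 - 1 ≠ 0 →
      (∀ i, p ≠ u i) →
      D.src p (fun t => D.W h t (J.map (Slot.map u))) (l.map u)
        - D.P p * (ker p (l.map u) * D.W h p (J.map (Slot.map u))) = G p u := by
  have hF := hW.reg_P_mul hk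
  obtain ⟨g, hg, e⟩ := hW
  rcases l with i | i
  · obtain ⟨G, hG, h1⟩ := hF.exists_divided_difference i
    obtain ⟨H, hH, h2⟩ := hG.exists_divided_difference i
    refine ⟨fun p u => (2⁻¹ * (u i)⁻¹ * G (u i) u - H p u) * ((p + u i)⁻¹ * (p + u i)⁻¹), ?_,
      fun p u hp hp1 hpu => ?_⟩
    · exact Reg.mul (Reg.sub (Reg.mul (Reg.mul (Reg.const _) (Reg.coord_inv (some i)))
        (Reg.const1 (Reg1.eval hG i))) hH) (Reg.mul (Reg.inv none (some i)) (Reg.inv none (some i)))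
    · obtain ⟨hu, hp0, hpa, -⟩ := adm_ins.1 hp
      have ha := hu.ne_zero i
      have hpa := hpa i
      have hpi : p - u i ≠ 0 := sub_ne_zero.2 (hpu i)
      have hs : p ^ 2 - u i ^ 2 ≠ 0 := by
        rw [sq_sub_sq]
        exact mul_ne_zero hpa hpi
      have hd := (Reg1.hasDerivAt_of_divided hG h1 hu).div
        ((hasDerivAt_pow 2 (u i)).const_sub (p ^ 2)) hs
      have e1 := h1 p u hp
      have e2 := h2 p u hp
      simp only [Slot.map, src, ker]
      have hd' : deriv (fun t => D.P t * D.W h t (J.map (Slot.map u)) / (p ^ 2 - t ^ 2)) (u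
        i) = _ :=
        hd.deriv
      rw [hd']
      generalize D.P p = Pp at *
      generalize D.P (u i) = Pa at *
      generalize D.W h p (J.map (Slot.map u)) = Wp at *
      generalize D.W h (u i) (J.map (Slot.map u)) = Wa at *
      have hs' : p ^ 2 - u i ^ 2 = (p + u i) * (p - u i) := sq_sub_sq _ _
      rw [hs']
      field_simp
      simp only [Nat.cast_ofNat, Nat.reduceSub, pow_one]
      linear_combination (-2 * u i) * e1 - (2 * u i * (p - u i)) * e2
  · obtain ⟨G, hG, h1⟩ := hF.exists_divided_difference i
    refine ⟨fun p u => (p ^ 2 - 1) ^ (D.k - 2) * g p u - G p u * (p + u i)⁻¹, ?_,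
      fun p u hp hp1 hpu => ?_⟩
    · exact ((Reg1.sqSubOnePow _).mul hg).sub (hG.mul (Reg.inv none (some i)))
    · obtain ⟨hu, hp0, hpa, -⟩ := adm_ins.1 hp
      have hpa := hpa i
      have hpi : p - u i ≠ 0 := sub_ne_zero.2 (hpu i)
      have e1 := h1 p u hp
      have e2 := e p u hp hp1
      have hs' : p ^ 2 - u i ^ 2 = (p + u i) * (p - u i) := sq_sub_sq _ _
      have hP : D.P p = (p ^ 2 - 1) ^ (D.k - 2) * (p ^ 2 - 1) ^ 2 := by
        rw [P, ← pow_add, Nat.sub_add_cancel hk]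
      have hg : g p u = (p ^ 2 - 1) * D.W h p (J.map (Slot.map u)) := by rw [e2]; field_simp
      simp only [Slot.map, src, ker]
      rw [hs', hg]
      rw [hP] at e1 ⊢
      generalize D.P (u i) = Pa at *
      generalize D.W h p (J.map (Slot.map u)) = Wp at *
      generalize D.W h (u i) (J.map (Slot.map u)) = Wa at *
      field_simp
      linear_combination -e1

omit [Fintype ι] in
theorem QReg.conv_term (hk : 2 ≤ D.k) {h' : ℕ} {J' : Multiset (Slot ι)} (hW : D.QReg h J)
    (hW' : D.QReg h' J') :
    ∃ G : ℂ → (ι → ℂ) → ℂ, Reg1 false G ∧ ∀ p u, Adm false (ins p u) → p ^ 2 - 1 ≠ 0 →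
      D.P p * (D.W h p (J.map (Slot.map u)) * D.W h' p (J'.map (Slot.map u))) = G p u := by
  obtain ⟨g, hg, e⟩ := hW
  obtain ⟨g', hg', e'⟩ := hW'
  refine ⟨_, (Reg1.sqSubOnePow (D.k - 2)).mul (hg.mul hg'), fun p u hp hp1 => ?_⟩
  obtain ⟨n, hn⟩ := Nat.exists_eq_add_of_le' hk
  rw [e p u hp hp1, e' p u hp hp1, P, hn, Nat.add_sub_cancel]
  field_simp
  ring

theorem QReg.deriv_term (hk : 2 ≤ D.k) (hW : D.QReg h J) :
    ∃ G : ℂ → (ι → ℂ) → ℂ, Reg1 false G ∧ ∀ p u, Adm false (ins p u) → p ^ 2 - 1 ≠ 0 →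
      D.P p * (deriv (fun t => D.W h t (J.map (Slot.map u))) p / (2 * p)
      + 2 / (p ^ 2 - 1) * D.W h p (J.map (Slot.map u))) = G p u := by
  obtain ⟨g, hg, e⟩ := hW
  refine ⟨_, ((Reg1.sqSubOnePow (D.k - 1)).mul (hg.deriv.mul ((Reg1.const 2⁻¹).mul Reg1.inv))).add
    ((Reg1.sqSubOnePow (D.k - 2)).mul hg), fun p u hp hp1 => ?_⟩
  have hp0 := (adm_ins.1 hp).2.1
  have h1 := (hg.differentiableAt hp).hasDerivAt.div ((hasDerivAt_pow 2 p).sub_const 1) hp1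
  have h2 : (fun t => D.W h t (J.map (Slot.map u))) =ᶠ[𝓝 p] fun t => g t u / (t ^ 2 - 1) := by
    have : ∀ᶠ t in 𝓝 p, t ^ 2 - 1 ≠ 0 :=
      ContinuousAt.eventually_ne (by fun_prop) hp1
    filter_upwards [hp.eventually_ins, this] with t ht ht1 using e t u ht ht1
  have h3 : deriv (fun t => g t u / (t ^ 2 - 1)) p = _ := h1.deriv
  rw [h2.deriv_eq, h3, e p u hp hp1, P]
  have e1 : D.k - 1 = D.k - 2 + 1 := by omega
  nth_rewrite 1 [← Nat.sub_add_cancel hk]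
  rw [e1, pow_add, pow_add]
  field_simp
  simp only [Nat.cast_ofNat, Nat.reduceSub, pow_one]
  ring

end LoopData

/-! ### The loop equations -/

namespace LoopData

variable (D : LoopData)

/-- The loop equation. -/
def LoopEq (h : ℕ) (J : Multiset (Slot ℂ)) (p : ℂ) : Prop :=
  D.c * p * D.W h p J = eraseSum (fun l K => D.src p (fun t => D.W h t K) l) J
    - D.P p * D.recTerm D.W h J p

variable {D} {ι : Type} [Fintype ι]

/-- `QReg` for all correlators of weight less than `n`. -/
def QRegBelow (D : LoopData) (n : ℕ) : Prop :=
  ∀ (ι : Type) [Fintype ι] (h : ℕ) (J : Multiset (Slot ι)), 1 ≤ h + J.card → h + J.card < n →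
    D.QReg h J

/-- The singularities on the right side of the loop equation cancel. -/
theorem exists_reg_loop_rhs (hk : 2 ≤ D.k) (h : ℕ) (J : Multiset (Slot ι)) (hJ : 2 ≤ h + J.card)
    (ih : D.QRegBelow (h + J.card)) :
    ∃ G : ℂ → (ι → ℂ) → ℂ, Reg1 false G ∧ ∀ p u, Adm false (ins p u) → p ^ 2 - 1 ≠ 0 →
      (∀ i, p ≠ u i) →
      eraseSum (fun l K => D.src p (fun t => D.W h t K) l) (J.map (Slot.map u))
        - D.P p * D.recTerm D.W h (J.map (Slot.map u)) p = G p u := by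
  classical
  have h1 : ∀ l ∈ J, ∃ G : ℂ → (ι → ℂ) → ℂ, Reg1 false G ∧ ∀ p u, Adm false (ins p u) →
      p ^ 2 - 1 ≠ 0 → (∀ i, p ≠ u i) →
      D.src p (fun t => D.W h t ((J.erase l).map (Slot.map u))) (l.map u)
        - D.P p * (ker p (l.map u) * D.W h p ((J.erase l).map (Slot.map u))) = G p u := by
    intro l hl
    have := Multiset.card_erase_add_one hl
    exact QReg.slot_term hk (ih ι h (J.erase l) (by omega) (by omega)) l
  choose! G1 hG1 e1 using h1
  have h2 : ∀ g ∈ antidiagonal h, ∀ K ∈ J.antidiagonal,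
      ∃ G : ℂ → (ι → ℂ) → ℂ, Reg1 false G ∧ ∀ p u, Adm false (ins p u) → p ^ 2 - 1 ≠ 0 →
      D.P p * (D.W g.1 p (K.1.map (Slot.map u)) * D.W g.2 p (K.2.map (Slot.map u))) = G p u := by
    intro g hg K hK
    have h1 := mem_antidiagonal.1 hg
    have h2 := congrArg Multiset.card (Multiset.mem_antidiagonal.1 hK)
    rw [Multiset.card_add] at h2
    by_cases hK0 : g.1 + K.1.card = 0
    · have h3 : g.1 = 0 := by omega
      have h4 : K.1 = 0 := Multiset.card_eq_zero.1 (by omega)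
      exact ⟨_, Reg1.const 0, fun p u _ _ => by rw [h3, h4]; simp⟩
    by_cases hL0 : g.2 + K.2.card = 0
    · have h3 : g.2 = 0 := by omega
      have h4 : K.2 = 0 := Multiset.card_eq_zero.1 (by omega)
      exact ⟨_, Reg1.const 0, fun p u _ _ => by rw [h3, h4]; simp⟩
    exact QReg.conv_term hk (ih ι g.1 K.1 (by omega) (by omega))
      (ih ι g.2 K.2 (by omega) (by omega))
  choose! G2 hG2 e2 using h2
  have h3 : ∃ G : ℂ → (ι → ℂ) → ℂ, Reg1 false G ∧ ∀ p u, Adm false (ins p u) → p ^ 2 - 1 ≠ 0 →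
      D.P p * (if 2 ≤ h then D.W (h - 2) p (.point p ::ₘ J.map (Slot.map u)) else 0) = G p u := by
    by_cases h2 : 2 ≤ h
    · simp only [if_pos h2]
      have hq := ih (Option ι) (h - 2) (.point none ::ₘ J.map (Slot.map some))
        (by simp; omega) (by simp; omega)
      have hr := (hq.reg_P_mul hk).eval none
      refine ⟨fun p u => D.P p * D.W (h - 2) p (.point p ::ₘ J.map (Slot.map u)), hr.congr ?_,
        fun _ _ _ _ => rfl⟩
      intro v hv
      rw [Multiset.map_cons, Multiset.map_map]
      congr 4
      funext l
      cases l <;> rfl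
    · simp only [if_neg h2]
      exact ⟨_, Reg1.const 0, fun p u _ _ => by simp⟩
  obtain ⟨G3, hG3, e3⟩ := h3
  have h4 : ∃ G : ℂ → (ι → ℂ) → ℂ, Reg1 false G ∧ ∀ p u, Adm false (ins p u) → p ^ 2 - 1 ≠ 0 →
      D.P p * (if 1 ≤ h then D.Q * (deriv (fun t => D.W (h - 1) t (J.map (Slot.map u))) p / (2 * p)
      + 2 / (p ^ 2 - 1) * D.W (h - 1) p (J.map (Slot.map u))) else 0) = G p u := by
    by_cases h2 : 1 ≤ h
    · simp only [if_pos h2]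
      obtain ⟨G, hG, e⟩ := QReg.deriv_term hk (ih ι (h - 1) J (by omega) (by omega))
      exact ⟨_, (Reg1.const D.Q).mul hG, fun p u hp hp1 => by rw [← e p u hp hp1]; ring⟩
    · simp only [if_neg h2]
      exact ⟨_, Reg1.const 0, fun p u _ _ => by simp⟩
  obtain ⟨G4, hG4, e4⟩ := h4
  refine ⟨fun p u => (J.map fun l => G1 l p u).sum - (∑ g ∈ antidiagonal h,
    (J.antidiagonal.map fun K => G2 g K p u).sum) - G3 p u - G4 p u, ?_, fun p u hp hp1 hpu => ?_⟩
  · refine Reg.sub (Reg.sub (Reg.sub ?_ ?_) hG3) hG4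
    · exact Reg.multiset_sum J fun l hl => hG1 l hl
    · exact Reg.sum _ fun g hg => Reg.multiset_sum _ fun K hK => hG2 g hg K hK
  · beta_reduce
    rw [← e3 p u hp hp1, ← e4 p u hp hp1]
    have s1 : (J.map fun l => G1 l p u).sum = eraseSum (fun l K => D.src p (fun t => D.W h t K) l)
        (J.map (Slot.map u))
        - D.P p * eraseSum (fun l K => ker p l * D.W h p K) (J.map (Slot.map u)) := by
      rw [eraseSum_map, eraseSum_map]
      unfold eraseSum
      rw [← Multiset.sum_map_mul_left, ← Multiset.sum_map_sub]
      congr 1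
      refine Multiset.map_congr rfl fun l hl => ?_
      exact (e1 l hl p u hp hp1 hpu).symm
    have s2 : (∑ g ∈ antidiagonal h,
        (J.antidiagonal.map fun K => G2 g K p u).sum) = D.P p *
        ∑ g ∈ antidiagonal h,
          conv (D.W g.1 p) (D.W g.2 p) (J.map (Slot.map u)) := by
      rw [Finset.mul_sum]
      refine Finset.sum_congr rfl fun g hg => ?_
      rw [conv_map]
      unfold conv
      rw [← Multiset.sum_map_mul_left]
      congr 1
      refine Multiset.map_congr rfl fun K hK => ?_
      exact (e2 g hg K hK p u hp hp1).symm
    rw [s1, s2, recTerm]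
    ring

theorem reg_and_loopEq_of_below (hk : 2 ≤ D.k) (hc : D.c ≠ 0) (h : ℕ) (J : Multiset (Slot ι))
    (hJ : 2 ≤ h + J.card) (ih : D.QRegBelow (h + J.card)) :
    Reg1 false (fun p (u : ι → ℂ) => D.W h p (J.map (Slot.map u))) ∧
      ∀ p u, Adm false (ins p u) → p ^ 2 - 1 ≠ 0 → (∀ i, p ≠ u i) →
        D.LoopEq h (J.map (Slot.map u)) p := by
  obtain ⟨G, hG, e⟩ := exists_reg_loop_rhs hk h J hJ ih
  have hG' : Reg1 false fun p u => D.c⁻¹ * p⁻¹ * G p u :=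
    ((Reg1.const _).mul Reg1.inv).mul hG
  have key : ∀ p u, Adm false (ins p u) →
      D.W h p (J.map (Slot.map u)) = D.c⁻¹ * p⁻¹ * G p u := by
    intro p u hp
    rw [W_eq _ _ _ _ (by simpa using hJ)]
    refine Tendsto.limUnder_eq ?_
    have h1 := (hG'.differentiableAt hp).continuousAt.tendsto
    refine (h1.mono_left nhdsWithin_le_nhds).congr' ?_
    filter_upwards [eventually_generic p u, hp.eventually_ins.filter_mono nhdsWithin_le_nhds]
      with q hq hq'
    rw [step, e q u hq' hq.1 hq.2]
    have := (adm_ins.1 hq').2.1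
    field_simp
  refine ⟨hG'.congr fun p u hp => (key p u hp).symm, fun p u hp hp1 hpu => ?_⟩
  rw [LoopEq, e p u hp hp1 hpu, key p u hp]
  have := (adm_ins.1 hp).2.1
  field_simp

theorem qregBelow (hk : 2 ≤ D.k) (hc : D.c ≠ 0) (n : ℕ) : D.QRegBelow n := by
  induction n with
  | zero => intro ι _ h J h1 h2; omega
  | succ n ih =>
    intro ι _ h J h1 h2
    rcases Nat.lt_or_ge (h + J.card) n with h3 | h3
    · exact ih ι h J h1 h3
    have h4 : h + J.card = n := by omega
    by_cases h5 : h + J.card = 1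
    · rcases Nat.eq_zero_or_pos h with rfl | h6
      · obtain ⟨l, rfl⟩ := Multiset.card_eq_one.1 (show J.card = 1 by omega)
        exact qreg_two l
      · obtain rfl : h = 1 := by omega
        obtain rfl : J = 0 := Multiset.card_eq_zero.1 (by omega)
        exact qreg_half
    · have h6 := (reg_and_loopEq_of_below hk hc h J (by omega) (h4 ▸ ih)).1
      refine ⟨_, (Reg1.sqSubOnePow 1).mul h6, fun p u _ hp1 => ?_⟩
      field_simp

theorem qreg (hk : 2 ≤ D.k) (hc : D.c ≠ 0) (h : ℕ) (J : Multiset (Slot ι)) (hJ : 1 ≤ h + J.card) :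
    D.QReg h J := qregBelow hk hc _ ι h J hJ (Nat.lt_succ_self _)

/-- Stable correlators are regular, also at coincident arguments and at `∞₊` and `∞₋`. -/
theorem reg_W (hk : 2 ≤ D.k) (hc : D.c ≠ 0) (h : ℕ) (J : Multiset (Slot ι))
    (hJ : 2 ≤ h + J.card) : Reg1 false fun p (u : ι → ℂ) => D.W h p (J.map (Slot.map u)) :=
  (reg_and_loopEq_of_below hk hc h J hJ (qregBelow hk hc _)).1

theorem loopEq_map (hk : 2 ≤ D.k) (hc : D.c ≠ 0) (h : ℕ) (J : Multiset (Slot ι))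
    (hJ : 2 ≤ h + J.card) {p : ℂ} {u : ι → ℂ} (hp : Adm false (ins p u)) (hp1 : p ^ 2 - 1 ≠ 0)
    (hpu : ∀ i, p ≠ u i) : D.LoopEq h (J.map (Slot.map u)) p :=
  (reg_and_loopEq_of_below hk hc h J hJ (qregBelow hk hc _)).2 p u hp hp1 hpu

theorem reg_W_true (hk : 2 ≤ D.k) (hc : D.c ≠ 0) (h : ℕ) (J : Multiset (Slot ι)) :
    Reg1 true fun p (u : ι → ℂ) => D.W h p (J.map (Slot.map u)) := by
  by_cases hJ : h + J.card = 0
  · obtain rfl : h = 0 := by omega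
    obtain rfl : J = 0 := Multiset.card_eq_zero.1 (by omega)
    exact (Reg1.const 0).congr fun p u _ => by simp
  · obtain ⟨g, hg, e⟩ := qreg hk hc h J (by omega)
    refine ((Reg.mono (e := true) hg).mul (Reg.pole rfl none)).congr fun v hv => ?_
    have h1 := hv.2 rfl none
    beta_reduce
    rw [e]
    · rfl
    · refine (adm_ins.2 ⟨(hv.comp some).to_false, hv.ne_zero none, fun i => hv.1 none (some i),
        by simp⟩)
    · exact h1

end LoopData

/-! ### Regular functions of two points -/

section

variable {ι : Type} {e : Bool}

@[simp] theorem map_map_ins (J : Multiset (Slot ι)) (a : ℂ) (u : ι → ℂ) :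
    (J.map (Slot.map some)).map (Slot.map (ins a u)) = J.map (Slot.map u) := by
  rw [Multiset.map_map]
  congr 1
  funext l
  cases l <;> rfl

theorem Adm.ins_comp {κ : Type} {p : ℂ} {u : ι → ℂ} (h : Adm e (ins p u)) (φ : κ → ι) :
    Adm e (ins p fun i => u (φ i)) := by
  obtain ⟨h1, h2, h3, h4⟩ := adm_ins.1 h
  exact adm_ins.2 ⟨h1.comp φ, h2, fun i => h3 _, h4⟩

theorem Adm.ins_tail {p a : ℂ} {u : ι → ℂ} (h : Adm e (ins p (ins a u))) : Adm e (ins p u) :=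
  h.ins_comp some

theorem Adm.ins_swap {p a : ℂ} {u : ι → ℂ} (h : Adm e (ins p (ins a u))) :
    Adm e (ins a (ins p u)) := by
  convert h.comp (fun o : Option (Option ι) => match o with
    | none => some none
    | some none => none
    | some (some i) => some (some i)) using 1
  funext o
  rcases o with _ | _ | i <;> rfl

theorem Adm.ins_dup {p : ℂ} {u : ι → ℂ} (h : Adm e (ins p u)) : Adm e (ins p (ins p u)) := by
  convert h.comp (fun o : Option (Option ι) => match o with
    | none => none
    | some none => none
    | some (some i) => some i) using 1
  funext o
  rcases o with _ | _ | i <;> rfl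

theorem Adm.ins_dup₂ {p a : ℂ} {u : ι → ℂ} (h : Adm e (ins p (ins a u))) :
    Adm e (ins p (ins a (ins p u))) := by
  convert h.comp (fun o : Option (Option (Option ι)) => match o with
    | none => none
    | some none => some none
    | some (some none) => none
    | some (some (some i)) => some (some i)) using 1
  funext o
  rcases o with _ | _ | _ | i <;> rfl

theorem Adm.ins_of_mem {u : ι → ℂ} (h : Adm e u) (i : ι) : Adm e (ins (u i) u) := by
  convert h.comp (fun o : Option ι => o.elim i id) using 1
  funext o
  rcases o with _ | i <;> rfl

theorem Reg1.eq_zero_of_generic [Fintype ι] {F : ℂ → (ι → ℂ) → ℂ} (h : Reg1 e F) {u : ι → ℂ}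
    (h0 : ∀ p, Adm e (ins p u) → (∀ i, p ≠ u i) → F p u = 0) {p : ℂ} (hp : Adm e (ins p u)) :
    F p u = 0 := by
  have h1 := (h.differentiableAt hp).continuousAt.tendsto.mono_left
    (nhdsWithin_le_nhds (s := {p}ᶜ))
  refine tendsto_nhds_unique h1 (tendsto_const_nhds.congr' ?_)
  filter_upwards [eventually_generic p u, hp.eventually_ins.filter_mono nhdsWithin_le_nhds]
    with q hq hq'
  exact (h0 q hq' hq.2).symm

theorem hasDerivAt_ins (p : ℂ) (u : ι → ℂ) [DecidableEq (Option ι)] [Fintype ι] :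
    HasDerivAt (fun t : ℂ => ins t u) (Pi.single none 1) p := by
  refine hasDerivAt_pi.2 fun o => ?_
  cases o
  · rw [Pi.single_eq_same]; exact hasDerivAt_id' p
  · simpa [ins] using hasDerivAt_const p _

theorem hasDerivAt_ins_ins (s t : ℂ) (u : ι → ℂ) [DecidableEq (Option (Option ι))] [Fintype ι] :
    HasDerivAt (fun t : ℂ => ins s (ins t u)) (Pi.single (some none) 1) t := by
  refine hasDerivAt_pi.2 fun o => ?_
  rcases o with _ | _ | i
  · simpa [ins] using hasDerivAt_const t _
  · rw [Pi.single_eq_same]; exact hasDerivAt_id' t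
  · simpa [ins] using hasDerivAt_const t _

/-- Regularity of a function of two distinguished points and a configuration. -/
def Reg2 (e : Bool) (F : ℂ → ℂ → (ι → ℂ) → ℂ) : Prop :=
  Reg e fun v : Option (Option ι) → ℂ => F (v none) (v (some none)) fun i => v (some (some i))

open Classical in
/-- Partial derivatives of regular functions commute. -/
theorem Reg2.hasDerivAt_deriv [Fintype ι] {F : ℂ → ℂ → (ι → ℂ) → ℂ} (h : Reg2 e F) {s t : ℂ}
    {u : ι → ℂ} (ha : Adm e (ins s (ins t u))) {G : ℂ → ℂ}
    (hG : ∀ᶠ r in 𝓝 s, HasDerivAt (fun t => F r t u) (G r) t) :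
    HasDerivAt (fun t => deriv (fun s => F s t u) s) (deriv G s) t := by
  set Φ : (Option (Option ι) → ℂ) → ℂ :=
    fun v => F (v none) (v (some none)) fun i => v (some (some i)) with hΦ
  have hΦr : Reg e Φ := h
  have h1 : ∀ r t, Adm e (ins r (ins t u)) →
      HasDerivAt (fun s => F s t u) (fderiv ℂ Φ (ins r (ins t u)) (Pi.single none 1)) r :=
    fun r t h => by
      have hi := hasDerivAt_ins r (ins t u)
      exact (hΦr.differentiableAt h).hasFDerivAt.comp_hasDerivAt r hi
  have h2 : ∀ r t, Adm e (ins r (ins t u)) →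
      HasDerivAt (fun t => F r t u) (fderiv ℂ Φ (ins r (ins t u)) (Pi.single (some none) 1)) t :=
    fun r t h => by
      have hi := hasDerivAt_ins_ins r t u
      exact (hΦr.differentiableAt h).hasFDerivAt.comp_hasDerivAt t hi
  have hi := hasDerivAt_ins_ins s t u
  have hi' := hasDerivAt_ins s (ins t u)
  have h3 := ((hΦr.fderiv (Pi.single none 1)).differentiableAt ha).hasFDerivAt.comp_hasDerivAt t hi
  have h4 := ((hΦr.fderiv (Pi.single (some none) 1)).differentiableAt
    ha).hasFDerivAt.comp_hasDerivAt s hi'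
  rw [hΦr.fderiv_comm ha] at h3
  have h5 : deriv G s = _ := (h4.congr_of_eventuallyEq (f₁ := G) (by
    filter_upwards [hG, ha.eventually_ins] with r hr hr'
    exact hr.unique (h2 r t hr'))).deriv
  rw [h5]
  refine h3.congr_of_eventuallyEq ?_
  have h6 : ∀ᶠ t' in 𝓝 t, Adm e (ins s (ins t' u)) := by
    filter_upwards [ha.ins_swap.eventually_ins] with t' ht' using ht'.ins_swap
  filter_upwards [h6] with t' ht'
  exact (h1 s t' ht').deriv

open Classical in
theorem Reg2.exists_hasDerivAt_snd [Fintype ι] {F : ℂ → ℂ → (ι → ℂ) → ℂ} (h : Reg2 e F) :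
    ∃ G : ℂ → ℂ → (ι → ℂ) → ℂ, Reg2 e G ∧ ∀ s t u, Adm e (ins s (ins t u)) →
      HasDerivAt (fun t => F s t u) (G s t u) t := by
  refine ⟨fun s t u => fderiv ℂ (fun v : Option (Option ι) → ℂ =>
    F (v none) (v (some none)) fun i => v (some (some i))) (ins s (ins t u))
    (Pi.single (some none) 1), ?_, fun s t u hp => ?_⟩
  · refine (Reg.fderiv h (Pi.single (some none) 1)).congr fun v _ => ?_
    congr 2
    funext o
    rcases o with _ | _ | i <;> rfl
  · have hi := hasDerivAt_ins_ins s t u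
    exact (Reg.differentiableAt h hp).hasFDerivAt.comp_hasDerivAt t hi

theorem Reg2.eq_zero_of_generic [Fintype ι] {F : ℂ → ℂ → (ι → ℂ) → ℂ} (h : Reg2 e F) {a : ℂ}
    {u : ι → ℂ} (h0 : ∀ p, Adm e (ins p (ins a u)) → p ≠ a → (∀ i, p ≠ u i) → F p a u = 0) {p : ℂ}
    (hp : Adm e (ins p (ins a u))) : F p a u = 0 :=
  Reg1.eq_zero_of_generic (F := fun p (u' : Option ι → ℂ) => F p (u' none) fun i => u' (some i)) h
    (u := ins a u) (fun p hp hpu => h0 p hp (hpu none) fun i => hpu (some i)) hp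

theorem hasDerivAt_multiset_sum {α : Type} (s : Multiset α) {F : α → ℂ → ℂ} {F' : α → ℂ} {t : ℂ}
    (h : ∀ a ∈ s, HasDerivAt (F a) (F' a) t) :
    HasDerivAt (fun t => (s.map fun a => F a t).sum) (s.map F').sum t := by
  induction s using Multiset.induction with
  | empty => simpa using hasDerivAt_const t _
  | cons a s ih =>
    simp only [Multiset.map_cons, Multiset.sum_cons]
    exact (h a (by simp)).add (ih fun b hb => h b (by simp [hb]))

theorem hasDerivAt_eraseSum {α : Type} {J : Multiset α} {F : ℂ → α → Multiset α → ℂ}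
    {F' : α → Multiset α → ℂ} {t : ℂ}
    (h : ∀ a K, J = a ::ₘ K → HasDerivAt (fun t => F t a K) (F' a K) t) :
    HasDerivAt (fun t => eraseSum (F t) J) (eraseSum F' J) t := by
  classical
  exact hasDerivAt_multiset_sum J fun a ha => h a _ (by rw [Multiset.cons_erase ha])

theorem hasDerivAt_conv {α : Type} {J : Multiset α} (f : Multiset α → ℂ)
    {F : ℂ → Multiset α → ℂ} {F' : Multiset α → ℂ} {t : ℂ}
    (h : ∀ K L, K + L = J → HasDerivAt (fun t => f K * F t L) (f K * F' L) t) :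
    HasDerivAt (fun t => conv f (F t) J) (conv f F' J) t :=
  hasDerivAt_multiset_sum J.antidiagonal fun _ hK => h _ _ (Multiset.mem_antidiagonal.1 hK)

theorem eraseSum_mul_left {α : Type} (J : Multiset α) (c : ℂ) (φ : α → Multiset α → ℂ) :
    eraseSum (fun a K => c * φ a K) J = c * eraseSum φ J := by
  simp [eraseSum, Multiset.sum_map_mul_left]

theorem eraseSum_add {α A : Type} [CommRing A] (J : Multiset α) (φ ψ : α → Multiset α → A) :
    eraseSum (fun a K => φ a K + ψ a K) J = eraseSum φ J + eraseSum ψ J := by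
  simp [eraseSum, Multiset.sum_map_add]

theorem conv_mul_left {α : Type} (J : Multiset α) (c : ℂ) (f g : Multiset α → ℂ) :
    conv f (fun K => c * g K) J = c * conv f g J := by
  simp [conv, ← Multiset.sum_map_mul_left, mul_left_comm]

end

namespace LoopData

variable {D : LoopData} {ι : Type} [Fintype ι]

variable (D) in
/-- The coefficient of the value of `f` in `src q f l`. -/
def srcVal (q : ℂ) : Slot ℂ → ℂ
  | .point a => deriv (fun t => D.P t / (q ^ 2 - t ^ 2)) a / (2 * a)
  | .divisor a => D.P a / (q ^ 2 - a ^ 2)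

variable (D) in
/-- The coefficient of the derivative of `f` in `src q f l`. -/
def srcDer (q : ℂ) : Slot ℂ → ℂ
  | .point a => D.P a / (q ^ 2 - a ^ 2) / (2 * a)
  | .divisor _ => 0

theorem differentiable_P : Differentiable ℂ D.P := by
  unfold P
  fun_prop

theorem src_eq {q : ℂ} {f : ℂ → ℂ} {l : Slot ℂ} (hf : DifferentiableAt ℂ f l.pos)
    (hq : q ^ 2 - l.pos ^ 2 ≠ 0) :
    D.src q f l = D.srcVal q l * f l.pos + D.srcDer q l * deriv f l.pos := by
  rcases l with a | a
  · have h0 : DifferentiableAt ℂ (fun t => D.P t / (q ^ 2 - t ^ 2)) a :=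
      (differentiable_P a).div (by fun_prop) hq
    have h1 := h0.hasDerivAt
    have h2 := (h1.mul hf.hasDerivAt).deriv
    have h3 : (fun t => D.P t * f t / (q ^ 2 - t ^ 2)) = (fun t => D.P t /
      (q ^ 2 - t ^ 2)) * f := by
      funext t
      simp only [Pi.mul_apply]
      ring
    simp only [src, srcVal, srcDer, Slot.pos] at *
    rw [h3, h2]
    ring
  · simp only [src, srcVal, srcDer, Slot.pos]
    ring

theorem two_hasDerivAt {p a : ℂ} (hp : p ≠ 0) (ha : a ≠ 0) (hpa : p + a ≠ 0) :
    HasDerivAt (fun t => D.two p (.divisor t)) (2 * a * D.two p (.point a)) a := by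
  have h1 := (((hasDerivAt_id' a).const_add p).inv hpa).const_sub ((p - D.ν) / (p ^ 2 - 1))
  have h2 := (h1.const_mul (1 / (2 * p))).congr_deriv
    (show _ = 2 * a * (1 / (4 * p * a * (p + a) ^ 2)) by field_simp; norm_num)
  refine h2.congr_of_eventuallyEq (Eventually.of_forall fun t => ?_)
  simp [two]

variable (D) in
/-- The derivative with respect to the position of a divisor label is the correlator with a point
label; the factor `2 a` is `dX / da`. -/
def DivDeriv (h : ℕ) {ι : Type} (J : Multiset (Slot ι)) : Prop :=
  ∀ (p a : ℂ) (u : ι → ℂ), Adm true (ins p (ins a u)) →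
    HasDerivAt (fun t => D.W h p (.divisor t ::ₘ J.map (Slot.map u)))
      (2 * a * D.W h p (.point a ::ₘ J.map (Slot.map u))) a

theorem reg2_W_true (hk : 2 ≤ D.k) (hc : D.c ≠ 0) (h : ℕ) (J : Multiset (Slot ι))
    (σ : Slot Unit) : Reg2 true fun p a (u : ι → ℂ) =>
      D.W h p (σ.map (fun _ => a) ::ₘ J.map (Slot.map u)) := by
  have h1 := reg_W_true hk hc h (ι := Option ι) (σ.map (fun _ => none) ::ₘ J.map (Slot.map some))
  refine Reg.congr h1 fun v _ => ?_
  beta_reduce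
  rw [Multiset.map_cons, Multiset.map_map]
  congr 2
  · cases σ <;> rfl
  · congr 1
    funext l
    cases l <;> rfl

theorem DivDeriv.deriv_hasDerivAt (hk : 2 ≤ D.k) (hc : D.c ≠ 0) {h : ℕ} {J : Multiset (Slot ι)}
    (hJ : D.DivDeriv h J) {p a : ℂ} {u : ι → ℂ} (hp : Adm true (ins p (ins a u))) :
    HasDerivAt (fun t => deriv (fun s => D.W h s (.divisor t ::ₘ J.map (Slot.map u))) p)
      (2 * a * deriv (fun s => D.W h s (.point a ::ₘ J.map (Slot.map u))) p) a := by
  have h1 := (reg2_W_true hk hc h J (.divisor ())).hasDerivAt_deriv hp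
    (G := fun r => 2 * a * D.W h r (.point a ::ₘ J.map (Slot.map u))) (by
      filter_upwards [hp.eventually_ins] with r hr using hJ r a u hr)
  rwa [deriv_const_mul_field] at h1

theorem differentiableAt_W (hk : 2 ≤ D.k) (hc : D.c ≠ 0) (h : ℕ) (J : Multiset (Slot ι)) {p : ℂ}
    {u : ι → ℂ} (hp : Adm true (ins p u)) :
    DifferentiableAt ℂ (fun s => D.W h s (J.map (Slot.map u))) p :=
  (reg_W_true hk hc h J).differentiableAt hp

omit [Fintype ι] in
theorem sq_sub_ne {e : Bool} {p a : ℂ} {u : ι → ℂ} (hp : Adm e (ins p (ins a u))) (hpa : p ≠ a) :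
    p ^ 2 - a ^ 2 ≠ 0 := by
  rw [sq_sub_sq]
  exact mul_ne_zero (hp.1 none (some none)) (sub_ne_zero.2 hpa)

omit [Fintype ι] in
theorem sq_sub_ne' {e : Bool} {p : ℂ} {u : ι → ℂ} (hp : Adm e (ins p u)) (l : Slot ι)
    (hpa : p ≠ u l.pos) : p ^ 2 - (l.map u).pos ^ 2 ≠ 0 := by
  have : (l.map u).pos = u l.pos := by cases l <;> rfl
  rw [sq_sub_sq, this]
  exact mul_ne_zero ((adm_ins.1 hp).2.2.1 _) (sub_ne_zero.2 hpa)

omit [Fintype ι] in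
theorem pos_map {α β : Type} (f : α → β) (l : Slot α) : (l.map f).pos = f l.pos := by
  cases l <;> rfl

theorem DivDeriv.src_hasDerivAt (hk : 2 ≤ D.k) (hc : D.c ≠ 0) {h : ℕ} {J : Multiset (Slot ι)}
    (hJ : D.DivDeriv h J) {q a : ℂ} {u : ι → ℂ} (hp : Adm true (ins a u)) (l : Slot ι)
    (hq : q ^ 2 - (l.map u).pos ^ 2 ≠ 0) :
    HasDerivAt (fun t => D.src q (fun s => D.W h s (.divisor t ::ₘ J.map (Slot.map u))) (l.map u))
      (2 * a * D.src q (fun s => D.W h s (.point a ::ₘ J.map (Slot.map u))) (l.map u)) a := by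
  have h0 : ∀ t, Adm true (ins t u) → Adm true (ins (l.map u).pos (ins t u)) := fun t ht => by
    rw [pos_map]
    exact ht.ins_of_mem (some l.pos)
  have hd : ∀ (σ : Slot Unit) (t : ℂ), Adm true (ins t u) → DifferentiableAt ℂ (fun s =>
      D.W h s (σ.map (fun _ => t) ::ₘ J.map (Slot.map u))) (l.map u).pos := by
    intro σ t ht
    have := differentiableAt_W hk hc h (σ.map (fun _ => none) ::ₘ J.map (Slot.map some)) (h0 t ht)
    rw [Multiset.map_cons, map_map_ins] at this
    cases σ <;> exact this
  have hd1 : DifferentiableAt ℂ (fun s => D.W h s (.point a ::ₘ J.map (Slot.map u)))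
    (l.map u).pos := hd (.point ()) a hp
  rw [src_eq hd1 hq]
  have h1 := ((hJ _ a u (h0 a hp)).const_mul (D.srcVal q (l.map u))).add
    ((hJ.deriv_hasDerivAt hk hc (h0 a hp)).const_mul (D.srcDer q (l.map u)))
  refine (h1.congr_deriv (by ring)).congr_of_eventuallyEq ?_
  filter_upwards [hp.eventually_ins] with t ht
  exact src_eq (hd (.divisor ()) t ht) hq

/-! ### Derivatives with respect to the divisor slots -/

variable (D) in
/-- The part of `recTerm` that is linear in the correlators carrying one further label, when these
are given by `V`. -/
def recLin (V : ℕ → ℂ → Multiset (Slot ℂ) → ℂ) (h : ℕ) (J : Multiset (Slot ℂ))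
    (q : ℂ) : ℂ :=
  eraseSum (fun l K => ker q l * V h q K) J
  + 2 * ∑ g ∈ antidiagonal h, conv (D.W g.1 q) (V g.2 q) J
  + (if 2 ≤ h then V (h - 2) q (.point q ::ₘ J) else 0)
  + (if 1 ≤ h then D.Q * (deriv (fun t => V (h - 1) t J) q / (2 * q)
      + 2 / (q ^ 2 - 1) * V (h - 1) q J) else 0)

theorem recTerm_cons (h : ℕ) (l : Slot ℂ) (J : Multiset (Slot ℂ)) (q : ℂ) :
    D.recTerm D.W h (l ::ₘ J) q =
      ker q l * D.W h q J + D.recLin (fun h q K => D.W h q (l ::ₘ K)) h J q := by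
  have h1 : ∑ g ∈ antidiagonal h, conv (D.W g.1 q) (D.W g.2 q) (l ::ₘ J)
      = 2 * ∑ g ∈ antidiagonal h,
        conv (D.W g.1 q) (fun K => D.W g.2 q (l ::ₘ K)) J := by
    simp only [conv_cons, Finset.sum_add_distrib, two_mul]
    congr 1
    rw [← Finset.Nat.sum_antidiagonal_swap]
    exact Finset.sum_congr rfl fun g _ => conv_comm _ _ _
  rw [recTerm, recLin, h1, eraseSum_cons]
  simp only [Multiset.cons_swap (Slot.point q) l J]
  ring

theorem eraseSum_src_cons (h : ℕ) (l : Slot ℂ) (J : Multiset (Slot ℂ)) (q : ℂ) :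
    eraseSum (fun l K => D.src q (fun t => D.W h t K) l) (l ::ₘ J) =
      D.src q (fun t => D.W h t J) l
        + eraseSum (fun l' K => D.src q (fun t => D.W h t (l ::ₘ K)) l') J := eraseSum_cons _ _ _

theorem hasDerivAt_ker {p a : ℂ} (h : p ^ 2 - a ^ 2 ≠ 0) :
    HasDerivAt (fun t => ker p (.divisor t)) (2 * a * ker p (.point a)) a := by
  have h1 := (((hasDerivAt_pow 2 a).const_sub (p ^ 2)).inv h).sub_const (1 / (p ^ 2 - 1))
  refine (h1.congr_deriv ?_).congr_of_eventuallyEq (Eventually.of_forall fun t => ?_)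
  · simp only [ker]
    field_simp
    norm_num
    ring
  · simp [ker]

theorem DivDeriv.recLin_hasDerivAt (hk : 2 ≤ D.k) (hc : D.c ≠ 0) {h : ℕ} {J : Multiset (Slot ι)}
    (ih : ∀ (ι : Type) [Fintype ι] (h' : ℕ) (J' : Multiset (Slot ι)),
      h' + J'.card < h + J.card → D.DivDeriv h' J') {p a : ℂ} {u : ι → ℂ}
    (hp : Adm true (ins p (ins a u))) :
    HasDerivAt
      (fun t => D.recLin (fun h q K => D.W h q (.divisor t ::ₘ K)) h (J.map (Slot.map u)) p)
      (2 * a * D.recLin (fun h q K => D.W h q (.point a ::ₘ K)) h (J.map (Slot.map u)) p) a := by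
  unfold recLin
  rw [mul_add, mul_add, mul_add]
  refine HasDerivAt.add (HasDerivAt.add (HasDerivAt.add ?_ ?_) ?_) ?_
  · rw [eraseSum_map, ← eraseSum_mul_left]
    simp only [eraseSum_map]
    refine hasDerivAt_eraseSum fun l K hK => ?_
    have h1 := (ih ι h K (by simp [hK]) p a u hp).const_mul (ker p (l.map u))
    exact h1.congr_deriv (by ring)
  · rw [mul_left_comm, Finset.mul_sum]
    refine HasDerivAt.const_mul _ (HasDerivAt.fun_sum fun g hg => ?_)
    rw [conv_map, ← conv_mul_left]
    simp only [conv_map]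
    refine hasDerivAt_conv _ fun K L hKL => ?_
    have h1 := mem_antidiagonal.1 hg
    have h2 := congrArg Multiset.card hKL
    rw [Multiset.card_add] at h2
    by_cases hK : g.1 + K.card = 0
    · have h3 : g.1 = 0 := by omega
      have h4 : K = 0 := Multiset.card_eq_zero.1 (by omega)
      rw [h3, h4]
      simpa using hasDerivAt_const a (0 : ℂ)
    · exact (ih ι g.2 L (by omega) p a u hp).const_mul _
  · split_ifs with h2
    · have h1 := ih (Option ι) (h - 2) (.point none ::ₘ J.map (Slot.map some))
        (by simp; omega) p a (ins p u) hp.ins_dup₂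
      rw [Multiset.map_cons, map_map_ins] at h1
      exact h1
    · simpa using hasDerivAt_const a (0 : ℂ)
  · split_ifs with h2
    · have hJ := ih ι (h - 1) J (by omega)
      have h1 := (((hJ.deriv_hasDerivAt hk hc hp).div_const (2 * p)).add
        ((hJ p a u hp).const_mul (2 / (p ^ 2 - 1)))).const_mul D.Q
      exact h1.congr_deriv (by ring)
    · simpa using hasDerivAt_const a (0 : ℂ)

theorem loopEq_cons (hk : 2 ≤ D.k) (hc : D.c ≠ 0) (h : ℕ) (σ : Slot Unit) (J : Multiset (Slot ι))
    (hJ : 1 ≤ h + J.card) {p a : ℂ} {u : ι → ℂ} (hp : Adm false (ins p (ins a u)))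
    (hp1 : p ^ 2 - 1 ≠ 0) (hpa : p ≠ a) (hpu : ∀ i, p ≠ u i) :
    D.c * p * D.W h p (σ.map (fun _ => a) ::ₘ J.map (Slot.map u)) =
      D.src p (fun t => D.W h t (J.map (Slot.map u))) (σ.map fun _ => a)
      + eraseSum (fun l' K => D.src p (fun t => D.W h t (σ.map (fun _ => a) ::ₘ K)) l')
        (J.map (Slot.map u))
      - D.P p * (ker p (σ.map fun _ => a) * D.W h p (J.map (Slot.map u))
      + D.recLin (fun h q K => D.W h q (σ.map (fun _ => a) ::ₘ K)) h (J.map (Slot.map u)) p) := by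
  have h1 := loopEq_map hk hc h (σ.map (fun _ => none) ::ₘ J.map (Slot.map some))
    (by simp; omega) hp hp1 (by
      rintro (_ | i)
      · exact hpa
      · exact hpu i)
  have h2 : (σ.map (fun _ => none)).map (ins a u) = σ.map (fun _ => a) := by cases σ <;> rfl
  rw [LoopEq, Multiset.map_cons, map_map_ins, eraseSum_src_cons, recTerm_cons, h2] at h1
  exact h1

/-- The correlators with a divisor label are primitives of those with a point label: both satisfy
the loop equations, which determine them. -/
theorem divDeriv (hk : 2 ≤ D.k) (hc : D.c ≠ 0) (h : ℕ) (J : Multiset (Slot ι)) :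
    D.DivDeriv h J := by
  induction hn : h + J.card using Nat.strong_induction_on generalizing h ι with
  | _ n ih =>
  have ih' : ∀ (ι : Type) [Fintype ι] (h' : ℕ) (J' : Multiset (Slot ι)),
      h' + J'.card < h + J.card → D.DivDeriv h' J' := fun ι _ h' J' hlt =>
    ih _ (hn ▸ hlt) h' J' rfl
  rcases Nat.eq_zero_or_pos (h + J.card) with h0 | h0
  · obtain rfl : h = 0 := by omega
    obtain rfl : J = 0 := Multiset.card_eq_zero.1 (by omega)
    intro p a u hp
    simp only [Multiset.map_zero, Multiset.cons_zero, W_two]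
    exact two_hasDerivAt (hp.ne_zero none) (hp.ne_zero (some none)) (hp.1 none (some none))
  -- away from coincidences, differentiate the loop equation
  have gen : ∀ (p a : ℂ) (u : ι → ℂ), Adm true (ins p (ins a u)) → p ≠ a → (∀ i, p ≠ u i) →
      HasDerivAt (fun t => D.W h p (.divisor t ::ₘ J.map (Slot.map u)))
      (2 * a * D.W h p (.point a ::ₘ J.map (Slot.map u))) a := by
    intro p a u hp hpa hpu
    have hp0 : p ≠ 0 := hp.ne_zero none
    have ha0 : a ≠ 0 := hp.ne_zero (some none)
    have hp1 : p ^ 2 - 1 ≠ 0 := hp.2 rfl none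
    have hau : Adm true (ins a u) := hp.ins_swap.ins_tail
    have hs := sq_sub_ne hp hpa
    have d1 : HasDerivAt (fun t => D.src p (fun s => D.W h s (J.map (Slot.map u))) (.divisor t))
        (2 * a * D.src p (fun s => D.W h s (J.map (Slot.map u))) (.point a)) a := by
      have hd := differentiableAt_W hk hc h J hau
      have : DifferentiableAt ℂ
          (fun t => D.P t * D.W h t (J.map (Slot.map u)) / (p ^ 2 - t ^ 2)) a :=
        ((differentiable_P a).mul hd).div (by fun_prop) hs
      refine this.hasDerivAt.congr_deriv ?_
      simp only [src]
      field_simp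
    have d2 : HasDerivAt (fun t => eraseSum (fun l K =>
        D.src p (fun s => D.W h s (.divisor t ::ₘ K)) l) (J.map (Slot.map u)))
        (2 * a * eraseSum (fun l K =>
        D.src p (fun s => D.W h s (.point a ::ₘ K)) l) (J.map (Slot.map u))) a := by
      rw [eraseSum_map, ← eraseSum_mul_left]
      simp only [eraseSum_map]
      refine hasDerivAt_eraseSum fun l K hK => ?_
      exact (ih' ι h K (by simp [hK])).src_hasDerivAt hk hc hau l (sq_sub_ne' hp.ins_tail l (hpu _))
    have d3 := (hasDerivAt_ker hs).mul_const (D.W h p (J.map (Slot.map u)))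
    have d4 := DivDeriv.recLin_hasDerivAt hk hc ih' hp
    have d5 := ((d1.add d2).sub ((d3.add d4).const_mul (D.P p))).const_mul (D.c * p)⁻¹
    have e1 := loopEq_cons hk hc h (.point ()) J h0 hp.to_false hp1 hpa hpu
    refine (d5.congr_deriv ?_).congr_of_eventuallyEq ?_
    · simp only [Slot.map] at e1
      rw [inv_mul_eq_iff_eq_mul₀ (mul_ne_zero hc hp0)]
      linear_combination (-2 * a) * e1
    · have h6 : ∀ᶠ t' in 𝓝 a, Adm true (ins p (ins t' u)) := by
        filter_upwards [hp.ins_swap.eventually_ins] with t' ht' using ht'.ins_swap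
      have h7 : ∀ᶠ t' in 𝓝 a, p ≠ t' := by
        filter_upwards [eventually_ne_nhds hpa.symm] with t' ht' using ht'.symm
      filter_upwards [h6, h7] with t ht htp
      have e2 := loopEq_cons hk hc h (.divisor ()) J h0 ht.to_false hp1 htp hpu
      simp only [Slot.map] at e2
      rw [eq_inv_mul_iff_mul_eq₀ (mul_ne_zero hc hp0), e2]
      rfl
  -- the identity of regular functions extends to the coincidences
  intro p a u hp
  have hR := reg2_W_true hk hc h J (.divisor ())
  have hS := reg2_W_true hk hc h J (.point ())
  obtain ⟨G, hG, hRG⟩ := hR.exists_hasDerivAt_snd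
  have hGS : Reg2 true fun p a (u : ι → ℂ) =>
      G p a u - 2 * a * D.W h p (.point a ::ₘ J.map (Slot.map u)) :=
    Reg.sub hG (((Reg.const 2).mul (Reg.coord (some none))).mul hS)
  refine (hRG p a u hp).congr_deriv (sub_eq_zero.1 (hGS.eq_zero_of_generic ?_ hp))
  intro p hp hpa hpu
  rw [sub_eq_zero]
  exact (hRG p a u hp).unique (gen p a u hp hpa hpu)

end LoopData

/-! ### Vanishing of the boundary terms -/

theorem comb_deriv_eq_zero {f₁ f₂ : ℂ → ℂ} {c₁ c₂ x : ℂ} (h₁ : DifferentiableAt ℂ f₁ x)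
    (h₂ : DifferentiableAt ℂ f₂ x) (h : ∀ᶠ t in 𝓝 x, c₁ * f₁ t + c₂ * f₂ t = 0) :
    c₁ * deriv f₁ x + c₂ * deriv f₂ x = 0 :=
  (((h₁.hasDerivAt.const_mul c₁).add (h₂.hasDerivAt.const_mul c₂)).congr_of_eventuallyEq
    (f₁ := fun _ => 0) (h.mono fun _ ht => ht.symm)).unique (hasDerivAt_const x 0)

@[simp] theorem Slot.map_divisor {α β : Type} (f : α → β) (a : α) :
    (Slot.divisor a).map f = .divisor (f a) := rfl

@[simp] theorem Slot.map_point {α β : Type} (f : α → β) (a : α) :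
    (Slot.point a).map f = .point (f a) := rfl

theorem Adm.ins_ins_of_sq {ι : Type} {p s : ℂ} {u : ι → ℂ} (h : Adm true (ins p u))
    (hs : s ^ 2 = 1) : Adm false (ins p (ins s u)) := by
  obtain ⟨h1, h2, h3, h4⟩ := adm_ins.1 h
  have hs0 : s ≠ 0 := by
    rintro rfl
    norm_num at hs
  have key : ∀ a : ℂ, a ^ 2 - 1 ≠ 0 → a + s ≠ 0 := fun a ha h0 => ha (by
    linear_combination (a - s) * h0 + hs)
  refine adm_ins.2 ⟨adm_ins.2 ⟨h1.to_false, hs0, fun i => ?_, by simp⟩, h2, ?_, by simp⟩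
  · rw [add_comm]
    exact key _ (h1.2 rfl i)
  · rintro (_ | i)
    · exact key _ (h4 rfl)
    · exact h3 i

namespace LoopData

variable {D : LoopData} {ι : Type} [Fintype ι]

theorem differentiableAt_W' (hk : 2 ≤ D.k) (hc : D.c ≠ 0) (h : ℕ) (J : Multiset (Slot ι)) {p : ℂ}
    {u : ι → ℂ} (hp : Adm false (ins p u)) (hp1 : p ^ 2 - 1 ≠ 0) :
    DifferentiableAt ℂ (fun s => D.W h s (J.map (Slot.map u))) p := by
  by_cases hJ : h + J.card = 0
  · obtain rfl : h = 0 := by omega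
    obtain rfl : J = 0 := Multiset.card_eq_zero.1 (by omega)
    simp
  · obtain ⟨g, hg, e⟩ := qreg hk hc h J (by omega)
    have h1 : DifferentiableAt ℂ (fun s => g s u / (s ^ 2 - 1)) p :=
      (hg.differentiableAt hp).div (by fun_prop) hp1
    refine h1.congr_of_eventuallyEq ?_
    have : ∀ᶠ t in 𝓝 p, t ^ 2 - 1 ≠ 0 := ContinuousAt.eventually_ne (by fun_prop) hp1
    filter_upwards [hp.eventually_ins, this] with t ht ht1 using e t u ht ht1

theorem differentiableAt_W_cons (hk : 2 ≤ D.k) (hc : D.c ≠ 0) (h : ℕ) (σ : Slot Unit)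
    (J : Multiset (Slot ι)) {p a : ℂ} {u : ι → ℂ} (hp : Adm false (ins p (ins a u)))
    (hp1 : p ^ 2 - 1 ≠ 0) :
    DifferentiableAt ℂ (fun s => D.W h s (σ.map (fun _ => a) ::ₘ J.map (Slot.map u))) p := by
  have := differentiableAt_W' hk hc h (σ.map (fun _ => none) ::ₘ J.map (Slot.map some)) hp hp1
  rw [Multiset.map_cons, map_map_ins] at this
  cases σ <;> exact this

variable (D) in
/-- The weighted sum of the values of a divisor label at `∞₊` and `∞₋`. It vanishes when the
primitive `divisor t` is the integral along the divisor `D(z)`. -/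
def bdry (h : ℕ) (p : ℂ) (J : Multiset (Slot ℂ)) : ℂ :=
  (1 + D.ν) / 2 * D.W h p (.divisor 1 ::ₘ J) + (1 - D.ν) / 2 * D.W h p (.divisor (-1) ::ₘ J)

theorem bdry_recLin_eq_zero (hk : 2 ≤ D.k) (hc : D.c ≠ 0) {h : ℕ} {J : Multiset (Slot ι)}
    (ih : ∀ (ι : Type) [Fintype ι] (h' : ℕ) (J' : Multiset (Slot ι)),
      h' + J'.card < h + J.card → ∀ (p : ℂ) (u : ι → ℂ), Adm true (ins p u) →
        D.bdry h' p (J'.map (Slot.map u)) = 0) {p : ℂ} {u : ι → ℂ} (hp : Adm true (ins p u)) :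
    (1 + D.ν) / 2 *
        D.recLin (fun h q K => D.W h q (.divisor 1 ::ₘ K)) h (J.map (Slot.map u)) p +
      (1 - D.ν) / 2 *
        D.recLin (fun h q K => D.W h q (.divisor (-1) ::ₘ K)) h (J.map (Slot.map u)) p = 0 := by
  unfold recLin
  have e1 : (1 + D.ν) / 2 * eraseSum (fun l K => ker p l * D.W h p (.divisor 1 ::ₘ K))
        (J.map (Slot.map u)) +
      (1 - D.ν) / 2 * eraseSum (fun l K => ker p l * D.W h p (.divisor (-1) ::ₘ K))
        (J.map (Slot.map u)) = 0 := by
    rw [← eraseSum_mul_left, ← eraseSum_mul_left, ← eraseSum_add, eraseSum_map]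
    refine (eraseSum_congr (ψ := fun _ _ => 0) fun l K hK => ?_).trans (by simp [eraseSum])
    have := ih ι h K (by simp [hK]) p u hp
    rw [bdry] at this
    linear_combination ker p (l.map u) * this
  have e2 : ∀ g ∈ antidiagonal h,
      (1 + D.ν) / 2 * conv (D.W g.1 p) (fun K => D.W g.2 p (.divisor 1 ::ₘ K)) (J.map
        (Slot.map u)) +
      (1 - D.ν) / 2 * conv (D.W g.1 p) (fun K => D.W g.2 p (.divisor (-1) ::ₘ K))
        (J.map (Slot.map u)) = 0 := by
    intro g hg
    rw [← conv_mul_left, ← conv_mul_left, ← conv_add, conv_map]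
    refine (conv_congr (f' := fun _ => 0) (g' := fun _ => 0) fun K L hKL => ?_).trans
      (by simp [conv])
    have h1 := mem_antidiagonal.1 hg
    have h2 := congrArg Multiset.card hKL
    rw [Multiset.card_add] at h2
    by_cases hK : g.1 + K.card = 0
    · have h3 : g.1 = 0 := by omega
      have h4 : K = 0 := Multiset.card_eq_zero.1 (by omega)
      rw [h3, h4]
      simp
    · have := ih ι g.2 L (by omega) p u hp
      rw [bdry] at this
      rw [this, mul_zero, mul_zero]
  have e2' := Finset.sum_eq_zero e2
  rw [Finset.sum_add_distrib, ← Finset.mul_sum, ← Finset.mul_sum] at e2'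
  have e3 : (1 + D.ν) / 2 * (if 2 ≤ h then
        D.W (h - 2) p (.divisor 1 ::ₘ .point p ::ₘ J.map (Slot.map u)) else 0) +
      (1 - D.ν) / 2 * (if 2 ≤ h then
        D.W (h - 2) p (.divisor (-1) ::ₘ .point p ::ₘ J.map (Slot.map u)) else 0) = 0 := by
    split_ifs with h2
    · have h1 := ih (Option ι) (h - 2) (.point none ::ₘ J.map (Slot.map some))
        (by simp; omega) p (ins p u) hp.ins_dup
      rw [Multiset.map_cons, map_map_ins] at h1
      exact h1
    · simp
  have e4 : (1 + D.ν) / 2 * (if 1 ≤ h then D.Q * (deriv (fun t =>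
        D.W (h - 1) t (.divisor 1 ::ₘ J.map (Slot.map u))) p / (2 * p)
        + 2 / (p ^ 2 - 1) * D.W (h - 1) p (.divisor 1 ::ₘ J.map (Slot.map u))) else 0) +
      (1 - D.ν) / 2 * (if 1 ≤ h then D.Q * (deriv (fun t =>
        D.W (h - 1) t (.divisor (-1) ::ₘ J.map (Slot.map u))) p / (2 * p)
        + 2 / (p ^ 2 - 1) * D.W (h - 1) p (.divisor (-1) ::ₘ J.map (Slot.map u))) else 0) = 0 := by
    split_ifs with h2
    · have h1 := ih ι (h - 1) J (by omega)
      have hp1 := hp.2 rfl none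
      have h3 := comb_deriv_eq_zero
        (differentiableAt_W_cons hk hc (h - 1) (.divisor ()) J
          (hp.ins_ins_of_sq (show (1 : ℂ) ^ 2 = 1 by norm_num)) hp1)
        (differentiableAt_W_cons hk hc (h - 1) (.divisor ()) J
          (hp.ins_ins_of_sq (show (-1 : ℂ) ^ 2 = 1 by norm_num)) hp1)
        (c₁ := (1 + D.ν) / 2) (c₂ := (1 - D.ν) / 2)
        (hp.eventually_ins.mono fun t ht => h1 t u ht)
      have h4 := h1 p u hp
      rw [bdry] at h4
      simp only [Slot.map] at h3
      linear_combination (D.Q / (2 * p)) * h3 + (D.Q * (2 / (p ^ 2 - 1))) * h4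
    · simp
  linear_combination e1 + 2 * e2' + e3 + e4

/-- The combination `bdry` satisfies a homogeneous linear loop equation, and hence vanishes. -/
theorem bdry_eq_zero (hk : 2 ≤ D.k) (hc : D.c ≠ 0) (h : ℕ) (J : Multiset (Slot ι)) (p : ℂ)
    (u : ι → ℂ) (hp : Adm true (ins p u)) : D.bdry h p (J.map (Slot.map u)) = 0 := by
  induction hn : h + J.card using Nat.strong_induction_on generalizing h ι p with
  | _ n ih =>
  have ih' : ∀ (ι : Type) [Fintype ι] (h' : ℕ) (J' : Multiset (Slot ι)),
      h' + J'.card < h + J.card → ∀ (p : ℂ) (u : ι → ℂ), Adm true (ins p u) →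
        D.bdry h' p (J'.map (Slot.map u)) = 0 := fun ι _ h' J' hlt p u hp =>
    ih _ (hn ▸ hlt) h' J' p u hp rfl
  have s1 : (1 : ℂ) ^ 2 = 1 := by norm_num
  have s2 : (-1 : ℂ) ^ 2 = 1 := by norm_num
  rcases Nat.eq_zero_or_pos (h + J.card) with h0 | h0
  · obtain rfl : h = 0 := by omega
    obtain rfl : J = 0 := Multiset.card_eq_zero.1 (by omega)
    have hp0 := hp.ne_zero none
    have hp1 := hp.2 rfl none
    have hp2 := (hp.ins_ins_of_sq s1).1 none (some none)
    have hp3 := (hp.ins_ins_of_sq s2).1 none (some none)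
    simp only [bdry, Multiset.map_zero, Multiset.cons_zero, W_two, two]
    simp only [ins, Option.elim_none, Option.elim_some] at hp0 hp1 hp2 hp3
    have : p ^ 2 - 1 = (p + 1) * (p + -1) := by ring
    rw [this]
    field_simp
    ring
  have gen : ∀ p, Adm true (ins p u) → (∀ i, p ≠ u i) → D.bdry h p (J.map (Slot.map u)) = 0 := by
    intro p hp hpu
    have hp1 : p ^ 2 - 1 ≠ 0 := hp.2 rfl none
    have hp0 : p ≠ 0 := hp.ne_zero none
    have hne : ∀ s : ℂ, s ^ 2 = 1 → p ≠ s := fun s hs h => hp1 (by rw [h, hs, sub_self])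
    have l1 := loopEq_cons hk hc h (.divisor ()) J h0 (hp.ins_ins_of_sq s1) hp1 (hne _ s1) hpu
    have l2 := loopEq_cons hk hc h (.divisor ()) J h0 (hp.ins_ins_of_sq s2) hp1 (hne _ s2) hpu
    have e0 := bdry_recLin_eq_zero hk hc ih' hp
    have e1 : (1 + D.ν) / 2 * eraseSum (fun l K => D.src p (fun t => D.W h t (.divisor 1 ::ₘ K)) l)
          (J.map (Slot.map u)) + (1 - D.ν) / 2 * eraseSum (fun l K =>
          D.src p (fun t => D.W h t (.divisor (-1) ::ₘ K)) l) (J.map (Slot.map u)) = 0 := by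
      rw [← eraseSum_mul_left, ← eraseSum_mul_left, ← eraseSum_add, eraseSum_map]
      refine (eraseSum_congr (ψ := fun _ _ => 0) fun l K hK => ?_).trans (by simp [eraseSum])
      have h1 := ih' ι h K (by simp [hK])
      have hl : Adm true (ins (l.map u).pos u) := by
        rw [pos_map]
        exact (adm_ins.1 hp).1.ins_of_mem l.pos
      have hl1 := hl.2 rfl none
      have d1 := differentiableAt_W_cons hk hc h (.divisor ()) K (hl.ins_ins_of_sq s1) hl1
      have d2 := differentiableAt_W_cons hk hc h (.divisor ()) K (hl.ins_ins_of_sq s2) hl1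
      have h3 := comb_deriv_eq_zero d1 d2 (c₁ := (1 + D.ν) / 2) (c₂ := (1 - D.ν) / 2)
        (hl.eventually_ins.mono fun t ht => h1 t u ht)
      have h4 := h1 _ u hl
      have hq := sq_sub_ne' hp l (hpu _)
      simp only [Slot.map_divisor] at d1 d2 h3
      rw [src_eq d1 hq, src_eq d2 hq]
      rw [bdry] at h4
      linear_combination D.srcVal p (l.map u) * h4 + D.srcDer p (l.map u) * h3
    have hP : ∀ s : ℂ, s ^ 2 = 1 → ∀ f, D.src p f (.divisor s) = 0 := fun s hs f => by
      simp [src, P, hs, show D.k ≠ 0 by omega]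
    have hK : ∀ s : ℂ, s ^ 2 = 1 → ker p (.divisor s) = 0 := fun s hs => by simp [ker, hs]
    simp only [Slot.map, hP _ s1, hP _ s2, hK _ s1, hK _ s2] at l1 l2
    rw [bdry]
    refine (mul_eq_zero.1 (?_ : D.c * p * _ = 0)).resolve_left (mul_ne_zero hc hp0)
    linear_combination (1 + D.ν) / 2 * l1 + (1 - D.ν) / 2 * l2 + e1 - D.P p * e0
  have hp1 : p ^ 2 - 1 ≠ 0 := hp.2 rfl none
  have hd : DifferentiableAt ℂ (fun p => D.bdry h p (J.map (Slot.map u))) p :=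
    ((differentiableAt_W_cons hk hc h (.divisor ()) J (hp.ins_ins_of_sq s1) hp1).const_mul _).add
    ((differentiableAt_W_cons hk hc h (.divisor ()) J (hp.ins_ins_of_sq s2) hp1).const_mul _)
  refine tendsto_nhds_unique (hd.continuousAt.tendsto.mono_left
    (nhdsWithin_le_nhds (s := {p}ᶜ))) (tendsto_const_nhds.congr' ?_)
  filter_upwards [eventually_generic p u, hp.eventually_ins.filter_mono nhdsWithin_le_nhds]
    with q hq hq'
  exact (gen q hq' hq.2).symm

end LoopData

/-! ### The exchange relation as a ring identity -/

section Exchange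

variable {R ι : Type} [CommRing R] [Fintype ι]

/-- One of the two ways of applying the loop equations for `p` and then for `q` to the two-point
function; the other one is obtained by exchanging `p` and `q`. -/
theorem loop_loop {H Q vp vq yp yq m Dm Ypq DlYqp Zq : R} {e a b mq Yl : ι → R}
    {Spq Sqp DSpq DlSqp DDqp S3p_pq S3q_pp DlS3q_qp DS3q_pp S4q : R}
    {Slq Sql DSql DlSlq DlSlp S3q_ql S3l_qq S3l_pp : ι → R} {Sll : ι → ι → R}
    (h1 : vp * Spq + H ^ 2 * S3p_pq + H * Q * DSpq + m * yp = ∑ l, a l * e l * Slq l + Ypq)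
    (h1D : vq * DlSqp + H ^ 2 * DlS3q_qp + H * Q * DDqp + yq * Dm
      = ∑ l, b l * e l * DlSlp l + DlYqp)
    (hl : ∀ l, vq * Sql l + H ^ 2 * S3q_ql l + H * Q * DSql l + mq l * yq
      = ∑ n, b n * e n * Sll n l + Yl l)
    (h2 : vq * S3q_pp + 2 * Sqp ^ 2 + H ^ 2 * S4q + H * Q * DS3q_pp + 2 * m * Sqp
      = ∑ l, b l * e l * S3l_pp l + 2 * Zq)
    (s1 : H * DSpq = H * DlSqp) (s2 : ∀ l, e l * Slq l = e l * Sql l)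
    (s3 : ∀ l, e l * (H * DSql l) = e l * (H * DlSlq l))
    (s4 : H ^ 2 * S3p_pq = H ^ 2 * S3q_pp)
    (s5 : ∀ l, e l * (H ^ 2 * S3q_ql l) = e l * (H ^ 2 * S3l_qq l)) :
    vp * vq * Spq = (∑ l, a l * e l * (Yl l - mq l * yq) + vq * Ypq - vq * m * yp
        - H * Q * (DlYqp - yq * Dm) - 2 * H ^ 2 * Zq)
      + (∑ l, ∑ n, a l * b n * (e l * e n * Sll n l)) - H * Q * (∑ l, a l * e l * DlSlq l)
      - H ^ 2 * (∑ l, a l * e l * S3l_qq l) - H * Q * (∑ l, b l * e l * DlSlp l)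
      + H ^ 2 * Q ^ 2 * DDqp + H ^ 3 * Q * DlS3q_qp + 2 * H ^ 2 * Sqp ^ 2 + H ^ 4 * S4q
      + H ^ 3 * Q * DS3q_pp + 2 * H ^ 2 * m * Sqp - H ^ 2 * (∑ l, b l * e l * S3l_pp l) := by
  have key : vq * (∑ l, a l * e l * Slq l) = (∑ l, a l * e l * (Yl l - mq l * yq))
      + (∑ l, ∑ n, a l * b n * (e l * e n * Sll n l)) - H * Q * (∑ l, a l * e l * DlSlq l)
      - H ^ 2 * (∑ l, a l * e l * S3l_qq l) := by
    simp only [Finset.mul_sum]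
    rw [← Finset.sum_add_distrib, ← Finset.sum_sub_distrib, ← Finset.sum_sub_distrib]
    refine Finset.sum_congr rfl fun l _ => ?_
    have h3 : ∑ n, a l * b n * (e l * e n * Sll n l) = a l * e l * ∑ n, b n * e n * Sll n l := by
      rw [Finset.mul_sum]
      exact Finset.sum_congr rfl fun n _ => by ring
    rw [h3, ← sub_eq_iff_eq_add.2 (hl l)]
    linear_combination (vq * a l) * s2 l - a l * Q * s3 l - a l * s5 l
  linear_combination (vq) * h1 + key - vq * Q * s1 - vq * s4 - H * Q * h1D
    - H ^ 2 * h2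

/-- The part of the exchange relation that is linear in the two-point functions and quadratic in the
one-point function is symmetric; this is where the one-point loop equation enters. -/
theorem loop_sources_symm {H Q yp yp1 yp2 yq yq1 yq2 m DXm DYm Gp Gp1 Gp2 Gq Gq1 Gq2 rp rp1 rq rq1
      Spp Spp1 Spp' Sqq Sqq1 Sqq' ψp ψp1 ψq ψq1 : R}
    {e a a1 da b b1 db mp mq Kp Kp1 Kq Kq1 yl yl1 : ι → R}
    (hp : yp ^ 2 + (∑ l, Kp l * e l) * yp + H ^ 2 * Spp + H * Q * (yp1 + rp * yp)
      = ψp + ∑ l, a l * e l * yl l)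
    (hp1 : 2 * yp * yp1 + (∑ l, Kp1 l * e l) * yp + (∑ l, Kp l * e l) * yp1 + H ^ 2 * Spp'
      + H * Q * (yp2 + rp * yp1 + rp1 * yp) = ψp1 + ∑ l, a1 l * e l * yl l)
    (hq : yq ^ 2 + (∑ l, Kq l * e l) * yq + H ^ 2 * Sqq + H * Q * (yq1 + rq * yq)
      = ψq + ∑ l, b l * e l * yl l)
    (hq1 : 2 * yq * yq1 + (∑ l, Kq1 l * e l) * yq + (∑ l, Kq l * e l) * yq1 + H ^ 2 * Sqq'
      + H * Q * (yq2 + rq * yq1 + rq1 * yq) = ψq1 + ∑ l, b1 l * e l * yl l)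
    (sp : 2 * H ^ 2 * Spp1 = H ^ 2 * Spp') (sq : 2 * H ^ 2 * Sqq1 = H ^ 2 * Sqq')
    (cQp : Gp2 - rp * Gp1 - rp1 * Gp + DYm = 0) (cQq : Gq2 - rq * Gq1 - rq1 * Gq + DXm = 0)
    (cKp : ∀ l, m * Kq l - b l * mp l - (Gp1 * Kp l + Gp * Kp1 l) = 0)
    (cKq : ∀ l, m * Kp l - a l * mq l - (Gq1 * Kq l + Gq * Kq1 l) = 0)
    (cN : ∀ l, a l * db l + 2 * Gq1 * b l + Gq * b1 l = b l * da l + 2 * Gp1 * a l + Gp * a1 l)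
    (cψ : 2 * Gq1 * ψq + Gq * ψq1 = 2 * Gp1 * ψp + Gp * ψp1) :
    ∑ l, a l * e l * ((db l * yl l + b l * yl1 l) - mq l * yq)
        + (2 * yq + ∑ l, Kq l * e l) * (Gq1 * yq + Gq * yq1)
        - (2 * yq + ∑ l, Kq l * e l) * m * yp
        - H * Q * (Gp2 * yp + 2 * Gp1 * yp1 + Gp * yp2 + rp * (Gp1 * yp + Gp * yp1) - yq * DXm)
        - 2 * H ^ 2 * (Gp1 * Spp + Gp * Spp1) =
      ∑ l, b l * e l * ((da l * yl l + a l * yl1 l) - mp l * yp)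
        + (2 * yp + ∑ l, Kp l * e l) * (Gp1 * yp + Gp * yp1)
        - (2 * yp + ∑ l, Kp l * e l) * m * yq
        - H * Q * (Gq2 * yq + 2 * Gq1 * yq1 + Gq * yq2 + rq * (Gq1 * yq + Gq * yq1) - yp * DYm)
        - 2 * H ^ 2 * (Gq1 * Sqq + Gq * Sqq1) := by
  have key : (∑ l, a l * e l * ((db l * yl l + b l * yl1 l) - mq l * yq))
      - (∑ l, b l * e l * ((da l * yl l + a l * yl1 l) - mp l * yp))
      + 2 * Gq1 * (∑ l, b l * e l * yl l) + Gq * (∑ l, b1 l * e l * yl l)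
      - 2 * Gp1 * (∑ l, a l * e l * yl l) - Gp * (∑ l, a1 l * e l * yl l)
      + ((∑ l, Kp l * e l) * (m * yq + Gp1 * yp) + (∑ l, Kp1 l * e l) * (Gp * yp)
      - (∑ l, Kq l * e l) * (m * yp + Gq1 * yq) - (∑ l, Kq1 l * e l) * (Gq * yq)) = 0 := by
    simp only [Finset.mul_sum, Finset.sum_mul]
    simp only [← Finset.sum_add_distrib, ← Finset.sum_sub_distrib]
    refine Finset.sum_eq_zero fun l _ => ?_
    linear_combination e l * yl l * cN l + e l * yq * cKq l - e l * yp * cKp l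
  linear_combination key + 2 * Gq1 * hq + Gq * hq1 - 2 * Gp1 * hp - Gp * hp1
    + Gq * sq - Gp * sp + H * Q * yq * cQq - H * Q * yp * cQp + cψ

/-- The exchange relation. The two-point function with first argument `p` is expressed by the loop
equations for `p` and then for `q`; the symmetry of the terms of lower order and of the sources
(`hT`) makes the result symmetric in `p` and `q`. -/
theorem exchange {H Q vp vq yp yq m DXm DYm Ypq Yqp DlYpq DlYqp Zp Zq : R}
    {e a b mp mq Yp Yq : ι → R}
    {Spq Sqp DSpq DSqp DlSpq DlSqp DDpq DDqp S3p_pq S3q_qp S3p_qq S3q_pp DlS3p_pq DlS3q_qp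
      DS3p_qq DS3q_pp S4p S4q : R}
    {Slp Slq Spl Sql DSpl DSql DlSlp DlSlq S3p_pl S3q_ql S3l_pp S3l_qq : ι → R} {Sll : ι → ι → R}
    (h1 : vp * Spq + H ^ 2 * S3p_pq + H * Q * DSpq + m * yp = ∑ l, a l * e l * Slq l + Ypq)
    (h1' : vq * Sqp + H ^ 2 * S3q_qp + H * Q * DSqp + m * yq = ∑ l, b l * e l * Slp l + Yqp)
    (h1D : vq * DlSqp + H ^ 2 * DlS3q_qp + H * Q * DDqp + yq * DXm
      = ∑ l, b l * e l * DlSlp l + DlYqp)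
    (h1D' : vp * DlSpq + H ^ 2 * DlS3p_pq + H * Q * DDpq + yp * DYm
      = ∑ l, a l * e l * DlSlq l + DlYpq)
    (hl : ∀ l, vq * Sql l + H ^ 2 * S3q_ql l + H * Q * DSql l + mq l * yq
      = ∑ n, b n * e n * Sll n l + Yq l)
    (hl' : ∀ l, vp * Spl l + H ^ 2 * S3p_pl l + H * Q * DSpl l + mp l * yp
      = ∑ n, a n * e n * Sll n l + Yp l)
    (h2 : vq * S3q_pp + 2 * Sqp ^ 2 + H ^ 2 * S4q + H * Q * DS3q_pp + 2 * m * Sqp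
      = ∑ l, b l * e l * S3l_pp l + 2 * Zq)
    (h2' : vp * S3p_qq + 2 * Spq ^ 2 + H ^ 2 * S4p + H * Q * DS3p_qq + 2 * m * Spq
      = ∑ l, a l * e l * S3l_qq l + 2 * Zp)
    (s0 : H * Spq = H * Sqp) (s1 : H * DSpq = H * DlSqp) (s1' : H * DSqp = H * DlSpq)
    (s2 : ∀ l, e l * Slq l = e l * Sql l) (s2' : ∀ l, e l * Slp l = e l * Spl l)
    (s3 : ∀ l, e l * (H * DSql l) = e l * (H * DlSlq l))
    (s3' : ∀ l, e l * (H * DSpl l) = e l * (H * DlSlp l))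
    (s4 : H ^ 2 * S3p_pq = H ^ 2 * S3q_pp) (s4' : H ^ 2 * S3q_qp = H ^ 2 * S3p_qq)
    (s5 : ∀ l, e l * (H ^ 2 * S3q_ql l) = e l * (H ^ 2 * S3l_qq l))
    (s5' : ∀ l, e l * (H ^ 2 * S3p_pl l) = e l * (H ^ 2 * S3l_pp l))
    (s6 : H * DDqp = H * DDpq)
    (s7 : H ^ 2 * DlS3q_qp = H ^ 2 * DS3p_qq) (s7' : H ^ 2 * DlS3p_pq = H ^ 2 * DS3q_pp)
    (s8 : H ^ 4 * S4q = H ^ 4 * S4p) (s9 : ∀ l n, e l * (e n * Sll n l) = e l * (e n * Sll l n))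
    (hT : (∑ l, a l * e l * (Yq l - mq l * yq) + vq * Ypq - vq * m * yp
        - H * Q * (DlYqp - yq * DXm) - 2 * H ^ 2 * Zq) =
      (∑ l, b l * e l * (Yp l - mp l * yp) + vp * Yqp - vp * m * yq
        - H * Q * (DlYpq - yp * DYm) - 2 * H ^ 2 * Zp)) :
    vp * vq * (Spq - Sqp) = 0 := by
  have e1 := loop_loop h1 h1D hl h2 s1 s2 s3 s4 s5
  have e2 := loop_loop h1' h1D' hl' h2' s1' s2' s3' s4' s5'
  have e3 : ∑ l, ∑ n, a l * b n * (e l * e n * Sll n l) =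
      ∑ l, ∑ n, b l * a n * (e l * e n * Sll n l) := by
    rw [Finset.sum_comm]
    refine Finset.sum_congr rfl fun l _ => Finset.sum_congr rfl fun n _ => ?_
    linear_combination a n * b l * s9 n l
  linear_combination e1 - e2 + hT + e3 + H * Q ^ 2 * s6 + H * Q * s7 - H * Q * s7' + s8
    - 2 * (H * Sqp + H * Spq + H * m) * s0

end Exchange

/-! ### Power series in the labels and in `ħ` -/

theorem conv_of_support_zero {α A : Type} [CommRing A] (f g : Multiset α → A) (J : Multiset α)
    (hf : ∀ K, K ≠ 0 → f K = 0) : conv f g J = f 0 * g J := by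
  induction J using Multiset.induction generalizing g with
  | empty => simp
  | cons a J ih =>
    have h0 : conv (fun K => f (a ::ₘ K)) g J = 0 :=
      (conv_congr (f' := fun _ => 0) (g' := fun _ => 0) fun K L _ => by
        rw [hf _ (Multiset.cons_ne_zero), zero_mul, zero_mul]).trans (by simp [conv])
    rw [conv_cons, ih, h0, add_zero]

open Classical in
/-- The function supported at the empty multiset, with value `s` there. -/
def atZero {α A : Type} [CommRing A] (s : A) : Multiset α → A :=
  fun J => if J = 0 then s else 0

theorem conv_atZero {α A : Type} [CommRing A] (s : A) (f : Multiset α → A) (J : Multiset α) :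
    conv (atZero s) f J = s * f J := by
  rw [conv_of_support_zero (atZero s) _ _ fun K hK => if_neg hK]
  simp [atZero]

open Classical in
/-- The indicator function of the multiset `{l}`. -/
def atSingle (A : Type) [CommRing A] {α : Type} (l : α) : Multiset α → A :=
  fun J => if J = {l} then 1 else 0

open Classical in
theorem conv_atSingle {α A : Type} [CommRing A] (l : α) (f : Multiset α → A) (J : Multiset α) :
    conv (atSingle A l) f J = eraseSum (fun b K => if b = l then f K else 0) J := by
  induction J using Multiset.induction generalizing f with
  | empty => simp [atSingle, eraseSum_zero]
  | cons a J ih =>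
    have h1 : conv (fun K => atSingle A l (a ::ₘ K)) f J = if a = l then f J else 0 := by
      rw [conv_of_support_zero]
      · by_cases h : a = l <;> simp [atSingle, h]
      · intro K hK
        refine if_neg fun h => hK ?_
        have := congrArg Multiset.card h
        simpa using this
    rw [conv_cons, h1, eraseSum_cons, add_comm, ih]

theorem eraseSum_finset_sum {α κ A : Type} [CommRing A] (s : Finset κ)
    (φ : κ → α → Multiset α → A) (J : Multiset α) :
    ∑ i ∈ s, eraseSum (φ i) J = eraseSum (fun a K => ∑ i ∈ s, φ i a K) J := by
  classical
  induction s using Finset.induction_on with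
  | empty => simp [eraseSum]
  | insert i s hi ih => simp only [Finset.sum_insert hi, ih, ← eraseSum_add]

/-- Formal power series in `ħ` and in commuting variables indexed by labels, in exponential
normalisation: the value at a multiset `J` is the coefficient of the divided power of `J`. -/
def LabelSeries (ι : Type) : Type := Multiset ι → PowerSeries ℂ

namespace LabelSeries

variable {ι : Type}

instance : AddCommGroup (LabelSeries ι) :=
  inferInstanceAs (AddCommGroup (Multiset ι → PowerSeries ℂ))

instance : CommRing (LabelSeries ι) where
  mul f g := conv f g
  one := atZero 1
  left_distrib f g h := funext fun J => conv_add f g h J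
  right_distrib f g h := funext fun J => add_conv f g h J
  zero_mul f := funext fun J =>
    (conv_of_support_zero (fun _ => 0) f J fun _ _ => rfl).trans (zero_mul _)
  mul_zero f := funext fun J => (conv_comm _ _ J).trans <|
    (conv_of_support_zero (fun _ => 0) f J fun _ _ => rfl).trans (zero_mul _)
  mul_assoc f g h := funext fun J => conv_assoc f g h J
  mul_comm f g := funext fun J => conv_comm f g J
  one_mul f := funext fun J => (conv_atZero 1 f J).trans (one_mul _)
  mul_one f := funext fun J => (conv_comm f _ J).trans ((conv_atZero 1 f J).trans (one_mul _))
  neg_add_cancel := neg_add_cancel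
  zsmul := zsmulRec

/-- The coefficient of order `h` in `ħ` and at `J`. -/
def cf (h : ℕ) (J : Multiset ι) (f : LabelSeries ι) : ℂ := PowerSeries.coeff h (f J)

@[ext] theorem ext {f g : LabelSeries ι} (h : ∀ n J, cf n J f = cf n J g) : f = g :=
  funext fun J => PowerSeries.ext fun n => h n J

@[simp] theorem cf_add (h : ℕ) (J : Multiset ι) (f g : LabelSeries ι) :
    cf h J (f + g) = cf h J f + cf h J g := map_add (PowerSeries.coeff h) (f J) (g J)

@[simp] theorem cf_zero (h : ℕ) (J : Multiset ι) : cf h J 0 = 0 := map_zero (PowerSeries.coeff h)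

@[simp] theorem cf_neg (h : ℕ) (J : Multiset ι) (f : LabelSeries ι) : cf h J (-f) = -cf h J f :=
  map_neg (PowerSeries.coeff h) (f J)

@[simp] theorem cf_sub (h : ℕ) (J : Multiset ι) (f g : LabelSeries ι) :
    cf h J (f - g) = cf h J f - cf h J g := by rw [sub_eq_add_neg, cf_add, cf_neg, sub_eq_add_neg]

theorem cf_sum {κ : Type} (s : Finset κ) (h : ℕ) (J : Multiset ι) (f : κ → LabelSeries ι) :
    cf h J (∑ i ∈ s, f i) = ∑ i ∈ s, cf h J (f i) := by
  classical
  induction s using Finset.induction_on with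
  | empty => simp
  | insert a s ha ih => rw [Finset.sum_insert ha, Finset.sum_insert ha, cf_add, ih]

theorem cf_mul (h : ℕ) (J : Multiset ι) (f g : LabelSeries ι) :
    cf h J (f * g) = ∑ n ∈ antidiagonal h,
      conv (fun K => cf n.1 K f) (fun K => cf n.2 K g) J := by
  have h1 : ∀ s : Multiset (Multiset ι × Multiset ι),
      PowerSeries.coeff h (s.map fun K => f K.1 * g K.2).sum =
        ∑ n ∈ antidiagonal h,
          (s.map fun K => cf n.1 K.1 f * cf n.2 K.2 g).sum := by
    intro s
    induction s using Multiset.induction with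
    | empty => simp
    | cons K s ih =>
      simp only [Multiset.map_cons, Multiset.sum_cons, map_add, ih, Finset.sum_add_distrib,
        PowerSeries.coeff_mul]
      rfl
  exact h1 _

/-- Constant series. -/
def C : ℂ →+* LabelSeries ι where
  toFun s := (atZero (PowerSeries.C s) : Multiset ι → PowerSeries ℂ)
  map_one' := by rw [map_one]; rfl
  map_zero' := funext fun J => by
    change atZero (PowerSeries.C (0 : ℂ)) J = 0
    simp [atZero]
  map_add' s t := funext fun J => by
    change atZero (PowerSeries.C (s + t)) J =
      atZero (PowerSeries.C s) J + atZero (PowerSeries.C t) J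
    by_cases hJ : J = 0 <;> simp [atZero, hJ]
  map_mul' s t := funext fun J => by
    change atZero (PowerSeries.C (s * t)) J =
      conv (atZero (PowerSeries.C s)) (atZero (PowerSeries.C t)) J
    rw [conv_atZero]
    by_cases hJ : J = 0 <;> simp [atZero, hJ]

@[simp] theorem cf_C_mul (s : ℂ) (h : ℕ) (J : Multiset ι) (f : LabelSeries ι) :
    cf h J (C s * f) = s * cf h J f := by
  refine (congrArg (PowerSeries.coeff h) (conv_atZero (PowerSeries.C s) f J)).trans ?_
  rw [PowerSeries.coeff_C_mul]
  rfl

theorem cf_C_zero (s : ℂ) : cf 0 (0 : Multiset ι) (C s) = s := by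
  change PowerSeries.coeff 0 (atZero (PowerSeries.C s) (0 : Multiset ι)) = s
  simp [atZero]

theorem cf_C_pos (s : ℂ) {h : ℕ} {J : Multiset ι} (hJ : 0 < h + J.card) : cf h J (C s) = 0 := by
  change PowerSeries.coeff h (atZero (PowerSeries.C s) J) = 0
  by_cases h0 : J = 0
  · subst h0
    have : h ≠ 0 := by simpa using hJ.ne'
    simp [atZero, PowerSeries.coeff_C, this]
  · simp [atZero, h0]

/-- The series `ħ`. -/
def H : LabelSeries ι := (atZero PowerSeries.X : Multiset ι → PowerSeries ℂ)

theorem cf_H_mul (h : ℕ) (J : Multiset ι) (f : LabelSeries ι) :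
    cf h J (H * f) = if 1 ≤ h then cf (h - 1) J f else 0 := by
  refine (congrArg (PowerSeries.coeff h) (conv_atZero PowerSeries.X f J)).trans ?_
  cases h with
  | zero => simp
  | succ n => simp [PowerSeries.coeff_succ_X_mul, cf]

theorem cf_H_sq_mul (h : ℕ) (J : Multiset ι) (f : LabelSeries ι) :
    cf h J (H ^ 2 * f) = if 2 ≤ h then cf (h - 2) J f else 0 := by
  rw [pow_two, mul_assoc, cf_H_mul, cf_H_mul]
  split_ifs <;> first | rfl | omega

/-- The variable of a label. -/
def label (l : ι) : LabelSeries ι := (atSingle (PowerSeries ℂ) l)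

theorem cf_label_mul (h : ℕ) (J : Multiset ι) (l : ι) (f : LabelSeries ι) [DecidableEq ι] :
    cf h J (label l * f) = eraseSum (fun b K => if b = l then cf h K f else 0) J := by
  refine (congrArg (PowerSeries.coeff h) (conv_atSingle l f J)).trans ?_
  simp only [eraseSum, map_multiset_sum, Multiset.map_map, Function.comp_def]
  congr 1
  refine Multiset.map_congr rfl fun b _ => ?_
  split_ifs
  · congr 2
  · simp

theorem cf_sum_label_mul [Fintype ι] (h : ℕ) (J : Multiset ι) (s : ι → ℂ)
    (f : ι → LabelSeries ι) : cf h J (∑ l, C (s l) * label l * f l) =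
      eraseSum (fun b K => s b * cf h K (f b)) J := by
  classical
  rw [cf_sum]
  simp only [mul_assoc, cf_C_mul, cf_label_mul]
  simp only [← eraseSum_mul_left, eraseSum_finset_sum]
  refine eraseSum_congr fun b K _ => ?_
  simp

variable (ι) in
/-- The ideal of series all of whose coefficients of weight less than `d` vanish. -/
def weightIdeal (d : ℕ) : Ideal (LabelSeries ι) where
  carrier := {f | ∀ h J, h + Multiset.card J < d → cf h J f = 0}
  zero_mem' h J _ := cf_zero h J
  add_mem' hf hg h J hd := by rw [cf_add, hf h J hd, hg h J hd, add_zero]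
  smul_mem' g f hf h J hd := by
    rw [smul_eq_mul, cf_mul]
    refine Finset.sum_eq_zero fun n hn => ?_
    refine (conv_congr (f' := fun _ => 0) (g' := fun _ => 0) fun K L hKL => ?_).trans
      (by simp [conv])
    have h1 := mem_antidiagonal.1 hn
    have h2 := congrArg Multiset.card hKL
    rw [Multiset.card_add] at h2
    rw [hf n.2 L (by omega), mul_zero, mul_zero]

theorem mem_weightIdeal {d : ℕ} {f : LabelSeries ι} :
    f ∈ weightIdeal ι d ↔ ∀ h J, h + Multiset.card J < d → cf h J f = 0 := Iff.rfl

theorem weightIdeal_anti {d d' : ℕ} (h : d ≤ d') {f : LabelSeries ι} (hf : f ∈ weightIdeal ι d') :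
    f ∈ weightIdeal ι d := fun n J hJ => hf n J (hJ.trans_le h)

theorem mul_mem_weightIdeal {a b : ℕ} {f g : LabelSeries ι} (hf : f ∈ weightIdeal ι a)
    (hg : g ∈ weightIdeal ι b) : f * g ∈ weightIdeal ι (a + b) := by
  intro h J hd
  rw [cf_mul]
  refine Finset.sum_eq_zero fun n hn => ?_
  refine (conv_congr (f' := fun _ => 0) (g' := fun _ => 0) fun K L hKL => ?_).trans
    (by simp [conv])
  have h1 := mem_antidiagonal.1 hn
  have h2 := congrArg Multiset.card hKL
  rw [Multiset.card_add] at h2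
  rcases Nat.lt_or_ge (n.1 + K.card) a with h3 | h3
  · rw [hf n.1 K h3, zero_mul, zero_mul]
  · rw [hg n.2 L (by omega), mul_zero, mul_zero]

theorem H_mem : (H : LabelSeries ι) ∈ weightIdeal ι 1 := fun h J hd => by
  have h1 := cf_H_mul h J (1 : LabelSeries ι)
  rw [mul_one] at h1
  rw [h1, if_neg (by omega)]

theorem label_mem (l : ι) : label l ∈ weightIdeal ι 1 := fun h J hd => by
  obtain rfl : J = 0 := Multiset.card_eq_zero.1 (by omega)
  change PowerSeries.coeff h (atSingle _ l 0) = 0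
  simp [atSingle]

/-- A factor with nonzero constant term can be cancelled modulo the weight filtration. -/
theorem mem_weightIdeal_succ_of_mul {d : ℕ} {v f : LabelSeries ι} {s : ℂ} (hs : s ≠ 0)
    (hv : v - C s ∈ weightIdeal ι 1) (hf : f ∈ weightIdeal ι d)
    (h : v * f ∈ weightIdeal ι (d + 1)) : f ∈ weightIdeal ι (d + 1) := by
  have h1 : C s * f ∈ weightIdeal ι (d + 1) := by
    have h2 := Ideal.sub_mem _ h (weightIdeal_anti (by omega) (mul_mem_weightIdeal hv hf))
    convert h2 using 1
    ring
  intro n J hJ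
  have h3 := h1 n J hJ
  rw [cf_C_mul] at h3
  exact (mul_eq_zero.1 h3).resolve_left hs

/-- The series with given coefficients. -/
def gen (F : ℕ → Multiset ι → ℂ) : LabelSeries ι := fun J => PowerSeries.mk fun h => F h J

@[simp] theorem cf_gen (F : ℕ → Multiset ι → ℂ) (h : ℕ) (J : Multiset ι) :
    cf h J (gen F) = F h J := by simp [cf, gen]

/-- Coefficientwise differentiability, the derivative being taken with respect to `x ^ 2`. -/
def HasDeriv (f : ℂ → LabelSeries ι) (f' : LabelSeries ι) (x : ℂ) : Prop :=
  ∀ h J, HasDerivAt (fun t => cf h J (f t)) (2 * x * cf h J f') x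

theorem HasDeriv.add {f g : ℂ → LabelSeries ι} {f' g' : LabelSeries ι} {x : ℂ}
    (hf : HasDeriv f f' x) (hg : HasDeriv g g' x) :
    HasDeriv (fun t => f t + g t) (f' + g') x := fun h J => by
  simp only [cf_add, mul_add]
  exact (hf h J).add (hg h J)

theorem HasDeriv.mul {f g : ℂ → LabelSeries ι} {f' g' : LabelSeries ι} {x : ℂ}
    (hf : HasDeriv f f' x) (hg : HasDeriv g g' x) :
    HasDeriv (fun t => f t * g t) (f' * g x + f x * g') x := fun h J => by
  simp only [cf_add, cf_mul]
  rw [← Finset.sum_add_distrib, Finset.mul_sum]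
  refine HasDerivAt.fun_sum fun n _ => ?_
  simp only [conv]
  rw [← Multiset.sum_map_add, ← Multiset.sum_map_mul_left]
  refine hasDerivAt_multiset_sum _ fun K _ => ?_
  exact ((hf n.1 K.1).mul (hg n.2 K.2)).congr_deriv (by ring)

theorem HasDeriv.const (f : LabelSeries ι) (x : ℂ) : HasDeriv (fun _ => f) 0 x := fun h J => by
  simpa using hasDerivAt_const x _

theorem HasDeriv.C {s : ℂ → ℂ} {s' x : ℂ} (hs : HasDerivAt s (2 * x * s') x) :
    HasDeriv (fun t => (LabelSeries.C (s t) : LabelSeries ι)) (LabelSeries.C s') x := fun h J => by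
  rcases Nat.eq_zero_or_pos (h + J.card) with h0 | h0
  · obtain rfl : h = 0 := by omega
    obtain rfl : J = 0 := Multiset.card_eq_zero.1 (by omega)
    simpa only [cf_C_zero] using hs
  · simpa only [cf_C_pos _ h0, mul_zero] using hasDerivAt_const x (0 : ℂ)

theorem HasDeriv.sum {κ : Type} (s : Finset κ) {f : κ → ℂ → LabelSeries ι}
    {f' : κ → LabelSeries ι} {x : ℂ} (hf : ∀ i, HasDeriv (f i) (f' i) x) :
    HasDeriv (fun t => ∑ i ∈ s, f i t) (∑ i ∈ s, f' i) x := fun h J => by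
  simp only [cf_sum, Finset.mul_sum]
  exact HasDerivAt.fun_sum fun i _ => hf i h J

theorem HasDeriv.unique {f g : ℂ → LabelSeries ι} {f' g' : LabelSeries ι} {x : ℂ} (hx : x ≠ 0)
    (hf : HasDeriv f f' x) (hg : HasDeriv g g' x) (h : ∀ᶠ t in 𝓝 x, f t = g t) : f' = g' := by
  ext n J
  have h1 := (hf n J).unique ((hg n J).congr_of_eventuallyEq (h.mono fun t ht => by
    beta_reduce
    rw [ht]))
  exact mul_left_cancel₀ (mul_ne_zero two_ne_zero hx) h1

theorem HasDeriv.gen {F : ℂ → ℕ → Multiset ι → ℂ} {x : ℂ} (hx : x ≠ 0)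
    (hF : ∀ h J, DifferentiableAt ℂ (fun t => F t h J) x) :
    HasDeriv (fun t => gen (F t)) (LabelSeries.gen fun h J => deriv (fun t => F t h J) x / (2 * x))
      x := fun h J => by
  simp only [cf_gen]
  exact (hF h J).hasDerivAt.congr_deriv (by field_simp)

end LabelSeries

/-! ### Generating series of correlators -/

namespace LoopData
open LabelSeries

variable {D : LoopData} {ι : Type} [Fintype ι]

/-- The labels `∫_{D(u i)}`, for `i` in `J`. -/
def divisors {ι : Type} (u : ι → ℂ) (J : Multiset ι) : Multiset (Slot ℂ) :=
  J.map fun i => .divisor (u i)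

theorem divisors_eq {ι : Type} (u : ι → ℂ) (J : Multiset ι) :
    divisors u J = (J.map Slot.divisor).map (Slot.map u) := by
  rw [Multiset.map_map]
  rfl

@[simp] theorem divisors_zero {ι : Type} (u : ι → ℂ) : divisors u 0 = 0 := rfl

@[simp] theorem divisors_cons {ι : Type} (u : ι → ℂ) (i : ι) (J : Multiset ι) :
    divisors u (i ::ₘ J) = .divisor (u i) ::ₘ divisors u J := Multiset.map_cons _ _ _

variable (D) in
/-- The generating series of the correlators `W h p (L ∪ J)`, where `J` runs over the multisets of
labels `∫_{D(u i)}`. -/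
def corr {ι : Type} (u : ι → ℂ) (L : Multiset (Slot ℂ)) (p : ℂ) : LabelSeries ι :=
  gen fun h J => D.W h p (L + divisors u J)

variable (D) in
/-- The derivative of `corr D u L p` with respect to `p ^ 2`. -/
def dcorr {ι : Type} (u : ι → ℂ) (L : Multiset (Slot ℂ)) (p : ℂ) : LabelSeries ι :=
  gen fun h J => deriv (fun t => D.W h t (L + divisors u J)) p / (2 * p)

variable (D) in
/-- The sum of the integrated kernels over the divisor labels. -/
def kerSeries (u : ι → ℂ) (p : ℂ) : LabelSeries ι :=
  ∑ l, C (ker p (.divisor (u l))) * label l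

variable (D) in
/-- The coefficient `P(q) / (P(p) (p² - q²))` of the source terms. -/
def G (p q : ℂ) : ℂ := D.P q / (D.P p * (p ^ 2 - q ^ 2))

variable (D) in
/-- The derivative of `G p q` with respect to `q ^ 2`. -/
def G1 (p q : ℂ) : ℂ :=
  D.P q / (D.P p * (p ^ 2 - q ^ 2)) * (D.k / (q ^ 2 - 1) + 1 / (p ^ 2 - q ^ 2))

theorem cf_sum_mul (h : ℕ) (J : Multiset ι) (s : ι → ℂ) (f : LabelSeries ι) :
    cf h J ((∑ l, C (s l) * label l) * f) = eraseSum (fun b K => s b * cf h K f) J := by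
  rw [Finset.sum_mul, cf_sum_label_mul]

theorem cf_recLin (u : ι → ℂ) (L : Multiset (Slot ℂ)) (p : ℂ) (h : ℕ) (J : Multiset ι) :
    cf h J ((2 * D.corr u 0 p + kerSeries u p) * D.corr u L p + H ^ 2 * D.corr u (.point p ::ₘ L) p
      + H * (C D.Q * (D.dcorr u L p + C (2 / (p ^ 2 - 1)) * D.corr u L p))) =
    D.recLin (fun h q K => D.W h q (L + K)) h (divisors u J) p := by
  have e1 : (2 * D.corr u 0 p + kerSeries u p) * D.corr u L p =
      C 2 * (D.corr u 0 p * D.corr u L p) + kerSeries u p * D.corr u L p := by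
    rw [map_ofNat]; ring
  rw [e1, cf_add, cf_add, cf_add, cf_C_mul, cf_mul, kerSeries, cf_sum_mul, cf_H_sq_mul, cf_H_mul,
    cf_C_mul, cf_add, cf_C_mul]
  simp only [corr, dcorr, cf_gen, zero_add, recLin]
  simp only [divisors, eraseSum_map, conv_map, Multiset.add_cons, Multiset.cons_add]
  ring

theorem recLin_cons (h : ℕ) (l l' : Slot ℂ) (J : Multiset (Slot ℂ)) (q : ℂ) :
    D.recLin (fun h q K => D.W h q (l ::ₘ K)) h (l' ::ₘ J) q =
      ker q l' * D.W h q (l ::ₘ J) + 2 * ∑ g ∈ antidiagonal h,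
        conv (fun K => D.W g.1 q (l ::ₘ K)) (fun K => D.W g.2 q (l' ::ₘ K)) J
      + D.recLin (fun h q K => D.W h q (l ::ₘ l' ::ₘ K)) h J q := by
  have h1 : ∑ g ∈ antidiagonal h,
      conv (fun K => D.W g.1 q (l' ::ₘ K)) (fun K => D.W g.2 q (l ::ₘ K)) J =
      ∑ g ∈ antidiagonal h,
        conv (fun K => D.W g.1 q (l ::ₘ K)) (fun K => D.W g.2 q (l' ::ₘ K)) J := by
    rw [← Finset.Nat.sum_antidiagonal_swap]
    exact Finset.sum_congr rfl fun g _ => conv_comm _ _ _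
  rw [recLin, recLin, eraseSum_cons]
  simp only [conv_cons, Finset.sum_add_distrib, h1, Multiset.cons_swap (Slot.point q) l']
  ring

theorem hasDerivAt_P (t : ℂ) (ht : t ^ 2 - 1 ≠ 0) :
    HasDerivAt D.P (2 * t * (D.P t * (D.k / (t ^ 2 - 1)))) t := by
  have h1 : HasDerivAt (fun t : ℂ => t ^ 2 - 1) (2 * t) t :=
    ((hasDerivAt_pow 2 t).sub_const 1).congr_deriv (by norm_num)
  refine (h1.pow D.k).congr_deriv ?_
  unfold P
  rcases Nat.eq_zero_or_pos D.k with h0 | h0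
  · simp [h0]
  · rw [← Nat.sub_add_cancel h0, pow_succ]
    field_simp
    simp
    ring

theorem P_ne_zero {t : ℂ} (ht : t ^ 2 - 1 ≠ 0) : D.P t ≠ 0 := pow_ne_zero _ ht

theorem srcVal_point {p a : ℂ} (hp : p ^ 2 - 1 ≠ 0) (ha : a ^ 2 - 1 ≠ 0) (ha0 : a ≠ 0)
    (hpa : p ^ 2 - a ^ 2 ≠ 0) : D.srcVal p (.point a) = D.P p * D.G1 p a := by
  have hP := D.P_ne_zero hp
  have h1 : HasDerivAt (fun t : ℂ => p ^ 2 - t ^ 2) (-(2 * a)) a :=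
    ((hasDerivAt_pow 2 a).const_sub (p ^ 2)).congr_deriv (by norm_num)
  have h2 := (hasDerivAt_P (D := D) a ha).div h1 hpa
  simp only [srcVal, G1]
  rw [show (fun t => D.P t / (p ^ 2 - t ^ 2)) = D.P / fun t => p ^ 2 - t ^ 2 from rfl, h2.deriv]
  field_simp
  ring

theorem srcDer_point {p a : ℂ} (hp : p ^ 2 - 1 ≠ 0) :
    D.srcDer p (.point a) = D.P p * D.G p a / (2 * a) := by
  have hP := D.P_ne_zero hp
  simp only [srcDer, G]
  field_simp

theorem src_divisor {p a : ℂ} (hp : p ^ 2 - 1 ≠ 0) (f : ℂ → ℂ) :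
    D.src p f (.divisor a) = D.P p * (D.G p a * f a) := by
  have hP := D.P_ne_zero hp
  simp only [src, G]
  field_simp

variable (D) in
/-- The full one-point series, including `ω_{0,1}`. -/
def onePoint {ι : Type} (u : ι → ℂ) (p : ℂ) : LabelSeries ι :=
  D.corr u 0 p + C (D.c * p / (2 * D.P p))

variable (D) in
/-- The derivative of `onePoint` with respect to `p ^ 2`. -/
def onePoint1 {ι : Type} (u : ι → ℂ) (p : ℂ) : LabelSeries ι :=
  D.dcorr u 0 p + C (D.c / (2 * D.P p) * (1 / (2 * p) - D.k * p / (p ^ 2 - 1)))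

theorem src_point {p q : ℂ} {f : ℂ → ℂ} (hf : DifferentiableAt ℂ f q) (hp : p ^ 2 - 1 ≠ 0)
    (hq : q ^ 2 - 1 ≠ 0) (hq0 : q ≠ 0) (hpq : p ^ 2 - q ^ 2 ≠ 0) :
    D.src p f (.point q) = D.P p * (D.G1 p q * f q + D.G p q * (deriv f q / (2 * q))) := by
  rw [src_eq (l := .point q) hf hpq, srcVal_point hp hq hq0 hpq, srcDer_point hp]
  simp only [Slot.pos]
  ring

theorem onePoint_loop_zero {p q : ℂ} (hp : p ^ 2 - 1 ≠ 0)
    (hq : q ^ 2 - 1 ≠ 0) (hp0 : p ≠ 0) (hq0 : q ≠ 0) (hpq : p + q ≠ 0) (hpq' : p - q ≠ 0) :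
    2 * (D.c * p / (2 * D.P p)) * D.two p (.point q)
      + 1 / (p ^ 2 - q ^ 2) ^ 2 * (D.c * p / (2 * D.P p)) =
    D.G1 p q * (D.c * q / (2 * D.P q))
      + D.G p q * (D.c / (2 * D.P q) * (1 / (2 * q) - D.k * q / (q ^ 2 - 1))) := by
  have hP := D.P_ne_zero hp
  have hP' := D.P_ne_zero hq
  have h1 : p ^ 2 - q ^ 2 = (p + q) * (p - q) := by ring
  simp only [two, G, G1, h1]
  clear h1
  generalize D.P p = Pp at *
  generalize D.P q = Pq at *
  generalize (D.k : ℂ) = k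
  generalize D.c = c
  have e1 : c / (2 * Pq) * (1 / (2 * q) - k * q / (q ^ 2 - 1)) =
    c / (2 * Pq) / (2 * q) - c / (2 * Pq) * q * (k / (q ^ 2 - 1)) := by ring
  rw [e1]
  generalize k / (q ^ 2 - 1) = r
  field_simp
  ring

/-- The loop equation with one point label. -/
theorem loop_point (hk : 2 ≤ D.k) (hc : D.c ≠ 0) {p q : ℂ} {u : ι → ℂ}
    (hp : Adm true (ins p (ins q u))) (hpq : p ≠ q) (hpu : ∀ i, p ≠ u i) :
    (2 * D.onePoint u p + kerSeries u p) * D.corr u {.point q} p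
      + H ^ 2 * D.corr u (.point p ::ₘ {.point q}) p
      + H * C D.Q * (D.dcorr u {.point q} p + C (2 / (p ^ 2 - 1)) * D.corr u {.point q} p)
      + C (1 / (p ^ 2 - q ^ 2) ^ 2) * D.onePoint u p =
    ∑ l, C (D.G p (u l)) * label l * D.corr u {.point q} (u l)
      + (C (D.G1 p q) * D.onePoint u q + C (D.G p q) * D.onePoint1 u q) := by
  have hp1 : p ^ 2 - 1 ≠ 0 := hp.2 rfl none
  have hq1 : q ^ 2 - 1 ≠ 0 := hp.2 rfl (some none)
  have hp0 : p ≠ 0 := hp.ne_zero none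
  have hq0 : q ≠ 0 := hp.ne_zero (some none)
  have hpq2 := sq_sub_ne hp hpq
  have hP := D.P_ne_zero hp1
  ext h J
  have e1 : (2 * D.onePoint u p + kerSeries u p) * D.corr u {.point q} p
      + H ^ 2 * D.corr u (.point p ::ₘ {.point q}) p
      + H * C D.Q * (D.dcorr u {.point q} p + C (2 / (p ^ 2 - 1)) * D.corr u {.point q} p) =
      C (2 * (D.c * p / (2 * D.P p))) * D.corr u {.point q} p +
      ((2 * D.corr u 0 p + kerSeries u p) * D.corr u {.point q} p
      + H ^ 2 * D.corr u (.point p ::ₘ {.point q}) p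
      + H * (C D.Q * (D.dcorr u {.point q} p + C (2 / (p ^ 2 - 1)) * D.corr u {.point q} p))) := by
    rw [onePoint, map_mul C 2, map_ofNat]
    ring
  rw [e1, cf_add, cf_add, cf_recLin, cf_add, cf_sum_label_mul]
  simp only [cf_C_mul, onePoint, onePoint1, cf_add]
  rcases Nat.eq_zero_or_pos (h + J.card) with h0 | h0
  · obtain rfl : h = 0 := by omega
    obtain rfl : J = 0 := Multiset.card_eq_zero.1 (by omega)
    have := onePoint_loop_zero (D := D) hp1 hq1 hp0 hq0 (hp.1 none (some none)) (sub_ne_zero.2 hpq)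
    simp only [corr, dcorr, cf_gen, divisors_zero, add_zero, zero_add, W_zero, cf_C_zero, recLin,
      W_two]
    simp
    simpa using this
  · simp only [cf_C_pos _ h0, add_zero]
    simp only [corr, dcorr, cf_gen, zero_add, Multiset.singleton_add]
    have hp' : Adm false (ins p (ins q u)) := hp.to_false
    have h1 := loopEq_map hk hc h (.point none ::ₘ (J.map Slot.divisor).map (Slot.map some))
      (by simp; omega) hp' hp1 (by rintro (_ | i); exacts [hpq, hpu i])
    rw [Multiset.map_cons, map_map_ins, LoopEq, ← divisors_eq, Slot.map_point] at h1
    simp only [ins, Option.elim_none] at h1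
    have hd : DifferentiableAt ℂ (fun t => D.W h t (divisors u J)) q := by
      rw [divisors_eq]
      exact differentiableAt_W hk hc h _ (adm_ins.1 hp).1
    rw [recTerm_cons, eraseSum_src_cons, src_point hd hp1 hq1 hq0 hpq2] at h1
    have h2 : eraseSum (fun l K => D.src p (fun t => D.W h t (.point q ::ₘ K)) l) (divisors u J) =
        D.P p * eraseSum (fun b K => D.G p (u b) * D.W h (u b) (.point q ::ₘ divisors u K)) J := by
      rw [← eraseSum_mul_left, divisors, eraseSum_map]
      exact eraseSum_congr fun b K _ => src_divisor hp1 _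
    rw [h2] at h1
    simp only [ker] at h1
    refine mul_left_cancel₀ hP ?_
    have h3 : D.P p * (2 * (D.c * p / (2 * D.P p))) = D.c * p := by field_simp
    linear_combination h1 + D.W h p (.point q ::ₘ divisors u J) * h3

/-! ### Loop equations for the generating series -/

omit [Fintype ι] in
theorem eraseSum_src_divisors {p : ℂ} (hp : p ^ 2 - 1 ≠ 0) (u : ι → ℂ) (J : Multiset ι)
    (f : ℂ → Multiset (Slot ℂ) → ℂ) :
    eraseSum (fun l K => D.src p (fun t => f t K) l) (divisors u J) =
      D.P p * eraseSum (fun b K => D.G p (u b) * f (u b) (divisors u K)) J := by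
  rw [← eraseSum_mul_left, divisors, eraseSum_map]
  exact eraseSum_congr fun b K _ => src_divisor hp _

/-- The loop equation with two coincident point labels. -/
theorem loop_point_point (hk : 2 ≤ D.k) (hc : D.c ≠ 0) {p q : ℂ} {u : ι → ℂ}
    (hp : Adm true (ins p (ins q u))) (hpq : p ≠ q) (hpu : ∀ i, p ≠ u i) :
    (2 * D.onePoint u p + kerSeries u p) * D.corr u (.point q ::ₘ {.point q}) p
      + 2 * D.corr u {.point q} p ^ 2
      + H ^ 2 * D.corr u (.point p ::ₘ .point q ::ₘ {.point q}) p
      + H * C D.Q * (D.dcorr u (.point q ::ₘ {.point q}) p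
        + C (2 / (p ^ 2 - 1)) * D.corr u (.point q ::ₘ {.point q}) p)
      + 2 * C (1 / (p ^ 2 - q ^ 2) ^ 2) * D.corr u {.point q} p =
    ∑ l, C (D.G p (u l)) * label l * D.corr u (.point q ::ₘ {.point q}) (u l)
      + 2 * (C (D.G1 p q) * D.corr u {.point q} q + C (D.G p q) * D.dcorr u {.point q} q) := by
  have hp1 : p ^ 2 - 1 ≠ 0 := hp.2 rfl none
  have hq1 : q ^ 2 - 1 ≠ 0 := hp.2 rfl (some none)
  have hp0 : p ≠ 0 := hp.ne_zero none
  have hq0 : q ≠ 0 := hp.ne_zero (some none)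
  have hpq2 := sq_sub_ne hp hpq
  have hP := D.P_ne_zero hp1
  ext h J
  have e1 : (2 * D.onePoint u p + kerSeries u p) * D.corr u (.point q ::ₘ {.point q}) p
      + 2 * D.corr u {.point q} p ^ 2
      + H ^ 2 * D.corr u (.point p ::ₘ .point q ::ₘ {.point q}) p
      + H * C D.Q * (D.dcorr u (.point q ::ₘ {.point q}) p
        + C (2 / (p ^ 2 - 1)) * D.corr u (.point q ::ₘ {.point q}) p)
      + 2 * C (1 / (p ^ 2 - q ^ 2) ^ 2) * D.corr u {.point q} p =
      C (2 * (D.c * p / (2 * D.P p))) * D.corr u (.point q ::ₘ {.point q}) p +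
      ((2 * D.corr u 0 p + kerSeries u p) * D.corr u (.point q ::ₘ {.point q}) p
      + H ^ 2 * D.corr u (.point p ::ₘ .point q ::ₘ {.point q}) p
      + H * (C D.Q * (D.dcorr u (.point q ::ₘ {.point q}) p
        + C (2 / (p ^ 2 - 1)) * D.corr u (.point q ::ₘ {.point q}) p)))
      + C 2 * (D.corr u {.point q} p * D.corr u {.point q} p)
      + C (2 * (1 / (p ^ 2 - q ^ 2) ^ 2)) * D.corr u {.point q} p := by
    rw [onePoint, map_mul C 2, map_mul C 2, map_ofNat]
    ring
  have e2 : (2 : LabelSeries ι) * (C (D.G1 p q) * D.corr u {.point q} q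
      + C (D.G p q) * D.dcorr u {.point q} q) = C (2 * D.G1 p q) * D.corr u {.point q} q
      + C (2 * D.G p q) * D.dcorr u {.point q} q := by
    rw [map_mul C 2, map_mul C 2, map_ofNat]
    ring
  rw [e1, e2, cf_add, cf_add, cf_add, cf_recLin, cf_add, cf_sum_label_mul]
  simp only [cf_C_mul, cf_add]
  rw [cf_mul]
  simp only [corr, dcorr, cf_gen, Multiset.singleton_add, Multiset.cons_add]
  have hp' : Adm false (ins p (ins q u)) := hp.to_false
  have h1 := loopEq_map hk hc h
    (.point none ::ₘ .point none ::ₘ (J.map Slot.divisor).map (Slot.map some))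
    (by simp; omega) hp' hp1 (by rintro (_ | i); exacts [hpq, hpu i])
  rw [Multiset.map_cons, Multiset.map_cons, map_map_ins, LoopEq, ← divisors_eq,
    Slot.map_point] at h1
  simp only [ins, Option.elim_none] at h1
  have hd : DifferentiableAt ℂ (fun t => D.W h t (.point q ::ₘ divisors u J)) q := by
    have hq : Adm true (ins q (ins q u)) := (adm_ins.1 hp).1.ins_dup
    have := differentiableAt_W hk hc h (.point none ::ₘ (J.map Slot.divisor).map (Slot.map some)) hq
    rw [Multiset.map_cons, map_map_ins, ← divisors_eq] at this
    exact this
  rw [recTerm_cons, recLin_cons, eraseSum_src_cons, eraseSum_cons,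
    src_point hd hp1 hq1 hq0 hpq2] at h1
  rw [eraseSum_src_divisors hp1 u J fun t K => D.W h t (.point q ::ₘ .point q ::ₘ K)] at h1
  simp only [ker] at h1
  refine mul_left_cancel₀ hP ?_
  have h3 : D.P p * (2 * (D.c * p / (2 * D.P p))) = D.c * p := by field_simp
  have h4 : ∑ x ∈ antidiagonal h,
      conv (fun K => D.W x.1 p (.point q ::ₘ divisors u K))
        (fun K => D.W x.2 p (.point q ::ₘ divisors u K)) J =
      ∑ x ∈ antidiagonal h,
      conv (fun K => D.W x.1 p (.point q ::ₘ K))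
        (fun K => D.W x.2 p (.point q ::ₘ K)) (divisors u J) := by
    simp only [divisors, conv_map]
  rw [h4]
  linear_combination h1 + D.W h p (.point q ::ₘ .point q ::ₘ divisors u J) * h3

variable (D) in
/-- The terms of the loop equation that come from `ω_{0,1}`, from `ω_{1/2,1}` and from the
normalisation of the divisor labels. -/
def source (p : ℂ) : LabelSeries ι :=
  C (D.c ^ 2 / 4 * (p ^ 2 / D.P p ^ 2)) + H * C (D.Q * D.c * D.μ / 2 * (1 / (D.P p * (p ^ 2 - 1))))
    - ∑ l, C (D.c * D.ν / 2 * (1 / (D.P p * (p ^ 2 - 1)))) * label l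

theorem cf_recTerm (u : ι → ℂ) (p : ℂ) (h : ℕ) (J : Multiset ι) :
    cf h J (D.corr u 0 p * D.corr u 0 p + kerSeries u p * D.corr u 0 p
      + H ^ 2 * D.corr u {.point p} p
      + H * (C D.Q * (D.dcorr u 0 p + C (2 / (p ^ 2 - 1)) * D.corr u 0 p))) =
    D.recTerm D.W h (divisors u J) p := by
  rw [cf_add, cf_add, cf_add, cf_mul, kerSeries, cf_sum_mul, cf_H_sq_mul, cf_H_mul,
    cf_C_mul, cf_add, cf_C_mul]
  simp only [corr, dcorr, cf_gen, zero_add, recTerm]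
  simp only [divisors, eraseSum_map, conv_map, Multiset.singleton_add]
  ring

theorem cf_source (p : ℂ) (h : ℕ) (J : Multiset ι) :
    cf h J (D.source p : LabelSeries ι) = cf h J
    (C (D.c ^ 2 / 4 * (p ^ 2 / D.P p ^ 2)) : LabelSeries ι)
      + (if 1 ≤ h then cf (h - 1) J
          (C (D.Q * D.c * D.μ / 2 * (1 / (D.P p * (p ^ 2 - 1)))) : LabelSeries ι) else 0)
      - eraseSum (fun _ K => D.c * D.ν / 2 * (1 / (D.P p * (p ^ 2 - 1)))
          * cf h K (C 1 : LabelSeries ι)) J := by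
  have : ∑ l, C (D.c * D.ν / 2 * (1 / (D.P p * (p ^ 2 - 1)))) * label l =
    ∑ l : ι, C (D.c * D.ν / 2 * (1 / (D.P p * (p ^ 2 - 1)))) * label l * C 1 := by
    simp
  rw [source, this, cf_sub, cf_add, cf_H_mul, cf_sum_label_mul]

/-- The one-point loop equation. -/
theorem loop_empty (hk : 2 ≤ D.k) (hc : D.c ≠ 0) {p : ℂ} {u : ι → ℂ}
    (hp : Adm true (ins p u)) (hpu : ∀ i, p ≠ u i) :
    D.onePoint u p ^ 2 + kerSeries u p * D.onePoint u p + H ^ 2 * D.corr u {.point p} p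
      + H * C D.Q * (D.onePoint1 u p + C (2 / (p ^ 2 - 1)) * D.onePoint u p) =
    D.source p + ∑ l, C (D.G p (u l)) * label l * D.onePoint u (u l) := by
  have hp1 : p ^ 2 - 1 ≠ 0 := hp.2 rfl none
  have hp0 : p ≠ 0 := hp.ne_zero none
  have hP := D.P_ne_zero hp1
  ext h J
  set κ := D.c * p / (2 * D.P p) with hκ
  set s1 := D.c / (2 * D.P p) * (1 / (2 * p) - D.k * p / (p ^ 2 - 1)) with hs1
  have e1 : D.onePoint u p ^ 2 + kerSeries u p * D.onePoint u p + H ^ 2 * D.corr u {.point p} p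
      + H * C D.Q * (D.onePoint1 u p + C (2 / (p ^ 2 - 1)) * D.onePoint u p) =
      (D.corr u 0 p * D.corr u 0 p + kerSeries u p * D.corr u 0 p
      + H ^ 2 * D.corr u {.point p} p
      + H * (C D.Q * (D.dcorr u 0 p + C (2 / (p ^ 2 - 1)) * D.corr u 0 p)))
      + C (2 * κ) * D.corr u 0 p + C (κ ^ 2) + kerSeries u p * C κ
      + H * C (D.Q * (s1 + 2 / (p ^ 2 - 1) * κ)) := by
    rw [onePoint, onePoint1, ← hκ, ← hs1]
    simp only [map_mul, map_add, map_pow, map_ofNat]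
    ring
  rw [e1, cf_add, cf_add, cf_add, cf_add, cf_recTerm, cf_add, cf_sum_label_mul, cf_source, cf_H_mul,
    kerSeries, cf_sum_mul, cf_C_mul]
  simp only [onePoint, cf_add]
  simp only [corr, cf_gen, zero_add]
  rcases Nat.lt_or_ge (h + J.card) 2 with h0 | h0
  · have hcases : (h = 0 ∧ J = 0) ∨ (h = 1 ∧ J = 0) ∨ (h = 0 ∧ ∃ i, J = {i}) := by
      rcases Nat.eq_zero_or_pos J.card with h1 | h1
      · rw [Multiset.card_eq_zero] at h1
        subst h1
        simp at h0 ⊢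
        omega
      · have : J.card = 1 := by omega
        exact .inr (.inr ⟨by omega, Multiset.card_eq_one.1 this⟩)
    rcases hcases with ⟨rfl, rfl⟩ | ⟨rfl, rfl⟩ | ⟨rfl, i, rfl⟩
    · simp [recTerm, cf_C_zero, -map_pow, -map_one, -map_mul]
      rw [hκ]
      field_simp
      ring
    · have hz : ∀ s : ℂ, cf 1 (0 : Multiset ι) (C s) = 0 := fun s => cf_C_pos s (by simp)
      simp [recTerm, cf_C_zero, hz, -map_pow, -map_one, -map_mul,  Finset.Nat.antidiagonal_succ,
        W_one]
      rw [hκ, hs1, half]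
      generalize D.P p = Pp at *
      field_simp
      ring
    · have hz : ∀ s : ℂ, cf 0 ({i} : Multiset ι) (C s) = 0 := fun s => cf_C_pos s (by simp)
      have hi : ({i} : Multiset ι) = i ::ₘ 0 := rfl
      have hu : D.W 0 p {Slot.divisor (u i)} = D.two p (.divisor (u i)) := W_two _ _ _
      have hpa := sub_ne_zero.2 (hpu i)
      have hpa' : p + u i ≠ 0 := hp.1 none (some i)
      have hui : u i ^ 2 - 1 ≠ 0 := hp.2 rfl (some i)
      have hPi := D.P_ne_zero hui
      simp only [hz]
      simp only [hi, divisors_cons, divisors_zero, eraseSum_cons, conv_cons, recTerm]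
      simp [cf_C_zero, hu, -map_pow, -map_one, -map_mul]
      have h1 : p ^ 2 - u i ^ 2 = (p + u i) * (p - u i) := by ring
      simp only [ker, two, hκ, G, h1]
      clear h1 e1
      generalize D.P p = Pp at *
      generalize D.P (u i) = Pu at *
      generalize u i = a at *
      field_simp
      ring
  · have e2 : eraseSum (fun b K => ker p (.divisor (u b)) * cf h K (C κ : LabelSeries ι)) J
        = 0 := (eraseSum_congr (ψ := fun _ _ => 0) fun b K hK => by
          rw [hK, Multiset.card_cons] at h0
          rw [cf_C_pos _ (by omega), mul_zero]).trans (by simp [eraseSum])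
    have e3 : eraseSum (fun _ K => D.c * D.ν / 2 * (1 / (D.P p * (p ^ 2 - 1)))
        * cf h K (C 1 : LabelSeries ι)) J
        = 0 := (eraseSum_congr (ψ := fun _ _ => 0) fun b K hK => by
          rw [hK, Multiset.card_cons] at h0
          rw [cf_C_pos _ (by omega), mul_zero]).trans (by simp [eraseSum])
    have e4 : eraseSum (fun b K => D.G p (u b) * (D.W h (u b) (divisors u K)
        + cf h K (C (D.c * u b / (2 * D.P (u b))) : LabelSeries ι))) J
        = eraseSum (fun b K => D.G p (u b) * D.W h (u b) (divisors u K)) J :=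
      eraseSum_congr fun b K hK => by
          rw [hK, Multiset.card_cons] at h0
          rw [cf_C_pos _ (by omega), add_zero]
    have e5 : ∀ s : ℂ, (if 1 ≤ h then cf (h - 1) J (C s : LabelSeries ι) else 0) = 0 := fun s => by
      split_ifs
      · exact cf_C_pos _ (by omega)
      · rfl
    rw [e2, e3, e4, e5, e5, cf_C_pos _ (by omega), cf_C_pos _ (by omega)]
    have h1 := loopEq_map hk hc h (J.map Slot.divisor) (by simp; omega) hp.to_false hp1 hpu
    rw [LoopEq, ← divisors_eq, eraseSum_src_divisors hp1 u J fun t K => D.W h t K] at h1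
    refine mul_left_cancel₀ hP ?_
    have h3 : D.P p * (2 * κ) = D.c * p := by rw [hκ]; field_simp
    linear_combination h1 + D.W h p (divisors u J) * h3

end LoopData

/-! ### The symmetry of the source terms -/

namespace LoopData
open LabelSeries

variable {D : LoopData} {ι : Type}

variable (D) in
/-- The second derivative of `G p q` with respect to `q ^ 2`. -/
def G2 (p q : ℂ) : ℂ :=
  D.P q / (D.P p * (p ^ 2 - q ^ 2)) * ((D.k / (q ^ 2 - 1) + 1 / (p ^ 2 - q ^ 2)) ^ 2
    - D.k / (q ^ 2 - 1) ^ 2 + 1 / (p ^ 2 - q ^ 2) ^ 2)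

variable (D) in
/-- The derivative of `G p a` with respect to `p ^ 2`. -/
def dG (p a : ℂ) : ℂ := D.G p a * (-(D.k / (p ^ 2 - 1)) - 1 / (p ^ 2 - a ^ 2))

/-- The derivative of `ker p (.divisor a)` with respect to `p ^ 2`. -/
def dker (p a : ℂ) : ℂ := -(1 / (p ^ 2 - a ^ 2) ^ 2) + 1 / (p ^ 2 - 1) ^ 2

theorem hasDerivAt_sq_sub (p a : ℂ) : HasDerivAt (fun t : ℂ => t ^ 2 - a) (2 * p) p :=
  ((hasDerivAt_pow 2 p).sub_const a).congr_deriv (by norm_num)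

theorem hasDerivAt_sub_sq (p a : ℂ) : HasDerivAt (fun t : ℂ => a - t ^ 2) (-(2 * p)) p :=
  ((hasDerivAt_pow 2 p).const_sub a).congr_deriv (by norm_num)

theorem hasDerivAt_G_right {p q : ℂ} (hp : p ^ 2 - 1 ≠ 0) (hq : q ^ 2 - 1 ≠ 0)
    (hpq : p ^ 2 - q ^ 2 ≠ 0) : HasDerivAt (fun t => D.G p t) (2 * q * D.G1 p q) q := by
  have hP := D.P_ne_zero hp
  have h1 := (hasDerivAt_P (D := D) q hq).fun_div ((hasDerivAt_sub_sq q (p ^ 2)).const_mul (D.P p))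
    (mul_ne_zero hP hpq)
  refine h1.congr_deriv ?_
  rw [G1]
  field_simp
  ring

theorem hasDerivAt_G1_right {p q : ℂ} (hp : p ^ 2 - 1 ≠ 0) (hq : q ^ 2 - 1 ≠ 0)
    (hpq : p ^ 2 - q ^ 2 ≠ 0) : HasDerivAt (fun t => D.G1 p t) (2 * q * D.G2 p q) q := by
  have h1 := ((hasDerivAt_const q (D.k : ℂ)).fun_div (hasDerivAt_sq_sub q 1) hq).fun_add
    ((hasDerivAt_const q (1 : ℂ)).fun_div (hasDerivAt_sub_sq q (p ^ 2)) hpq)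
  refine ((hasDerivAt_G_right (D := D) hp hq hpq).fun_mul h1).congr_deriv ?_
  rw [G1, G2, G]
  have hP := D.P_ne_zero hp
  field_simp
  ring

theorem hasDerivAt_G_left {p a : ℂ} (hp : p ^ 2 - 1 ≠ 0)
    (hpa : p ^ 2 - a ^ 2 ≠ 0) : HasDerivAt (fun t => D.G t a) (2 * p * D.dG p a) p := by
  have hP := D.P_ne_zero hp
  have h1 := (hasDerivAt_const p (D.P a)).fun_div
    ((hasDerivAt_P (D := D) p hp).fun_mul (hasDerivAt_sq_sub p (a ^ 2))) (mul_ne_zero hP hpa)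
  refine h1.congr_deriv ?_
  rw [dG, G]
  field_simp
  ring

theorem hasDerivAt_ker_left {p a : ℂ} (hp : p ^ 2 - 1 ≠ 0) (hpa : p ^ 2 - a ^ 2 ≠ 0) :
    HasDerivAt (fun t => ker t (.divisor a)) (2 * p * dker p a) p := by
  have h1 := ((hasDerivAt_const p (1 : ℂ)).fun_div (hasDerivAt_sq_sub p (a ^ 2)) hpa).fun_sub
    ((hasDerivAt_const p (1 : ℂ)).fun_div (hasDerivAt_sq_sub p 1) hp)
  refine h1.congr_deriv ?_
  rw [dker]
  field_simp
  ring

variable (D) in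
/-- The derivative of `source p` with respect to `p ^ 2`. -/
def source1 [Fintype ι] (p : ℂ) : LabelSeries ι :=
  C (D.c ^ 2 / 4 * (1 / D.P p ^ 2 * (1 - 2 * D.k * p ^ 2 / (p ^ 2 - 1))))
    + H * C (D.Q * D.c * D.μ / 2 * -((D.k + 1) / (D.P p * (p ^ 2 - 1) ^ 2)))
    - ∑ l, C (D.c * D.ν / 2 * -((D.k + 1) / (D.P p * (p ^ 2 - 1) ^ 2))) * label l

theorem hasDeriv_source [Fintype ι] {p : ℂ} (hp : p ^ 2 - 1 ≠ 0) :
    HasDeriv (fun t => (D.source t : LabelSeries ι)) (D.source1 p) p := by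
  have hP := D.P_ne_zero hp
  have h1 : HasDerivAt (fun t => t ^ 2 / D.P t ^ 2)
      (2 * p * (1 / D.P p ^ 2 * (1 - 2 * D.k * p ^ 2 / (p ^ 2 - 1)))) p := by
    refine ((hasDerivAt_pow 2 p).fun_div ((hasDerivAt_P (D := D) p hp).fun_pow 2)
      (pow_ne_zero 2 hP)).congr_deriv ?_
    field_simp
    ring
  have h2 : HasDerivAt (fun t => 1 / (D.P t * (t ^ 2 - 1)))
      (2 * p * -((D.k + 1) / (D.P p * (p ^ 2 - 1) ^ 2))) p := by
    refine ((hasDerivAt_const p (1 : ℂ)).fun_div ((hasDerivAt_P (D := D) p hp).fun_mul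
      (hasDerivAt_sq_sub p 1)) (mul_ne_zero hP hp)).congr_deriv ?_
    field_simp
    ring
  have key : ∀ a : ℂ, HasDerivAt (fun t => a * (1 / (D.P t * (t ^ 2 - 1))))
      (2 * p * (a * -((D.k + 1) / (D.P p * (p ^ 2 - 1) ^ 2)))) p :=
    fun a => (h2.const_mul a).congr_deriv (by ring)
  have h3 := ((HasDeriv.C (ι := ι) ((h1.const_mul (D.c ^ 2 / 4)).congr_deriv
    (show _ = 2 * p * (D.c ^ 2 / 4 * (1 / D.P p ^ 2 * (1 - 2 * D.k * p ^ 2 / (p ^ 2 - 1)))) by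
      ring))).add
    ((HasDeriv.const H p).mul (HasDeriv.C (ι := ι) (key (D.Q * D.c * D.μ / 2))))).add
    ((HasDeriv.const (-1) p).mul (HasDeriv.sum Finset.univ fun l : ι =>
      (HasDeriv.C (ι := ι) (key (D.c * D.ν / 2))).mul (HasDeriv.const (label l) p)))
  convert h3 using 1
  · funext t
    simp only [source]
    ring
  · simp only [source1, mul_zero, zero_mul, add_zero, zero_add]
    ring

/-! Rational function identities, valid for both curves. -/

section Scalar

variable {p q a : ℂ} (hk : D.k = 2 ∨ D.k = 3) (hp : p ^ 2 - 1 ≠ 0) (hq : q ^ 2 - 1 ≠ 0)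
  (ha : a ^ 2 - 1 ≠ 0) (hpq : p ^ 2 - q ^ 2 ≠ 0) (hpa : p ^ 2 - a ^ 2 ≠ 0) (hqa : q ^ 2 - a ^ 2 ≠ 0)

include hk hp hq hpq in
theorem G_identity_Q : D.G2 p q - 2 / (q ^ 2 - 1) * D.G1 p q - -(2 / (q ^ 2 - 1) ^ 2) * D.G p q
    + (-(2 / (p ^ 2 - q ^ 2) ^ 3) + 2 / (p ^ 2 - 1) * (1 / (p ^ 2 - q ^ 2) ^ 2)) = 0 := by
  have hq' : q ^ 2 - p ^ 2 ≠ 0 := by rwa [← neg_sub, neg_ne_zero]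
  simp only [G2, G1, G, P]
  generalize p ^ 2 = X at *
  generalize q ^ 2 = Y at *
  rcases hk with h | h <;> simp only [h, Nat.cast_ofNat] <;> field_simp <;> ring

include hk hp hq hpq hpa hqa in
theorem G_identity_ker : 1 / (p ^ 2 - q ^ 2) ^ 2 * ker p (.divisor a)
    - D.G p a * (1 / (q ^ 2 - a ^ 2) ^ 2)
    - (D.G1 p q * ker q (.divisor a) + D.G p q * dker q a) = 0 := by
  simp only [G1, G, P, ker, dker]
  generalize p ^ 2 = X at *
  generalize q ^ 2 = Y at *
  generalize a ^ 2 = Z at *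
  rcases hk with h | h <;> simp only [h, Nat.cast_ofNat] <;> field_simp <;> ring

include hk hp hq ha hpq hpa hqa in
theorem G_identity_label : D.G p a * D.G1 q a + 2 * D.G1 p q * D.G q a + D.G p q * D.dG q a =
    D.G q a * D.G1 p a + 2 * D.G1 q p * D.G p a + D.G q p * D.dG p a := by
  have hq' : q ^ 2 - p ^ 2 ≠ 0 := by rwa [← neg_sub, neg_ne_zero]
  have e : q ^ 2 - p ^ 2 = -(p ^ 2 - q ^ 2) := by ring
  simp only [G1, G, dG, P]
  rw [e]
  generalize p ^ 2 = X at *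
  generalize q ^ 2 = Y at *
  generalize a ^ 2 = Z at *
  rcases hk with h | h <;> simp only [h, Nat.cast_ofNat] <;> field_simp <;> ring

include hk hp hq hpq in
theorem G_identity_source₁ : 2 * D.G1 p q * (q ^ 2 / D.P q ^ 2)
    + D.G p q * (1 / D.P q ^ 2 * (1 - 2 * D.k * q ^ 2 / (q ^ 2 - 1))) =
    2 * D.G1 q p * (p ^ 2 / D.P p ^ 2)
    + D.G q p * (1 / D.P p ^ 2 * (1 - 2 * D.k * p ^ 2 / (p ^ 2 - 1))) := by
  have e : q ^ 2 - p ^ 2 = -(p ^ 2 - q ^ 2) := by ring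
  simp only [G1, G, P]
  rw [e]
  generalize p ^ 2 = X at *
  generalize q ^ 2 = Y at *
  rcases hk with h | h <;> simp only [h, Nat.cast_ofNat] <;> field_simp <;> ring

include hk hp hq hpq in
theorem G_identity_source₂ : 2 * D.G1 p q * (1 / (D.P q * (q ^ 2 - 1)))
    + D.G p q * -((D.k + 1) / (D.P q * (q ^ 2 - 1) ^ 2)) =
    2 * D.G1 q p * (1 / (D.P p * (p ^ 2 - 1)))
    + D.G q p * -((D.k + 1) / (D.P p * (p ^ 2 - 1) ^ 2)) := by
  have e : q ^ 2 - p ^ 2 = -(p ^ 2 - q ^ 2) := by ring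
  simp only [G1, G, P]
  rw [e]
  generalize p ^ 2 = X at *
  generalize q ^ 2 = Y at *
  rcases hk with h | h <;> simp only [h, Nat.cast_ofNat] <;> field_simp <;> ring

include hk hp hq hpq in
/-- The sources are symmetric in the sense required by `loop_sources_symm`. -/
theorem source_symm [Fintype ι] :
    2 * C (D.G1 p q) * D.source q + C (D.G p q) * D.source1 q =
    2 * C (D.G1 q p) * D.source p + C (D.G q p) * (D.source1 p : LabelSeries ι) := by
  have h1 := congrArg (C (ι := ι)) (G_identity_source₁ hk hp hq hpq)
  have h2 := congrArg (C (ι := ι)) (G_identity_source₂ hk hp hq hpq)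
  simp only [map_add, map_mul (C (ι := ι)), map_ofNat] at h1 h2
  simp only [source, source1, map_mul (C (ι := ι)) (D.c ^ 2 / 4),
    map_mul (C (ι := ι)) (D.c * D.ν / 2), mul_assoc, ← Finset.mul_sum]
  simp only [← mul_assoc] at h1 h2 ⊢
  simp only [map_mul (C (ι := ι))]
  linear_combination C (D.c ^ 2 / 4) * h1 + (H * C (D.Q * D.c * D.μ / 2)
    - C (D.c * D.ν / 2) * ∑ i, label i) * h2

end Scalar

end LoopData

/-! ### Derivatives of the generating series -/

namespace LoopData
open LabelSeries

variable {D : LoopData} {ι κ : Type} [Fintype κ]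

theorem _root_.RefinedTR.Adm.sq_sub_label_ne {e : Bool} {ι : Type} {p : ℂ} {u : ι → ℂ}
    (hp : Adm e (ins p u)) (i : ι)
    (hpu : p ≠ u i) : p ^ 2 - u i ^ 2 ≠ 0 := sq_sub_ne' hp (.divisor i) hpu

/-! Differentiability of correlators as functions of coinciding or exchanged arguments. -/

theorem differentiableAt_W_ins (hk : 2 ≤ D.k) (hc : D.c ≠ 0) (h : ℕ) (i : Option κ)
    (L : Multiset (Slot (Option κ))) {t : ℂ} {v : κ → ℂ} (ht : Adm true (ins t v)) :
    DifferentiableAt ℂ (fun t => D.W h (ins t v i) (L.map (Slot.map (ins t v)))) t := by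
  classical
  have hi := hasDerivAt_ins t v
  exact (((reg_W_true hk hc h L).eval i).differentiableAt ht).comp t hi.differentiableAt

theorem differentiableAt_deriv_W_ins (hk : 2 ≤ D.k) (hc : D.c ≠ 0) (h : ℕ) (i : Option κ)
    (L : Multiset (Slot (Option κ))) {t : ℂ} {v : κ → ℂ} (ht : Adm true (ins t v)) :
    DifferentiableAt ℂ
      (fun t => deriv (fun s => D.W h s (L.map (Slot.map (ins t v)))) (ins t v i)) t := by
  classical
  have hi := hasDerivAt_ins t v
  exact (((reg_W_true hk hc h L).deriv.eval i).differentiableAt ht).comp t hi.differentiableAt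

theorem map_divisor_map {ι κ : Type} (φ : ι → κ) (v : κ → ℂ) (J : Multiset ι) :
    (J.map fun i => Slot.divisor (φ i)).map (Slot.map v) = divisors (fun i => v (φ i)) J := by
  rw [Multiset.map_map]
  rfl

variable (D) in
/-- The derivative, with respect to `p ^ 2`, of `corr D u (L p) q`. -/
def lcorr (u : ι → ℂ) (L : ℂ → Multiset (Slot ℂ)) (q p : ℂ) : LabelSeries ι :=
  gen fun h J => deriv (fun t => D.W h q (L t + divisors u J)) p / (2 * p)

variable (D) in
/-- The derivative of `corr D u {.point p} p` with respect to `p ^ 2`. -/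
def tcorr (u : ι → ℂ) (p : ℂ) : LabelSeries ι :=
  gen fun h J => deriv (fun t => D.W h t ({.point t} + divisors u J)) p / (2 * p)

variable (D) in
/-- The derivative of `dcorr D u {.point p} q` with respect to `p ^ 2`. -/
def ldcorr (u : ι → ℂ) (q p : ℂ) : LabelSeries ι :=
  gen fun h J => deriv (fun t =>
    deriv (fun s => D.W h s ({.point t} + divisors u J)) q / (2 * q)) p / (2 * p)

variable (D) in
/-- The derivative of `onePoint1 D u p` with respect to `p ^ 2`. -/
def onePoint2 (u : ι → ℂ) (p : ℂ) : LabelSeries ι :=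
  gen (fun h J => deriv (fun t => deriv (fun s => D.W h s (0 + divisors u J)) t / (2 * t)) p
    / (2 * p)) + C (deriv (fun t => D.c / (2 * D.P t) * (1 / (2 * t) - D.k * t / (t ^ 2 - 1))) p
    / (2 * p))

section HasDeriv

variable [Fintype ι] (hk : 2 ≤ D.k) (hc : D.c ≠ 0) {p q : ℂ} {u : ι → ℂ}

include hk hc

theorem hasDeriv_onePoint (hp : Adm true (ins p u)) :
    HasDeriv (D.onePoint u) (D.onePoint1 u p) p := by
  have hp0 : p ≠ 0 := hp.ne_zero none
  have hp1 : p ^ 2 - 1 ≠ 0 := hp.2 rfl none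
  have hP := D.P_ne_zero hp1
  refine (HasDeriv.gen hp0 fun h J => ?_).add (HasDeriv.C ?_)
  · rw [zero_add, divisors_eq]
    exact differentiableAt_W hk hc h _ hp
  · refine (((hasDerivAt_id' p).const_mul D.c).fun_div ((hasDerivAt_P (D := D) p hp1).const_mul 2)
      (mul_ne_zero two_ne_zero hP)).congr_deriv ?_
    generalize D.P p = Pp at *
    generalize (D.k : ℂ) = k at *
    field_simp

theorem hasDeriv_onePoint1 (hp : Adm true (ins p u)) :
    HasDeriv (D.onePoint1 u) (D.onePoint2 u p) p := by
  have hp0 : p ≠ 0 := hp.ne_zero none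
  have hp1 : p ^ 2 - 1 ≠ 0 := hp.2 rfl none
  have hP := D.P_ne_zero hp1
  have hd := (hasDerivAt_P (D := D) p hp1).differentiableAt
  refine (HasDeriv.gen hp0 fun h J => ?_).add (HasDeriv.C ?_)
  · have h1 := differentiableAt_deriv_W_ins hk hc h none
      (J.map fun i => .divisor (some i)) hp
    simp only [map_divisor_map] at h1
    simp only [zero_add]
    exact h1.fun_div (by fun_prop) (by simpa using hp0)
  · have h1 : DifferentiableAt ℂ
        (fun t => D.c / (2 * D.P t) * (1 / (2 * t) - D.k * t / (t ^ 2 - 1))) p := by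
      fun_prop (disch := simpa using ‹_›)
    refine h1.hasDerivAt.congr_deriv ?_
    exact (mul_div_cancel₀ _ (mul_ne_zero two_ne_zero hp0)).symm

theorem hasDeriv_corr (hp : Adm true (ins p (ins q u))) (i : Option ι) :
    HasDeriv (fun t => D.corr u {.point t} (ins q u i))
      (D.lcorr u (fun t => {.point t}) (ins q u i) p) p := by
  refine HasDeriv.gen (hp.ne_zero none) fun h J => ?_
  have h1 := differentiableAt_W_ins hk hc h (some i)
    (.point none ::ₘ J.map fun i => .divisor (some (some i))) hp
  simp only [Multiset.map_cons, map_divisor_map] at h1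
  exact h1

theorem hasDeriv_corr_point (hp : Adm true (ins p (ins q u))) :
    HasDeriv (fun t => D.corr u (.point q ::ₘ {.point t}) q)
      (D.lcorr u (fun t => .point q ::ₘ {.point t}) q p) p := by
  refine HasDeriv.gen (hp.ne_zero none) fun h J => ?_
  have h1 := differentiableAt_W_ins hk hc h (some none)
    (.point (some none) ::ₘ .point none ::ₘ J.map fun i => .divisor (some (some i))) hp
  simp only [Multiset.map_cons, map_divisor_map] at h1
  have e : ∀ t, Slot.point q ::ₘ {Slot.point t} + divisors u J =
    .point q ::ₘ .point t ::ₘ divisors u J := fun t => by simp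
  simp only [e]
  exact h1

theorem hasDeriv_dcorr (hp : Adm true (ins p (ins q u))) :
    HasDeriv (fun t => D.dcorr u {.point t} q) (D.ldcorr u q p) p := by
  refine HasDeriv.gen (hp.ne_zero none) fun h J => ?_
  have h1 := differentiableAt_deriv_W_ins hk hc h (some none)
    (.point none ::ₘ J.map fun i => .divisor (some (some i))) hp
  simp only [Multiset.map_cons, map_divisor_map] at h1
  exact h1.div_const _

theorem hasDeriv_tcorr (hp : Adm true (ins p u)) :
    HasDeriv (fun t => D.corr u {.point t} t) (D.tcorr u p) p := by
  refine HasDeriv.gen (hp.ne_zero none) fun h J => ?_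
  have h1 := differentiableAt_W_ins hk hc h none
    (.point none ::ₘ J.map fun i => .divisor (some i)) hp
  simp only [Multiset.map_cons, map_divisor_map] at h1
  exact h1

variable (D) in
/-- The derivative of `kerSeries u p` with respect to `p ^ 2`. -/
def dkerSeries (u : ι → ℂ) (p : ℂ) : LabelSeries ι :=
  ∑ l, C (dker p (u l)) * label l

omit hk hc in
theorem hasDeriv_kerSeries (hp : Adm true (ins p u)) (hpu : ∀ i, p ≠ u i) :
    HasDeriv (kerSeries u) (dkerSeries u p) p := by
  have h1 := HasDeriv.sum Finset.univ fun l : ι => (HasDeriv.C (ι := ι)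
    (hasDerivAt_ker_left (hp.2 rfl none) (hp.sq_sub_label_ne l (hpu l)))).mul
    (HasDeriv.const (label l) p)
  simp only [mul_zero, add_zero] at h1
  exact h1

/-- The derivative of the one-point loop equation. -/
theorem loop_empty_deriv (hp : Adm true (ins p u)) (hpu : ∀ i, p ≠ u i) :
    2 * D.onePoint u p * D.onePoint1 u p + dkerSeries u p * D.onePoint u p
      + kerSeries u p * D.onePoint1 u p + H ^ 2 * D.tcorr u p
      + H * C D.Q * (D.onePoint2 u p + C (2 / (p ^ 2 - 1)) * D.onePoint1 u p
        + C (-(2 / (p ^ 2 - 1) ^ 2)) * D.onePoint u p) =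
    D.source1 p + ∑ l, C (D.dG p (u l)) * label l * D.onePoint u (u l) := by
  have hp0 : p ≠ 0 := hp.ne_zero none
  have hp1 : p ^ 2 - 1 ≠ 0 := hp.2 rfl none
  have hy := hasDeriv_onePoint hk hc hp
  have hr : HasDerivAt (fun t : ℂ => 2 / (t ^ 2 - 1)) (2 * p * -(2 / (p ^ 2 - 1) ^ 2)) p :=
    ((hasDerivAt_const p (2 : ℂ)).fun_div (hasDerivAt_sq_sub p 1) hp1).congr_deriv (by
      field_simp; ring)
  have h1 := (((hy.mul hy).add ((hasDeriv_kerSeries hp hpu).mul hy)).add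
    ((HasDeriv.const (H ^ 2) p).mul (hasDeriv_tcorr hk hc hp))).add
    ((HasDeriv.const (H * C D.Q) p).mul ((hasDeriv_onePoint1 hk hc hp).add
      ((HasDeriv.C (ι := ι) hr).mul hy)))
  have h2 := (hasDeriv_source (D := D) (ι := ι) hp1).add (HasDeriv.sum Finset.univ fun l : ι =>
    ((HasDeriv.C (ι := ι) (hasDerivAt_G_left (D := D) hp1
      (hp.sq_sub_label_ne l (hpu l)))).mul (HasDeriv.const (label l) p)).mul
      (HasDeriv.const (D.onePoint u (u l)) p))
  have h3 : ∀ᶠ t in 𝓝 p, ∀ i, t ≠ u i := eventually_all.2 fun i =>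
    continuousAt_id.eventually_ne (hpu i)
  have h4 := h1.unique hp0 h2 (by
    filter_upwards [hp.eventually_ins, h3] with t ht htu
    rw [← loop_empty hk hc ht htu, pow_two (D.onePoint u t)])
  simp only [mul_zero, add_zero, zero_mul, zero_add] at h4
  linear_combination h4

/-- The derivative of the loop equation with one point label with respect to that label. -/
theorem loop_point_deriv (hp : Adm true (ins p (ins q u))) (hpq : p ≠ q) (hqu : ∀ i, q ≠ u i) :
    (2 * D.onePoint u q + kerSeries u q) * D.lcorr u (fun t => {.point t}) q p
      + H ^ 2 * D.lcorr u (fun t => .point q ::ₘ {.point t}) q p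
      + H * C D.Q * (D.ldcorr u q p + C (2 / (q ^ 2 - 1)) * D.lcorr u (fun t => {.point t}) q p)
      + C (-(2 / (p ^ 2 - q ^ 2) ^ 3)) * D.onePoint u q =
    ∑ l, C (D.G q (u l)) * label l * D.lcorr u (fun t => {.point t}) (u l) p
      + (C (D.G2 q p) * D.onePoint u p + 2 * C (D.G1 q p) * D.onePoint1 u p
        + C (D.G q p) * D.onePoint2 u p) := by
  have hp0 : p ≠ 0 := hp.ne_zero none
  have hp1 : p ^ 2 - 1 ≠ 0 := hp.2 rfl none
  have hq1 : q ^ 2 - 1 ≠ 0 := hp.2 rfl (some none)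
  have hpq2 := sq_sub_ne hp hpq
  have hqp2 : q ^ 2 - p ^ 2 ≠ 0 := by rwa [← neg_sub, neg_ne_zero]
  have hpu : Adm true (ins p u) := hp.ins_tail
  have hm : HasDerivAt (fun t : ℂ => 1 / (q ^ 2 - t ^ 2) ^ 2)
      (2 * p * -(2 / (p ^ 2 - q ^ 2) ^ 3)) p := by
    refine ((hasDerivAt_const p (1 : ℂ)).fun_div ((hasDerivAt_sub_sq p (q ^ 2)).fun_pow 2)
      (pow_ne_zero 2 hqp2)).congr_deriv ?_
    rw [← neg_sub (p ^ 2)]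
    field_simp
    ring
  have hS := hasDeriv_corr hk hc hp none
  have h1 := ((((HasDeriv.const (2 * D.onePoint u q + kerSeries u q) p).mul hS).add
    ((HasDeriv.const (H ^ 2) p).mul (hasDeriv_corr_point hk hc hp))).add
    ((HasDeriv.const (H * C D.Q) p).mul ((hasDeriv_dcorr hk hc hp).add
      ((HasDeriv.const (C (2 / (q ^ 2 - 1))) p).mul hS)))).add
    ((HasDeriv.C (ι := ι) hm).mul (HasDeriv.const (D.onePoint u q) p))
  have h2 := (HasDeriv.sum Finset.univ fun l : ι =>
    (HasDeriv.const (C (D.G q (u l)) * label l) p).mul (hasDeriv_corr hk hc hp (some l))).add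
    (((HasDeriv.C (ι := ι) (hasDerivAt_G1_right (D := D) hq1 hp1 hqp2)).mul
      (hasDeriv_onePoint hk hc hpu)).add
    ((HasDeriv.C (ι := ι) (hasDerivAt_G_right (D := D) hq1 hp1 hqp2)).mul
      (hasDeriv_onePoint1 hk hc hpu)))
  have h4 := h1.unique hp0 h2 (by
    filter_upwards [hp.eventually_ins, continuousAt_id.eventually_ne hpq] with t ht htq
    exact loop_point hk hc ht.ins_swap (Ne.symm htq) hqu)
  simp only [mul_zero, add_zero, zero_mul, zero_add] at h4
  simp only [ins, Option.elim_none, Option.elim_some] at h4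
  linear_combination h4

end HasDeriv

end LoopData

/-! ### Congruences modulo the symmetry of lower order -/

theorem LabelSeries.sub_mem_weightIdeal {ι : Type} {d : ℕ} {f g : LabelSeries ι}
    (h : ∀ n J, n + Multiset.card J < d → LabelSeries.cf n J f = LabelSeries.cf n J g) :
    f - g ∈ LabelSeries.weightIdeal ι d := fun n J hd => by
  rw [LabelSeries.cf_sub, h n J hd, sub_self]

theorem LabelSeries.mk_mul_eq {ι : Type} {c d e : ℕ} {x f g : LabelSeries ι}
    (hx : x ∈ LabelSeries.weightIdeal ι c) (h : f - g ∈ LabelSeries.weightIdeal ι d)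
    (hcd : e ≤ c + d) : Ideal.Quotient.mk (LabelSeries.weightIdeal ι e) x *
      Ideal.Quotient.mk (LabelSeries.weightIdeal ι e) f =
    Ideal.Quotient.mk (LabelSeries.weightIdeal ι e) x *
      Ideal.Quotient.mk (LabelSeries.weightIdeal ι e) g := by
  rw [← map_mul, ← map_mul, Ideal.Quotient.eq, ← mul_sub]
  exact LabelSeries.weightIdeal_anti hcd (LabelSeries.mul_mem_weightIdeal hx h)

namespace LoopData
open LabelSeries

variable {D : LoopData} {ι : Type}

variable (D) in
/-- Symmetry of the correlators of weight less than `d`. -/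
def SymmBelow (d : ℕ) : Prop :=
  ∀ (κ : Type) [Fintype κ] (h : ℕ) (L : Multiset (Slot κ)), h + L.card < d →
    ∀ (p q : ℂ) (v : κ → ℂ), Adm true (ins p (ins q v)) →
      D.W h p (.point q ::ₘ L.map (Slot.map v)) = D.W h q (.point p ::ₘ L.map (Slot.map v))

section Swap

variable [Fintype ι] {d : ℕ} (sym : D.SymmBelow d) {p q : ℂ} {u : ι → ℂ}
  (hp : Adm true (ins p (ins q u)))

include sym hp

theorem SymmBelow.two (h : ℕ) (J : Multiset ι) (hd : h + J.card < d) :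
    D.W h p (.point q ::ₘ divisors u J) = D.W h q (.point p ::ₘ divisors u J) := by
  have := sym ι h (J.map Slot.divisor) (by simpa using hd) p q u hp
  rwa [← divisors_eq] at this

theorem SymmBelow.three (h : ℕ) (J : Multiset ι) (hd : h + J.card + 1 < d) :
    D.W h p (.point p ::ₘ .point q ::ₘ divisors u J) =
      D.W h q (.point p ::ₘ .point p ::ₘ divisors u J) := by
  have := sym (Option ι) h (.point none ::ₘ (J.map Slot.divisor).map (Slot.map some))
    (by simpa [add_assoc] using hd) p q (ins p u) hp.ins_dup₂
  rw [Multiset.map_cons, map_map_ins, ← divisors_eq, Multiset.cons_swap] at this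
  exact this

theorem SymmBelow.four (h : ℕ) (J : Multiset ι) (hd : h + J.card + 2 < d) :
    D.W h q (.point q ::ₘ .point p ::ₘ .point p ::ₘ divisors u J) =
      D.W h p (.point p ::ₘ .point q ::ₘ .point q ::ₘ divisors u J) := by
  have := sym (Option (Option ι)) h
    (.point none ::ₘ .point (some none) ::ₘ
      ((J.map Slot.divisor).map (Slot.map some)).map (Slot.map some))
    (by simpa [add_assoc] using hd) q p (ins q (ins p u)) (by
      convert hp.comp (fun o : Option (Option (Option (Option ι))) => match o with
        | none => some none
        | some none => none
        | some (some none) => some none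
        | some (some (some none)) => none
        | some (some (some (some i))) => some (some i)) using 1
      funext o
      rcases o with _ | _ | _ | _ | i <;> rfl)
  rw [Multiset.map_cons, Multiset.map_cons, map_map_ins, map_map_ins, ← divisors_eq] at this
  simp only [Slot.map_point, ins, Option.elim_none, Option.elim_some] at this
  rw [Multiset.cons_swap (Slot.point q) (Slot.point p), this,
    Multiset.cons_swap (Slot.point q) (Slot.point p),
    Multiset.cons_swap (Slot.point q) (Slot.point p)]

theorem SymmBelow.corr_mem : D.corr u {.point q} p - D.corr u {.point p} q ∈ weightIdeal ι d :=
  sub_mem_weightIdeal fun h J hd => by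
    simpa only [corr, cf_gen, Multiset.singleton_add] using sym.two hp h J hd

theorem SymmBelow.corr_point_mem : D.corr u (.point p ::ₘ {.point q}) p
    - D.corr u (.point p ::ₘ {.point p}) q ∈ weightIdeal ι (d - 1) :=
  sub_mem_weightIdeal fun h J hd => by
    simpa only [corr, cf_gen, Multiset.cons_add, Multiset.singleton_add]
      using sym.three hp h J (by omega)

theorem SymmBelow.corr_point_point_mem : D.corr u (.point q ::ₘ .point p ::ₘ {.point p}) q
    - D.corr u (.point p ::ₘ .point q ::ₘ {.point q}) p ∈ weightIdeal ι (d - 2) :=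
  sub_mem_weightIdeal fun h J hd => by
    simpa only [corr, cf_gen, Multiset.cons_add, Multiset.singleton_add]
      using sym.four hp h J (by omega)

theorem SymmBelow.dcorr_mem :
    D.dcorr u {.point q} p - D.lcorr u (fun t => {.point t}) q p ∈ weightIdeal ι d :=
  sub_mem_weightIdeal fun h J hd => by
    simp only [dcorr, lcorr, cf_gen, Multiset.singleton_add]
    congr 1
    refine Filter.EventuallyEq.deriv_eq ?_
    filter_upwards [hp.eventually_ins] with t ht using sym.two ht h J hd

theorem SymmBelow.lcorr_point_mem : D.lcorr u (fun t => .point q ::ₘ {.point t}) q p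
    - D.dcorr u (.point q ::ₘ {.point q}) p ∈ weightIdeal ι (d - 1) :=
  sub_mem_weightIdeal fun h J hd => by
    simp only [dcorr, lcorr, cf_gen, Multiset.cons_add, Multiset.singleton_add]
    congr 1
    refine Filter.EventuallyEq.deriv_eq ?_
    filter_upwards [hp.eventually_ins] with t ht using
      sym.three ht.ins_swap h J (by omega)

variable (hk : 2 ≤ D.k) (hc : D.c ≠ 0)

include hk hc

theorem SymmBelow.ldcorr_mem : D.ldcorr u q p - D.ldcorr u p q ∈ weightIdeal ι d :=
  sub_mem_weightIdeal fun h J hd => by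
    simp only [ldcorr, cf_gen, Multiset.singleton_add]
    have hr := reg2_W_true hk hc h (J.map Slot.divisor) (.point ())
    have hD : ∀ s t, Adm true (ins s (ins t u)) → DifferentiableAt ℂ
        (fun t => D.W h s (.point t ::ₘ divisors u J)) t := fun s t hst => by
      obtain ⟨G, -, hG⟩ := hr.exists_hasDerivAt_snd
      have := (hG s t u hst).differentiableAt
      simp only [← divisors_eq] at this
      exact this
    have h1 := hr.hasDerivAt_deriv hp.ins_swap
      (G := fun s => deriv (fun t => D.W h s (.point t ::ₘ divisors u J)) p) (by
        filter_upwards [hp.ins_swap.eventually_ins] with s hs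
        simp only [← divisors_eq]
        exact (hD s p hs).hasDerivAt)
    simp only [← divisors_eq] at h1
    have h2 : deriv (fun t => deriv (fun s => D.W h s (.point t ::ₘ divisors u J)) q) p =
        deriv (fun s => deriv (fun t => D.W h t (.point s ::ₘ divisors u J)) p) q := by
      refine h1.deriv.trans (Filter.EventuallyEq.deriv_eq ?_)
      filter_upwards [hp.ins_swap.eventually_ins] with s hs
      refine Filter.EventuallyEq.deriv_eq ?_
      filter_upwards [hs.ins_swap.eventually_ins] with t ht using
        (sym.two ht h J hd).symm
    have e1 : deriv (fun t => deriv (fun s => D.W h s (.point t ::ₘ divisors u J)) q / (2 * q)) p =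
        deriv (fun t => deriv (fun s => D.W h s (.point t ::ₘ divisors u J)) q) p / (2 * q) :=
      deriv_div_const _
    have e2 : deriv (fun s => deriv (fun t => D.W h t (.point s ::ₘ divisors u J)) p / (2 * p)) q =
        deriv (fun s => deriv (fun t => D.W h t (.point s ::ₘ divisors u J)) p) q / (2 * p) :=
      deriv_div_const _
    rw [e1, e2, h2, div_right_comm]

end Swap

open Classical in
theorem deriv_diag [Fintype ι] {e : Bool} {F : ℂ → ℂ → (ι → ℂ) → ℂ} (h : Reg2 e F) {p : ℂ}
    {u : ι → ℂ} (hp : Adm e (ins p (ins p u))) :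
    deriv (fun t => F t t u) p = deriv (fun t => F t p u) p + deriv (fun t => F p t u) p := by
  have hF := (Reg.differentiableAt h hp).hasFDerivAt
  have i1 := hasDerivAt_ins p (ins p u)
  have i2 := hasDerivAt_ins_ins p p u
  have h1 := hF.comp_hasDerivAt p i1
  have h2 := hF.comp_hasDerivAt p i2
  have i3 : HasDerivAt (fun t : ℂ => ins t (ins t u))
      (Pi.single none 1 + Pi.single (some none) 1) p := by
    refine hasDerivAt_pi.2 fun o => ?_
    rcases o with _ | _ | i
    · simpa [ins] using hasDerivAt_id' p
    · simpa [ins] using hasDerivAt_id' p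
    · simpa [ins] using hasDerivAt_const p _
  have h3 := hF.comp_hasDerivAt p i3
  rw [map_add] at h3
  exact (h3.deriv).trans (congrArg₂ _ h1.deriv.symm h2.deriv.symm)

theorem SymmBelow.tcorr_mem [Fintype ι] {d : ℕ} (sym : D.SymmBelow d) {p : ℂ} {u : ι → ℂ}
    (hk : 2 ≤ D.k) (hc : D.c ≠ 0) (hp : Adm true (ins p u)) :
    C 2 * D.dcorr u {.point p} p - D.tcorr u p ∈ weightIdeal ι d :=
  sub_mem_weightIdeal fun h J hd => by
    simp only [dcorr, tcorr, cf_gen, Multiset.singleton_add, cf_C_mul]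
    have hr := reg2_W_true hk hc h (J.map Slot.divisor) (.point ())
    have h1 := deriv_diag hr hp.ins_dup
    simp only [← divisors_eq] at h1
    have h2 : deriv (fun t => D.W h p (.point t ::ₘ divisors u J)) p =
        deriv (fun t => D.W h t (.point p ::ₘ divisors u J)) p := by
      refine Filter.EventuallyEq.deriv_eq ?_
      filter_upwards [hp.ins_dup.eventually_ins] with t ht using (sym.two ht h J hd).symm
    have h3 : deriv (fun t => D.W h t (.point t ::ₘ divisors u J)) p =
      deriv (fun t => D.W h t (.point p ::ₘ divisors u J)) p +
        deriv (fun t => D.W h p (.point t ::ₘ divisors u J)) p := h1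
    rw [h3, h2]
    ring

end LoopData

/-! ### Covariance of the loop equation -/

namespace LoopData
open LabelSeries

variable {D : LoopData} {ι : Type} [Fintype ι]

section Step

variable {d : ℕ} (sym : D.SymmBelow d) (hk : D.k = 2 ∨ D.k = 3) (hc : D.c ≠ 0) {p q : ℂ}
  {u : ι → ℂ} (hp : Adm true (ins p (ins q u))) (hpq : p ≠ q) (hpu : ∀ i, p ≠ u i)
  (hqu : ∀ i, q ≠ u i)

include hk hc hp hpq hqu in
/-- The loop equation with first argument `q` and one label `p`, differentiated covariantly with
respect to `p`. -/
theorem loop_point_covariant :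
    (2 * D.onePoint u q + kerSeries u q) * (D.lcorr u (fun t => {.point t}) q p
        + C (2 / (p ^ 2 - 1)) * D.corr u {.point p} q)
      + H ^ 2 * (D.lcorr u (fun t => .point q ::ₘ {.point t}) q p
        + C (2 / (p ^ 2 - 1)) * D.corr u (.point q ::ₘ {.point p}) q)
      + H * C D.Q * ((D.ldcorr u q p + C (2 / (q ^ 2 - 1)) * D.lcorr u (fun t => {.point t}) q p)
        + C (2 / (p ^ 2 - 1)) * (D.dcorr u {.point p} q
          + C (2 / (q ^ 2 - 1)) * D.corr u {.point p} q))
      + D.onePoint u q * C (-(2 / (p ^ 2 - q ^ 2) ^ 3)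
        + 2 / (p ^ 2 - 1) * (1 / (p ^ 2 - q ^ 2) ^ 2)) =
    ∑ l, C (D.G q (u l)) * label l * (D.lcorr u (fun t => {.point t}) (u l) p
        + C (2 / (p ^ 2 - 1)) * D.corr u {.point p} (u l))
      + (C (D.G2 q p) * D.onePoint u p + 2 * C (D.G1 q p) * D.onePoint1 u p
        + C (D.G q p) * D.onePoint2 u p + C (2 / (p ^ 2 - 1)) *
          (C (D.G1 q p) * D.onePoint u p + C (D.G q p) * D.onePoint1 u p)) := by
  have hk' : 2 ≤ D.k := by omega
  have h1 := loop_point_deriv hk' hc hp hpq hqu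
  have h2 := loop_point hk' hc hp.ins_swap (Ne.symm hpq) hqu
  rw [show (q ^ 2 - p ^ 2) ^ 2 = (p ^ 2 - q ^ 2) ^ 2 by ring] at h2
  simp only [mul_add, Finset.sum_add_distrib]
  have h3 : ∑ l, C (D.G q (u l)) * label l * (C (2 / (p ^ 2 - 1)) * D.corr u {.point p} (u l)) =
      C (2 / (p ^ 2 - 1)) * ∑ l, C (D.G q (u l)) * label l * D.corr u {.point p} (u l) := by
    rw [Finset.mul_sum]
    exact Finset.sum_congr rfl fun l _ => by ring
  rw [h3, map_add (C (ι := ι)), map_mul (C (ι := ι)) (2 / (p ^ 2 - 1))]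
  linear_combination h1 + C (2 / (p ^ 2 - 1)) * h2

include sym hk hc hp hpq hpu hqu in
set_option maxHeartbeats 4000000 in
/-- The exchange relation for the correlators, in a ring in which the series that agree by the
symmetry of lower order are identified. -/
theorem exchange_points {R : Type} [CommRing R] (π : LabelSeries ι →+* R)
    (sw : ∀ {f g : LabelSeries ι}, f - g ∈ weightIdeal ι d → π H * π f = π H * π g)
    (swl : ∀ l {f g : LabelSeries ι}, f - g ∈ weightIdeal ι d →
      π (label l) * π f = π (label l) * π g)
    (sw2 : ∀ {f g : LabelSeries ι}, f - g ∈ weightIdeal ι (d - 1) → π H ^ 2 * π f = π H ^ 2 * π g)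
    (sw4 : ∀ {f g : LabelSeries ι}, f - g ∈ weightIdeal ι (d - 2) →
      π H ^ 4 * π f = π H ^ 4 * π g) :
    π (2 * D.onePoint u p + kerSeries u p) * π (2 * D.onePoint u q + kerSeries u q) *
      (π (D.corr u {.point q} p) - π (D.corr u {.point p} q)) = 0 := by
  have hk' : 2 ≤ D.k := by omega
  have hqp := Ne.symm hpq
  have hq := hp.ins_swap
  have hp1 : p ^ 2 - 1 ≠ 0 := hp.2 rfl none
  have hq1 : q ^ 2 - 1 ≠ 0 := hp.2 rfl (some none)
  have hu1 : ∀ l, u l ^ 2 - 1 ≠ 0 := fun l => hp.2 rfl (some (some l))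
  have hpu' : Adm true (ins p u) := hp.ins_tail
  have hqu' : Adm true (ins q u) := hq.ins_tail
  have hpq2 := sq_sub_ne hp hpq
  have hqp2 := sq_sub_ne hq hqp
  have hpl2 : ∀ l, p ^ 2 - u l ^ 2 ≠ 0 := fun l => hpu'.sq_sub_label_ne l (hpu l)
  have hql2 : ∀ l, q ^ 2 - u l ^ 2 ≠ 0 := fun l => hqu'.sq_sub_label_ne l (hqu l)
  have hpl : ∀ l, Adm true (ins p (ins (u l) u)) := fun l =>
    (hpu'.ins_of_mem (some l)).ins_swap
  have hql : ∀ l, Adm true (ins q (ins (u l) u)) := fun l =>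
    (hqu'.ins_of_mem (some l)).ins_swap
  have hll : ∀ l n, Adm true (ins (u l) (ins (u n) u)) := fun l n =>
    ((adm_ins.1 hpu').1.ins_of_mem n).ins_of_mem (some l)
  have es : (p ^ 2 - q ^ 2) ^ 2 = (q ^ 2 - p ^ 2) ^ 2 := by ring
  -- the loop equations
  have h1 := congrArg π (loop_point hk' hc hp hpq hpu)
  have h1' := congrArg π (loop_point hk' hc hq hqp hqu)
  have h1D := congrArg π (loop_point_covariant hk hc hp hpq hqu)
  have h1D' := congrArg π (loop_point_covariant hk hc hq hqp hpu)
  have hl := fun l => congrArg π (loop_point hk' hc (hql l) (hqu l) hqu)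
  have hl' := fun l => congrArg π (loop_point hk' hc (hpl l) (hpu l) hpu)
  have h2 := congrArg π (loop_point_point hk' hc hq hqp hqu)
  have h2' := congrArg π (loop_point_point hk' hc hp hpq hpu)
  have h0 := congrArg π (loop_empty hk' hc hpu' hpu)
  have h0' := congrArg π (loop_empty hk' hc hqu' hqu)
  have h0D := congrArg π (loop_empty_deriv hk' hc hpu' hpu)
  have h0D' := congrArg π (loop_empty_deriv hk' hc hqu' hqu)
  rw [← es] at h1' h1D' h2
  have s0 := sw (sym.corr_mem hp)
  have s1 := sw (sym.dcorr_mem hp)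
  have s1' := sw (sym.dcorr_mem hq)
  have s2 := fun l => swl l (sym.corr_mem (hql l).ins_swap)
  have s2' := fun l => swl l (sym.corr_mem (hpl l).ins_swap)
  have s3 := fun l => sw (sym.dcorr_mem (hql l))
  have s3' := fun l => sw (sym.dcorr_mem (hpl l))
  have s3c := fun l => sw (sym.corr_mem (hql l))
  have s3c' := fun l => sw (sym.corr_mem (hpl l))
  have s4 := sw2 (sym.corr_point_mem hp)
  have s4' := sw2 (sym.corr_point_mem hq)
  have s5 := fun l => sw2 (sym.corr_point_mem (hql l))
  have s5' := fun l => sw2 (sym.corr_point_mem (hpl l))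
  have s6 := sw (sym.ldcorr_mem hp hk' hc)
  have s7 := sw2 (sym.lcorr_point_mem hp)
  have s7' := sw2 (sym.lcorr_point_mem hq)
  have s8 := sw4 (sym.corr_point_point_mem hp)
  have s9 := fun l n => swl n (sym.corr_mem (hll n l))
  have st := sw (sym.tcorr_mem hk' hc hpu')
  have st' := sw (sym.tcorr_mem hk' hc hqu')
  -- the rational function identities
  have c1 := congrArg (fun s => π (C s)) (G_identity_Q hk hq1 hp1 hqp2)
  have c1' := congrArg (fun s => π (C s)) (G_identity_Q hk hp1 hq1 hpq2)
  have c2 := fun l => congrArg (fun s => π (C s)) (G_identity_ker hk hq1 hp1 hqp2 (hql2 l) (hpl2 l))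
  have c2' := fun l => congrArg (fun s => π (C s))
    (G_identity_ker hk hp1 hq1 hpq2 (hpl2 l) (hql2 l))
  have c3 := fun l => congrArg (fun s => π (C s))
    (G_identity_label hk hp1 hq1 (hu1 l) hpq2 (hpl2 l) (hql2 l))
  have c4 := congrArg π (source_symm (ι := ι) hk hp1 hq1 hpq2)
  rw [← es] at c2
  simp only [kerSeries, dkerSeries, map_add, map_sub, map_mul, map_pow, map_sum, map_ofNat,
    map_neg, map_zero] at h1 h1' h1D h1D' hl hl' h2 h2' h0 h0' h0D h0D' c1 c1' c2 c2' c3 c4 st st'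
  rw [← es] at c1
  refine Eq.trans ?_ (exchange h1 h1' h1D h1D' hl hl'
    (S3l_pp := fun l => π (D.corr u (.point p ::ₘ {.point p}) (u l)))
    (S3l_qq := fun l => π (D.corr u (.point q ::ₘ {.point q}) (u l)))
    (DS3p_qq := π (D.dcorr u (.point q ::ₘ {.point q}) p)
      + π (C (2 / (p ^ 2 - 1))) * π (D.corr u (.point q ::ₘ {.point q}) p))
    (DS3q_pp := π (D.dcorr u (.point p ::ₘ {.point p}) q)
      + π (C (2 / (q ^ 2 - 1))) * π (D.corr u (.point p ::ₘ {.point p}) q))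
    (Zp := π (C (D.G1 p q)) * π (D.corr u {.point q} q)
      + π (C (D.G p q)) * π (D.dcorr u {.point q} q))
    (Zq := π (C (D.G1 q p)) * π (D.corr u {.point p} p)
      + π (C (D.G q p)) * π (D.dcorr u {.point p} p))
    ?_ ?_ s0 ?_ ?_ s2 s2' ?_ ?_ s4 s4' ?_ ?_ ?_ ?_ ?_ s8 ?_ ?_)
  · simp only [kerSeries, map_add, map_mul, map_sum, map_ofNat]
  · linear_combination h2
  · linear_combination h2'
  · linear_combination s1 + π (C (2 / (p ^ 2 - 1))) * s0
  · linear_combination s1' - π (C (2 / (q ^ 2 - 1))) * s0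
  · intro l
    linear_combination π (label l) * s3 l + π (label l) * π (C (2 / (q ^ 2 - 1))) * s3c l
  · intro l
    linear_combination π (label l) * s3' l + π (label l) * π (C (2 / (p ^ 2 - 1))) * s3c' l
  · intro l
    linear_combination π (label l) * s5 l
  · intro l
    linear_combination π (label l) * s5' l
  · linear_combination s6 - π (C (2 / (q ^ 2 - 1))) * s1 + π (C (2 / (p ^ 2 - 1))) * s1'
      - π (C (2 / (p ^ 2 - 1))) * π (C (2 / (q ^ 2 - 1))) * s0
  · linear_combination s7 + π (C (2 / (p ^ 2 - 1))) * s4'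
  · linear_combination s7' + π (C (2 / (q ^ 2 - 1))) * s4
  · intro l n
    linear_combination π (label l) * s9 l n
  · refine loop_sources_symm h0 h0D h0' h0D' ?_ ?_ ?_ ?_ c2 c2' c3 c4
    · linear_combination π H * st
    · linear_combination π H * st'
    · linear_combination c1
    · linear_combination c1'

end Step

/-! ### Symmetry of the multidifferentials -/

theorem two_onePoint_sub_mem (u : ι → ℂ) (p : ℂ) :
    2 * D.onePoint u p + kerSeries u p - C (D.c * p / D.P p) ∈ weightIdeal ι 1 := by
  have h1 : D.corr u 0 p ∈ weightIdeal ι 1 := fun h J hd => by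
    obtain rfl : h = 0 := by omega
    obtain rfl : J = 0 := Multiset.card_eq_zero.1 (by omega)
    simp [corr]
  have h2 : kerSeries u p ∈ weightIdeal ι 1 :=
    Ideal.sum_mem _ fun l _ => Ideal.mul_mem_left _ _ (label_mem l)
  have h3 : (2 : LabelSeries ι) * C (D.c * p / (2 * D.P p)) = C (D.c * p / D.P p) := by
    rw [← map_ofNat (C (ι := ι)), ← map_mul]
    congr 1
    rw [mul_div_assoc', mul_div_mul_left _ _ two_ne_zero]
  have h4 : 2 * D.onePoint u p + kerSeries u p - C (D.c * p / D.P p) =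
      2 * D.corr u 0 p + kerSeries u p := by
    rw [onePoint, mul_add, h3]
    ring
  rw [h4]
  exact Ideal.add_mem _ (Ideal.mul_mem_left _ _ h1) h2

/-- The exchange relation raises the order of symmetry by one: the factors of the difference in
`exchange_points` have the constant terms `c p / P(p)` and `c q / P(q)`. -/
theorem SymmBelow.corr_mem_succ {d : ℕ} (sym : D.SymmBelow d) (hk : D.k = 2 ∨ D.k = 3)
    (hc : D.c ≠ 0) {p q : ℂ} {u : ι → ℂ} (hp : Adm true (ins p (ins q u))) (hpq : p ≠ q)
    (hpu : ∀ i, p ≠ u i) (hqu : ∀ i, q ≠ u i) :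
    D.corr u {.point q} p - D.corr u {.point p} q ∈ weightIdeal ι (d + 1) := by
  have hH2 : (H : LabelSeries ι) ^ 2 ∈ weightIdeal ι 2 := by
    rw [sq]; exact mul_mem_weightIdeal H_mem H_mem
  have hH4 : (H : LabelSeries ι) ^ 4 ∈ weightIdeal ι 4 := by
    rw [show (H : LabelSeries ι) ^ 4 = H ^ 2 * H ^ 2 by ring]
    exact mul_mem_weightIdeal hH2 hH2
  have key := exchange_points sym hk hc hp hpq hpu hqu
    (Ideal.Quotient.mk (weightIdeal ι (d + 1)))
    (fun h => mk_mul_eq H_mem h (by omega)) (fun l _ _ h => mk_mul_eq (label_mem l) h (by omega))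
    (fun h => by rw [← map_pow]; exact mk_mul_eq hH2 h (by omega))
    (fun h => by rw [← map_pow]; exact mk_mul_eq hH4 h (by omega))
  rw [← map_sub, ← map_mul, ← map_mul, Ideal.Quotient.eq_zero_iff_mem, mul_assoc] at key
  have hs : ∀ t, t ≠ 0 → t ^ 2 - 1 ≠ 0 → D.c * t / D.P t ≠ 0 := fun t h0 h1 =>
    div_ne_zero (mul_ne_zero hc h0) (D.P_ne_zero h1)
  have hm := sym.corr_mem hp
  refine mem_weightIdeal_succ_of_mul (hs q (hp.ne_zero (some none)) (hp.2 rfl (some none)))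
    (two_onePoint_sub_mem u q) hm ?_
  exact mem_weightIdeal_succ_of_mul (hs p (hp.ne_zero none) (hp.2 rfl none))
    (two_onePoint_sub_mem u p) (Ideal.mul_mem_left _ _ hm) key

theorem exists_eq_divisors_add_points {κ : Type} (L : Multiset (Slot κ)) :
    ∃ J K : Multiset κ, L = J.map Slot.divisor + K.map Slot.point := by
  induction L using Multiset.induction with
  | empty => exact ⟨0, 0, rfl⟩
  | cons l L ih =>
    obtain ⟨J, K, rfl⟩ := ih
    rcases l with a | a
    · exact ⟨J, a ::ₘ K, by simp⟩
    · exact ⟨a ::ₘ J, K, by simp⟩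

theorem SymmBelow.divisors {d : ℕ} (sym : D.SymmBelow d) (hk : D.k = 2 ∨ D.k = 3)
    (hc : D.c ≠ 0) (h : ℕ) (J : Multiset ι) (hd : h + J.card = d) {p q : ℂ} {u : ι → ℂ}
    (hp : Adm true (ins p (ins q u))) :
    D.W h p (.point q ::ₘ (J.map Slot.divisor).map (Slot.map u)) =
      D.W h q (.point p ::ₘ (J.map Slot.divisor).map (Slot.map u)) := by
  have hk' : 2 ≤ D.k := by omega
  have hR := reg2_W_true hk' hc h (J.map Slot.divisor) (.point ())
  have hR' : Reg2 true fun p a (u : ι → ℂ) =>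
      D.W h a (.point p ::ₘ (J.map Slot.divisor).map (Slot.map u)) := by
    have h1 := Reg.rename hR (fun o : Option (Option ι) => match o with
      | none => some none
      | some none => none
      | some (some i) => some (some i))
    exact h1
  have hF : Reg2 true fun p a (u : ι → ℂ) =>
      D.W h p (.point a ::ₘ (J.map Slot.divisor).map (Slot.map u)) -
      D.W h a (.point p ::ₘ (J.map Slot.divisor).map (Slot.map u)) := Reg.sub hR hR'
  have gen1 : ∀ p q, Adm true (ins p (ins q u)) → (∀ i, q ≠ u i) →
      D.W h p (.point q ::ₘ (J.map Slot.divisor).map (Slot.map u)) -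
      D.W h q (.point p ::ₘ (J.map Slot.divisor).map (Slot.map u)) = 0 := by
    intro p q hp hqu
    refine hF.eq_zero_of_generic (fun p hp hpq hpu => ?_) hp
    have := mem_weightIdeal.1 (sym.corr_mem_succ hk hc hp hpq hpu hqu) h J (by omega)
    simpa only [cf_sub, corr, cf_gen, Multiset.singleton_add, divisors_eq] using this
  rw [← sub_eq_zero]
  refine hF.eq_zero_of_generic (fun p hp _ hpu => ?_) hp
  rw [← neg_sub, gen1 q p hp.ins_swap hpu, neg_zero]

/-- Symmetry in the presence of point labels follows by differentiating divisor labels. -/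
theorem SymmBelow.succ {d : ℕ} (sym : D.SymmBelow d) (hk : D.k = 2 ∨ D.k = 3)
    (hc : D.c ≠ 0) : D.SymmBelow (d + 1) := by
  have hk' : 2 ≤ D.k := by omega
  -- point labels are derivatives of divisor labels: induction on their number
  have key : ∀ (n : ℕ) (κ : Type) [Fintype κ] (h : ℕ) (J K : Multiset κ), K.card = n →
      h + (J.card + K.card) = d → ∀ (p q : ℂ) (v : κ → ℂ), Adm true (ins p (ins q v)) →
      D.W h p (.point q ::ₘ (J.map Slot.divisor + K.map Slot.point).map (Slot.map v)) =
      D.W h q (.point p ::ₘ (J.map Slot.divisor + K.map Slot.point).map (Slot.map v)) := by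
    intro n
    induction n with
    | zero =>
      intro κ _ h J K hK hd p q v hp
      obtain rfl := Multiset.card_eq_zero.1 hK
      simpa using sym.divisors hk hc h J (by simpa using hd) hp
    | succ n ih =>
      intro κ _ h J K hK hd p q v hp
      obtain ⟨a, ha⟩ := Multiset.card_pos_iff_exists_mem.1 (show 0 < K.card by omega)
      obtain ⟨K, rfl⟩ := Multiset.exists_cons_of_mem ha
      rw [Multiset.card_cons, add_left_inj] at hK
      rw [Multiset.card_cons] at hd
      set L := J.map Slot.divisor + K.map Slot.point with hL
      have hpa : Adm true (ins (v a) (ins p (ins q v))) := hp.ins_of_mem (some (some a))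
      have hpa1 : Adm true (ins p (ins (v a) (ins q v))) := hpa.ins_swap
      have hqa : Adm true (ins (v a) (ins q (ins p v))) := hp.ins_swap.ins_of_mem (some (some a))
      have h1 := divDeriv hk' hc h (.point none ::ₘ L.map (Slot.map some)) p (v a) (ins q v)
        hpa.ins_swap
      have h2 := divDeriv hk' hc h (.point none ::ₘ L.map (Slot.map some)) q (v a) (ins p v)
        hqa.ins_swap
      simp only [Multiset.map_cons, map_map_ins, Slot.map_point, ins, Option.elim_none] at h1 h2
      have h3 : (fun t => D.W h p (.divisor t ::ₘ .point q ::ₘ L.map (Slot.map v))) =ᶠ[𝓝 (v a)]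
          fun t => D.W h q (.divisor t ::ₘ .point p ::ₘ L.map (Slot.map v)) := by
        filter_upwards [hpa.eventually_ins] with t ht
        have ht' : Adm true (ins p (ins q (ins t v))) := by
          convert ht.comp (fun o : Option (Option (Option κ)) => match o with
            | none => some none
            | some none => some (some none)
            | some (some none) => none
            | some (some (some i)) => some (some (some i))) using 1
          funext o
          rcases o with _ | _ | _ | i <;> rfl
        have e := ih (Option κ) h (none ::ₘ J.map some) (K.map some) (by simpa using hK)
          (by simp; omega) p q (ins t v) ht'
        have e2 : ((none ::ₘ J.map some).map Slot.divisor + (K.map some).map Slot.point) =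
            .divisor none ::ₘ L.map (Slot.map some) := by
          simp [hL, Multiset.map_map, Function.comp_def]
        rw [e2, Multiset.map_cons, map_map_ins] at e
        simp only [Slot.map_divisor, ins, Option.elim_none] at e
        rw [Multiset.cons_swap, e, Multiset.cons_swap]
      have h4 := h1.unique (h2.congr_of_eventuallyEq h3)
      have ha : (2 : ℂ) * v a ≠ 0 := mul_ne_zero two_ne_zero (hpa.ne_zero none)
      have h5 := mul_left_cancel₀ ha h4
      rw [Multiset.map_cons, Multiset.add_cons, Multiset.map_cons, Slot.map_point,
        Multiset.cons_swap, h5, Multiset.cons_swap]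
  intro κ _ h L hd p q v hp
  rcases Nat.lt_or_ge (h + L.card) d with h1 | h1
  · exact sym κ h L h1 p q v hp
  obtain ⟨J, K, rfl⟩ := exists_eq_divisors_add_points L
  exact key _ κ h J K rfl (by simpa using (by omega : h + (J.map Slot.divisor
    + K.map Slot.point).card = d)) p q v hp

/-- The correlators are symmetric in all their arguments. -/
theorem W_symm (hk : D.k = 2 ∨ D.k = 3) (hc : D.c ≠ 0) (h : ℕ) (L : Multiset (Slot ι)) {p q : ℂ}
    {u : ι → ℂ} (hp : Adm true (ins p (ins q u))) :
    D.W h p (.point q ::ₘ L.map (Slot.map u)) = D.W h q (.point p ::ₘ L.map (Slot.map u)) := by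
  have key : ∀ d, D.SymmBelow d := fun d => by
    induction d with
    | zero => intro κ _ h L hd; omega
    | succ d ih => exact ih.succ hk hc
  exact key _ ι h L (Nat.lt_succ_self _) p q u hp

end LoopData

/-! ### Diagonal derivatives -/

section Diagonal

variable {e : Bool} {ι : Type} [Fintype ι]

open Classical in
theorem Reg2.hasDerivAt_diag {F : ℂ → ℂ → (ι → ℂ) → ℂ} (h : Reg2 e F) {a A B : ℂ} {u : ι → ℂ}
    (ha : Adm e (ins a (ins a u))) (hA : HasDerivAt (fun t => F t a u) A a)
    (hB : HasDerivAt (fun t => F a t u) B a) : HasDerivAt (fun t => F t t u) (A + B) a := by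
  have h1 := hasDerivAt_ins a (ins a u)
  have h2 := hasDerivAt_ins_ins a a u
  have hF := (Reg.differentiableAt h ha).hasFDerivAt
  have h3 : HasDerivAt (fun t => ins t (ins t u)) (Pi.single none 1 + Pi.single (some none)
    1) a := by
    refine hasDerivAt_pi.2 fun o => ?_
    have e1 := hasDerivAt_pi.1 h1 o
    have e2 := hasDerivAt_pi.1 h2 o
    rcases o with _ | _ | i
    · simpa [ins] using hasDerivAt_id' a
    · simpa [ins] using hasDerivAt_id' a
    · simpa [ins] using hasDerivAt_const a (u i)
  have c1 := hF.comp_hasDerivAt a h1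
  have c2 := hF.comp_hasDerivAt a h2
  have c3 := hF.comp_hasDerivAt a h3
  rw [map_add] at c3
  have k1 := hA.unique c1
  have k2 := hB.unique c2
  rw [k1, k2]
  exact c3

end Diagonal

namespace LoopData
open LabelSeries

variable {D : LoopData} {ι : Type} [Fintype ι]

/-- Differentiation of a correlator with respect to the common position of `m` divisor labels. -/
theorem hasDerivAt_replicate_divisor (hk : 2 ≤ D.k) (hc : D.c ≠ 0) (h m : ℕ) {p a : ℂ} {u : ι → ℂ}
    (L : Multiset (Slot ι)) (hp : Adm true (ins p (ins a u))) :
    HasDerivAt (fun t => D.W h p (replicate m (.divisor t) + L.map (Slot.map u)))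
      (2 * a * (m * D.W h p (.point a ::ₘ replicate (m - 1) (.divisor a)
        + L.map (Slot.map u)))) a := by
  induction m generalizing ι with
  | zero => simpa using hasDerivAt_const a _
  | succ m ih =>
    have hpa : Adm true (ins p (ins a (ins a u))) := by
      convert hp.comp (fun o : Option (Option (Option ι)) => match o with
        | none => none
        | some none => some none
        | some (some none) => some none
        | some (some (some i)) => some (some i)) using 1
      funext o
      rcases o with _ | _ | _ | i <;> rfl
    have hR := reg_W_true hk hc h (ι := Option (Option ι))
      (.divisor none ::ₘ (replicate m (.divisor (some none))
        + L.map (Slot.map (fun i => some (some i)))))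
    have hR2 := Reg.rename hR (κ := Option (Option (Option ι))) (fun o => match o with
      | none => some (some none)
      | some none => none
      | some (some none) => some none
      | some (some (some i)) => some (some (some i)))
    have hF : Reg2 true fun x y (v : Option ι → ℂ) => D.W h (v none)
        (.divisor x ::ₘ (replicate m (.divisor y) + L.map (Slot.map fun i => v (some i)))) := by
      refine Reg.congr hR2 fun v _ => ?_
      beta_reduce
      simp only [Multiset.map_cons, Multiset.map_add, Multiset.map_replicate, Multiset.map_map,
        Slot.map_divisor]
      congr 4
      funext l
      cases l <;> rfl
    have h1 := divDeriv hk hc h (replicate m (.divisor none) + L.map (Slot.map some))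
      p a (ins a u) hpa
    have h2 := ih (.divisor none ::ₘ L.map (Slot.map some)) hpa
    simp only [Multiset.map_add, Multiset.map_replicate, Multiset.map_cons, map_map_ins,
      Slot.map_divisor, ins, Option.elim_none] at h1 h2
    have e1 : ∀ t, replicate m (Slot.divisor t) + .divisor a ::ₘ L.map (Slot.map u) =
        .divisor a ::ₘ (replicate m (Slot.divisor t) + L.map (Slot.map u)) := fun t => by
      rw [Multiset.add_cons]
    simp only [e1] at h2
    have hpa' : Adm true (ins a (ins a (ins p u))) := by
      convert hp.comp (fun o : Option (Option (Option ι)) => match o with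
        | none => some none
        | some none => some none
        | some (some none) => none
        | some (some (some i)) => some (some i)) using 1
      funext o
      rcases o with _ | _ | _ | i <;> rfl
    have h3 := hF.hasDerivAt_diag (u := ins p u) hpa' h1 h2
    simp only [ins, Option.elim_none, Option.elim_some] at h3
    refine (h3.congr_deriv ?_).congr_of_eventuallyEq (Eventually.of_forall fun t => ?_)
    · rw [Nat.add_sub_cancel]
      rcases m with _ | m
      · simp
      · rw [Nat.add_sub_cancel, Multiset.replicate_succ]
        simp only [Multiset.cons_add, Multiset.add_cons, Multiset.cons_swap (Slot.divisor a)]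
        push_cast
        ring
    · simp only [Multiset.replicate_succ, Multiset.cons_add]

/-- The derivative along the diagonal, where the argument is the end point of the divisor; the
second summand comes from the divisor labels. -/
theorem hasDeriv_onePoint_diag (hk : 2 ≤ D.k) (hc : D.c ≠ 0) {w : ℂ} (hw : w ≠ 0)
    (hw1 : w ^ 2 - 1 ≠ 0) :
    HasDeriv (fun t => D.onePoint (fun _ : Unit => t) t)
      (D.onePoint1 (fun _ => w) w + label () * D.corr (fun _ => w) {.point w} w) w := by
  have hp : Adm true (ins w (fun _ : Unit => w)) := by
    refine ⟨fun i j => ?_, fun _ i => ?_⟩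
    · rcases i with _ | i <;> rcases j with _ | j <;> simpa [ins, ← two_mul] using hw
    · rcases i with _ | i <;> simpa [ins] using hw1
  have hp2 : Adm true (ins w (ins w (Empty.elim : Empty → ℂ))) := by
    refine ⟨fun i j => ?_, fun _ i => ?_⟩
    · rcases i with _ | _ | ⟨⟨⟩⟩ <;> rcases j with _ | _ | ⟨⟨⟩⟩ <;>
        simpa [ins, ← two_mul] using hw
    · rcases i with _ | _ | ⟨⟨⟩⟩ <;> simpa [ins] using hw1
  have h0 := hasDeriv_onePoint hk hc hp
  intro h J
  have h1 := h0 h J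
  obtain ⟨n, rfl⟩ : ∃ n, J = replicate n () :=
    ⟨J.card, Multiset.eq_replicate.2 ⟨rfl, fun _ _ => rfl⟩⟩
  have hR := reg_W_true hk hc h (ι := Option Empty) (replicate n (.divisor none))
  have hF : Reg2 true fun x y (_ : Empty → ℂ) => D.W h x (replicate n (.divisor y)) := by
    refine Reg.congr hR fun v _ => ?_
    beta_reduce
    rw [Multiset.map_replicate]
    rfl
  have hA : HasDerivAt (fun t => D.W h t (replicate n (.divisor w)))
      (2 * w * cf h (replicate n ()) (D.dcorr (fun _ => w) 0 w)) w := by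
    have := differentiableAt_W hk hc h (replicate n (.divisor ())) hp
    simp only [Multiset.map_replicate, Slot.map_divisor] at this
    refine this.hasDerivAt.congr_deriv ?_
    simp only [dcorr, cf_gen, zero_add, divisors, Multiset.map_replicate]
    field_simp
  have hB := hasDerivAt_replicate_divisor hk hc h n 0 hp2
  simp only [Multiset.map_zero, add_zero] at hB
  have h2 := hF.hasDerivAt_diag hp2 hA hB
  have h3 : HasDeriv (ι := Unit) (fun t => C (D.c * t / (2 * D.P t)))
      (C (D.c / (2 * D.P w) * (1 / (2 * w) - D.k * w / (w ^ 2 - 1)))) w := by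
    have hP := D.P_ne_zero hw1
    refine HasDeriv.C (((hasDerivAt_id' w).const_mul D.c).fun_div
      ((hasDerivAt_P (D := D) w hw1).const_mul 2) (mul_ne_zero two_ne_zero hP) |>.congr_deriv ?_)
    generalize D.P w = Pp at *
    generalize (D.k : ℂ) = k at *
    field_simp
  have h4 := h2.fun_add (h3 h (replicate n ()))
  refine (h4.congr_deriv ?_).congr_of_eventuallyEq (Eventually.of_forall fun t => ?_)
  · have e1 : cf h (replicate n ()) (label () * D.corr (fun _ => w) {.point w} w) =
        n * D.W h w (.point w ::ₘ replicate (n - 1) (.divisor w)) := by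
      have := cf_sum_label_mul h (replicate n ()) (fun _ : Unit => (1 : ℂ))
        (fun _ => D.corr (fun _ => w) {.point w} w)
      simp only [Finset.univ_unique, Finset.sum_singleton, map_one, one_mul] at this
      refine this.trans ?_
      simp only [eraseSum, Multiset.map_replicate, corr, cf_gen, divisors,
        Multiset.singleton_add, Multiset.sum_replicate, nsmul_eq_mul]
      rcases n with _ | n
      · simp
      · simp [Multiset.replicate_succ]
    simp only [cf_add, onePoint1]
    rw [e1]
    ring
  · simp only [onePoint, cf_add, corr, cf_gen, zero_add, divisors, Multiset.map_replicate]

end LoopData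

/-! ### Exponential generating series -/

namespace LabelSeries

theorem cf_replicate_mul (h n : ℕ) (f g : LabelSeries Unit) :
    cf h (replicate n ()) (f * g) = ∑ m ∈ antidiagonal h,
      ∑ k ∈ antidiagonal n, (n.choose k.1 : ℂ) *
        (cf m.1 (replicate k.1 ()) f * cf m.2 (replicate k.2 ()) g) := by
  have key : ∀ (F G : Multiset Unit → ℂ), conv F G (replicate n ()) =
      ∑ k ∈ antidiagonal n, (n.choose k.1 : ℂ) *
        (F (replicate k.1 ()) * G (replicate k.2 ())) := by
    induction n with
    | zero => intro F G; simp
    | succ n ih =>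
      intro F G
      rw [Multiset.replicate_succ, conv_cons, ih, ih]
      have := Finset.sum_antidiagonal_choose_succ_mul
        (fun i j => F (replicate i ()) * G (replicate j ())) n
      rw [this]
      simp only [Multiset.replicate_succ]
      congr 1
      refine Finset.sum_congr rfl fun k hk => ?_
      rw [mem_antidiagonal] at hk
      rw [← hk, Nat.choose_symm_add]
  rw [cf_mul]
  exact Finset.sum_congr rfl fun m _ => key _ _

/-- The ring homomorphism that sends `H` to `ħ` and the only label to `ħ / b`. -/
def eval (b : ℂ) : LabelSeries Unit →+* PowerSeries ℂ where
  toFun f := PowerSeries.mk fun j => ∑ m ∈ antidiagonal j,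
    cf m.1 (replicate m.2 ()) f / (b ^ m.2 * (m.2.factorial : ℂ))
  map_zero' := by ext; simp
  map_add' f g := by
    ext j
    simp [add_div, Finset.sum_add_distrib]
  map_one' := by
    ext j
    rw [PowerSeries.coeff_mk, ← map_one C, PowerSeries.coeff_one]
    rcases Nat.eq_zero_or_pos j with rfl | hj
    · simp [cf_C_zero, -map_one]
    · rw [if_neg hj.ne']
      refine Finset.sum_eq_zero fun m hm => ?_
      rw [mem_antidiagonal] at hm
      rw [cf_C_pos _ (by simp; omega), zero_div]
  map_mul' f g := by
    ext j
    simp only [PowerSeries.coeff_mk, PowerSeries.coeff_mul, cf_replicate_mul, Finset.sum_div,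
      Finset.sum_mul_sum]
    rw [Finset.sum_sigma', Finset.sum_sigma', Finset.sum_sigma', Finset.sum_sigma']
    refine Finset.sum_bij' (fun x _ => ⟨⟨(x.1.2.1 + x.2.1, x.1.2.2 + x.2.2), (x.1.2.1, x.2.1)⟩,
      (x.1.2.2, x.2.2)⟩) (fun x _ => ⟨⟨(x.1.2.1 + x.2.1, x.1.2.2 + x.2.2), (x.1.2.1, x.2.1)⟩,
      (x.1.2.2, x.2.2)⟩) ?_ ?_ ?_ ?_ ?_
    · rintro ⟨⟨⟨a, b⟩, c, d⟩, e, f⟩ h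
      simp only [Finset.mem_sigma, mem_antidiagonal] at h ⊢
      refine ⟨⟨?_, ?_⟩, ?_⟩ <;> first | exact trivial | exact rfl | omega
    · rintro ⟨⟨⟨a, b⟩, c, d⟩, e, f⟩ h
      simp only [Finset.mem_sigma, mem_antidiagonal] at h ⊢
      refine ⟨⟨?_, ?_⟩, ?_⟩ <;> first | exact trivial | exact rfl | omega
    · rintro ⟨⟨⟨a, b⟩, c, d⟩, e, f⟩ h
      simp only [Finset.mem_sigma, mem_antidiagonal] at h
      obtain ⟨⟨h1, h2⟩, h3⟩ := h
      simp only [h2, h3]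
    · rintro ⟨⟨⟨a, b⟩, c, d⟩, e, f⟩ h
      simp only [Finset.mem_sigma, mem_antidiagonal] at h
      obtain ⟨⟨h1, h2⟩, h3⟩ := h
      simp only [h2, h3]
    · rintro ⟨⟨⟨i, n⟩, c, d⟩, r, s⟩ h
      simp only [Finset.mem_sigma, mem_antidiagonal] at h
      obtain ⟨⟨h1, h2⟩, rfl⟩ := h
      simp only
      have h4 : ((r + s).factorial : ℂ) = (r + s).choose r * (r.factorial * s.factorial) := by
        have := Nat.add_choose_mul_factorial_mul_factorial r s
        rw [← Nat.choose_symm_add] at this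
        rw [← this]
        push_cast
        ring
      have h5 : ((r + s).choose r : ℂ) ≠ 0 := by
        exact_mod_cast (Nat.choose_pos (Nat.le_add_right r s)).ne'
      rw [h4, div_mul_div_comm, pow_add,
        show b ^ r * b ^ s * ((r + s).choose r * (r.factorial * s.factorial : ℂ)) =
          (r + s).choose r * (b ^ r * r.factorial * (b ^ s * s.factorial)) by ring,
        mul_div_mul_left _ _ h5]

theorem coeff_eval (b : ℂ) (j : ℕ) (f : LabelSeries Unit) : PowerSeries.coeff j (eval b f) =
    ∑ m ∈ antidiagonal j,
      cf m.1 (replicate m.2 ()) f / (b ^ m.2 * (m.2.factorial : ℂ)) := by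
  exact PowerSeries.coeff_mk (R := ℂ) j fun j => ∑ m ∈ antidiagonal j,
    cf m.1 (replicate m.2 ()) f / (b ^ m.2 * (m.2.factorial : ℂ))

theorem eval_C (b s : ℂ) : eval b (C s) = PowerSeries.C s := by
  ext j
  rw [coeff_eval, PowerSeries.coeff_C]
  rcases Nat.eq_zero_or_pos j with rfl | hj
  · simp [cf_C_zero]
  · rw [if_neg hj.ne']
    refine Finset.sum_eq_zero fun m hm => ?_
    rw [mem_antidiagonal] at hm
    rw [cf_C_pos _ (by simp; omega), zero_div]

theorem eval_H (b : ℂ) : eval b H = PowerSeries.X := by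
  ext j
  have h1 : ∀ h (J : Multiset Unit), cf h J (H : LabelSeries Unit) =
      if 1 ≤ h then cf (h - 1) J (C 1) else 0 := fun h J => by
    rw [← cf_H_mul, map_one, mul_one]
  rw [coeff_eval, PowerSeries.coeff_X]
  simp only [h1]
  rcases j with _ | j
  · simp
  · rw [Finset.Nat.sum_antidiagonal_succ, ]
    have h2 := congrArg (PowerSeries.coeff j) (eval_C b 1)
    rw [coeff_eval, PowerSeries.coeff_C] at h2
    simp at h2 ⊢
    rw [h2]

theorem eval_label (b : ℂ) : eval b (label ()) = PowerSeries.C b⁻¹ * PowerSeries.X := by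
  ext j
  rw [coeff_eval, PowerSeries.coeff_C_mul, PowerSeries.coeff_X]
  have h1 : ∀ h n, cf h (replicate n ()) (label () : LabelSeries Unit) =
      n * cf h (replicate (n - 1) ()) (C 1) := fun h n => by
    have := cf_label_mul h (replicate n ()) () (C 1)
    rw [map_one, mul_one] at this
    rw [this]
    simp only [eraseSum, Multiset.map_replicate, Multiset.sum_replicate, nsmul_eq_mul, if_true,
      map_one]
    rcases n with _ | n
    · simp
    · simp [Multiset.replicate_succ]
  simp only [h1]
  have h3 : ∀ h n, cf h (replicate n ()) (C 1) = if h = 0 ∧ n = 0 then 1 else 0 := by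
    intro h n
    split_ifs with h0
    · rw [h0.1, h0.2]; exact cf_C_zero 1
    · exact cf_C_pos _ (by simp; omega)
  simp only [h3]
  rcases j with _ | j
  · simp
  rw [Finset.sum_eq_single (0, j + 1)]
  · rcases j with _ | j <;> simp
  · rintro ⟨a, c⟩ hm hne
    simp only [mem_antidiagonal] at hm
    have : a ≠ 0 := by rintro rfl; simp_all
    simp [this]
  · simp

end LabelSeries

/-! ### The Riccati equation -/

namespace LabelSeries

theorem HasDeriv.C_of_differentiableAt {ι : Type} {s : ℂ → ℂ} {x : ℂ} (hx : x ≠ 0)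
    (hs : DifferentiableAt ℂ s x) :
    HasDeriv (fun t => (LabelSeries.C (s t) : LabelSeries ι)) (LabelSeries.C (deriv s x / (2 * x)))
      x := by
  refine HasDeriv.C (hs.hasDerivAt.congr_deriv ?_)
  field_simp

end LabelSeries

namespace LoopData
open LabelSeries

variable {D : LoopData}

/-- The one-point loop equation in which the divisor labels sit at the argument. -/
theorem loop_diag (hk : 2 ≤ D.k) (hc : D.c ≠ 0) {w : ℂ} (hw : w ≠ 0) (hw1 : w ^ 2 - 1 ≠ 0) :
    D.onePoint (fun _ : Unit => w) w ^ 2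
      + label () * (D.onePoint1 (fun _ => w) w
        + C ((D.k - 1) / (w ^ 2 - 1)) * D.onePoint (fun _ => w) w)
      + H ^ 2 * D.corr (fun _ => w) {.point w} w
      + H * C D.Q * (D.onePoint1 (fun _ => w) w + C (2 / (w ^ 2 - 1)) * D.onePoint (fun _ => w) w) =
    D.source w := by
  set u : Unit → ℂ := fun _ => w with hu
  have hp : Adm true (ins w u) := by
    refine ⟨fun i j => ?_, fun _ i => ?_⟩
    · rcases i with _ | i <;> rcases j with _ | j <;> simpa [ins, hu, ← two_mul] using hw
    · rcases i with _ | i <;> simpa [ins, hu] using hw1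
  have hP := D.P_ne_zero hw1
  have hdP := (hasDerivAt_P (D := D) w hw1)
  have a1 := hasDeriv_onePoint hk hc hp
  have a2 := hasDeriv_onePoint1 hk hc hp
  have a3 := hasDeriv_tcorr hk hc hp
  have a4 : HasDeriv (fun t => (D.source t : LabelSeries Unit)) (D.source1
    w) w := hasDeriv_source hw1
  have b1 := HasDeriv.C_of_differentiableAt (ι := Unit) hw hdP.differentiableAt
  have b2 := HasDeriv.C_of_differentiableAt (ι := Unit) (s := fun t => 2 / (t ^ 2 - 1)) hw
    (by fun_prop (disch := simpa using ‹_›))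
  have b3 := HasDeriv.C_of_differentiableAt (ι := Unit) (s := fun t => 1 / (t ^ 2 - 1)) hw
    (by fun_prop (disch := simpa using ‹_›))
  have b4 : HasDeriv (fun t => (C (t ^ 2 - w ^ 2) : LabelSeries Unit)) (C 1) w :=
    HasDeriv.C (((hasDerivAt_pow 2 w).sub_const _).congr_deriv (by simp))
  have b5 : HasDeriv (fun t => (C (D.P t) : LabelSeries Unit)) (C (D.k / (w ^ 2 - 1) * D.P w)) w :=
    HasDeriv.C (hdP.congr_deriv (by field_simp))
  have cc := fun f : LabelSeries Unit => HasDeriv.const f w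
  -- differentiate the loop equation, multiplied by `P(t) (t² - w²)`, at `t = w`
  have d1 := b4.mul (b5.mul (((((a1.mul a1).add ((cc (label ())).mul ((cc (-1)).mul
    (b3.mul a1)))).add
    ((cc (H ^ 2)).mul a3)).add ((cc (H * C D.Q)).mul (a2.add (b2.mul a1)))).add
      ((cc (-1)).mul a4)))
  have d2 := (cc (label ())).mul ((cc (C (D.P w) * D.onePoint u w)).add
    ((cc (-1)).mul (b5.mul a1)))
  have key := d1.unique hw d2 (by
    filter_upwards [hp.eventually_ins] with t ht
    by_cases htw : t = w
    · subst htw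
      simp only [sub_self, map_zero]
      ring
    have ht1 : t ^ 2 - 1 ≠ 0 := ht.2 rfl none
    have hPt := D.P_ne_zero ht1
    have hs : t ^ 2 - w ^ 2 ≠ 0 := ht.sq_sub_label_ne () htw
    have h1 := loop_empty hk hc ht (fun _ => htw)
    simp only [kerSeries, Finset.univ_unique, Finset.sum_singleton, ker] at h1
    change D.onePoint u t ^ 2 + C (1 / (t ^ 2 - w ^ 2) - 1 /
      (t ^ 2 - 1)) * label () * D.onePoint u t
      + H ^ 2 * D.corr u {.point t} t
      + H * C D.Q * (D.onePoint1 u t + C (2 / (t ^ 2 - 1)) * D.onePoint u t) =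
      D.source t + C (D.G t w) * label () * D.onePoint u w at h1
    have e1 : (C (t ^ 2 - w ^ 2) : LabelSeries Unit) * C (1 / (t ^ 2 - w ^ 2)) = 1 := by
      rw [← map_mul, mul_one_div_cancel hs, map_one]
    have e2 : (C (t ^ 2 - w ^ 2) : LabelSeries Unit) * (C (D.P t) * C (D.G t w)) = C (D.P w) := by
      rw [← map_mul, ← map_mul, G]
      congr 1
      field_simp
    rw [map_sub C (1 / (t ^ 2 - w ^ 2))] at h1
    linear_combination C (t ^ 2 - w ^ 2) * C (D.P t) * h1
      - C (D.P t) * label () * D.onePoint u t * e1 + label () * D.onePoint u w * e2)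
  simp only [sub_self, map_zero, map_one, zero_mul, zero_add, one_mul, add_zero] at key
  have e3 : (C (1 / D.P w) : LabelSeries Unit) * C (D.P w) = 1 := by
    rw [← map_mul, one_div_mul_cancel hP, map_one]
  have e4 : (C ((D.k - 1) / (w ^ 2 - 1)) : LabelSeries Unit) =
      C (D.k / (w ^ 2 - 1)) - C (1 / (w ^ 2 - 1)) := by
    rw [← map_sub]
    congr 1
    ring
  rw [map_mul] at key
  rw [e4]
  linear_combination C (1 / D.P w) * key - (D.onePoint u w ^ 2 + label () * (D.onePoint1 u w +
    (C (D.k / (w ^ 2 - 1)) - C (1 / (w ^ 2 - 1))) * D.onePoint u w)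
      + H ^ 2 * D.corr u {.point w} w
      + H * C D.Q * (D.onePoint1 u w + C (2 / (w ^ 2 - 1)) * D.onePoint u w) - D.source w) * e3

variable (D) in
/-- `b ħ` times the derivative of `log ψ` with respect to `w ^ 2`: the one-point series whose
divisor labels all end at the argument. -/
def U (b w : ℂ) : PowerSeries ℂ := eval b (D.onePoint (fun _ => w) w)

variable (D) in
/-- The derivative of `U` with respect to `w ^ 2`. -/
def U1 (b w : ℂ) : PowerSeries ℂ :=
  eval b (D.onePoint1 (fun _ => w) w + label () * D.corr (fun _ => w) {.point w} w)

theorem hasDerivAt_coeff_U (hk : 2 ≤ D.k) (hc : D.c ≠ 0) (b : ℂ) (j : ℕ) {w : ℂ} (hw : w ≠ 0)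
    (hw1 : w ^ 2 - 1 ≠ 0) :
    HasDerivAt (fun t => PowerSeries.coeff j (D.U b t)) (2 * w * PowerSeries.coeff j (D.U1 b w))
      w := by
  have h1 := hasDeriv_onePoint_diag hk hc hw hw1
  simp only [U, U1, coeff_eval, Finset.mul_sum]
  refine HasDerivAt.fun_sum fun m _ => ?_
  exact ((h1 m.1 (replicate m.2 ())).div_const _).congr_deriv (by ring)

/-- The Riccati equation, which is the quantum curve for the logarithmic derivative of the wave
function. The relation `Q = b - b⁻¹` turns `label ∂` and `Q ħ ∂` into `b ħ ∂`. -/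
theorem riccati (hk : 2 ≤ D.k) (hc : D.c ≠ 0) {b : ℂ} (hb : b ≠ 0) (hQ : D.Q = b - b⁻¹) {w : ℂ}
    (hw : w ≠ 0) (hw1 : w ^ 2 - 1 ≠ 0) :
    D.U b w ^ 2 + PowerSeries.X * (PowerSeries.C b * D.U1 b w
      + PowerSeries.C ((2 * b ^ 2 + D.k - 3) / b / (w ^ 2 - 1)) * D.U b w) =
    PowerSeries.C (D.c ^ 2 * w ^ 2 / (4 * D.P w ^ 2))
      + PowerSeries.X * PowerSeries.C (D.c * ((D.Q * D.μ - D.ν / b) / 2) / (D.P w *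
    (w ^ 2 - 1))) := by
  have hP := D.P_ne_zero hw1
  have h1 := congrArg (eval b) (loop_diag hk hc hw hw1)
  simp only [source, map_add, map_sub, map_mul, map_pow, eval_H, eval_C, eval_label,
    Finset.univ_unique, Finset.sum_singleton] at h1
  have h2 : (eval b) (label default) = PowerSeries.C b⁻¹ * PowerSeries.X := eval_label b
  rw [h2] at h1
  simp only [U, U1, map_add, map_mul, eval_label]
  have hbC : (PowerSeries.C b : PowerSeries ℂ) * PowerSeries.C b⁻¹ = 1 := by
    rw [← map_mul, mul_inv_cancel₀ hb, map_one]
  have hQC : (PowerSeries.C D.Q : PowerSeries ℂ) = PowerSeries.C b - PowerSeries.C b⁻¹ := by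
    rw [← map_sub, hQ]
  have e1 : (PowerSeries.C ((2 * b ^ 2 + D.k - 3) / b / (w ^ 2 - 1)) : PowerSeries ℂ) =
      PowerSeries.C b⁻¹ * PowerSeries.C ((D.k - 1) / (w ^ 2 - 1))
      + PowerSeries.C D.Q * PowerSeries.C (2 / (w ^ 2 - 1)) := by
    rw [← map_mul, ← map_mul, ← map_add]
    congr 1
    rw [hQ]
    field_simp
    ring
  have e2 : (PowerSeries.C (D.c ^ 2 * w ^ 2 / (4 * D.P w ^ 2)) : PowerSeries ℂ) =
      PowerSeries.C (D.c ^ 2 / 4) * PowerSeries.C (w ^ 2 / D.P w ^ 2) := by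
    rw [← map_mul]
    congr 1
    field_simp
  have e3 : (PowerSeries.C (D.c * ((D.Q * D.μ - D.ν / b) / 2) / (D.P w * (w ^ 2 - 1))) :
      PowerSeries ℂ) = PowerSeries.C (D.Q * D.c * D.μ / 2) * PowerSeries.C (1 / (D.P w *
        (w ^ 2 - 1)))
        - PowerSeries.C (D.c * D.ν / 2) * PowerSeries.C (1 / (D.P w * (w ^ 2 - 1)))
          * PowerSeries.C b⁻¹ := by
    rw [← map_mul, ← map_mul, ← map_mul, ← map_sub]
    congr 1
    field_simp
  rw [e1, e2, e3]
  linear_combination h1 + PowerSeries.X ^ 2 * eval b (D.corr (fun _ => w) {.point w} w) * hbC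
    - PowerSeries.X * eval b (D.onePoint1 (fun _ => w) w) * hQC
end LoopData

/-! ### Residues of rational functions -/

section Residues

/-- Rational functions with poles in `S`, presented by their partial fractions; the values on `S`
are irrelevant. -/
inductive PF (S : Finset ℂ) : (ℂ → ℂ) → Prop
  | pow (n : ℕ) : PF S fun q => q ^ n
  | pole (s : ℂ) (hs : s ∈ S) (n : ℕ) : PF S fun q => (q - s)⁻¹ ^ (n + 1)
  | add {F G : ℂ → ℂ} : PF S F → PF S G → PF S fun q => F q + G q
  | smul (c : ℂ) {F : ℂ → ℂ} : PF S F → PF S fun q => c * F q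
  | congr {F G : ℂ → ℂ} : PF S F → (∀ q, q ∉ S → F q = G q) → PF S G

variable {S : Finset ℂ} {F G : ℂ → ℂ}

theorem PF.const (c : ℂ) : PF S fun _ => c := by
  simpa using (PF.pow (S := S) 0).smul c

theorem PF.id_mul (h : PF S F) : PF S fun q => q * F q := by
  induction h with
  | pow n => exact (PF.pow (n + 1)).congr fun q _ => by ring
  | pole s hs n =>
    rcases n with _ | n
    · refine ((PF.const 1).add ((PF.pole s hs 0).smul s)).congr fun q hq => ?_
      have : q - s ≠ 0 := sub_ne_zero.2 fun h => hq (h ▸ hs)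
      linear_combination -mul_inv_cancel₀ this
    · refine ((PF.pole s hs n).add ((PF.pole s hs (n + 1)).smul s)).congr fun q hq => ?_
      have : q - s ≠ 0 := sub_ne_zero.2 fun h => hq (h ▸ hs)
      linear_combination -(q - s)⁻¹ ^ (n + 1) * mul_inv_cancel₀ this
  | add _ _ h1 h2 => exact (h1.add h2).congr fun q _ => by ring
  | smul c _ h => exact (h.smul c).congr fun q _ => by ring
  | congr _ e h => exact h.congr fun q hq => by rw [e q hq]

theorem PF.pole_mul {t : ℂ} (ht : t ∈ S) (h : PF S F) : PF S fun q => (q - t)⁻¹ * F q := by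
  induction h with
  | pow n =>
    induction n with
    | zero => exact (PF.pole t ht 0).congr fun q _ => by ring
    | succ n ih =>
      refine ((PF.pow n).add (ih.smul t)).congr fun q hq => ?_
      have : q - t ≠ 0 := sub_ne_zero.2 fun h => hq (h ▸ ht)
      field_simp
      ring
  | pole s hs n =>
    by_cases hst : s = t
    · subst hst
      exact (PF.pole s hs (n + 1)).congr fun q _ => by ring
    · have hst' : s - t ≠ 0 := sub_ne_zero.2 hst
      have key : ∀ n : ℕ, PF S fun q => (q - t)⁻¹ * (q - s)⁻¹ ^ n := by
        intro n
        induction n with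
        | zero => exact (PF.pole t ht 0).congr fun q _ => by ring
        | succ n ih =>
          refine (((PF.pole s hs n).smul (s - t)⁻¹).add (ih.smul (-(s - t)⁻¹))).congr
            fun q hq => ?_
          have h1 : q - t ≠ 0 := sub_ne_zero.2 fun h => hq (h ▸ ht)
          have h2 : q - s ≠ 0 := sub_ne_zero.2 fun h => hq (h ▸ hs)
          linear_combination -(s - t)⁻¹ * (q - s)⁻¹ ^ n * ((q - s)⁻¹ * mul_inv_cancel₀ h1
            - (q - t)⁻¹ * mul_inv_cancel₀ h2)
            + (q - s)⁻¹ ^ n * (q - s)⁻¹ * (q - t)⁻¹ * inv_mul_cancel₀ hst'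
      exact key (n + 1)
  | add _ _ h1 h2 => exact (h1.add h2).congr fun q _ => by ring
  | smul c _ h => exact (h.smul c).congr fun q _ => by ring
  | congr _ e h => exact h.congr fun q hq => by rw [e q hq]

theorem PF.mul (hF : PF S F) (hG : PF S G) : PF S fun q => F q * G q := by
  induction hF with
  | pow n =>
    induction n with
    | zero => simpa using hG
    | succ n ih => exact ih.id_mul.congr fun q _ => by ring
  | pole s hs n =>
    induction n with
    | zero => simpa using hG.pole_mul hs
    | succ n ih => exact (ih.pole_mul hs).congr fun q _ => by ring
  | add _ _ h1 h2 => exact (h1.add h2).congr fun q _ => by ring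
  | smul c _ h => exact (h.smul c).congr fun q _ => by ring
  | congr _ e h => exact h.congr fun q hq => by rw [e q hq]

theorem PF.sub (hF : PF S F) (hG : PF S G) : PF S fun q => F q - G q :=
  (hF.add (hG.smul (-1))).congr fun q _ => by ring

theorem PF.id : PF S fun q => q := (PF.pow 1).congr fun q _ => pow_one q

theorem PF.sub_inv {s : ℂ} (hs : s ∈ S) : PF S fun q => (q - s)⁻¹ :=
  (PF.pole s hs 0).congr fun q _ => by ring

theorem PF.differentiableAt (h : PF S F) {q : ℂ} (hq : q ∉ S) : DifferentiableAt ℂ F q := by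
  have hS : ∀ᶠ p in 𝓝 q, p ∉ S := S.finite_toSet.isClosed.isOpen_compl.eventually_mem hq
  induction h with
  | pow n => fun_prop
  | pole s hs n =>
    have : q - s ≠ 0 := sub_ne_zero.2 fun h => hq (h ▸ hs)
    fun_prop (disch := assumption)
  | add _ _ h1 h2 => exact h1.fun_add h2
  | smul c _ h => exact h.const_mul c
  | congr _ e h => exact h.congr_of_eventuallyEq (hS.mono fun p hp => (e p hp).symm)

/-- `F` is continuous away from `S`, and the residue of `F dq` at each `s` in `S` is `res s`, in the
sense that `F` minus its simple fractions has a primitive. -/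
def HasPrim (S : Finset ℂ) (F : ℂ → ℂ) (res : ℂ → ℂ) : Prop :=
  ContinuousOn F (S : Set ℂ)ᶜ ∧
    ∃ G : ℂ → ℂ, ∀ q, q ∉ S → HasDerivAt G (F q - ∑ s ∈ S, res s * (q - s)⁻¹) q

theorem PF.exists_hasPrim (h : PF S F) : ∃ res, HasPrim S F res := by
  suffices h' : ∃ res : ℂ → ℂ, ∃ G : ℂ → ℂ, ∀ q, q ∉ S →
      HasDerivAt G (F q - ∑ s ∈ S, res s * (q - s)⁻¹) q by
    obtain ⟨res, hG⟩ := h'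
    exact ⟨res, fun q hq => (h.differentiableAt hq).continuousAt.continuousWithinAt, hG⟩
  induction h with
  | pow n =>
    refine ⟨0, fun q => q ^ (n + 1) / (n + 1), fun q _ => ?_⟩
    refine ((hasDerivAt_pow (n + 1) q).div_const _).congr_deriv ?_
    have : (n + 1 : ℂ) ≠ 0 := by exact_mod_cast n.succ_ne_zero
    simp
    field_simp
  | pole s hs n =>
    rcases n with _ | n
    · refine ⟨fun t => if t = s then 1 else 0, 0, fun q _ => ?_⟩
      simp only [ite_mul, zero_mul, one_mul, Finset.sum_ite_eq', hs, if_true]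
      simp
    · refine ⟨0, fun q => -((q - s)⁻¹ ^ (n + 1) / (n + 1)), fun q hq => ?_⟩
      have h0 : q - s ≠ 0 := sub_ne_zero.2 fun h => hq (h ▸ hs)
      have : (n + 1 : ℂ) ≠ 0 := by exact_mod_cast n.succ_ne_zero
      refine ((((((hasDerivAt_id' q).sub_const s).fun_inv h0).fun_pow (n + 1)).div_const
        _).fun_neg).congr_deriv ?_
      simp
      field_simp
      ring
  | add _ _ h1 h2 =>
    obtain ⟨r1, G1, h1⟩ := h1
    obtain ⟨r2, G2, h2⟩ := h2
    refine ⟨fun s => r1 s + r2 s, _, fun q hq => ((h1 q hq).add (h2 q hq)).congr_deriv ?_⟩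
    simp only [add_mul, Finset.sum_add_distrib]
    ring
  | smul c _ h =>
    obtain ⟨r, G, h⟩ := h
    refine ⟨fun s => c * r s, _, fun q hq => ((h q hq).const_mul c).congr_deriv ?_⟩
    simp only [mul_assoc, ← Finset.mul_sum]
    ring
  | congr _ e h =>
    obtain ⟨r, G, h⟩ := h
    exact ⟨r, G, fun q hq => (h q hq).congr_deriv (by rw [e q hq])⟩

theorem residue_eq_of_eventually {F : ℂ → ℂ} {r a : ℂ}
    (h : ∀ᶠ ε : ℝ in 𝓝[>] 0, (∮ z in C(r, ε), F z) = 2 * (Real.pi : ℂ) * Complex.I * a) :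
    residue F r = a := by
  refine Tendsto.limUnder_eq (tendsto_const_nhds.congr' ?_)
  filter_upwards [h] with ε hε
  rw [hε]
  have := Complex.two_pi_I_ne_zero
  field_simp

theorem eventually_sphere {r : ℂ} {p : ℂ → Prop} (h : ∀ᶠ q in 𝓝[≠] r, p q) :
    ∀ᶠ ε : ℝ in 𝓝[>] 0, 0 < ε ∧ ∀ q ∈ Metric.sphere r ε, p q := by
  rw [eventually_nhdsWithin_iff, Metric.eventually_nhds_iff] at h
  obtain ⟨δ, hδ, h⟩ := h
  filter_upwards [Ioo_mem_nhdsGT hδ] with ε hε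
  refine ⟨hε.1, fun q hq => h (by rw [Metric.mem_sphere.1 hq]; exact hε.2) fun hqr => ?_⟩
  rw [Set.mem_singleton_iff] at hqr
  rw [hqr, Metric.mem_sphere, dist_self] at hq
  exact hε.1.ne hq

theorem circleIntegral_sub_inv_of_notMem {r s : ℂ} {ε : ℝ} (hε : 0 < ε) (hs : ε < dist s r) :
    (∮ z in C(r, ε), (z - s)⁻¹) = 0 := by
  have h0 : ∀ z ∈ Metric.closedBall r ε, z - s ≠ 0 := fun z hz h => by
    rw [sub_eq_zero.1 h, Metric.mem_closedBall] at hz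
    exact absurd hz (not_le.2 hs)
  refine Complex.circleIntegral_eq_zero_of_differentiable_on_off_countable hε.le
    Set.countable_empty (fun z hz => ?_) fun z hz => ?_
  · have := h0 z hz
    exact (by fun_prop (disch := assumption) :
      ContinuousAt (fun z => (z - s)⁻¹) z).continuousWithinAt
  · have := h0 z (Metric.ball_subset_closedBall hz.1)
    fun_prop (disch := assumption)

open Classical in
theorem HasPrim.residue_eq {res : ℂ → ℂ} (h : HasPrim S F res) {F' : ℂ → ℂ} {r : ℂ}
    (hF : F' =ᶠ[𝓝[≠] r] F) : residue F' r = if r ∈ S then res r else 0 := by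
  obtain ⟨hc, G, hG⟩ := h
  refine residue_eq_of_eventually ?_
  have h1 : ∀ᶠ q in 𝓝[≠] r, q ∉ S := by
    have : ∀ᶠ q in 𝓝[≠] r, q ∉ S.erase r :=
      ((S.erase r).finite_toSet.isClosed.isOpen_compl.eventually_mem (by simp)).filter_mono
        nhdsWithin_le_nhds
    filter_upwards [this, self_mem_nhdsWithin] with q hq hqr hqS
    exact hq (Finset.mem_erase.2 ⟨hqr, hqS⟩)
  have h2 : ∀ᶠ ε : ℝ in 𝓝[>] 0, ∀ s ∈ S, s ≠ r → ε < dist s r := by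
    rw [Filter.eventually_all_finset]
    intro s _
    by_cases hs : s = r
    · simp [hs]
    · filter_upwards [Ioo_mem_nhdsGT (dist_pos.2 hs)] with ε hε _ using hε.2
  filter_upwards [eventually_sphere (h1.and hF), h2] with ε ⟨hε, hq⟩ hs
  have e1 : (∮ z in C(r, ε), F' z) = ∮ z in C(r, ε), F z :=
    circleIntegral.integral_congr hε.le fun z hz => (hq z hz).2
  have hcs : ∀ s ∈ S, ContinuousOn (fun z => res s * (z - s)⁻¹) (Metric.sphere r ε) := by
    intro s hsS z hz
    have : z - s ≠ 0 := sub_ne_zero.2 fun h => (hq z hz).1 (h ▸ hsS)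
    exact (by fun_prop (disch := assumption) :
      ContinuousAt (fun z => res s * (z - s)⁻¹) z).continuousWithinAt
  have e2 : (∮ z in C(r, ε), (F z - ∑ s ∈ S, res s * (z - s)⁻¹)) = 0 :=
    circleIntegral.integral_eq_zero_of_hasDerivWithinAt hε.le fun z hz =>
      (hG z (hq z hz).1).hasDerivWithinAt
  have e3 : (∮ z in C(r, ε), ∑ s ∈ S, res s * (z - s)⁻¹) =
      ∑ s ∈ S, ∮ z in C(r, ε), res s * (z - s)⁻¹ :=
    circleIntegral.integral_fun_sum fun s hsS => (hcs s hsS).circleIntegrable hε.le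
  rw [circleIntegral.integral_sub
    ((hc.mono fun z hz => (hq z hz).1).circleIntegrable hε.le)
    ((continuousOn_finsetSum S hcs).circleIntegrable hε.le), sub_eq_zero] at e2
  rw [e1, e2, e3]
  have e4 : ∀ s ∈ S, (∮ z in C(r, ε), res s * (z - s)⁻¹) =
      if s = r then 2 * (Real.pi : ℂ) * Complex.I * res r else 0 := by
    intro s hsS
    rw [circleIntegral.integral_const_mul]
    split_ifs with h
    · rw [h, circleIntegral.integral_sub_center_inv _ hε.ne']
      ring
    · rw [circleIntegral_sub_inv_of_notMem hε (hs s hsS h), mul_zero]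
  rw [Finset.sum_congr rfl e4, Finset.sum_ite_eq']
  split_ifs <;> simp

open Classical in
/-- The residues of the pull-back of `F dq` under the inversion `q = 1 / p`. -/
theorem HasPrim.inversion {res : ℂ → ℂ} (h : HasPrim S F res) (h0 : (0 : ℂ) ∉ S) :
    HasPrim (insert 0 (S.image fun s => s⁻¹)) (fun p => -(F p⁻¹ / p ^ 2))
      (fun s => if s = 0 then -∑ s ∈ S, res s else res s⁻¹) := by
  obtain ⟨hc, G, hG⟩ := h
  have hm : ∀ p, p ∉ insert (0 : ℂ) (S.image fun s => s⁻¹) → p ≠ 0 ∧ p⁻¹ ∉ S := by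
    intro p hp
    rw [Finset.mem_insert, not_or] at hp
    exact ⟨hp.1, fun h => hp.2 (Finset.mem_image.2 ⟨_, h, inv_inv p⟩)⟩
  have h0' : (0 : ℂ) ∉ S.image fun s => s⁻¹ := fun h => by
    obtain ⟨s, hs, h⟩ := Finset.mem_image.1 h
    exact h0 (inv_eq_zero.1 h ▸ hs)
  refine ⟨fun p hp => ?_, fun p => G p⁻¹, fun p hp => ?_⟩
  · obtain ⟨hp0, hpS⟩ := hm p hp
    have h1 : ContinuousAt F p⁻¹ :=
      hc.continuousAt (S.finite_toSet.isClosed.isOpen_compl.mem_nhds hpS)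
    have h2 : ContinuousAt (fun p : ℂ => p⁻¹) p := continuousAt_inv₀ hp0
    have h3 : ContinuousAt (fun p : ℂ => F p⁻¹) p := ContinuousAt.comp (g := F) h1 h2
    have h4 : ContinuousAt (fun p : ℂ => p ^ 2) p := by fun_prop
    exact ((h3.div h4 (pow_ne_zero 2 hp0)).neg).continuousWithinAt
  · obtain ⟨hp0, hpS⟩ := hm p hp
    have h1 := (hG p⁻¹ hpS).comp p (hasDerivAt_inv hp0)
    refine h1.congr_deriv ?_
    rw [Finset.sum_insert h0', Finset.sum_image fun _ _ _ _ h => inv_inj.1 h]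
    beta_reduce
    rw [if_pos rfl]
    have h2 : ∀ s ∈ S, (if s⁻¹ = 0 then -∑ s ∈ S, res s else res s⁻¹⁻¹) * (p - s⁻¹)⁻¹ =
        res s * p⁻¹ - (p ^ 2)⁻¹ * (res s * (p⁻¹ - s)⁻¹) := by
      intro s hs
      have hs0 : s ≠ 0 := fun h => h0 (h ▸ hs)
      have hps : p⁻¹ - s ≠ 0 := sub_ne_zero.2 fun h => hpS (h ▸ hs)
      have e1 : p⁻¹ - s = (1 - p * s) / p := by field_simp
      have e2 : p - s⁻¹ = -(1 - p * s) / s := by field_simp; ring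
      have hps' : 1 - p * s ≠ 0 := fun h => hps (by rw [e1, h, zero_div])
      rw [if_neg (inv_ne_zero hs0), inv_inv, e1, e2]
      field_simp
      ring
    rw [Finset.sum_congr rfl h2, Finset.sum_sub_distrib, ← Finset.sum_mul, ← Finset.mul_sum]
    ring
end Residues

section

theorem PF.mono {S S' : Finset ℂ} (hS : S ⊆ S') {F : ℂ → ℂ} (h : PF S F) : PF S' F := by
  induction h with
  | pow n => exact .pow n
  | pole s hs n => exact .pole s (hS hs) n
  | add _ _ h1 h2 => exact h1.add h2
  | smul c _ h => exact h.smul c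
  | congr _ e h => exact h.congr fun q hq => e q fun h => hq (hS h)

theorem PF.multiset_sum {S : Finset ℂ} {α : Type} (s : Multiset α) {F : α → ℂ → ℂ}
    (h : ∀ a ∈ s, PF S (F a)) : PF S fun q => (s.map fun a => F a q).sum := by
  induction s using Multiset.induction with
  | empty => simpa using PF.const 0
  | cons a s ih =>
    simp only [Multiset.map_cons, Multiset.sum_cons]
    exact (h a (Multiset.mem_cons_self a s)).add (ih fun b hb => h b (Multiset.mem_cons_of_mem hb))

theorem PF.eraseSum {S : Finset ℂ} {α : Type} {J : Multiset α} {φ : ℂ → α → Multiset α → ℂ}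
    (h : ∀ a K, J = a ::ₘ K → PF S fun q => φ q a K) : PF S fun q => RefinedTR.eraseSum
    (φ q) J := by
  classical
  exact PF.multiset_sum J fun a ha => h a _ (by rw [Multiset.cons_erase ha])

/-- A rational function of several points, evaluated at the point `g q` and at fixed points. -/
theorem Reg.pf {ι : Type} {S : Finset ℂ} {g : ℂ → ℂ} {u : ι → ℂ} {F : (Option ι → ℂ) → ℂ}
    (hF : Reg false F) (hg : PF S g) (hgg : PF S fun q => (g q)⁻¹)
    (hgu : ∀ i, PF S fun q => (g q + u i)⁻¹) (hadm : ∀ q, q ∉ S → Adm false (ins (g q) u)) :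
    PF S fun q => F (ins (g q) u) := by
  induction hF with
  | const c => exact .const c
  | coord i =>
    rcases i with _ | i
    · exact hg
    · exact .const _
  | inv i j =>
    rcases i with _ | i <;> rcases j with _ | j
    · refine (hgg.smul 2⁻¹).congr fun q _ => ?_
      simp [ins, ← two_mul, mul_comm]
    · exact hgu j
    · exact (hgu i).congr fun q _ => by simp [ins, add_comm]
    · exact PF.const (u i + u j)⁻¹
  | pole he => simp at he
  | add _ _ h1 h2 => exact h1.add h2
  | mul _ _ h1 h2 => exact h1.mul h2
  | congr _ e h => exact h.congr fun q hq => e _ (hadm q hq)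

open Classical in
theorem HasPrim.residue_sub {S S' : Finset ℂ} {F G : ℂ → ℂ} {res res' : ℂ → ℂ}
    (hF : HasPrim S F res)
    (hG : HasPrim S' G res') (c : ℂ) {F' : ℂ → ℂ} {r : ℂ}
    (h : F' =ᶠ[𝓝[≠] r] fun q => c * (F q - G q)) : residue F' r =
      c * ((if r ∈ S then res r else 0) - if r ∈ S' then res' r else 0) := by
  have key : HasPrim (S ∪ S') (fun q => c * (F q - G q)) fun r =>
      c * ((if r ∈ S then res r else 0) - if r ∈ S' then res' r else 0) := by
    obtain ⟨h1, G1, hG1⟩ := hF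
    obtain ⟨h2, G2, hG2⟩ := hG
    refine ⟨fun q hq => ?_, fun q => c * (G1 q - G2 q), fun q hq => ?_⟩
    · rw [Finset.coe_union, Set.compl_union] at hq ⊢
      exact (((h1.mono Set.inter_subset_left).sub (h2.mono Set.inter_subset_right)).const_smul
        c) q hq
    · rw [Finset.mem_union, not_or] at hq
      refine (((hG1 q hq.1).sub (hG2 q hq.2)).const_mul c).congr_deriv ?_
      simp only [mul_assoc, ← Finset.mul_sum, sub_mul, Finset.sum_sub_distrib, ite_mul, zero_mul,
        Finset.sum_ite_mem, Finset.union_inter_cancel_left, Finset.union_inter_cancel_right]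
      ring
  rw [key.residue_eq h]
  split_ifs with h1 h2 h3 h4 h5 h6 <;> simp_all

theorem residue_of_simple_pole {F f : ℂ → ℂ} {r : ℂ} (hf : ∀ᶠ q in 𝓝 r, DifferentiableAt ℂ f q)
    (h : F =ᶠ[𝓝[≠] r] fun q => (q - r)⁻¹ * f q) : residue F r = f r := by
  refine residue_eq_of_eventually ?_
  obtain ⟨δ, hδ, hf⟩ := Metric.eventually_nhds_iff.1 hf
  filter_upwards [eventually_sphere h, Ioo_mem_nhdsGT hδ] with ε ⟨hε, hq⟩ hεδ
  have hd : ∀ z ∈ Metric.closedBall r ε, DifferentiableAt ℂ f z := fun z hz =>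
    hf ((Metric.mem_closedBall.1 hz).trans_lt hεδ.2)
  rw [circleIntegral.integral_congr hε.le hq]
  have := Complex.circleIntegral_sub_inv_smul_of_differentiable_on_off_countable (f := f)
    Set.countable_empty (Metric.mem_ball_self hε)
    (fun z hz => (hd z hz).continuousAt.continuousWithinAt)
    fun z hz => hd z (Metric.ball_subset_closedBall hz.1)
  simpa only [smul_eq_mul] using this

end

/-! ### The coordinate change -/

/-- The coordinate in which the involution is `w ↦ -w`; the ramification points are `0` and `∞`, and
`∞₊` and `∞₋` are `1` and `-1`. -/
def xi (z : ℂ) : ℂ := (1 + z) / (1 - z)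

/-- The derivative of `xi z ^ 2`. -/
def jac (z : ℂ) : ℂ := 4 * xi z / (1 - z) ^ 2

/-- The points of `J` avoid each other's images under the involution, and `∞₊`. -/
def Gen (J : Multiset ℂ) : Prop := ∀ a ∈ J, a ≠ 0 ∧ ∀ b ∈ J, a * b ≠ 1

theorem Gen.mono {J K : Multiset ℂ} (h : Gen J) (hK : ∀ a ∈ K, a ∈ J) : Gen K :=
  fun a ha => ⟨(h a (hK a ha)).1, fun b hb => (h a (hK a ha)).2 b (hK b hb)⟩

theorem Gen.ne_one {J : Multiset ℂ} (h : Gen J) {a : ℂ} (ha : a ∈ J) : a ≠ 1 := fun h1 =>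
  (h a ha).2 a ha (by rw [h1, one_mul])

theorem Gen.ne_neg_one {J : Multiset ℂ} (h : Gen J) {a : ℂ} (ha : a ∈ J) : a ≠ -1 := fun h1 =>
  (h a ha).2 a ha (by rw [h1]; norm_num)

theorem xi_ne_zero {z : ℂ} (h1 : z ≠ 1) (h : z ≠ -1) : xi z ≠ 0 :=
  div_ne_zero (fun h0 => h (by linear_combination h0)) (fun h0 => h1 (by linear_combination -h0))

theorem xi_add_xi {a b : ℂ} (ha : a ≠ 1) (hb : b ≠ 1) :
    xi a + xi b = 2 * (1 - a * b) / ((1 - a) * (1 - b)) := by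
  have h1 : 1 - a ≠ 0 := fun h0 => ha (by linear_combination -h0)
  have h2 : 1 - b ≠ 0 := fun h0 => hb (by linear_combination -h0)
  simp only [xi]
  field_simp
  ring

theorem xi_sub_xi {a b : ℂ} (ha : a ≠ 1) (hb : b ≠ 1) :
    xi a - xi b = 2 * (a - b) / ((1 - a) * (1 - b)) := by
  have h1 : 1 - a ≠ 0 := fun h0 => ha (by linear_combination -h0)
  have h2 : 1 - b ≠ 0 := fun h0 => hb (by linear_combination -h0)
  simp only [xi]
  field_simp
  ring

theorem xi_sq_sub_one {z : ℂ} (h1 : z ≠ 1) : xi z ^ 2 - 1 = 4 * z / (1 - z) ^ 2 := by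
  have h1 : 1 - z ≠ 0 := fun h0 => h1 (by linear_combination -h0)
  simp only [xi]
  field_simp
  ring

theorem xi_inv {z : ℂ} (h0 : z ≠ 0) (h1 : z ≠ 1) : xi z⁻¹ = -xi z := by
  have h1 : 1 - z ≠ 0 := fun h0 => h1 (by linear_combination -h0)
  have h2 : 1 - z⁻¹ ≠ 0 := by
    rw [show 1 - z⁻¹ = -(1 - z) / z by field_simp; ring]
    exact div_ne_zero (neg_ne_zero.2 h1) h0
  have e : 1 - z⁻¹ = -(1 - z) / z := by field_simp; ring
  simp only [xi]
  rw [e]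
  field_simp
  ring

theorem hasDerivAt_xi {z : ℂ} (h1 : z ≠ 1) : HasDerivAt xi (2 / (1 - z) ^ 2) z := by
  have h1 : 1 - z ≠ 0 := fun h0 => h1 (by linear_combination -h0)
  refine (((hasDerivAt_id' z).const_add 1).fun_div ((hasDerivAt_id' z).const_sub 1)
    h1).congr_deriv ?_
  congr 1
  ring

theorem adm_xi {ι : Type} {u : ι → ℂ} (h0 : ∀ i, u i ≠ 0) (h : ∀ i j, u i * u j ≠ 1) :
    Adm true fun i => xi (u i) := by
  have h1 : ∀ i, u i ≠ 1 := fun i h1 => h i i (by rw [h1, one_mul])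
  have h2 : ∀ i, 1 - u i ≠ 0 := fun i => sub_ne_zero.2 (h1 i).symm
  refine ⟨fun i j => ?_, fun _ i => ?_⟩
  · rw [xi_add_xi (h1 i) (h1 j)]
    exact div_ne_zero (mul_ne_zero two_ne_zero (sub_ne_zero.2 (h i j).symm))
      (mul_ne_zero (h2 i) (h2 j))
  · rw [xi_sq_sub_one (h1 i)]
    exact div_ne_zero (mul_ne_zero (by norm_num) (h0 i)) (pow_ne_zero 2 (h2 i))

theorem adm_ins_xi {J : Multiset ℂ} {z : ℂ} (h : Gen (z ::ₘ J)) :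
    Adm true (ins (xi z) fun a : {a // a ∈ J} => xi a) := by
  have := adm_xi (u := fun o : Option {a // a ∈ J} => o.elim z fun a => (a : ℂ))
    (by rintro (_ | ⟨a, ha⟩)
        · exact (h z (by simp)).1
        · exact (h a (by simp [ha])).1)
    (by rintro (_ | ⟨a, ha⟩) (_ | ⟨b, hb⟩)
        · exact (h z (by simp)).2 z (by simp)
        · exact (h z (by simp)).2 b (by simp [hb])
        · exact (h a (by simp [ha])).2 z (by simp)
        · exact (h a (by simp [ha])).2 b (by simp [hb]))
  convert this using 1
  funext o
  cases o <;> rfl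

/-! ### Residues of the correlator terms -/

/-- The point labels `ξ a`, for `a` in `J`. -/
def points (J : Multiset ℂ) : Multiset (Slot ℂ) := J.map fun a => .point (xi a)

@[simp] theorem points_cons (a : ℂ) (J : Multiset ℂ) :
    points (a ::ₘ J) = .point (xi a) ::ₘ points J := Multiset.map_cons _ _ _

@[simp] theorem points_zero : points 0 = 0 := rfl

theorem points_eq (J : Multiset ℂ) {K : Multiset ℂ} (h : ∀ a ∈ J, a ∈ K) :
    ∃ L : Multiset (Slot {a // a ∈ K}), L.card = J.card ∧
      points J = L.map (Slot.map fun a : {a // a ∈ K} => xi a) := by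
  refine ⟨J.attach.map fun a : {a // a ∈ J} => .point ⟨a, h a a.2⟩, by simp, ?_⟩
  rw [Multiset.map_map, points]
  conv_lhs => rw [← Multiset.attach_map_val J, Multiset.map_map]
  rfl

instance (K : Multiset ℂ) : Fintype {a // a ∈ K} :=
  Fintype.subtype K.toFinset (by simp)

section Total

variable {J : Multiset ℂ} {z : ℂ}

/-- `∫_{1/p}^p B(z, ·)`, regular at `p = 0`. -/
def etaReg (p z : ℂ) : ℂ := 1 / (z - p) - p / (z * p - 1)

theorem eta_eq {p z : ℂ} (hp : p ≠ 0) : SpectralCurve.eta p z = etaReg p z := by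
  rw [SpectralCurve.eta, etaReg]
  congr 1
  by_cases h : z * p - 1 = 0
  · rw [h, div_zero, show z - p⁻¹ = 0 by field_simp; linear_combination h, div_zero]
  · have : z - p⁻¹ ≠ 0 := fun h0 => h (by
      have : z = p⁻¹ := by linear_combination h0
      rw [this, inv_mul_cancel₀ hp, sub_self])
    field_simp

theorem etaReg_inv {p : ℂ} (hp : p ≠ 0) : etaReg p⁻¹ z = -etaReg p z := by
  have h1 := eta_eq (z := z) hp
  have h2 := eta_eq (z := z) (inv_ne_zero hp)
  rw [SpectralCurve.eta] at h1 h2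
  rw [inv_inv] at h2
  rw [← h1, ← h2]
  ring

theorem pf_etaReg {S : Finset ℂ} (hz : z ≠ 0) (h1 : z ∈ S) (h2 : z⁻¹ ∈ S) :
    PF S fun p => etaReg p z := by
  refine (((PF.sub_inv h1).smul (-1)).sub
    ((PF.id.mul (PF.sub_inv h2)).smul z⁻¹)).congr fun p hp => ?_
  have e1 : p - z ≠ 0 := sub_ne_zero.2 fun h => hp (h ▸ h1)
  have e1' : z - p ≠ 0 := sub_ne_zero.2 fun h => hp (h ▸ h1)
  have e2 : p - z⁻¹ ≠ 0 := sub_ne_zero.2 fun h => hp (h ▸ h2)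
  have e3 : p - z⁻¹ = (z * p - 1) / z := by field_simp
  have e4 : z * p - 1 ≠ 0 := fun h => e2 (by rw [e3, h, zero_div])
  rw [etaReg, e3, ← neg_sub z p]
  field_simp

theorem pf_xi {S : Finset ℂ} (h1 : (1 : ℂ) ∈ S) : PF S xi := by
  refine ((((PF.const 1).add PF.id).mul (PF.sub_inv h1)).smul (-1)).congr fun p hp => ?_
  have e1 : p - 1 ≠ 0 := sub_ne_zero.2 fun h => hp (h ▸ h1)
  rw [xi, ← neg_sub p 1]
  field_simp

theorem pf_xi_inv {S : Finset ℂ} (h2 : (-1 : ℂ) ∈ S) :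
    PF S fun p => (xi p)⁻¹ := by
  refine (((PF.const 1).sub PF.id).mul (PF.sub_inv h2)).congr fun p hp => ?_
  rw [xi, inv_div, sub_neg_eq_add, div_eq_mul_inv, add_comm p]

theorem pf_jac {S : Finset ℂ} (h1 : (1 : ℂ) ∈ S) : PF S jac := by
  refine (((pf_xi h1).mul (PF.pole 1 h1 1)).smul 4).congr fun p hp => ?_
  rw [jac, show (1 - p) ^ 2 = (p - 1) ^ 2 by ring, div_eq_mul_inv, ← inv_pow]
  ring

theorem pf_xi_add_inv {S : Finset ℂ} {a : ℂ} (h1 : (1 : ℂ) ∈ S) (ha : a⁻¹ ∈ S) (ha0 : a ≠ 0)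
    (ha1 : a ≠ 1) : PF S fun p => (xi p + xi a)⁻¹ := by
  refine ((((PF.const 1).sub PF.id).mul (PF.sub_inv ha)).smul (-((1 - a) / (2 * a)))).congr
    fun p hp => ?_
  have e1 : p ≠ 1 := fun h => hp (h ▸ h1)
  have e2 : p - a⁻¹ ≠ 0 := sub_ne_zero.2 fun h => hp (h ▸ ha)
  have e3 : p - a⁻¹ = -((1 - p * a) / a) := by field_simp; ring
  have e4 : 1 - p * a ≠ 0 := fun h => e2 (by rw [e3, h, zero_div, neg_zero])
  rw [xi_add_xi e1 ha1, e3, inv_div]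
  field_simp

theorem pf_xi_sub_inv {S : Finset ℂ} {a : ℂ} (h1 : (1 : ℂ) ∈ S) (ha : a ∈ S) (ha1 : a ≠ 1) :
    PF S fun p => (xi p - xi a)⁻¹ := by
  refine ((((PF.const 1).sub PF.id).mul (PF.sub_inv ha)).smul ((1 - a) / 2)).congr
    fun p hp => ?_
  have e1 : p ≠ 1 := fun h => hp (h ▸ h1)
  have e2 : p - a ≠ 0 := sub_ne_zero.2 fun h => hp (h ▸ ha)
  rw [xi_sub_xi e1 ha1, inv_div]
  field_simp

open Classical in
/-- The sum over the residue points of the residues of `η_p f(p)`, where `f` is a correlator: the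
only other pole is `p = z`, and the total vanishes because pulling back by the involution leads to
a form that is regular at `p = 0`. -/
theorem sum_residues_correlator {F : (Option {a // a ∈ J} → ℂ) → ℂ} (hF : Reg false F)
    (hJ : Gen (z ::ₘ J)) : ∃ res, ∃ S : Finset ℂ,
      HasPrim S (fun p => etaReg p z * (jac p * F (ins (xi p) fun a => xi a))) res ∧
      ∑ r ∈ SpectralCurve.residuePoints z J, (if r ∈ S then res r else 0) =
        jac z * F (ins (xi z) fun a => xi a) := by
  have hz := hJ z (by simp)
  have hz1 := hJ.ne_one (a := z) (by simp)
  have ha : ∀ a : {a // a ∈ J}, (a : ℂ) ≠ 0 ∧ (a : ℂ) ≠ 1 ∧ (a : ℂ) ≠ -1 := fun a =>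
    ⟨(hJ a (by simp [a.2])).1, hJ.ne_one (by simp [a.2]), hJ.ne_neg_one (by simp [a.2])⟩
  have hadm := (adm_xi (u := fun a : {a // a ∈ J} => (a : ℂ)) (fun a => (ha a).1)
    fun a b => (hJ a (by simp [a.2])).2 b (by simp [b.2])).to_false
  -- the correlator, as a function of its first argument
  set S₀ : Finset ℂ := {1, -1} ∪ (insert z J.toFinset).image fun z => z⁻¹ with hS₀
  have m1 : (1 : ℂ) ∈ S₀ := by simp [hS₀]
  have m2 : (-1 : ℂ) ∈ S₀ := by simp [hS₀]
  have m3 : z⁻¹ ∈ S₀ := by simp [hS₀]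
  have m4 : ∀ a : {a // a ∈ J}, (a : ℂ)⁻¹ ∈ S₀ := fun a => by simp [hS₀, a.2]
  have m0 : (0 : ℂ) ∉ S₀ := by
    simp only [hS₀, Finset.mem_union, Finset.mem_insert, Finset.mem_singleton, Finset.mem_image,
      Multiset.mem_toFinset, not_or, not_exists, not_and]
    exact ⟨⟨by norm_num, by norm_num⟩, fun a h h0 => by
      rcases h with rfl | h
      · exact hz.1 (inv_eq_zero.1 h0)
      · exact (hJ a (by simp [h])).1 (inv_eq_zero.1 h0)⟩
  have mz : z ∉ S₀ := by
    simp only [hS₀, Finset.mem_union, Finset.mem_insert, Finset.mem_singleton, Finset.mem_image,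
      Multiset.mem_toFinset, not_or, not_exists, not_and]
    refine ⟨⟨hz1, hJ.ne_neg_one (by simp)⟩, fun a h h0 => ?_⟩
    refine hz.2 a (by simpa using h) ?_
    rw [← h0, inv_mul_cancel₀]
    rcases h with rfl | h
    · exact hz.1
    · exact (hJ a (by simp [h])).1
  have adm₀ : ∀ p, p ∉ S₀ → Adm false (ins (xi p) fun a : {a // a ∈ J} => xi a) := by
    intro p hp
    have p1 : p ≠ 1 := fun h => hp (h ▸ m1)
    refine adm_ins.2 ⟨hadm, xi_ne_zero p1 fun h => hp (h ▸ m2), fun a => ?_, by simp⟩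
    rw [xi_add_xi p1 (ha a).2.1]
    refine div_ne_zero (mul_ne_zero two_ne_zero (sub_ne_zero.2 fun h => hp ?_))
      (mul_ne_zero (sub_ne_zero.2 p1.symm) (sub_ne_zero.2 (ha a).2.1.symm))
    rw [eq_inv_of_mul_eq_one_left h.symm]
    exact m4 a
  have f₀ : PF S₀ fun p => jac p * F (ins (xi p) fun a => xi a) := (pf_jac m1).mul
    (hF.pf (pf_xi m1) (pf_xi_inv m2)
      (fun a => pf_xi_add_inv m1 (m4 a) (ha a).1 (ha a).2.1) adm₀)
  -- the product with `η`
  have hS : S₀ ⊆ insert z S₀ := Finset.subset_insert _ _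
  have B : PF (insert z S₀) fun p => etaReg p z * (jac p * F (ins (xi p) fun a => xi a)) :=
    (pf_etaReg hz.1 (by simp) (hS m3)).mul (f₀.mono hS)
  obtain ⟨res, hB⟩ := B.exists_hasPrim
  refine ⟨res, insert z S₀, hB, ?_⟩
  -- the residue at `z`
  have rz : res z = -(jac z * F (ins (xi z) fun a => xi a)) := by
    have h1 := hB.residue_eq (r := z) EventuallyEq.rfl
    rw [if_pos (Finset.mem_insert_self _ _)] at h1
    have hd : ∀ᶠ p in 𝓝 z, p ∉ S₀ ∧ z * p - 1 ≠ 0 := by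
      refine (S₀.finite_toSet.isClosed.isOpen_compl.eventually_mem mz).and ?_
      have h2 : ContinuousAt (fun p => z * p - 1) z := by fun_prop
      exact h2.eventually_ne (sub_ne_zero.2 (hz.2 z (by simp)))
    have h2 := residue_of_simple_pole
      (F := fun p => etaReg p z * (jac p * F (ins (xi p) fun a => xi a)))
      (f := fun p => (-1 - (p - z) * (p / (z * p - 1))) *
        (jac p * F (ins (xi p) fun a => xi a))) (r := z)
      (by
        filter_upwards [hd] with p hp
        have := hp.2
        exact DifferentiableAt.fun_mul (by fun_prop (disch := assumption))
          (f₀.differentiableAt hp.1))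
      (by
        filter_upwards [hd.filter_mono nhdsWithin_le_nhds, self_mem_nhdsWithin] with p hp hpz
        have e1 : p - z ≠ 0 := sub_ne_zero.2 hpz
        have e2 := hp.2
        rw [etaReg, ← neg_sub p z]
        field_simp)
    rw [h2] at h1
    rw [← h1]
    ring
  -- the pull-back by the involution is regular at `0`
  have h0S : (0 : ℂ) ∉ insert z S₀ := by
    rw [Finset.mem_insert, not_or]
    exact ⟨hz.1.symm, m0⟩
  have htot : ∑ s ∈ insert z S₀, res s = 0 := by
    have h1 := (hB.inversion h0S).residue_eq (r := 0) EventuallyEq.rfl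
    rw [if_pos (Finset.mem_insert_self _ _)] at h1
    set S₂ : Finset ℂ := {1, -1, z, z⁻¹} ∪ J.toFinset with hS₂
    have n1 : (1 : ℂ) ∈ S₂ := by simp [hS₂]
    have n2 : (-1 : ℂ) ∈ S₂ := by simp [hS₂]
    have n4 : ∀ a : {a // a ∈ J}, (a : ℂ) ∈ S₂ := fun a => by simp [hS₂, a.2]
    have n0 : (0 : ℂ) ∉ S₂ := by
      simp only [hS₂, Finset.mem_union, Finset.mem_insert, Finset.mem_singleton,
        Multiset.mem_toFinset, not_or]
      exact ⟨⟨by norm_num, by norm_num, hz.1.symm, (inv_ne_zero hz.1).symm⟩, fun h =>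
        (hJ 0 (by simp [h])).1 rfl⟩
    have adm₂ : ∀ p, p ∉ S₂ → Adm false (ins (-xi p) fun a : {a // a ∈ J} => xi a) := by
      intro p hp
      have p1 : p ≠ 1 := fun h => hp (h ▸ n1)
      refine adm_ins.2 ⟨hadm, neg_ne_zero.2 (xi_ne_zero p1 fun h => hp (h ▸ n2)), fun a => ?_,
        by simp⟩
      rw [← sub_eq_neg_add, xi_sub_xi (ha a).2.1 p1]
      refine div_ne_zero (mul_ne_zero two_ne_zero (sub_ne_zero.2 fun h => hp (h ▸ n4 a)))
        (mul_ne_zero (sub_ne_zero.2 (ha a).2.1.symm) (sub_ne_zero.2 p1.symm))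
    have f₂ : PF S₂ fun p => etaReg p z * (jac p * F (ins (-xi p) fun a => xi a)) :=
      (pf_etaReg hz.1 (by simp [hS₂]) (by simp [hS₂])).mul ((pf_jac n1).mul
      (hF.pf (((pf_xi n1).smul (-1)).congr fun p _ => by ring)
        (((pf_xi_inv n2).smul (-1)).congr fun p _ => by rw [inv_neg]; ring)
        (fun a => ((pf_xi_sub_inv n1 (n4 a) (ha a).2.1).smul (-1)).congr fun p _ => by
          rw [← sub_eq_neg_add, ← neg_sub (xi p), inv_neg]; ring) adm₂))
    obtain ⟨res₂, h₂⟩ := (f₂.smul (-1)).exists_hasPrim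
    have h3 := h₂.residue_eq (r := 0) (F' := fun p =>
      -(etaReg p⁻¹ z * (jac p⁻¹ * F (ins (xi p⁻¹) fun a => xi a)) / p ^ 2)) (by
        have : ∀ᶠ p in 𝓝[≠] (0 : ℂ), p ≠ 1 :=
          (eventually_ne_nhds zero_ne_one).filter_mono nhdsWithin_le_nhds
        filter_upwards [this, self_mem_nhdsWithin] with p hp hp0
        have hp0 : p ≠ 0 := hp0
        have e1 : 1 - p ≠ 0 := sub_ne_zero.2 (Ne.symm hp)
        have e2 : 1 - p⁻¹ = -(1 - p) / p := by field_simp; ring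
        have e3 : jac p⁻¹ = -p ^ 2 * jac p := by
          rw [jac, jac, xi_inv hp0 hp, e2]
          field_simp
        rw [etaReg_inv hp0, e3, xi_inv hp0 hp]
        field_simp)
    rw [if_neg n0] at h3
    rw [h3] at h1
    simpa using h1.symm
  rw [Finset.sum_insert mz, rz] at htot
  have hRP : SpectralCurve.residuePoints z J = insert 0 S₀ := by
    ext r
    simp only [SpectralCurve.residuePoints, hS₀, Finset.mem_union, Finset.mem_insert,
      Finset.mem_singleton, Finset.mem_image, Multiset.mem_toFinset]
    rw [or_assoc, or_assoc, or_assoc, or_left_comm (a := r = -1), or_left_comm (a := r = 1)]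
  rw [hRP, Finset.sum_insert m0, if_neg h0S, zero_add, Finset.sum_congr rfl fun r hr =>
    if_pos (Finset.mem_insert_of_mem hr)]
  linear_combination htot

end Total

/-! ### Residues of the source terms -/

section Source

variable {J : Multiset ℂ} {z : ℂ}

/-- `4 / (1 - p)²` times `1 / (X - A)`, where `X = ξ(p)²` and `A = ξ(a)²`. -/
def frac₁ (a p : ℂ) : ℂ := (1 - a) ^ 2 / ((p - a) * (1 - p * a))

/-- `4 / (1 - p)²` times `1 / (X - A)²`, where `X = ξ(p)²` and `A = ξ(a)²`. -/
def frac₂ (a p : ℂ) : ℂ :=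
  (1 - a) ^ 4 * (1 - p) ^ 2 / (4 * ((p - a) * (1 - p * a)) ^ 2)

theorem xi_sq_sub {a p : ℂ} (ha : a ≠ 1) (hp : p ≠ 1) : xi p ^ 2 - xi a ^ 2 =
    4 * ((p - a) * (1 - p * a)) / ((1 - p) ^ 2 * (1 - a) ^ 2) := by
  rw [sq_sub_sq, xi_add_xi hp ha, xi_sub_xi hp ha, div_mul_div_comm]
  congr 1 <;> ring

theorem frac₁_eq {a p : ℂ} (ha : a ≠ 1) (hp : p ≠ 1) :
    frac₁ a p = 4 / (1 - p) ^ 2 * (1 / (xi p ^ 2 - xi a ^ 2)) := by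
  have h1 : 1 - a ≠ 0 := sub_ne_zero.2 ha.symm
  have h2 : 1 - p ≠ 0 := sub_ne_zero.2 hp.symm
  rw [frac₁, xi_sq_sub ha hp, one_div, inv_div]
  by_cases h : (p - a) * (1 - p * a) = 0
  · simp [h]
  · field_simp

theorem frac₂_eq {a p : ℂ} (ha : a ≠ 1) (hp : p ≠ 1) :
    frac₂ a p = 4 / (1 - p) ^ 2 * (1 / (xi p ^ 2 - xi a ^ 2) ^ 2) := by
  have h1 : 1 - a ≠ 0 := sub_ne_zero.2 ha.symm
  have h2 : 1 - p ≠ 0 := sub_ne_zero.2 hp.symm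
  rw [frac₂, xi_sq_sub ha hp, one_div, ← inv_pow, inv_div]
  by_cases h : (p - a) * (1 - p * a) = 0
  · simp [h]
  · field_simp

theorem frac₁_inv {a p : ℂ} (hp : p ≠ 0) : frac₁ a p⁻¹ = p ^ 2 * frac₁ a p := by
  have h : (p⁻¹ - a) * (1 - p⁻¹ * a) = (p - a) * (1 - p * a) / p ^ 2 := by field_simp
  rw [frac₁, frac₁, h]
  field_simp

theorem frac₂_inv {a p : ℂ} (hp : p ≠ 0) : frac₂ a p⁻¹ = p ^ 2 * frac₂ a p := by
  have h : (p⁻¹ - a) * (1 - p⁻¹ * a) = (p - a) * (1 - p * a) / p ^ 2 := by field_simp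
  have h' : (1 - p⁻¹) ^ 2 = (1 - p) ^ 2 / p ^ 2 := by field_simp; ring
  rw [frac₂, frac₂, h, h']
  field_simp

theorem pf_frac {S : Finset ℂ} {a : ℂ} (ha0 : a ≠ 0) (h1 : a ∈ S) (h2 : a⁻¹ ∈ S) :
    PF S (frac₁ a) ∧ PF S (frac₂ a) := by
  have e1 := (PF.sub_inv h1).mul (PF.sub_inv h2)
  have e2 : ∀ p, p ∉ S → (p - a) * (1 - p * a) ≠ 0 := fun p hp => by
    refine mul_ne_zero (sub_ne_zero.2 fun h => hp (h ▸ h1)) (sub_ne_zero.2 fun h => hp ?_)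
    rw [eq_inv_of_mul_eq_one_left h.symm]
    exact h2
  have e3 : ∀ p, p ∉ S → (p - a)⁻¹ * (p - a⁻¹)⁻¹ = -a * ((p - a) * (1 - p * a))⁻¹ := fun p hp => by
    have := e2 p hp
    have h3 : p - a⁻¹ = -((1 - p * a) / a) := by field_simp; ring
    rw [h3, mul_inv, inv_neg, inv_div]
    ring
  constructor
  · refine (e1.smul (-(1 - a) ^ 2 / a)).congr fun p hp => ?_
    rw [e3 p hp, frac₁]
    field_simp
  · refine (((e1.mul e1).mul (((PF.const 1).sub PF.id).mul ((PF.const 1).sub PF.id))).smul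
      ((1 - a) ^ 4 / (4 * a ^ 2))).congr fun p hp => ?_
    rw [e3 p hp, frac₂]
    field_simp

open Classical in
/-- The source terms do not contribute to the residues: multiplied by `η_p` they give a form that is
invariant under the involution, whose poles come in pairs. -/
theorem sum_residues_source (hJ : Gen (z ::ₘ J)) (α β : ℂ → Multiset ℂ → ℂ) :
    ∃ res, ∃ S : Finset ℂ, HasPrim S (fun p => etaReg p z *
      eraseSum (fun a K => α a K * frac₁ a p + β a K * frac₂ a p) J) res ∧
      ∑ r ∈ SpectralCurve.residuePoints z J, (if r ∈ S then res r else 0) = 0 := by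
  set T : Finset ℂ := insert z J.toFinset with hT
  set S : Finset ℂ := T ∪ T.image fun z => z⁻¹ with hS
  have hmT : ∀ a, a ∈ T ↔ a ∈ z ::ₘ J := fun a => by simp [hT]
  have hTS : ∀ a ∈ T, a ∈ S ∧ a⁻¹ ∈ S := fun a ha =>
    ⟨Finset.mem_union_left _ ha, Finset.mem_union_right _ (Finset.mem_image_of_mem _ ha)⟩
  have hST : ∀ a ∈ S, a ∈ T ∨ a⁻¹ ∈ T := fun a ha => by
    rcases Finset.mem_union.1 ha with h | h
    · exact .inl h
    · obtain ⟨b, hb, rfl⟩ := Finset.mem_image.1 h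
      exact .inr (by rwa [inv_inv])
  have h0 : (0 : ℂ) ∉ S := fun h => by
    rcases hST 0 h with h | h
    · exact (hJ 0 ((hmT 0).1 h)).1 rfl
    · rw [inv_zero] at h
      exact (hJ 0 ((hmT 0).1 h)).1 rfl
  have h1 : (1 : ℂ) ∉ S := fun h => by
    rcases hST 1 h with h | h
    · exact hJ.ne_one ((hmT _).1 h) rfl
    · rw [inv_one] at h
      exact hJ.ne_one ((hmT _).1 h) rfl
  have h1' : (-1 : ℂ) ∉ S := fun h => by
    rcases hST _ h with h | h
    · exact hJ.ne_neg_one ((hmT _).1 h) rfl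
    · rw [inv_neg, inv_one] at h
      exact hJ.ne_neg_one ((hmT _).1 h) rfl
  have hz : z ∈ T := Finset.mem_insert_self _ _
  have hz0 := (hJ z (by simp)).1
  have A : PF S fun p => etaReg p z *
      eraseSum (fun a K => α a K * frac₁ a p + β a K * frac₂ a p) J := by
    refine (pf_etaReg hz0 (hTS z hz).1 (hTS z hz).2).mul (PF.eraseSum fun a K hK => ?_)
    have ha : a ∈ T := (hmT a).2 (by simp [hK])
    have := pf_frac (S := S) (hJ a ((hmT a).1 ha)).1 (hTS a ha).1 (hTS a ha).2
    exact (this.1.smul _).add (this.2.smul _)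
  obtain ⟨res, hA⟩ := A.exists_hasPrim
  refine ⟨res, S, hA, ?_⟩
  -- invariance under the involution
  have hinv : ∀ r : ℂ, (fun p => -(etaReg p⁻¹ z *
      eraseSum (fun a K => α a K * frac₁ a p⁻¹ + β a K * frac₂ a p⁻¹) J / p ^ 2)) =ᶠ[𝓝[≠] r]
      fun p => etaReg p z * eraseSum (fun a K => α a K * frac₁ a p + β a K * frac₂ a p) J := by
    intro r
    have : ∀ᶠ p in 𝓝[≠] r, p ≠ 0 := by
      by_cases hr : r = 0
      · subst hr
        exact self_mem_nhdsWithin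
      · exact (eventually_ne_nhds hr).filter_mono nhdsWithin_le_nhds
    filter_upwards [this] with p hp
    have e : eraseSum (fun a K => α a K * frac₁ a p⁻¹ + β a K * frac₂ a p⁻¹) J =
        p ^ 2 * eraseSum (fun a K => α a K * frac₁ a p + β a K * frac₂ a p) J := by
      rw [← eraseSum_mul_left]
      exact eraseSum_congr fun a K _ => by rw [frac₁_inv hp, frac₂_inv hp]; ring
    rw [etaReg_inv hp, e]
    field_simp
  have hr : ∀ r, (if r ∈ S then res r else 0) = if r ∈ insert 0 (S.image fun s => s⁻¹) then
      (if r = 0 then -∑ s ∈ S, res s else res r⁻¹) else 0 := fun r => by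
    rw [← hA.residue_eq (hinv r), (hA.inversion h0).residue_eq EventuallyEq.rfl]
  have htot : ∑ s ∈ S, res s = 0 := by
    have := hr 0
    rw [if_neg h0, if_pos (Finset.mem_insert_self _ _), if_pos rfl] at this
    simpa using this.symm
  have hpair : ∀ s ∈ T, res s⁻¹ = res s := fun s hs => by
    have := hr s
    rw [if_pos (hTS s hs).1, if_pos (Finset.mem_insert_of_mem (Finset.mem_image.2
      ⟨s⁻¹, (hTS s hs).2, inv_inv s⟩)), if_neg (hJ s ((hmT s).1 hs)).1] at this
    exact this.symm
  have hdisj : Disjoint T (T.image fun z => z⁻¹) := by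
    refine Finset.disjoint_left.2 fun a ha ha' => ?_
    obtain ⟨b, hb, rfl⟩ := Finset.mem_image.1 ha'
    exact (hJ _ ((hmT _).1 ha)).2 b ((hmT b).1 hb) (inv_mul_cancel₀ (hJ b ((hmT b).1 hb)).1)
  have hsum : ∑ s ∈ T.image fun z => z⁻¹, res s = ∑ s ∈ T, res s := by
    rw [Finset.sum_image fun _ _ _ _ h => inv_inj.1 h]
    exact Finset.sum_congr rfl hpair
  rw [hS, Finset.sum_union hdisj, hsum] at htot
  have hRP : SpectralCurve.residuePoints z J = {1, -1, 0} ∪ T.image fun z => z⁻¹ := by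
    ext r
    simp only [SpectralCurve.residuePoints, hT, Finset.mem_union, Finset.mem_insert,
      Finset.mem_singleton, Finset.mem_image, Multiset.mem_toFinset]
  have hd2 : Disjoint ({1, -1, 0} : Finset ℂ) (T.image fun z => z⁻¹) := by
    refine Finset.disjoint_left.2 fun a ha ha' => ?_
    have : a ∈ S := Finset.mem_union_right _ ha'
    simp only [Finset.mem_insert, Finset.mem_singleton] at ha
    rcases ha with rfl | rfl | rfl
    · exact h1 this
    · exact h1' this
    · exact h0 this
  rw [hRP, Finset.sum_union hd2, Finset.sum_eq_zero, Finset.sum_congr rfl fun r hr =>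
    if_pos (Finset.mem_union_right _ hr), hsum]
  · linear_combination (1 / 2 : ℂ) * htot
  · intro r hr
    simp only [Finset.mem_insert, Finset.mem_singleton] at hr
    rcases hr with rfl | rfl | rfl
    · exact if_neg h1
    · exact if_neg h1'
    · exact if_neg h0

end Source

/-! ### Uniformised spectral curves -/

/-- The curve `S` is described by the data `D` in the coordinate `ξ`:
`y dx = (c / 2) w / P(w) dX` and `x = const - κ / (X - 1)`, where `w = ξ(z)` and `X = w²`. -/
structure Uniformised (S : SpectralCurve) (D : LoopData) (κ : ℂ) : Prop where
  k_eq : D.k = 2 ∨ D.k = 3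
  c_ne : D.c ≠ 0
  κ_ne : κ ≠ 0
  ydx : ∀ z, z ≠ 0 → z ≠ 1 → z ≠ -1 → S.ydx z = D.c / 2 * xi z / D.P (xi z) * jac z
  dx : ∀ z, z ≠ 0 → z ≠ 1 → z ≠ -1 → S.dx z = κ * jac z / (xi z ^ 2 - 1) ^ 2
  x : ∀ z a, z ≠ 0 → z ≠ 1 → a ≠ 0 → a ≠ 1 →
    S.x z - S.x a = κ * (xi z ^ 2 - xi a ^ 2) / ((xi z ^ 2 - 1) * (xi a ^ 2 - 1))
  half : ∀ z, z ≠ 0 → z ≠ 1 → z ≠ -1 → S.omegaHalf1 D.Q z = D.half (xi z) * jac z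

theorem Uniformised.two_le {S : SpectralCurve} {D : LoopData} {κ : ℂ} (hS : Uniformised S D κ) :
    2 ≤ D.k := by
  rcases hS.k_eq with h | h <;> omega

theorem jac_ne_zero {z : ℂ} (h1 : z ≠ 1) (h : z ≠ -1) : jac z ≠ 0 :=
  div_ne_zero (mul_ne_zero (by norm_num) (xi_ne_zero h1 h)) (pow_ne_zero 2 (sub_ne_zero.2 h1.symm))

theorem xi_sq_sub_one_ne_zero {z : ℂ} (h0 : z ≠ 0) (h1 : z ≠ 1) : xi z ^ 2 - 1 ≠ 0 := by
  rw [xi_sq_sub_one h1]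
  exact div_ne_zero (mul_ne_zero (by norm_num) h0) (pow_ne_zero 2 (sub_ne_zero.2 h1.symm))

theorem gen_cons {p : ℂ} {J : Multiset ℂ} :
    Gen (p ::ₘ J) ↔ Gen J ∧ p ≠ 0 ∧ p * p ≠ 1 ∧ ∀ b ∈ J, p * b ≠ 1 := by
  constructor
  · intro h
    exact ⟨h.mono fun a ha => by simp [ha], (h p (by simp)).1, (h p (by simp)).2 p (by simp),
      fun b hb => (h p (by simp)).2 b (by simp [hb])⟩
  · rintro ⟨h1, h2, h3, h4⟩ a ha
    rcases Multiset.mem_cons.1 ha with e | ha'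
    · subst e
      refine ⟨h2, fun b hb => ?_⟩
      rcases Multiset.mem_cons.1 hb with e | hb'
      · rwa [e]
      · exact h4 b hb'
    · refine ⟨(h1 a ha').1, fun b hb => ?_⟩
      rcases Multiset.mem_cons.1 hb with e | hb'
      · rw [e, mul_comm]
        exact h4 a ha'
      · exact (h1 a ha').2 b hb'

theorem Gen.eventually {p : ℂ} {J : Multiset ℂ} (h : Gen (p ::ₘ J)) :
    ∀ᶠ q in 𝓝 p, Gen (q ::ₘ J) := by
  classical
  obtain ⟨h1, h2, h3, h4⟩ := gen_cons.1 h
  have e3 : ∀ᶠ q in 𝓝 p, q * q ≠ 1 :=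
    (by fun_prop : ContinuousAt (fun q : ℂ => q * q) p).eventually_ne h3
  have e4 : ∀ᶠ q in 𝓝 p, ∀ b ∈ J.toFinset, q * b ≠ 1 := by
    rw [Filter.eventually_all_finset]
    exact fun b hb => (by fun_prop : ContinuousAt (fun q : ℂ => q * b) p).eventually_ne
      (h4 b (Multiset.mem_toFinset.1 hb))
  filter_upwards [eventually_ne_nhds h2, e3, e4] with q a1 a2 a3
  exact gen_cons.2 ⟨h1, a1, a2, fun b hb => a3 b (Multiset.mem_toFinset.2 hb)⟩

theorem eventually_gen {J : Multiset ℂ} (h : Gen J) (r : ℂ) :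
    ∀ᶠ p in 𝓝[≠] r, Gen (p ::ₘ J) ∧ p ∉ J := by
  classical
  have h1 : ∀ᶠ p in 𝓝[≠] r, p ∉ (({0, 1, -1} ∪ J.toFinset ∪ J.toFinset.image fun a => a⁻¹).erase r :
      Finset ℂ) :=
    ((Finset.finite_toSet _).isClosed.isOpen_compl.eventually_mem (by simp)).filter_mono
      nhdsWithin_le_nhds
  filter_upwards [h1, self_mem_nhdsWithin] with p hp hpr
  have hpr : p ≠ r := hpr
  simp only [Finset.mem_erase, Finset.mem_union, Finset.mem_insert, Finset.mem_singleton,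
    Multiset.mem_toFinset, Finset.mem_image, not_and, not_or, not_exists] at hp
  obtain ⟨⟨⟨a1, a2, a3⟩, a4⟩, a5⟩ := hp hpr
  refine ⟨gen_cons.2 ⟨h, a1, fun h0 => ?_, fun b hb h0 => a5 b hb ?_⟩, a4⟩
  · rcases mul_self_eq_one_iff.1 h0 with h0 | h0
    · exact a2 h0
    · exact a3 h0
  · exact inv_eq_of_mul_eq_one_left h0

section Rec

variable {S : SpectralCurve} {D : LoopData} {κ : ℂ} (hS : Uniformised S D κ)

include hS

variable (S D) in
omit hS in
/-- The multidifferentials of weight less than `d` are the correlators. -/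
def OmegaBelow (d : ℕ) : Prop := ∀ h z J, 1 ≤ h + Multiset.card J → h + J.card < d →
  Gen (z ::ₘ J) → S.omega D.Q h z J = D.W h (xi z) (points J) * (jac z * (J.map jac).prod)

/-- The recursion terms of the curve are those of the correlators, in the coordinate `ξ`. -/
theorem rec_eq {h : ℕ} {J : Multiset ℂ} (hJ : 2 ≤ h + J.card) (ih : OmegaBelow S D (h + J.card))
    {p : ℂ} (hp : Gen (p ::ₘ J)) (hpJ : p ∉ J) : S.Rec D.Q (S.omega D.Q) h p J =
      jac p ^ 2 * (J.map jac).prod * D.recTerm D.W h (points J) (xi p) := by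
  have hk := hS.two_le
  have hp0 := (hp p (by simp)).1
  have hp1 := hp.ne_one (a := p) (by simp)
  have hp2 := hp.ne_neg_one (a := p) (by simp)
  have hx := xi_sq_sub_one_ne_zero hp0 hp1
  have hjp := jac_ne_zero hp1 hp2
  rw [SpectralCurve.Rec, LoopData.recTerm, mul_add, mul_add, mul_add]
  congr 1
  · congr 1
    · congr 1
      · -- the terms with `dx(p) dx(a) / (x(p) - x(a))²`
        rw [points, eraseSum_map, ← eraseSum_mul_left, eraseSum]
        congr 1
        refine Multiset.map_congr rfl fun a ha => ?_
        have hK : J = a ::ₘ J.erase a := (Multiset.cons_erase ha).symm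
        have hcard := Multiset.card_erase_add_one ha
        have ha0 := (hp a (by simp [ha])).1
        have ha1 := hp.ne_one (a := a) (by simp [ha])
        have ha2 := hp.ne_neg_one (a := a) (by simp [ha])
        have hax := xi_sq_sub_one_ne_zero ha0 ha1
        have hja := jac_ne_zero ha1 ha2
        have hκ := hS.κ_ne
        have hX : xi p ^ 2 - xi a ^ 2 ≠ 0 := by
          rw [xi_sq_sub ha1 hp1]
          refine div_ne_zero (mul_ne_zero (by norm_num) (mul_ne_zero ?_ ?_)) (mul_ne_zero
            (pow_ne_zero 2 (sub_ne_zero.2 hp1.symm)) (pow_ne_zero 2 (sub_ne_zero.2 ha1.symm)))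
          · exact sub_ne_zero.2 fun h => hpJ (h ▸ ha)
          · exact sub_ne_zero.2 ((hp p (by simp)).2 a (by simp [ha])).symm
        rw [ih h p (J.erase a) (by omega) (by omega) (hp.mono fun b hb => by
          rcases Multiset.mem_cons.1 hb with rfl | hb
          · simp
          · simp [Multiset.mem_of_mem_erase hb]), hS.dx p hp0 hp1 hp2, hS.dx a ha0 ha1 ha2,
          hS.x p a hp0 hp1 ha0 ha1]
        conv_rhs => rw [hK, Multiset.map_cons, Multiset.prod_cons]
        have e : (a ::ₘ J.erase a).erase a = J.erase a := Multiset.erase_cons_head _ _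
        have e' : ∀ i : DecidableEq ℂ, (@Multiset.erase ℂ i (a ::ₘ J.erase a) a) = J.erase a := by
          intro i
          convert e
        simp only [LoopData.ker, points, e']
        field_simp
      · -- the products
        rw [Finset.mul_sum]
        refine Finset.sum_congr rfl fun g hg => ?_
        have hg := mem_antidiagonal.1 hg
        rw [points, conv_map, ← conv_mul_left, conv]
        congr 1
        refine Multiset.map_congr rfl fun K hK => ?_
        have hK := Multiset.mem_antidiagonal.1 hK
        have hcard := congrArg Multiset.card hK
        rw [Multiset.card_add] at hcard
        have hg1 : Gen (p ::ₘ K.1) := hp.mono fun b hb => by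
          rcases Multiset.mem_cons.1 hb with rfl | hb
          · simp
          · simp [← hK, hb]
        have hg2 : Gen (p ::ₘ K.2) := hp.mono fun b hb => by
          rcases Multiset.mem_cons.1 hb with rfl | hb
          · simp
          · simp [← hK, hb]
        split_ifs with h0
        · rcases h0 with ⟨h1, h2⟩ | ⟨h1, h2⟩ <;> simp [h1, h2]
        · rw [← Multiset.card_eq_zero, ← Multiset.card_eq_zero] at h0
          rw [ih g.1 p K.1 (by omega) (by omega) hg1, ih g.2 p K.2 (by omega) (by omega) hg2,
            ← hK, Multiset.map_add, Multiset.prod_add]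
          simp only [points]
          ring
    · split_ifs with h2
      · rw [ih (h - 2) p (p ::ₘ J) (by simp; omega) (by simp; omega) (hp.mono fun b hb => by
          simpa using hb)]
        simp only [points_cons, Multiset.map_cons, Multiset.prod_cons]
        ring
      · ring
  · split_ifs with h2
    · -- the derivative
      have h3 : (fun q => S.omega D.Q (h - 1) q J / S.dx q) =ᶠ[𝓝 p] fun q =>
          D.W (h - 1) (xi q) (points J) * (xi q ^ 2 - 1) ^ 2 * ((J.map jac).prod / κ) := by
        filter_upwards [hp.eventually] with q hq
        have hq0 := (hq q (by simp)).1
        have hq1 := hq.ne_one (a := q) (by simp)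
        have hq2 := hq.ne_neg_one (a := q) (by simp)
        have hjq := jac_ne_zero hq1 hq2
        have hx := xi_sq_sub_one_ne_zero hq0 hq1
        have hκ := hS.κ_ne
        rw [ih (h - 1) q J (by omega) (by omega) hq, hS.dx q hq0 hq1 hq2]
        field_simp
      have hd : DifferentiableAt ℂ (fun s => D.W (h - 1) s (points J)) (xi p) := by
        obtain ⟨L, -, hL⟩ := points_eq J (fun a ha => ha)
        rw [hL]
        exact LoopData.differentiableAt_W hk hS.c_ne (h - 1) L (adm_ins_xi hp)
      have hxi := hasDerivAt_xi hp1
      have h4 := ((hd.hasDerivAt.comp p hxi).mul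
        (((hxi.fun_pow 2).sub_const 1).fun_pow 2)).mul_const
        ((J.map jac).prod / κ)
      have h5 := h3.deriv_eq.trans h4.deriv
      rw [h5, hS.dx p hp0 hp1 hp2]
      have hκ := hS.κ_ne
      have e1 : (1 : ℂ) - p ≠ 0 := sub_ne_zero.2 hp1.symm
      have hξ := xi_ne_zero hp1 hp2
      simp only [Function.comp]
      generalize deriv (fun s => D.W (h - 1) s (points J)) (xi p) = d
      generalize D.W (h - 1) (xi p) (points J) = w
      rw [jac]
      generalize xi p = x at *
      field_simp
      ring
    · ring

end Rec

/-! ### Identification of the multidifferentials -/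

section

variable {S : SpectralCurve} {D : LoopData} {κ : ℂ}

theorem differentiableAt_W_points (hk : 2 ≤ D.k) (hc : D.c ≠ 0) (h : ℕ) {a : ℂ} {K : Multiset ℂ}
    (ha : Gen (a ::ₘ K)) : DifferentiableAt ℂ (fun t => D.W h t (points K)) (xi a) := by
  obtain ⟨L, -, hL⟩ := points_eq K (fun a ha => ha)
  rw [hL]
  exact LoopData.differentiableAt_W hk hc h L (adm_ins_xi ha)

/-- The integrand of the residue formula splits, by the loop equation, into a source part and the
correlator itself. -/
theorem integrand_eq (hS : Uniformised S D κ) {h : ℕ} {J : Multiset ℂ} (hJ : 2 ≤ h + J.card)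
    (ih : OmegaBelow S D (h + J.card)) {p z : ℂ} (hp : Gen (p ::ₘ J)) (hpJ : p ∉ J) :
    SpectralCurve.eta p z / (2 * S.ydx p) * S.Rec D.Q (S.omega D.Q) h p J = (J.map jac).prod *
      (etaReg p z * eraseSum (fun a K =>
          D.P (xi a) / D.c * (D.k / (xi a ^ 2 - 1) * D.W h (xi a) (points K) +
            deriv (fun t => D.W h t (points K)) (xi a) / (2 * xi a)) * frac₁ a p +
          D.P (xi a) / D.c * D.W h (xi a) (points K) * frac₂ a p) J -
        etaReg p z * (jac p * D.W h (xi p) (points J))) := by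
  have hk := hS.two_le
  have hc := hS.c_ne
  have hp0 := (hp p (by simp)).1
  have hp1 := hp.ne_one (a := p) (by simp)
  have hp2 := hp.ne_neg_one (a := p) (by simp)
  have hx := xi_sq_sub_one_ne_zero hp0 hp1
  have hξ := xi_ne_zero hp1 hp2
  have hP := D.P_ne_zero hx
  have e1 : (1 : ℂ) - p ≠ 0 := sub_ne_zero.2 hp1.symm
  have hloop : D.LoopEq h (points J) (xi p) := by
    obtain ⟨L, hL0, hL⟩ := points_eq J (fun a ha => ha)
    rw [hL]
    refine LoopData.loopEq_map hk hc h L (by omega) (adm_ins_xi hp).to_false hx fun a h0 => ?_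
    have ha1 := hp.ne_one (a := a) (by simp [a.2])
    have h1 := xi_sub_xi hp1 ha1
    rw [h0, sub_self] at h1
    refine div_ne_zero (mul_ne_zero two_ne_zero (sub_ne_zero.2 fun h => hpJ (by rw [h]; exact a.2)))
      (mul_ne_zero e1 (sub_ne_zero.2 ha1.symm)) h1.symm
  have hsrc : eraseSum (fun a K =>
          D.P (xi a) / D.c * (D.k / (xi a ^ 2 - 1) * D.W h (xi a) (points K) +
            deriv (fun t => D.W h t (points K)) (xi a) / (2 * xi a)) * frac₁ a p +
          D.P (xi a) / D.c * D.W h (xi a) (points K) * frac₂ a p) J =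
      4 / (1 - p) ^ 2 / D.c *
        eraseSum (fun l K => D.src (xi p) (fun t => D.W h t K) l) (points J) := by
    rw [points, eraseSum_map, ← eraseSum_mul_left]
    refine eraseSum_congr fun a K hK => ?_
    have ha0 := (hp a (by simp [hK])).1
    have ha1 := hp.ne_one (a := a) (by simp [hK])
    have ha2 := hp.ne_neg_one (a := a) (by simp [hK])
    have hax := xi_sq_sub_one_ne_zero ha0 ha1
    have haξ := xi_ne_zero ha1 ha2
    have hPa := D.P_ne_zero hax
    have hX : xi p ^ 2 - xi a ^ 2 ≠ 0 := by
      rw [xi_sq_sub ha1 hp1]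
      refine div_ne_zero (mul_ne_zero (by norm_num) (mul_ne_zero ?_ ?_)) (mul_ne_zero
        (pow_ne_zero 2 e1) (pow_ne_zero 2 (sub_ne_zero.2 ha1.symm)))
      · exact sub_ne_zero.2 fun h => hpJ (by rw [h, hK]; simp)
      · exact sub_ne_zero.2 ((hp p (by simp)).2 a (by simp [hK])).symm
    change _ = _ * D.src (xi p) (fun t => D.W h t (points K)) (.point (xi a))
    rw [LoopData.src_point (differentiableAt_W_points hk hc h (hp.mono fun b hb => by
      rw [hK]; exact Multiset.mem_cons_of_mem hb)) hx hax haξ hX, frac₁_eq ha1 hp1, frac₂_eq ha1 hp1]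
    simp only [LoopData.G1, LoopData.G, points]
    generalize deriv (fun s => D.W h s _) (xi a) = d
    generalize D.W h (xi a) _ = w
    generalize D.P (xi a) = Pa at *
    generalize D.P (xi p) = Pp at *
    generalize xi a = x at *
    generalize xi p = y at *
    generalize (D.k : ℂ) = k
    field_simp
    ring
  rw [eta_eq hp0, hS.ydx p hp0 hp1 hp2, rec_eq hS hJ ih hp hpJ, hsrc]
  have h1 : eraseSum (fun l K => D.src (xi p) (fun t => D.W h t K) l) (points J) =
    D.c * xi p * D.W h (xi p) (points J) + D.P (xi p) * D.recTerm D.W h (points J) (xi p) := by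
    have h2 := hloop
    rw [LoopData.LoopEq] at h2
    linear_combination -h2
  rw [h1]
  have hj : jac p = 4 * xi p / (1 - p) ^ 2 := rfl
  rw [hj]
  generalize D.recTerm D.W h (points J) (xi p) = R
  generalize D.W h (xi p) (points J) = w
  generalize D.P (xi p) = Pp at *
  generalize xi p = y at *
  field_simp
  ring

/-- The multidifferentials of the refined topological recursion are the correlators. -/
theorem omega_eq_W (hS : Uniformised S D κ) (h : ℕ) (z : ℂ) (J : Multiset ℂ)
    (hJ : 1 ≤ h + Multiset.card J) (hz : Gen (z ::ₘ J)) :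
    S.omega D.Q h z J = D.W h (xi z) (points J) * (jac z * (J.map jac).prod) := by
  suffices ∀ d, OmegaBelow S D d from this (h + J.card + 1) h z J hJ (by omega) hz
  intro d
  induction d with
  | zero => exact fun h z J _ h0 => absurd h0 (by omega)
  | succ d ih =>
    intro h z J hJ hd hz
    by_cases hlt : h + J.card < d
    · exact ih h z J hJ hlt hz
    obtain rfl : d = h + J.card := by omega
    have hz0 := (hz z (by simp)).1
    have hz1 := hz.ne_one (a := z) (by simp)
    have hz2 := hz.ne_neg_one (a := z) (by simp)
    have hk := hS.two_le
    by_cases h2 : 2 ≤ h + J.card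
    · classical
      rw [SpectralCurve.omega_eq _ _ _ _ _ h2]
      obtain ⟨L, hL0, hL⟩ := points_eq J (fun a ha => ha)
      obtain ⟨resB, SB, hB, hB0⟩ := sum_residues_correlator
        (LoopData.reg_W hk hS.c_ne h L (by omega)) hz
      obtain ⟨resA, SA, hA, hA0⟩ := sum_residues_source hz
        (fun a K => D.P (xi a) / D.c * (D.k / (xi a ^ 2 - 1) * D.W h (xi a) (points K) +
            deriv (fun t => D.W h t (points K)) (xi a) / (2 * xi a)))
        (fun a K => D.P (xi a) / D.c * D.W h (xi a) (points K))
      have key : ∀ r, residue (fun p => SpectralCurve.eta p z / (2 * S.ydx p) *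
          S.Rec D.Q (S.omega D.Q) h p J) r = (J.map jac).prod *
            ((if r ∈ SA then resA r else 0) - if r ∈ SB then resB r else 0) := fun r => by
        refine hA.residue_sub hB _ ?_
        filter_upwards [eventually_gen (hz.mono fun a ha => Multiset.mem_cons_of_mem ha)
          r] with p hp
        rw [integrand_eq hS h2 ih hp.1 hp.2, hL]
        rfl
      rw [Finset.sum_congr rfl fun r _ => key r, ← Finset.mul_sum, Finset.sum_sub_distrib,
        hA0, hB0, hL]
      simp only [ins, Option.elim]
      ring
    · rw [SpectralCurve.omega, if_pos (by omega)]
      rcases Nat.lt_or_ge 0 h with h1 | h1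
      · obtain rfl : h = 1 := by omega
        obtain rfl : J = 0 := Multiset.card_eq_zero.1 (by omega)
        rw [if_pos rfl, hS.half z hz0 hz1 hz2, points_zero, LoopData.W_one]
        simp
      · obtain rfl : h = 0 := by omega
        obtain ⟨a, rfl⟩ := Multiset.card_eq_one.1 (show J.card = 1 by omega)
        have ha1 := hz.ne_one (a := a) (by simp)
        have ha2 := hz.ne_neg_one (a := a) (by simp)
        have hξa := xi_ne_zero ha1 ha2
        have hξz := xi_ne_zero hz1 hz2
        have e1 : 1 - z ≠ 0 := sub_ne_zero.2 hz1.symm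
        have e2 : 1 - a ≠ 0 := sub_ne_zero.2 ha1.symm
        have e3 : 1 - z * a ≠ 0 := sub_ne_zero.2 ((hz z (by simp)).2 a (by simp)).symm
        rw [if_neg (by norm_num), if_neg (Multiset.singleton_ne_zero a)]
        rw [show points {a} = {.point (xi a)} from rfl, LoopData.W_two]
        simp only [LoopData.two, Multiset.map_singleton, Multiset.sum_singleton,
          Multiset.prod_singleton, SpectralCurve.omega02, jac]
        rw [xi_add_xi hz1 ha1]
        field_simp
        ring

theorem uniformised_weber (s μ Q ν : ℂ) (hs : s ≠ 0) :
    Uniformised (weber s μ) ⟨3, -16 * s ^ 2, Q, μ, ν⟩ (-4 * s) := by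
  have key : ∀ z : ℂ, z ≠ 0 → z ≠ 1 → z ≠ -1 → 1 - z ≠ 0 ∧ 1 + z ≠ 0 := fun z _ h1 h2 =>
    ⟨sub_ne_zero.2 h1.symm, fun h => h2 (by linear_combination h)⟩
  refine ⟨.inr rfl, mul_ne_zero (by norm_num) (pow_ne_zero 2 hs), mul_ne_zero (by norm_num) hs,
    fun z h0 h1 h2 => ?_, fun z h0 h1 h2 => ?_, fun z a h0 h1 ha0 ha1 => ?_, fun z h0 h1 h2 => ?_⟩
  · obtain ⟨e1, e2⟩ := key z h0 h1 h2
    rw [(weber_ydx s μ z h0).2]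
    simp only [LoopData.P]
    rw [xi_sq_sub_one h1, jac, xi]
    field_simp
    ring
  · obtain ⟨e1, e2⟩ := key z h0 h1 h2
    rw [(weber_ydx s μ z h0).1, xi_sq_sub_one h1, jac, xi]
    field_simp
    ring
  · have e1 : 1 - z ≠ 0 := sub_ne_zero.2 h1.symm
    have e2 : 1 - a ≠ 0 := sub_ne_zero.2 ha1.symm
    rw [xi_sq_sub_one h1, xi_sq_sub_one ha1, xi_sq_sub ha1 h1]
    simp only [weber]
    field_simp
    ring
  · obtain ⟨e1, e2⟩ := key z h0 h1 h2
    have hd : deriv (weber s μ).y z = -(s / 2) * (1 - -(z ^ 2)⁻¹) :=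
      (((hasDerivAt_id z).sub (hasDerivAt_inv h0)).const_mul (-(s / 2))).deriv
    have h3 : z - z⁻¹ = -((1 - z) * (1 + z)) / z := by field_simp; ring
    rw [SpectralCurve.omegaHalf1, hd]
    simp only [LoopData.half, weber, h3]
    rw [xi_sq_sub_one h1, jac, xi]
    field_simp
    ring

theorem uniformised_whittaker (m μ Q ν : ℂ) (hm : m ≠ 0) :
    Uniformised (whittaker m μ) ⟨2, 4 * m, Q, μ, ν⟩ (-4 * m) := by
  have key : ∀ z : ℂ, z ≠ 0 → z ≠ 1 → z ≠ -1 → 1 - z ≠ 0 ∧ 1 + z ≠ 0 := fun z _ h1 h2 =>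
    ⟨sub_ne_zero.2 h1.symm, fun h => h2 (by linear_combination h)⟩
  refine ⟨.inl rfl, mul_ne_zero (by norm_num) hm, mul_ne_zero (by norm_num) hm,
    fun z h0 h1 h2 => ?_, fun z h0 h1 h2 => ?_, fun z a h0 h1 ha0 ha1 => ?_, fun z h0 h1 h2 => ?_⟩
  · obtain ⟨e1, e2⟩ := key z h0 h1 h2
    rw [(whittaker_ydx m μ z h0 h1).2]
    simp only [LoopData.P]
    rw [xi_sq_sub_one h1, jac, xi]
    field_simp
    ring
  · obtain ⟨e1, e2⟩ := key z h0 h1 h2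
    rw [(whittaker_ydx m μ z h0 h1).1, xi_sq_sub_one h1, jac, xi]
    field_simp
    ring
  · have e1 : 1 - z ≠ 0 := sub_ne_zero.2 h1.symm
    have e2 : 1 - a ≠ 0 := sub_ne_zero.2 ha1.symm
    rw [xi_sq_sub_one h1, xi_sq_sub_one ha1, xi_sq_sub ha1 h1]
    simp only [whittaker]
    field_simp
    ring
  · obtain ⟨e1, e2⟩ := key z h0 h1 h2
    have e3 : 2 * (z - 1) ≠ 0 := mul_ne_zero two_ne_zero (sub_ne_zero.2 h1)
    have hd : deriv (whittaker m μ).y z =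
        (1 * (2 * (z - 1)) - (z + 1) * (2 * 1)) / (2 * (z - 1)) ^ 2 :=
      (((hasDerivAt_id z).add_const 1).div
        (((hasDerivAt_id z).sub_const 1).const_mul 2) e3).deriv
    have h3 : z - 1 = -(1 - z) := by ring
    have h4 : z + 1 ≠ 0 := by rwa [add_comm]
    rw [SpectralCurve.omegaHalf1, hd]
    simp only [LoopData.half, whittaker, h3]
    rw [xi_sq_sub_one h1, jac, xi]
    push_cast
    field_simp
    ring

end

/-! ### Integration along a ray -/

section

open MeasureTheory

/-- A complex number off the half-line `[0, ∞)` keeps, with its neighbours, a uniform distance from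
the inverses of the points of the half-line. -/
theorem exists_ray_bound {ζ₀ : ℂ} (h : ∀ r : ℝ, 0 ≤ r → ζ₀ ≠ r) :
    ∃ c : ℝ, 0 < c ∧ ∀ᶠ ζ : ℂ in 𝓝 ζ₀, ∀ t : ℝ, 0 ≤ t → c * (1 + t) ≤ ‖1 - t * ζ‖ := by
  have hcont : Continuous fun θ : ℝ => ‖(1 - θ : ℂ) - θ * ζ₀‖ := by fun_prop
  obtain ⟨θ₀, hθ₀, hmin⟩ := (isCompact_Icc (a := (0 : ℝ)) (b := 1)).exists_isMinOn
    ⟨0, by simp⟩ hcont.continuousOn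
  have hpos : 0 < ‖(1 - θ₀ : ℂ) - θ₀ * ζ₀‖ := by
    rw [norm_pos_iff]
    intro h0
    have hθ : θ₀ ≠ 0 := by
      rintro rfl
      simp at h0
    refine h ((1 - θ₀) / θ₀) (div_nonneg (by linarith [hθ₀.2]) hθ₀.1) ?_
    have : (θ₀ : ℂ) ≠ 0 := by exact_mod_cast hθ
    push_cast
    field_simp
    linear_combination -h0
  set c := ‖(1 - θ₀ : ℂ) - θ₀ * ζ₀‖ / 2 with hc
  refine ⟨c, half_pos hpos, ?_⟩
  filter_upwards [Metric.ball_mem_nhds ζ₀ (half_pos hpos)] with ζ hζ t ht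
  have h1 : 0 < 1 + t := by linarith
  have h1' : (1 + t : ℂ) ≠ 0 := by exact_mod_cast h1.ne'
  have hθ : t / (1 + t) ∈ Set.Icc (0 : ℝ) 1 :=
    ⟨by positivity, (div_le_one h1).2 (by linarith)⟩
  have h2 := hmin hθ
  simp only [Set.mem_ofPred_eq] at h2
  have h3 : ‖(1 - (t / (1 + t) : ℝ) : ℂ) - (t / (1 + t) : ℝ) * ζ₀‖ =
      ‖1 - t * ζ₀‖ / (1 + t) := by
    have h4 : (1 - (t / (1 + t) : ℝ) : ℂ) - (t / (1 + t) : ℝ) * ζ₀ =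
        (1 - t * ζ₀) / ((1 + t : ℝ) : ℂ) := by
      push_cast
      field_simp
      ring
    rw [h4, norm_div, Complex.norm_real, Real.norm_of_nonneg h1.le]
  rw [h3, le_div_iff₀ h1] at h2
  have h5 : ‖1 - t * ζ₀‖ ≤ ‖1 - t * ζ‖ + t * c := by
    have h6 : 1 - t * ζ₀ = (1 - t * ζ) + t * (ζ - ζ₀) := by ring
    have h7 : ‖(t : ℂ) * (ζ - ζ₀)‖ ≤ t * c := by
      rw [norm_mul, Complex.norm_real, Real.norm_of_nonneg ht]
      exact mul_le_mul_of_nonneg_left (by rw [← dist_eq_norm]; exact (Metric.mem_ball.1 hζ).le) ht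
    rw [h6]
    exact (norm_add_le _ _).trans (by linarith)
  nlinarith

theorem integral_ray {f f' : ℝ → ℂ} {m : ℂ} (h0 : ContinuousWithinAt f (Set.Ici 0) 0)
    (hd : ∀ t ∈ Set.Ioi (0 : ℝ), HasDerivAt f (f' t) t) (hi : IntegrableOn f' (Set.Ioi 0))
    (hm : Tendsto f atTop (𝓝 m)) :
    ∫ t in Set.Ioc (0 : ℝ) 1, f' t = f 1 - f 0 ∧ ∫ t in Set.Ioi (1 : ℝ), f' t = m - f 1 := by
  have hs : Set.Ioi (1 : ℝ) ⊆ Set.Ioi 0 := Set.Ioi_subset_Ioi zero_le_one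
  have h1 := integral_Ioi_of_hasDerivAt_of_tendsto h0 hd hi hm
  have h2 := integral_Ioi_of_hasDerivAt_of_tendsto
    (hd 1 (Set.mem_Ioi.2 one_pos)).continuousAt.continuousWithinAt (fun t ht => hd t
      (hs ht)) (hi.mono_set hs) hm
  have hdisj : Disjoint (Set.Ioc (0 : ℝ) 1) (Set.Ioi 1) := Set.disjoint_left.2 fun t h h' =>
    not_lt.2 h.2 h'
  rw [← Set.Ioc_union_Ioi_eq_Ioi zero_le_one, setIntegral_union hdisj measurableSet_Ioi
    (hi.mono_set Set.Ioc_subset_Ioi_self) (hi.mono_set hs), h2] at h1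
  exact ⟨by linear_combination h1, h2⟩

theorem mul_im_ne_zero {z : ℂ} (hz : z.im ≠ 0) {t : ℝ} (ht : 0 < t) : ((t : ℂ) * z).im ≠ 0 := by
  simpa using ⟨ht.ne', hz⟩

theorem ne_ofReal {z : ℂ} (hz : z.im ≠ 0) (r : ℝ) : z ≠ r := fun h => hz (by rw [h]; simp)

theorem sq_ne_ofReal {z : ℂ} (hz : z.im ≠ 0) {r : ℝ} (hr : 0 ≤ r) : z * z ≠ r := fun h => by
  rw [← Real.mul_self_sqrt hr, Complex.ofReal_mul, mul_self_eq_mul_self_iff] at h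
  rcases h with h | h <;> exact hz (by rw [h]; simp)

theorem tendsto_xi_ray {z : ℂ} (hz : z.im ≠ 0) :
    Tendsto (fun t : ℝ => xi (t * z)) atTop (𝓝 (-1)) := by
  have hz0 : z ≠ 0 := by simpa using ne_ofReal hz 0
  have h1 : Tendsto (fun t : ℝ => ((t⁻¹ : ℝ) : ℂ)) atTop (𝓝 0) :=
    (Complex.continuous_ofReal.tendsto' 0 0 (by simp)).comp tendsto_inv_atTop_zero
  have h2 := (h1.add_const z).div (h1.sub_const z) (by simpa using hz0)
  have h3 : (0 + z) / (0 - z) = -1 := by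
    rw [zero_add, zero_sub, div_neg, div_self hz0]
  rw [h3] at h2
  refine h2.congr' ?_
  filter_upwards [eventually_gt_atTop 0] with t ht
  have ht0 : (t : ℂ) ≠ 0 := by exact_mod_cast ht.ne'
  have h4 : 1 - t * z ≠ 0 := sub_ne_zero.2 fun h => ne_ofReal (mul_im_ne_zero hz ht) 1 (by simp [h])
  have h5 : ((t⁻¹ : ℝ) : ℂ) - z = (1 - t * z) / t := by push_cast; field_simp
  have h6 : ((t⁻¹ : ℝ) : ℂ) + z = (1 + t * z) / t := by push_cast; field_simp
  simp only [Pi.div_apply]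
  rw [h5, h6, xi]
  field_simp

theorem one_sub_ray_ne_zero {z : ℂ} (hz : z.im ≠ 0) {t : ℝ} (ht : 0 ≤ t) : 1 - t * z ≠ 0 := by
  rcases ht.eq_or_lt with rfl | ht
  · simp
  · exact sub_ne_zero.2 fun h => ne_ofReal (mul_im_ne_zero hz ht) 1 (by simp [h])

theorem hasDerivAt_xi_ray {z : ℂ} (hz : z.im ≠ 0) {t : ℝ} (ht : 0 ≤ t) :
    HasDerivAt (fun s : ℝ => xi (s * z)) (2 / (1 - t * z) ^ 2 * z) t := by
  have h3 : HasDerivAt (fun s : ℂ => s *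
    z) z t := by simpa using (hasDerivAt_id (t : ℂ)).mul_const z
  exact ((hasDerivAt_xi (sub_ne_zero.1 (one_sub_ray_ne_zero hz ht)).symm).comp (t : ℂ)
    h3).comp_ofReal

/-- A form `g dX` that is continuous at both ends of the ray is integrable, since `dX / dt` is `O((1
+ t)⁻²)`. -/
theorem integrableOn_xi_ray {g : ℂ → ℂ} {z : ℂ} (hz : z.im ≠ 0) (g1 : ContinuousAt g 1)
    (g2 : ContinuousAt g (-1)) (hg : ∀ t : ℝ, 0 < t → ContinuousAt g (xi (t * z))) :
    IntegrableOn (fun t : ℝ => g (xi (t * z)) * jac (t * z) * z) (Set.Ioi 0) := by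
  have hne : ∀ t : ℝ, 0 ≤ t → 1 - t * z ≠ 0 := fun t ht => one_sub_ray_ne_zero hz ht
  have hcont : ContinuousOn (fun t : ℝ => g (xi (t * z)) * jac (t * z) * z) (Set.Ioi 0) := by
    intro t ht
    have e1 : ContinuousAt (fun s : ℝ => g (xi (s * z))) t :=
      (hg t ht).comp (f := fun s : ℝ => xi (s * z)) (hasDerivAt_xi_ray hz
        (le_of_lt ht)).continuousAt
    have e2 : ContinuousAt (fun s : ℝ => jac (s * z)) t := by
      unfold jac
      refine ((hasDerivAt_xi_ray hz (le_of_lt ht)).continuousAt.const_mul 4).div (by fun_prop)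
        (pow_ne_zero 2 (hne t (le_of_lt ht)))
    exact ((e1.mul e2).mul_const z).continuousWithinAt
  -- the ray, completed by its two ends, is compact
  obtain ⟨M, hM⟩ : ∃ M, ∀ t : ℝ, 0 < t → ‖g (xi (t * z)) * xi (t * z)‖ ≤ M := by
    have hden : ∀ θ ∈ Set.Icc (0 : ℝ) 1, (1 - θ : ℂ) - θ * z ≠ 0 := by
      intro θ hθ h0
      have h3 := congrArg Complex.im h0
      simp only [Complex.sub_im, Complex.one_im, Complex.ofReal_im, sub_zero, Complex.mul_im,
        Complex.ofReal_re, zero_mul, add_zero, zero_sub, Complex.zero_im, neg_eq_zero,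
        mul_eq_zero] at h3
      rcases h3 with rfl | h3
      · simp at h0
      · exact hz h3
    have harc : ∀ θ ∈ Set.Icc (0 : ℝ) 1, ContinuousAt
        (fun θ : ℝ => ((1 - θ : ℂ) + θ * z) / ((1 - θ : ℂ) - θ * z)) θ := fun θ hθ =>
      ContinuousAt.div (by fun_prop) (by fun_prop) (hden θ hθ)
    have harc' : ContinuousOn (fun θ : ℝ =>
        g (((1 - θ : ℂ) + θ * z) / ((1 - θ : ℂ) - θ * z)) *
          (((1 - θ : ℂ) + θ * z) / ((1 - θ : ℂ) - θ * z))) (Set.Icc 0 1) := by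
      intro θ hθ
      refine (ContinuousAt.mul (ContinuousAt.comp (g := g) ?_ (harc θ hθ))
        (harc θ hθ)).continuousWithinAt
      rcases hθ.1.eq_or_lt with rfl | h3
      · simpa using g1
      rcases hθ.2.eq_or_lt with rfl | h4
      · have hz0 : z ≠ 0 := by simpa using ne_ofReal hz 0
        simpa [div_neg, div_self hz0] using g2
      · have h5 := hg (θ / (1 - θ)) (div_pos h3 (by linarith))
        have h6 : xi ((θ / (1 - θ) : ℝ) * z) = ((1 - θ : ℂ) + θ * z) / ((1 - θ : ℂ) - θ * z) := by
          have h7 : (1 - θ : ℂ) ≠ 0 := by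
            exact_mod_cast (sub_pos.2 h4).ne'
          have h8 := hden θ hθ
          have h9 : 1 - ((θ / (1 - θ) : ℝ) : ℂ) * z = ((1 - θ : ℂ) - θ * z) / (1 - θ) := by
            push_cast; field_simp
          rw [xi, h9]
          push_cast
          field_simp
        rwa [h6] at h5
    obtain ⟨M, hM⟩ := isCompact_Icc.exists_bound_of_continuousOn harc'
    refine ⟨M, fun t ht => ?_⟩
    have h1t : 0 < 1 + t := by linarith
    have hθ : t / (1 + t) ∈ Set.Icc (0 : ℝ) 1 :=
      ⟨by positivity, (div_le_one h1t).2 (by linarith)⟩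
    have h3 := hM _ hθ
    have h4 : ((1 - (t / (1 + t) : ℝ) : ℂ) + (t / (1 + t) : ℝ) * z) /
        ((1 - (t / (1 + t) : ℝ) : ℂ) - (t / (1 + t) : ℝ) * z) = xi (t * z) := by
      have h5 : (1 + t : ℂ) ≠ 0 := by exact_mod_cast h1t.ne'
      have h6 : (1 - (t / (1 + t) : ℝ) : ℂ) + (t / (1 + t) : ℝ) * z = (1 + t * z) / (1 + t) := by
        push_cast; field_simp; ring
      have h7 : (1 - (t / (1 + t) : ℝ) : ℂ) - (t / (1 + t) : ℝ) * z = (1 - t * z) / (1 + t) := by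
        push_cast; field_simp; ring
      rw [h6, h7, div_div_div_cancel_right₀ h5, xi]
    rwa [h4] at h3
  obtain ⟨c, hc, hb⟩ := exists_ray_bound (ζ₀ := z) fun r _ => ne_ofReal hz r
  refine Integrable.mono' ((integrable_inv_one_add_sq.const_mul
    (M * 4 * ‖z‖ / c ^ 2)).integrableOn) (hcont.aestronglyMeasurable measurableSet_Ioi) ?_
  refine (ae_restrict_iff' measurableSet_Ioi).2 (Eventually.of_forall fun t ht => ?_)
  have ht0 : 0 < t := ht
  have h3 := hb.self_of_nhds t ht0.le
  have h4 : g (xi (t * z)) * jac (t * z) * z =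
      (g (xi (t * z)) * xi (t * z)) * (4 * z / (1 - t * z) ^ 2) := by
    rw [jac]
    ring
  have hn4 : ‖(4 : ℂ)‖ = 4 := by norm_num
  rw [h4, norm_mul, norm_div, norm_pow, norm_mul (4 : ℂ), hn4]
  have h5 : c ^ 2 * (1 + t ^ 2) ≤ ‖1 - t * z‖ ^ 2 := by
    have := pow_le_pow_left₀ (by positivity) h3 2
    nlinarith [mul_pos (pow_pos hc 2) ht0]
  have h6 : 4 * ‖z‖ / ‖1 - t * z‖ ^ 2 ≤ 4 * ‖z‖ / (c ^ 2 * (1 + t ^ 2)) :=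
    div_le_div_of_nonneg_left (by positivity) (by positivity) h5
  calc _ ≤ M * (4 * ‖z‖ / (c ^ 2 * (1 + t ^ 2))) :=
        mul_le_mul (hM t ht0) h6 (by positivity) ((norm_nonneg _).trans (hM t ht0))
    _ = _ := by field_simp

/-- The fundamental theorem of calculus along a ray from `∞₊` to `∞₋`, for a form `g dX` that is
regular at both ends. -/
theorem integral_xi_ray {Φ g : ℂ → ℂ} {z : ℂ} (hz : z.im ≠ 0)
    (hΦ : ∀ t : ℝ, 0 < t → HasDerivAt Φ (2 * xi (t * z) * g (xi (t * z))) (xi (t * z)))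
    (h1 : ContinuousAt Φ 1) (h2 : ContinuousAt Φ (-1)) (g1 : ContinuousAt g 1)
    (g2 : ContinuousAt g (-1)) (hg : ∀ t : ℝ, 0 < t → ContinuousAt g (xi (t * z))) :
    IntegrableOn (fun t : ℝ => g (xi (t * z)) * jac (t * z) * z) (Set.Ioi 0) ∧
    ∫ t in Set.Ioc (0 : ℝ) 1, g (xi (t * z)) * jac (t * z) * z = Φ (xi z) - Φ 1 ∧
    ∫ t in Set.Ioi (1 : ℝ), g (xi (t * z)) * jac (t * z) * z = Φ (-1) - Φ (xi z) := by
  have hint := integrableOn_xi_ray hz g1 g2 hg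
  have hd : ∀ t ∈ Set.Ioi (0 : ℝ), HasDerivAt (fun s : ℝ => Φ (xi (s * z)))
      (g (xi (t * z)) * jac (t * z) * z) t := by
    intro t ht
    refine ((hΦ t ht).scomp t (hasDerivAt_xi_ray hz (le_of_lt ht))).congr_deriv ?_
    have := one_sub_ray_ne_zero hz (le_of_lt ht)
    rw [smul_eq_mul, jac]
    field_simp
    ring
  refine ⟨hint, ?_⟩
  have h3 := integral_ray (f := fun s : ℝ => Φ (xi (s * z))) (m := Φ (-1)) ?_ hd hint
    (h2.tendsto.comp (tendsto_xi_ray hz))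
  · simpa [xi] using h3
  · refine ContinuousAt.continuousWithinAt (ContinuousAt.comp (g := Φ) ?_
      (hasDerivAt_xi_ray hz le_rfl).continuousAt)
    simpa [xi] using h1

/-! ### Integration along the divisor -/

theorem gen_ray {z : ℂ} (hz : z.im ≠ 0) {K : Multiset ℂ}
    (hK : ∀ a ∈ K, ∃ t : ℝ, 0 < t ∧ a = t * z) :
    Gen K := by
  intro a ha
  obtain ⟨t, ht, rfl⟩ := hK a ha
  have hz0 : z ≠ 0 := by simpa using ne_ofReal hz 0
  have ht0 : (t : ℂ) ≠ 0 := by exact_mod_cast ht.ne'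
  refine ⟨mul_ne_zero ht0 hz0, fun b hb h => ?_⟩
  obtain ⟨s, hs, rfl⟩ := hK b hb
  have hs0 : (s : ℂ) ≠ 0 := by exact_mod_cast hs.ne'
  refine sq_ne_ofReal hz (r := (t * s)⁻¹) (by positivity) ?_
  push_cast
  field_simp
  linear_combination h

theorem divisorIntegral_congr {ν z : ℂ} {f g : ℂ → ℂ} (h : ∀ t : ℝ, 0 < t → f (t * z) = g (t * z)) :
    divisorIntegral ν z f = divisorIntegral ν z g := by
  have h1 : ∫ t in Set.Ioc (0 : ℝ) 1, f (t * z) * z = ∫ t in Set.Ioc (0 : ℝ) 1, g (t * z) * z :=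
    setIntegral_congr_fun measurableSet_Ioc fun t ht => by simp only [h t ht.1]
  have h2 : ∫ t in Set.Ioi (1 : ℝ), f (t * z) * z = ∫ t in Set.Ioi (1 : ℝ), g (t * z) * z :=
    setIntegral_congr_fun measurableSet_Ioi fun t ht => by
      simp only [h t (one_pos.trans ht)]
  rw [divisorIntegral, divisorIntegral, h1, h2]

theorem divisorIntegral_const_mul {ν z : ℂ} (c : ℂ) (f : ℂ → ℂ) :
    divisorIntegral ν z (fun a => c * f a) =
      c * divisorIntegral ν z f := by
  simp only [divisorIntegral, mul_assoc, integral_const_mul]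
  ring

namespace LoopData

variable {D : LoopData}

/-- A stable correlator is continuous in the position of a label, also at the points over
`∞₊` and `∞₋`. -/
theorem continuousAt_label {ι : Type} [Fintype ι] (hk : 2 ≤ D.k) (hc : D.c ≠ 0) {h : ℕ}
    {J : Multiset (Slot ι)} (hJ : 1 ≤ h + J.card) (σ : Slot Unit) {p a : ℂ} {u : ι → ℂ}
    (hp : Adm false (ins p (ins a u))) :
    ContinuousAt (fun t => D.W h p (σ.map (fun _ => t) ::ₘ J.map (Slot.map u))) a := by
  have h1 := reg_W hk hc h (ι := Option ι) (σ.map (fun _ => none) ::ₘ J.map (Slot.map some))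
    (by simp; omega)
  have h2 : Reg2 false fun p a (u : ι → ℂ) =>
      D.W h p (σ.map (fun _ => a) ::ₘ J.map (Slot.map u)) := by
    refine Reg.congr h1 fun v _ => ?_
    beta_reduce
    rw [Multiset.map_cons, Multiset.map_map]
    congr 2
    · cases σ <;> rfl
    · congr 1
      funext l
      cases l <;> rfl
  obtain ⟨G, -, hG⟩ := h2.exists_hasDerivAt_snd
  exact (hG p a u hp).continuousAt

/-- Integration of a stable correlator along the divisor `D(z)` turns a point label into a divisor
label: the boundary terms cancel. The integrals converge. -/
theorem integral_label (hk : 2 ≤ D.k) (hc : D.c ≠ 0) {h : ℕ} {z z₀ : ℂ} (hz : z.im ≠ 0)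
    {K : Multiset ℂ} (hK : ∀ a ∈ z₀ ::ₘ K, ∃ t : ℝ, 0 < t ∧ a = t * z)
    (L : Multiset (Slot {a // a ∈ K}))
    (hL : 1 ≤ h + L.card) :
    IntegrableOn (fun t : ℝ => D.W h (xi z₀) (.point (xi (t * z)) ::ₘ L.map (Slot.map fun
    a : {a // a ∈ K} => xi a)) *
      jac (t * z) * z) (Set.Ioi 0) ∧
    divisorIntegral D.ν z (fun a =>
      D.W h (xi z₀) (.point (xi a) ::ₘ L.map (Slot.map fun a : {a // a ∈ K} => xi a)) * jac a) =
      D.W h (xi z₀) (.divisor (xi z) ::ₘ L.map (Slot.map fun a : {a // a ∈ K} => xi a)) := by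
  have hadm : Adm true (ins (xi z₀) fun a : {a // a ∈ K} => xi a) := adm_ins_xi (gen_ray hz hK)
  have hray : ∀ t : ℝ, 0 < t → Adm true (ins (xi z₀) (ins (xi (t * z)) fun a : {a // a ∈ K} => xi
    a)) := by
    intro t ht
    have h1 : Gen (z₀ ::ₘ (t * z) ::ₘ K) := gen_ray hz fun a ha => by
      rcases Multiset.mem_cons.1 ha with e | ha
      · exact hK a (by simp [e])
      rcases Multiset.mem_cons.1 ha with e | ha
      · exact ⟨t, ht, e⟩
      · exact hK a (by simp [ha])
    have h2 := (adm_ins_xi h1).comp (fun o : Option (Option {a // a ∈ K}) => match o with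
      | none => none
      | some none => some ⟨t * z, by simp⟩
      | some (some a) => some ⟨a, by simp [a.2]⟩)
    convert h2 using 1
    funext o
    rcases o with _ | _ | a <;> rfl
  have s1 : (1 : ℂ) ^ 2 = 1 := by norm_num
  have s2 : (-1 : ℂ) ^ 2 = 1 := by norm_num
  have key := integral_xi_ray hz
    (Φ := fun w => D.W h (xi z₀) (.divisor w ::ₘ L.map (Slot.map fun a : {a // a ∈ K} => xi a)))
    (g := fun w => D.W h (xi z₀) (.point w ::ₘ L.map (Slot.map fun a : {a // a ∈ K} => xi a)))
    (fun t ht => divDeriv hk hc h L _ _ _ (hray t ht))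
    (continuousAt_label hk hc hL (.divisor ()) (hadm.ins_ins_of_sq s1))
    (continuousAt_label hk hc hL (.divisor ()) (hadm.ins_ins_of_sq s2))
    (continuousAt_label hk hc hL (.point ()) (hadm.ins_ins_of_sq s1))
    (continuousAt_label hk hc hL (.point ()) (hadm.ins_ins_of_sq s2))
    (fun t ht => continuousAt_label hk hc hL (.point ()) (hray t ht).to_false)
  refine ⟨key.1, ?_⟩
  have hb := bdry_eq_zero hk hc h L _ _ hadm
  rw [bdry] at hb
  rw [divisorIntegral, key.2.1, key.2.2]
  linear_combination -hb

theorem points_add_replicate {K A : Multiset ℂ} (hA : ∀ a ∈ A, a ∈ K) {z : ℂ} (hz : z ∈ K) (m : ℕ) :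
    ∃ L : Multiset (Slot {a // a ∈ K}), L.card = A.card + m ∧
      points A + replicate m (.divisor (xi z)) = L.map (Slot.map fun a : {a // a ∈ K} => xi a) := by
  obtain ⟨L, h1, h2⟩ := points_eq A hA
  exact ⟨L + replicate m (.divisor ⟨z, hz⟩), by simp [h1], by simp [h2]⟩

theorem iteratedDivisorIntegral_eq (hk : 2 ≤ D.k) (hc : D.c ≠ 0) {h n : ℕ} {z z₀ : ℂ}
    (hz : z.im ≠ 0)
    (A : Multiset ℂ) (hA : ∀ a ∈ z₀ ::ₘ A, ∃ t : ℝ, 0 < t ∧ a = t * z) (hn : 2 ≤ h + A.card + n)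
    (c : ℂ)
    {f : Multiset ℂ → ℂ} (hf : ∀ J : Multiset ℂ, (∀ a ∈ J, ∃ t : ℝ, 0 < t ∧ a = t * z) → J.card = n
    →
      f J = c * D.W h (xi z₀) (points (A + J)) * (J.map jac).prod) :
    iteratedDivisorIntegral D.ν z n f =
      c * D.W h (xi z₀) (points A + replicate n (.divisor (xi z))) := by
  induction n generalizing A c f with
  | zero =>
    rw [iteratedDivisorIntegral, hf 0 (by simp) rfl]
    simp
  | succ n ih =>
    rw [iteratedDivisorIntegral]
    have h1 : ∀ t : ℝ, 0 < t → iteratedDivisorIntegral D.ν z n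
        (fun J => f ((t * z) ::ₘ J)) = c * (D.W h (xi z₀) (.point (xi (t * z)) ::ₘ
          (points A + replicate n (.divisor (xi z)))) * jac (t * z)) := by
      intro t ht
      rw [ih ((t * z) ::ₘ A) (fun a ha => ?_) (by simp; omega) (c * jac (t * z)) fun J hJ hJn => ?_]
      · rw [points_cons, Multiset.cons_add]
        ring
      · simp only [Multiset.mem_cons] at ha
        rcases ha with e | e | ha
        · exact hA a (by simp [e])
        · exact ⟨t, ht, e⟩
        · exact hA a (by simp [ha])
      · rw [hf _ (fun a ha => ?_) (by simp [hJn]), Multiset.map_cons, Multiset.prod_cons,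
          Multiset.cons_add, Multiset.add_cons]
        · ring
        · rcases Multiset.mem_cons.1 ha with e | ha
          · exact ⟨t, ht, e⟩
          · exact hJ a ha
    rw [divisorIntegral_congr (g := fun a => c * (D.W h (xi z₀) (.point (xi a) ::ₘ
          (points A + replicate n (.divisor (xi z)))) * jac a)) h1,
      divisorIntegral_const_mul]
    obtain ⟨L, hL, e⟩ := points_add_replicate (K := z ::ₘ A) (A := A)
      (fun a ha => by simp [ha]) (Multiset.mem_cons_self z A) n
    rw [e, (integral_label hk hc hz (fun a ha => ?_) L (by omega)).2, ← e, Multiset.replicate_succ,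
      Multiset.add_cons]
    simp only [Multiset.mem_cons] at ha
    rcases ha with e | e | ha
    · exact hA a (by simp [e])
    · exact ⟨1, one_pos, by simp [e]⟩
    · exact hA a (by simp [ha])

end LoopData

/-- The integrals over all but one of the arguments of a multidifferential, along the divisor. -/
theorem iteratedDivisorIntegral_omega {S : SpectralCurve} {D : LoopData} {κ : ℂ}
    (hS : Uniformised S D κ) {h n : ℕ} (hn : 2 ≤ h + n) {z : ℂ} (hz : z.im ≠ 0) {t : ℝ}
    (ht : 0 < t) :
    iteratedDivisorIntegral D.ν z n (fun J => S.omega D.Q h (t * z) J) =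
      D.W h (xi (t * z)) (replicate n (.divisor (xi z))) * jac (t * z) := by
  have hk := hS.two_le
  have h1 := LoopData.iteratedDivisorIntegral_eq (n := n) (h := h) hk hS.c_ne hz (z₀ := t * z) 0
    (fun a ha => ⟨t, ht, by simpa using ha⟩) (by simpa using hn) (jac (t * z))
    (f := fun J => S.omega D.Q h (t * z) J) fun J hJ hJn => by
      rw [omega_eq_W hS h _ J (by omega) (gen_ray hz fun a ha => ?_), zero_add]
      · ring
      · rcases Multiset.mem_cons.1 ha with e | ha
        · exact ⟨t, ht, e⟩
        · exact hJ a ha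
  rw [h1]
  simp [mul_comm]

end

/-! ### The logarithmic derivative of the wave function -/

section

open MeasureTheory

theorem hasDerivAt_pair {k : ℂ × ℂ → ℂ} {t z k₁ k₂ : ℂ} (hk : DifferentiableAt ℂ k (t * z, z))
    (h₁ : HasDerivAt (fun p => k (p, z)) k₁ (t * z))
    (h₂ : HasDerivAt (fun a => k (t * z, a)) k₂ z) :
    HasDerivAt (fun z => k (t * z, z)) (t * k₁ + k₂) z := by
  have h := hk.hasFDerivAt
  set L := fderiv ℂ k (t * z, z) with hL
  have e1 : L (1, 0) = k₁ := by
    have h3 : HasDerivAt (fun p : ℂ => (p, z)) ((1 : ℂ), (0 : ℂ)) (t * z) :=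
      (hasDerivAt_id _).prodMk (hasDerivAt_const _ _)
    exact (h.comp_hasDerivAt (t * z) h3).unique h₁
  have e2 : L (0, 1) = k₂ := by
    have h3 : HasDerivAt (fun a : ℂ => (t * z, a)) ((0 : ℂ), (1 : ℂ)) z :=
      (hasDerivAt_const _ _).prodMk (hasDerivAt_id _)
    exact (h.comp_hasDerivAt z h3).unique h₂
  have h3 : HasDerivAt (fun z : ℂ => (t * z, z)) (t, (1 : ℂ)) z := by
    refine HasDerivAt.prodMk ?_ (hasDerivAt_id _)
    simpa using (hasDerivAt_id z).const_mul t
  refine (HasFDerivAt.comp_hasDerivAt (f := fun z : ℂ => (t * z, z)) z h h3).congr_deriv ?_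
  have e3 : ((t, 1) : ℂ × ℂ) = t • ((1 : ℂ), (0 : ℂ)) + ((0 : ℂ), (1 : ℂ)) := by simp
  rw [e3, map_add, map_smul, e1, e2, smul_eq_mul]

/-- Differentiation under the integral sign for a holomorphic family with an integrable bound; the
bound on the derivatives comes from Cauchy's estimate. -/
theorem hasDerivAt_integral_of_bound {F : ℂ → ℝ → ℂ} {z₀ : ℂ} {ρ : ℝ} (hρ : 0 < ρ) {bd : ℝ → ℝ}
    {s : Set ℝ} (hs : MeasurableSet s) (hbd : IntegrableOn bd s)
    (hF : ∀ z ∈ Metric.ball z₀ ρ, ContinuousOn (F z) s)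
    (hd : ∀ t ∈ s, DifferentiableOn ℂ (fun z => F z t) (Metric.ball z₀ ρ))
    (hb : ∀ t ∈ s, ∀ z ∈ Metric.ball z₀ ρ, ‖F z t‖ ≤ bd t) {F' : ℝ → ℂ}
    (hF' : ∀ t ∈ s, HasDerivAt (fun z => F z t) (F' t) z₀) :
    IntegrableOn F' s ∧ HasDerivAt (fun z => ∫ t in s, F z t) (∫ t in s, F' t) z₀ := by
  have hz₀ : z₀ ∈ Metric.ball z₀ ρ := Metric.mem_ball_self hρ
  have hm : ∀ z ∈ Metric.ball z₀ ρ, AEStronglyMeasurable (F z) (volume.restrict s) :=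
    fun z hz => (hF z hz).aestronglyMeasurable hs
  have hF'm : AEStronglyMeasurable (fun t => deriv (fun z => F z t) z₀) (volume.restrict s) := by
    have h1 : Tendsto (fun n : ℕ => ((ρ / 2 / ((n : ℝ) + 1) : ℝ) : ℂ)) atTop (𝓝[≠] 0) := by
      refine tendsto_nhdsWithin_iff.2 ⟨(Complex.continuous_ofReal.tendsto' 0 0 (by simp)).comp ?_,
        Eventually.of_forall fun n => ?_⟩
      · have := (tendsto_one_div_add_atTop_nhds_zero_nat (𝕜 := ℝ)).const_mul (ρ / 2)
        simpa [div_eq_mul_inv] using this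
      · have : ρ / 2 / ((n : ℝ) + 1) ≠ 0 := by positivity
        exact Complex.ofReal_ne_zero.2 this
    refine aestronglyMeasurable_of_tendsto_ae atTop (f := fun n : ℕ =>
      (((ρ / 2 / ((n : ℝ) + 1) : ℝ) : ℂ))⁻¹ • (F (z₀ + ((ρ / 2 / ((n : ℝ) + 1) : ℝ) : ℂ)) - F z₀))
      (fun n => ((hm _ ?_).sub (hm _ hz₀)).const_smul _) ?_
    · rw [Metric.mem_ball, dist_self_add_left, Complex.norm_real, Real.norm_of_nonneg
      (by positivity)]
      have h2 : ρ / 2 / ((n : ℝ) + 1) ≤ ρ / 2 :=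
        div_le_self (by positivity) (by linarith [Nat.cast_nonneg (α := ℝ) n])
      linarith
    · refine (ae_restrict_iff' hs).2 (Eventually.of_forall fun t ht => ?_)
      have h2 := (hF' t ht).differentiableAt.hasDerivAt.tendsto_slope_zero
      exact h2.comp h1
  have key := hasDerivAt_integral_of_dominated_loc_of_deriv_le (μ := volume.restrict s)
    (F := F) (F' := fun z t => deriv (fun z => F z t) z) (x₀ := z₀) (bound := fun t => bd t /
      (ρ / 2))
    (Metric.ball_mem_nhds z₀ (half_pos hρ))
    (by filter_upwards [Metric.ball_mem_nhds z₀ hρ] with z hz using hm z hz)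
    (Integrable.mono' hbd (hm z₀ hz₀) ((ae_restrict_iff' hs).2
      (Eventually.of_forall fun t ht => hb t ht z₀ hz₀)))
    hF'm
    ((ae_restrict_iff' hs).2 (Eventually.of_forall fun t ht z hz => by
      have hsub : Metric.closedBall z (ρ / 2) ⊆ Metric.ball z₀ ρ :=
        Metric.closedBall_subset_ball' (by linarith [Metric.mem_ball.1 hz])
      exact Complex.norm_deriv_le_of_forall_mem_sphere_norm_le (half_pos hρ)
        ((hd t ht).diffContOnCl_ball hsub) fun w hw =>
          hb t ht w (hsub (Metric.sphere_subset_closedBall hw))))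
    (hbd.div_const _)
    ((ae_restrict_iff' hs).2 (Eventually.of_forall fun t ht z hz =>
      ((hd t ht).differentiableAt (Metric.isOpen_ball.mem_nhds
        (Metric.ball_subset_ball (by linarith) hz))).hasDerivAt))
  have hcongr : ∀ t ∈ s, deriv (fun z => F z t) z₀ = F' t := fun t ht => (hF' t ht).deriv
  refine ⟨IntegrableOn.congr_fun key.1 hcongr hs, ?_⟩
  rw [← setIntegral_congr_fun hs hcongr]
  exact key.2

/-- On a neighbourhood of a point off the real axis, a regular function of two points is bounded
along the rays. -/
theorem exists_bound_ray {F : (Option Unit → ℂ) → ℂ} (hF : Reg false F) {z₀ : ℂ} (hz₀ : z₀.im ≠ 0) :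
    ∃ ρ : ℝ, 0 < ρ ∧ ∃ C : ℝ, ∀ z ∈ Metric.ball z₀ ρ, z.im ≠ 0 ∧ ∀ t : ℝ, 0 ≤ t →
      ‖F (ins (xi (t * z)) fun _ => xi z) * jac (t * z) * z‖ ≤ C * (1 + t ^ 2)⁻¹ := by
  obtain ⟨c₁, hc₁, b₁⟩ := exists_ray_bound (ζ₀ := z₀) fun r _ => ne_ofReal hz₀ r
  obtain ⟨c₂, hc₂, b₂⟩ := exists_ray_bound (ζ₀ := -z₀) fun r _ => ne_ofReal (by simpa using hz₀) r
  obtain ⟨c₃, hc₃, b₃⟩ := exists_ray_bound (ζ₀ := z₀ * z₀) fun r hr => sq_ne_ofReal hz₀ hr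
  set B := ‖z₀‖ + 1 with hB
  have hB0 : 0 < B := by positivity
  -- `N` bounds `ξ` on the ray; `δ` bounds the sums of two coordinates, the possible denominators,
  -- from below
  set N := (1 + B) / c₁ with hN
  set δ := min (2 * c₂ / (1 + B)) (2 * c₃ / (1 + B) ^ 2) with hδ
  have hδ0 : 0 < δ := lt_min (by positivity) (by positivity)
  obtain ⟨M, hM⟩ := hF.exists_bound N δ hδ0
  have hev : ∀ᶠ z : ℂ in 𝓝 z₀, z.im ≠ 0 ∧ ‖z‖ < B ∧ (∀ t : ℝ, 0 ≤ t → c₁ * (1 + t) ≤ ‖1 - t * z‖) ∧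
      (∀ t : ℝ, 0 ≤ t → c₂ * (1 + t) ≤ ‖1 - t * -z‖) ∧
      ∀ t : ℝ, 0 ≤ t → c₃ * (1 + t) ≤ ‖1 - t * (z * z)‖ := by
    have h1 : ∀ᶠ z : ℂ in 𝓝 z₀, z.im ≠ 0 := Complex.continuous_im.continuousAt.eventually_ne hz₀
    have h2 : ∀ᶠ z : ℂ in 𝓝 z₀, ‖z‖ < B :=
      continuous_norm.continuousAt.eventually_lt continuousAt_const (by simp [hB])
    have h3 := continuous_neg.continuousAt.eventually b₂
    have h4 := (by fun_prop : ContinuousAt (fun z : ℂ => z * z) z₀).eventually b₃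
    filter_upwards [h1, h2, b₁, h3, h4] with z a1 a2 a3 a4 a5 using ⟨a1, a2, a3, a4, a5⟩
  obtain ⟨ρ, hρ, hball⟩ := Metric.eventually_nhds_iff_ball.1 hev
  refine ⟨ρ, hρ, M * (4 * N * B / c₁ ^ 2), fun z hz => ?_⟩
  obtain ⟨him, hzB, e1, e2, e3⟩ := hball z hz
  refine ⟨him, fun t ht => ?_⟩
  have up : ∀ s : ℝ, 0 ≤ s → ‖1 + s * z‖ ≤ (1 + s) * (1 + B) ∧ ‖1 - s * z‖ ≤ (1 + s) * (1 + B) := by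
    intro s hs
    have h1 : ‖(s : ℂ) * z‖ ≤ s * B := by
      rw [norm_mul, Complex.norm_real, Real.norm_of_nonneg hs]
      exact mul_le_mul_of_nonneg_left hzB.le hs
    have h2 := norm_add_le (1 : ℂ) (s * z)
    have h3 := norm_sub_le (1 : ℂ) (s * z)
    rw [norm_one] at h2 h3
    constructor <;> nlinarith
  have hpos : ∀ s : ℝ, 0 ≤ s → 0 < ‖1 - s * z‖ := fun s hs =>
    (mul_pos hc₁ (by linarith)).trans_le (e1 s hs)
  have hxi : ∀ s : ℝ, 0 ≤ s → ‖xi (s * z)‖ ≤ N ∧ 2 * c₂ / (1 + B) ≤ ‖xi (s * z) + xi (s * z)‖ := by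
    intro s hs
    have h1 : 0 < 1 + s := by linarith
    have h2 := hpos s hs
    constructor
    · rw [xi, norm_div, div_le_iff₀ h2, hN]
      calc _ ≤ (1 + s) * (1 + B) := (up s hs).1
        _ = (1 + B) / c₁ * (c₁ * (1 + s)) := by field_simp
        _ ≤ _ := mul_le_mul_of_nonneg_left (e1 s hs) (by positivity)
    · have h3 : xi (s * z) + xi (s * z) = 2 * (1 - s * -z) / (1 - s * z) := by rw [xi]; ring
      rw [h3, norm_div, norm_mul, Complex.norm_two, le_div_iff₀ h2, div_mul_eq_mul_div,
        div_le_iff₀ (by positivity)]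
      have h4 := e2 s hs
      have h5 := (up s hs).2
      calc _ ≤ 2 * c₂ * ((1 + s) * (1 + B)) := mul_le_mul_of_nonneg_left h5 (by positivity)
        _ = 2 * (c₂ * (1 + s)) * (1 + B) := by ring
        _ ≤ _ := by gcongr
  have hmix : 2 * c₃ / (1 + B) ^ 2 ≤ ‖xi (t * z) + xi z‖ := by
    have h2 := hpos t ht
    have h3 := hpos 1 zero_le_one
    have h4 : (1 : ℂ) - t * z ≠ 0 := norm_pos_iff.1 h2
    have h5 : (1 : ℂ) - z ≠ 0 := by simpa using norm_pos_iff.1 h3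
    rw [xi_add_xi (sub_ne_zero.1 h4).symm (sub_ne_zero.1 h5).symm, mul_assoc (t : ℂ), norm_div,
      norm_mul, norm_mul, Complex.norm_two]
    have h6 := up t ht
    have h7 : ‖1 - z‖ ≤ 1 + B := by
      have := norm_sub_le (1 : ℂ) z
      rw [norm_one] at this
      linarith
    have h8 : 0 < ‖1 - z‖ := norm_pos_iff.2 h5
    rw [le_div_iff₀ (mul_pos h2 h8), div_mul_eq_mul_div, div_le_iff₀ (by positivity)]
    have h9 := e3 t ht
    calc _ ≤ 2 * c₃ * ((1 + t) * (1 + B) * (1 + B)) := by gcongr; exact h6.2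
      _ = 2 * (c₃ * (1 + t)) * (1 + B) ^ 2 := by ring
      _ ≤ _ := by gcongr
  have hx1 := hxi t ht
  have hx2 := hxi 1 zero_le_one
  simp only [Complex.ofReal_one, one_mul] at hx2
  have hFb := hM (ins (xi (t * z)) fun _ => xi z)
    (by rintro (_ | _); exacts [hx1.1, hx2.1])
    (by
      rintro (_ | _) (_ | _)
      · exact (min_le_left _ _).trans hx1.2
      · exact (min_le_right _ _).trans hmix
      · exact (min_le_right _ _).trans (hmix.trans_eq (by rw [add_comm]; rfl))
      · exact (min_le_left _ _).trans hx2.2)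
  have hM0 : 0 ≤ M := (norm_nonneg _).trans hFb
  have hj : ‖jac (t * z)‖ ≤ 4 * N / (c₁ ^ 2 * (1 + t ^ 2)) := by
    rw [jac, norm_div, norm_mul, norm_pow, show ‖(4 : ℂ)‖ = 4 by norm_num]
    have h5 : c₁ ^ 2 * (1 + t ^ 2) ≤ ‖1 - t * z‖ ^ 2 := by
      have := pow_le_pow_left₀ (by positivity) (e1 t ht) 2
      nlinarith [mul_nonneg (pow_pos hc₁ 2).le ht]
    have := hx1.1
    gcongr
  have hN0 : 0 ≤ N := by positivity
  calc _ = ‖F (ins (xi (t * z)) fun _ => xi z)‖ * ‖jac (t * z)‖ * ‖z‖ := by rw [norm_mul, norm_mul]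
    _ ≤ M * (4 * N / (c₁ ^ 2 * (1 + t ^ 2))) * B := by gcongr
    _ = _ := by field_simp

end

/-! ### The wave function and the solution of the Riccati equation -/

section

open MeasureTheory

namespace LoopData
open LabelSeries

variable {D : LoopData}

theorem adm_ray {z : ℂ} (hz : z.im ≠ 0) {t : ℝ} (ht : 0 < t) :
    Adm true (ins (xi (t * z)) fun _ : Unit => xi z) := by
  have h1 : Gen ((t * z) ::ₘ {z}) := gen_ray hz fun a ha => by
    simp only [Multiset.mem_cons, Multiset.mem_singleton] at ha
    rcases ha with e | e
    · exact ⟨t, ht, e⟩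
    · exact ⟨1, one_pos, by simp [e]⟩
  convert (adm_ins_xi h1).comp fun o : Option Unit => o.map fun _ => ⟨z, by simp⟩ using 1
  funext o
  cases o <;> rfl

variable (D) in
/-- A correlator with all but the first argument integrated along `D(z)`, as a form in `p`. -/
def partInt (h m : ℕ) (v : ℂ × ℂ) : ℂ :=
  D.W h (xi v.1) (replicate m (.divisor (xi v.2))) * jac v.1

theorem differentiableAt_partInt (hk : 2 ≤ D.k) (hc : D.c ≠ 0) {h m : ℕ} (hm : 2 ≤ h + m) {p z : ℂ}
    (hp1 : p ≠ 1) (hz1 : z ≠ 1) (hp : Adm false (ins (xi p) fun _ : Unit => xi z)) :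
    DifferentiableAt ℂ (D.partInt h m) (p, z) := by
  have hR := reg_W hk hc h (replicate m (.divisor ()) : Multiset (Slot Unit)) (by simpa using hm)
  have h1 := (Reg.differentiableAt hR hp).hasFDerivAt.differentiableAt
  have h2 : DifferentiableAt ℂ (fun v : ℂ × ℂ => ins (xi v.1) fun _ : Unit => xi v.2) (p, z) := by
    refine differentiableAt_pi.2 fun o => ?_
    cases o
    · exact DifferentiableAt.comp (f := Prod.fst) (p, z) (hasDerivAt_xi
      hp1).differentiableAt differentiableAt_fst
    · exact DifferentiableAt.comp (f := Prod.snd) (p, z) (hasDerivAt_xi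
      hz1).differentiableAt differentiableAt_snd
  have h3 : DifferentiableAt ℂ jac p := by
    unfold jac
    exact ((hasDerivAt_xi hp1).differentiableAt.const_mul 4).div (by fun_prop)
      (pow_ne_zero 2 (sub_ne_zero.2 hp1.symm))
  have h4 := (DifferentiableAt.comp (p, z) h1 h2).mul (DifferentiableAt.comp (f := Prod.fst) (p, z)
    h3 differentiableAt_fst)
  refine h4.congr_of_eventuallyEq (Eventually.of_forall fun v => ?_)
  simp [partInt, ins]

/-- The derivative in the end point of the integrals along `D(z)`. By symmetry of the correlators
all `m + 1` integrations contribute equally. -/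
theorem hasDerivAt_divisorIntegral_partInt (hk : D.k = 2 ∨ D.k = 3) (hc : D.c ≠ 0) {h m : ℕ}
    (hm : 2 ≤ h + m) {z₀ : ℂ} (hz₀ : z₀.im ≠ 0) :
    HasDerivAt (fun z => divisorIntegral D.ν z fun a => D.partInt h m (a, z))
      ((m + 1) * D.partInt h m (z₀, z₀)) z₀ := by
  have hk' : 2 ≤ D.k := by rcases hk with h | h <;> omega
  have hne : ∀ {z : ℂ}, z.im ≠ 0 → z ≠ 1 := fun h h0 => ne_ofReal h 1 (by simpa using h0)
  have hdiff : ∀ {z : ℂ}, z.im ≠ 0 → ∀ t : ℝ, 0 < t → DifferentiableAt ℂ (D.partInt h m) (t * z,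
    z) :=
    fun hz t ht => differentiableAt_partInt hk' hc hm (hne (mul_im_ne_zero hz ht)) (hne hz)
      (adm_ray hz ht).to_false
  obtain ⟨ρ, hρ, C, hC⟩ := exists_bound_ray
    (reg_W hk' hc h (replicate m (.divisor ()) : Multiset (Slot Unit)) (by simpa using hm)) hz₀
  have hbd : ∀ z ∈ Metric.ball z₀ ρ, ∀ t : ℝ, 0 ≤ t →
      ‖D.partInt h m (t * z, z) * z‖ ≤ C * (1 + t ^ 2)⁻¹ := fun z hz t ht => by
    have := (hC z hz).2 t ht
    simpa [partInt, ins] using this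
  -- the derivative in the second argument
  set M : ℂ := m * jac z₀ with hM
  set κ₂ : ℝ → ℂ := fun t => D.W h (xi z₀) (.point (xi (t * z₀)) ::ₘ
    replicate (m - 1) (.divisor (xi z₀))) * jac (t * z₀) with hκ₂
  have hk₂ : ∀ t : ℝ, 0 < t → HasDerivAt (fun a => D.partInt h m (t * z₀, a)) (M * κ₂ t) z₀ := by
    intro t ht
    have ha := adm_ray hz₀ ht
    have ha2 : Adm true (ins (xi (t * z₀)) (ins (xi z₀) (Empty.elim : Empty → ℂ))) := by
      convert ha.comp (fun o : Option (Option Empty) => o.map fun _ => ()) using 1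
      funext o
      rcases o with _ | _ | a
      · rfl
      · rfl
      · exact a.elim
    have h1 := hasDerivAt_replicate_divisor hk' hc h m (0 : Multiset (Slot Empty)) ha2
    have h2 := (h1.comp z₀ (hasDerivAt_xi (hne hz₀))).mul_const (jac (t * z₀))
    have hs : D.W h (xi (t * z₀)) (.point (xi z₀) ::ₘ replicate (m - 1) (.divisor (xi z₀))) =
        D.W h (xi z₀) (.point (xi (t * z₀)) ::ₘ replicate (m - 1) (.divisor (xi z₀))) := by
      have ha3 : Adm true (ins (xi (t * z₀)) (ins (xi z₀) fun _ : Unit => xi z₀)) := by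
        convert ha.comp (fun o : Option (Option Unit) => o.map fun _ => ()) using 1
        funext o
        rcases o with _ | _ | a <;> rfl
      simpa using W_symm hk hc h (replicate (m - 1) (.divisor ())) ha3
    simp only [Multiset.map_zero, add_zero, hs] at h2
    refine h2.congr_deriv ?_
    have : 1 - z₀ ≠ 0 := sub_ne_zero.2 (hne hz₀).symm
    simp only [hM, hκ₂, jac]
    field_simp
    ring
  have hI : m ≠ 0 → IntegrableOn (fun t : ℝ => κ₂ t * z₀) (Set.Ioi 0) ∧
      divisorIntegral D.ν z₀ (fun a => D.W h (xi z₀) (.point (xi a) ::ₘ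
        replicate (m - 1) (.divisor (xi z₀))) * jac a) =
      D.W h (xi z₀) (replicate m (.divisor (xi z₀))) := by
    intro hm0
    have h1 := integral_label hk' hc (h := h) hz₀ (z₀ := z₀) (K := {z₀}) (fun a ha =>
      ⟨1, one_pos, by
      simpa using ha⟩) (replicate (m - 1) (.divisor ⟨z₀, by simp⟩)) (by simp; omega)
    simp only [Multiset.map_replicate, Slot.map_divisor] at h1
    refine ⟨h1.1, h1.2.trans ?_⟩
    rw [← Multiset.replicate_succ, Nat.sub_add_cancel (by omega)]
  have hI₂ : IntegrableOn (fun t : ℝ => M * (κ₂ t * z₀)) (Set.Ioi 0) := by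
    by_cases hm0 : m = 0
    · simp [hM, hm0]
    · exact (hI hm0).1.const_mul M
  have hI₃ : (1 + D.ν) / 2 * (∫ t in Set.Ioc (0 : ℝ) 1, M * (κ₂ t * z₀)) + (1 - D.ν) / 2 *
      (-∫ t in Set.Ioi (1 : ℝ), M * (κ₂ t * z₀)) = m * D.partInt h m (z₀, z₀) := by
    by_cases hm0 : m = 0
    · simp [hM, hm0]
    · have h1 := (hI hm0).2
      rw [divisorIntegral] at h1
      rw [integral_const_mul, integral_const_mul, partInt, hM]
      linear_combination m * jac z₀ * h1
  -- the derivative in the first argument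
  have hk₁ : ∀ t : ℝ, 0 < t → HasDerivAt (fun p => D.partInt h m (p, z₀))
      (deriv (fun p => D.partInt h m (p, z₀)) (t * z₀)) (t * z₀) := fun t ht => by
    have h1 : DifferentiableAt ℂ (fun p : ℂ => (p, z₀)) (t * z₀) :=
      differentiableAt_id.prodMk (differentiableAt_const _)
    exact (DifferentiableAt.comp (t * z₀ : ℂ) (hdiff hz₀ t ht) h1).hasDerivAt
  set k₁ : ℝ → ℂ := fun t => deriv (fun p => D.partInt h m (p, z₀)) (t * z₀) with hk₁'
  set e' : ℝ → ℂ := fun t => D.partInt h m (t * z₀, z₀) + t * (k₁ t * z₀) with he'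
  have hF' : ∀ t ∈ Set.Ioi (0 : ℝ), HasDerivAt (fun z => D.partInt h m (t * z, z) * z)
      (e' t + M * (κ₂ t * z₀)) z₀ := by
    intro t ht
    have h1 := (hasDerivAt_pair (hdiff hz₀ t ht) (hk₁ t ht) (hk₂ t ht)).mul (hasDerivAt_id z₀)
    refine h1.congr_deriv ?_
    simp only [he', id, hk₁']
    ring
  have key : ∀ s : Set ℝ, s ⊆ Set.Ioi 0 → MeasurableSet s → IntegrableOn (fun t =>
      e' t + M * (κ₂ t * z₀)) s ∧ HasDerivAt (fun z => ∫ t in s, D.partInt h m (t * z, z) * z)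
        (∫ t in s, (e' t + M * (κ₂ t * z₀))) z₀ := by
    intro s hs hsm
    refine hasDerivAt_integral_of_bound hρ hsm
      ((integrable_inv_one_add_sq.const_mul C).integrableOn) (fun z hz t ht => ?_)
      (fun t ht z hz => ?_) (fun t ht z hz => hbd z hz t (le_of_lt (hs ht))) fun t ht => hF' t (hs
        ht)
    · have h1 : ContinuousAt (fun t : ℝ => ((t * z : ℂ), z)) t := by fun_prop
      exact ((ContinuousAt.comp (f := fun t : ℝ => ((t * z : ℂ), z))
        (hdiff (hC z hz).1 t (hs ht)).continuousAt
        h1).mul_const z).continuousWithinAt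
    · have h1 : DifferentiableAt ℂ (fun z : ℂ => ((t * z : ℂ), z)) z := by fun_prop
      exact ((DifferentiableAt.comp (f := fun z : ℂ => ((t * z : ℂ), z)) z
        (hdiff (hC z hz).1 t (hs ht)) h1).mul
        differentiableAt_id).differentiableWithinAt
  -- the total derivative along the ray
  have hz0 : z₀ ≠ 0 := by simpa using ne_ofReal hz₀ 0
  have hie : IntegrableOn e' (Set.Ioi 0) := by
    have := (key _ subset_rfl measurableSet_Ioi).1.sub hI₂
    refine this.congr (Eventually.of_forall fun t => ?_)
    simp
  have hde : ∀ t ∈ Set.Ioi (0 : ℝ), HasDerivAt (fun t : ℝ => (t : ℂ) * D.partInt h m (t * z₀, z₀))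
      (e' t) t := by
    intro t ht
    have h1 : HasDerivAt (fun s : ℂ => s * z₀) z₀ (t : ℂ) := by
      simpa using (hasDerivAt_id (t : ℂ)).mul_const z₀
    have h2 := ((hasDerivAt_id (t : ℂ)).mul (HasDerivAt.comp (t : ℂ) (hk₁ t ht) h1)).comp_ofReal
    refine h2.congr_deriv ?_
    simp [he', hk₁']
  have hnorm : ∀ t : ℝ, 0 ≤ t → ‖(t : ℂ) * D.partInt h m (t * z₀, z₀)‖ ≤
      C / ‖z₀‖ * (t * (1 + t ^ 2)⁻¹) := by
    intro t ht
    have h1 := hbd z₀ (Metric.mem_ball_self hρ) t ht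
    have h2 : 0 < ‖z₀‖ := norm_pos_iff.2 hz0
    rw [norm_mul] at h1
    rw [norm_mul, Complex.norm_real, Real.norm_of_nonneg ht]
    calc _ = t / ‖z₀‖ * (‖D.partInt h m (t * z₀, z₀)‖ * ‖z₀‖) := by field_simp
      _ ≤ t / ‖z₀‖ * (C * (1 + t ^ 2)⁻¹) := by gcongr
      _ = _ := by ring
  have hray := integral_ray (f := fun t : ℝ => (t : ℂ) * D.partInt h m (t * z₀, z₀)) (m := 0)
    (by
      rw [ContinuousWithinAt, Complex.ofReal_zero, zero_mul]
      refine squeeze_zero_norm' (a := fun t : ℝ => C / ‖z₀‖ * (t * (1 + t ^ 2)⁻¹)) ?_ ?_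
      · filter_upwards [self_mem_nhdsWithin] with t ht using hnorm t ht
      · refine (Continuous.tendsto' ?_ 0 0 (by simp)).mono_left nhdsWithin_le_nhds
        exact continuous_const.mul (continuous_id.mul ((by fun_prop : Continuous fun t : ℝ =>
          1 + t ^ 2).inv₀ fun t => by positivity))) hde hie (by
      refine squeeze_zero_norm' (a := fun t : ℝ => C / ‖z₀‖ * t⁻¹) ?_ ?_
      · filter_upwards [eventually_gt_atTop 0] with t ht
        refine (hnorm t ht.le).trans ?_
        have hC0 : 0 ≤ C := by
          have := (norm_nonneg _).trans (hbd z₀ (Metric.mem_ball_self hρ) 0 le_rfl)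
          simpa using this
        have : t * (1 + t ^ 2)⁻¹ ≤ t⁻¹ := by
          rw [← div_eq_mul_inv, ← one_div, div_le_div_iff₀ (by positivity) ht]
          nlinarith
        gcongr
      · simpa using tendsto_inv_atTop_zero.const_mul (C / ‖z₀‖))
  have d1 := (key (Set.Ioc 0 1) Set.Ioc_subset_Ioi_self measurableSet_Ioc).2
  have d2 := (key (Set.Ioi 1) (Set.Ioi_subset_Ioi zero_le_one) measurableSet_Ioi).2
  rw [integral_add (hie.mono_set Set.Ioc_subset_Ioi_self) (hI₂.mono_set Set.Ioc_subset_Ioi_self),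
    hray.1] at d1
  rw [integral_add (hie.mono_set (Set.Ioi_subset_Ioi zero_le_one))
    (hI₂.mono_set (Set.Ioi_subset_Ioi zero_le_one)), hray.2] at d2
  refine ((d1.const_mul ((1 + D.ν) / 2)).add (d2.neg.const_mul ((1 - D.ν) / 2))).congr_deriv ?_
  rw [Complex.ofReal_one, Complex.ofReal_zero, one_mul, one_mul]
  linear_combination hI₃

theorem coeff_U (b : ℂ) {j : ℕ} (hj : 1 ≤ j) (w : ℂ) : PowerSeries.coeff j (D.U b w) =
    ∑ m ∈ Finset.range (j + 1), D.W (j - m) w (replicate m (.divisor w)) /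
      (b ^ m * (m.factorial : ℂ)) := by
  rw [U, coeff_eval, ← Finset.Nat.sum_antidiagonal_eq_sum_range_succ
    (fun m h => D.W h w (replicate m (.divisor w)) / (b ^ m * (m.factorial : ℂ))),
    ← Finset.Nat.sum_antidiagonal_swap]
  refine Finset.sum_congr rfl fun m hm => ?_
  have hm := mem_antidiagonal.1 hm
  rw [onePoint, cf_add, cf_C_pos _ (by simp; omega), corr, cf_gen, add_zero, zero_add]
  simp [divisors]

end LoopData

/-- The coefficients of the logarithmic derivative of the wave function. -/
theorem logDerivPsi_eq {S : SpectralCurve} {D : LoopData} {κ b : ℂ} (hS : Uniformised S D κ)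
    (hQ : D.Q = refinement b) {k : ℕ} (hk1 : 1 ≤ k) {z : ℂ} (hz : z.im ≠ 0) :
    S.logDerivPsi b D.ν k z = b⁻¹ * PowerSeries.coeff (k + 1) (D.U b (xi z)) * jac z := by
  have hk := hS.two_le
  have h1 : ∀ᶠ z' in 𝓝 z, S.logPsi b D.ν k z' = ∑ m ∈ Finset.range (k + 2),
      1 / (b ^ (m + 1) * ((m + 1).factorial : ℂ)) * divisorIntegral D.ν z'
        fun a => D.partInt (k + 1 - m) m (a, z') := by
    have h2 : ∀ᶠ z' : ℂ in 𝓝 z, z'.im ≠ 0 := Complex.continuous_im.continuousAt.eventually_ne hz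
    filter_upwards [h2] with z' hz'
    have hshift := Finset.sum_Ico_add' (fun n =>
      1 / (b ^ n * (n.factorial : ℂ)) * divisorIntegral D.ν z'
        fun a => D.partInt (k + 1 - (n - 1)) (n - 1) (a, z')) 0 (k + 2) 1
    simp only [Nat.add_sub_cancel] at hshift
    rw [SpectralCurve.logPsi, Finset.range_eq_Ico, hshift]
    refine Finset.sum_congr (by ext; simp) fun n hn => ?_
    have hn := Finset.mem_Icc.1 hn
    congr 1
    rw [SpectralCurve.omegaIntegral, ← hQ]
    refine divisorIntegral_congr fun t ht => ?_
    rw [iteratedDivisorIntegral_omega hS (by omega) hz' ht, LoopData.partInt,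
      show k + 1 - (n - 1) = k + 2 - n by omega]
  have h2 := HasDerivAt.fun_sum (u := Finset.range (k + 2)) fun m hm =>
    (LoopData.hasDerivAt_divisorIntegral_partInt (D := D) hS.k_eq hS.c_ne (h := k + 1 - m) (m := m)
      (by have := Finset.mem_range.1 hm; omega) hz).const_mul
        (1 / (b ^ (m + 1) * ((m + 1).factorial : ℂ)))
  rw [SpectralCurve.logDerivPsi, Filter.EventuallyEq.deriv_eq h1, h2.deriv, LoopData.coeff_U b
    (by omega),
    Finset.mul_sum, Finset.sum_mul]
  refine Finset.sum_congr rfl fun m _ => ?_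
  have : ((m : ℂ) + 1) ≠ 0 := by exact_mod_cast Nat.succ_ne_zero m
  rw [LoopData.partInt, Nat.factorial_succ, pow_succ]
  push_cast
  field_simp

end

/-! ### Families of formal power series -/

section

open PowerSeries

/-- Coefficientwise differentiability of a family of power series. -/
def HasD (f : ℂ → PowerSeries ℂ) (f' : PowerSeries ℂ) (w : ℂ) : Prop :=
  ∀ j, HasDerivAt (fun t => coeff j (f t)) (coeff j f') w

theorem mul_inv_cancel_of_coeff {f : PowerSeries ℂ} (h : coeff 0 f ≠ 0) : f * f⁻¹ = 1 :=
  PowerSeries.mul_inv_cancel f (by rwa [← coeff_zero_eq_constantCoeff_apply])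

theorem coeff_zero_mul (f g : PowerSeries ℂ) : coeff 0 (f * g) = coeff 0 f * coeff 0 g := by
  simp [coeff_mul]

section HasD

variable {f g : ℂ → PowerSeries ℂ} {f' g' : PowerSeries ℂ} {w : ℂ}

theorem HasD.congr_deriv (h : HasD f f' w) (e : f' = g') : HasD f g' w := e ▸ h

theorem HasD.congr (h : HasD f f' w) (e : g =ᶠ[𝓝 w] f) : HasD g f' w := fun j =>
  (h j).congr_of_eventuallyEq (e.mono fun t ht => by simp only [ht])

theorem HasD.unique (h : HasD f f' w) (h' : HasD f g' w) : f' = g' := by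
  ext j
  exact (h j).unique (h' j)

theorem hasD_const (a : PowerSeries ℂ) : HasD (fun _ => a) 0 w := fun j => by
  simpa using hasDerivAt_const w (coeff j a)

theorem HasD.scalar {s : ℂ → ℂ} {s' : ℂ} (h : HasDerivAt s s' w) : HasD (fun t => C (s t))
    (C s') w := by
  intro j
  simp only [coeff_C]
  split_ifs
  · exact h
  · exact hasDerivAt_const w 0

theorem HasD.add (hf : HasD f f' w) (hg : HasD g g' w) : HasD (fun t => f t + g t) (f' + g') w :=
  fun j => by simpa only [map_add] using (hf j).fun_add (hg j)

theorem HasD.mul (hf : HasD f f' w) (hg : HasD g g' w) :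
    HasD (fun t => f t * g t) (f' * g w + f w * g') w := fun j => by
  simp only [coeff_mul, map_add]
  rw [← Finset.sum_add_distrib]
  exact HasDerivAt.fun_sum fun m _ => (hf m.1).fun_mul (hg m.2)

theorem exists_hasD (h : ∀ j, DifferentiableAt ℂ (fun t => coeff j (f t)) w) : ∃ F, HasD f F w :=
  ⟨mk fun j => deriv (fun t => coeff j (f t)) w, fun j => by
    simpa only [coeff_mk] using (h j).hasDerivAt⟩

theorem HasD.inv (hf : HasD f f' w) (h0 : coeff 0 (f w) ≠ 0) :
    HasD (fun t => (f t)⁻¹) (-(f' * (f w)⁻¹ * (f w)⁻¹)) w := by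
  have hd : ∀ j, DifferentiableAt ℂ (fun t => coeff j (f t)⁻¹) w := by
    intro j
    induction j using Nat.strong_induction_on with
    | _ j ih =>
      have hc : DifferentiableAt ℂ (fun t => (constantCoeff (f t))⁻¹) w := by
        simp only [← coeff_zero_eq_constantCoeff_apply]
        exact (hf 0).differentiableAt.inv h0
      by_cases hj : j = 0
      · refine hc.congr_of_eventuallyEq (Eventually.of_forall fun t => ?_)
        beta_reduce
        rw [coeff_inv, if_pos hj]
      · refine DifferentiableAt.congr_of_eventuallyEq ?_ (Eventually.of_forall fun t => by
          beta_reduce; rw [coeff_inv, if_neg hj])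
        refine hc.neg.mul (DifferentiableAt.fun_sum fun m _ => ?_)
        split_ifs with hm
        · exact (hf m.1).differentiableAt.mul (ih m.2 hm)
        · exact differentiableAt_const 0
  obtain ⟨F, hF⟩ := exists_hasD hd
  have hev : ∀ᶠ t in 𝓝 w, coeff 0 (f t) ≠ 0 := (hf 0).continuousAt.eventually_ne h0
  have h1 : HasD (fun _ => 1) (f' * (f w)⁻¹ + f w * F) w :=
    (hf.mul hF).congr (hev.mono fun t ht => (mul_inv_cancel_of_coeff ht).symm)
  have h2 := h1.unique (hasD_const 1)
  have h3 := mul_inv_cancel_of_coeff h0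
  refine hF.congr_deriv ?_
  linear_combination (f w)⁻¹ * h2 - F * h3

end HasD

/-- The derivation `ħ d/dħ`. -/
def theta (f : PowerSeries ℂ) : PowerSeries ℂ := X * derivative ℂ f

/-- The logarithmic derivative with respect to `log ħ`. For `j ≥ 1` its coefficients are those of
`log f`, multiplied by `j`. -/
def logD (f : PowerSeries ℂ) : PowerSeries ℂ := theta f * f⁻¹

theorem theta_mul (f g : PowerSeries ℂ) : theta (f * g) = theta f * g + f * theta g := by
  simp only [theta, Derivation.leibniz, smul_eq_mul]
  ring

theorem theta_C (a : ℂ) : theta (C a) = 0 := by simp [theta]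

theorem coeff_theta (j : ℕ) (f : PowerSeries ℂ) : coeff j (theta f) = j * coeff j f := by
  rcases j with _ | j
  · simp [theta]
  · rw [theta, coeff_succ_X_mul, coeff_derivative]
    push_cast
    ring

theorem HasD.theta {f : ℂ → PowerSeries ℂ} {f' : PowerSeries ℂ} {w : ℂ} (hf : HasD f f' w) :
    HasD (fun t => theta (f t)) (RefinedTR.theta f') w := fun j => by
  simpa only [coeff_theta] using (hf j).const_mul (j : ℂ)

theorem HasD.logD {f : ℂ → PowerSeries ℂ} {f' : PowerSeries ℂ} {w : ℂ} (hf : HasD f f' w)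
    (h0 : coeff 0 (f w) ≠ 0) : HasD (fun t => logD (f t)) (RefinedTR.theta (f' * (f w)⁻¹)) w := by
  have h1 := mul_inv_cancel_of_coeff h0
  have h2 : RefinedTR.theta (f w * (f w)⁻¹) = 0 := by rw [h1, ← map_one C, theta_C]
  refine (hf.theta.mul (hf.inv h0)).congr_deriv ?_
  rw [theta_mul] at h2 ⊢
  linear_combination (-f' * (f w)⁻¹) * h2 + f' * RefinedTR.theta (f w)⁻¹ * h1

theorem logD_C_mul {a : ℂ} (ha : a ≠ 0) (f : PowerSeries ℂ) : logD (C a * f) = logD f := by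
  have h : (C a : PowerSeries ℂ) * C a⁻¹ = 1 := by rw [← map_mul, mul_inv_cancel₀ ha, map_one]
  rw [logD, logD, theta_mul, theta_C, PowerSeries.mul_inv_rev, C_inv]
  linear_combination theta f * f⁻¹ * h

theorem logD_mul {f g : PowerSeries ℂ} (hf : coeff 0 f ≠ 0) (hg : coeff 0 g ≠ 0) :
    logD (f * g) = logD f + logD g := by
  have h1 := mul_inv_cancel_of_coeff hf
  have h2 := mul_inv_cancel_of_coeff hg
  rw [logD, logD, logD, theta_mul, PowerSeries.mul_inv_rev]
  linear_combination theta f * f⁻¹ * h2 + theta g * g⁻¹ * h1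

theorem coeff_logD_linear (a : ℂ) {k : ℕ} (hk : 1 ≤ k) :
    coeff k (logD (1 + C a * X)) = (-1) ^ (k + 1) * a ^ k := by
  set S : PowerSeries ℂ := mk fun k => if k = 0 then 0 else (-1) ^ (k + 1) * a ^ k with hS
  have h0 : coeff 0 (1 + C a * X : PowerSeries ℂ) ≠ 0 := by simp
  have h1 : theta (1 + C a * X) = S * (1 + C a * X) := by
    have e : S * (1 + C a * X) = S + C a * (S * X) := by ring
    rw [e]
    ext j
    rw [coeff_theta]
    rcases j with _ | j
    · simp [hS]
    · rw [map_add, map_add, coeff_C_mul, coeff_C_mul, coeff_succ_mul_X, coeff_X, coeff_one]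
      rcases j with _ | j <;> simp [hS]
      ring
  rw [logD, h1, mul_assoc, mul_inv_cancel_of_coeff h0, mul_one, hS, coeff_mk, if_neg (by omega)]

/-- A formal solution of a Riccati equation is determined by its leading term. -/
theorem riccati_unique {Ω : Set ℂ} (hΩ : IsOpen Ω) {f g f' g' rhs : ℂ → PowerSeries ℂ} {ω l : ℂ → ℂ}
    (b : ℂ) (hω : ∀ w ∈ Ω, ω w ≠ 0) (hf : ∀ w ∈ Ω, HasD f (C (ω w) * f' w) w)
    (hg : ∀ w ∈ Ω, HasD g (C (ω w) * g' w) w)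
    (ef : ∀ w ∈ Ω, f w ^ 2 + X * (C b * f' w + C (l w) * f w) = rhs w)
    (eg : ∀ w ∈ Ω, g w ^ 2 + X * (C b * g' w + C (l w) * g w) = rhs w)
    (h0 : ∀ w ∈ Ω, coeff 0 (f w) = coeff 0 (g w)) (h0' : ∀ w ∈ Ω, coeff 0 (g w) ≠ 0) :
    ∀ w ∈ Ω, f w = g w := by
  suffices ∀ j, ∀ w ∈ Ω, coeff j (f w) = coeff j (g w) from fun w hw => by
    ext j
    exact this j w hw
  intro j
  induction j using Nat.strong_induction_on with
  | _ j ih =>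
  rcases j with _ | j
  · exact h0
  intro w hw
  have hd : coeff j (f' w) = coeff j (g' w) := by
    have h1 := hf w hw j
    have h2 := (hg w hw j).congr_of_eventuallyEq ((hΩ.eventually_mem hw).mono fun t ht =>
      ih j (Nat.lt_succ_self j) t ht)
    have h3 := h1.unique h2
    rw [coeff_C_mul, coeff_C_mul] at h3
    exact mul_left_cancel₀ (hω w hw) h3
  have h1 : (X : PowerSeries ℂ) ^ (j + 1) ∣ f w - g w := X_pow_dvd_iff.2 fun i hi => by
    rw [map_sub, ih i hi w hw, sub_self]
  obtain ⟨r, hr⟩ := h1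
  have h2 : (f w + g w) * r * X ^ (j + 1) +
      X * (C b * (f' w - g' w) + C (l w) * (f w - g w)) = 0 := by
    linear_combination ef w hw - eg w hw - (f w + g w) * hr
  have h3 := congrArg (coeff (j + 1)) h2
  rw [map_add, coeff_mul_X_pow' , if_pos le_rfl, Nat.sub_self, coeff_succ_X_mul, map_add,
    coeff_C_mul,
    coeff_C_mul, map_sub, map_sub, hd, ih j (Nat.lt_succ_self j) w hw, sub_self, sub_self, mul_zero,
    mul_zero, add_zero, add_zero, map_zero, coeff_zero_mul, map_add, h0 w hw, ← two_mul] at h3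
  have h4 : coeff 0 r = 0 := by
    rcases mul_eq_zero.1 h3 with h | h
    · exact absurd h (mul_ne_zero two_ne_zero (h0' w hw))
    · exact h
  have h5 := congrArg (coeff (j + 1)) hr
  rw [coeff_X_pow_mul', if_pos le_rfl, Nat.sub_self, h4, map_sub] at h5
  exact sub_eq_zero.1 h5

end

/-! ### The Voros coefficients -/

section

open PowerSeries MeasureTheory

namespace LoopData

variable {D : LoopData}

theorem coeff_zero_U (b w : ℂ) : coeff 0 (D.U b w) = D.c * w / (2 * D.P w) := by
  rw [U, LabelSeries.coeff_eval]
  simp [onePoint, corr, LabelSeries.cf_C_zero, divisors]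

variable (D) in
/-- The coefficient of `ħ` in `(w ^ 2 - 1) U`. -/
def subleading (b w : ℂ) : ℂ :=
  D.Q / 2 * (-((w ^ 2 - 1) / (2 * w ^ 2)) + ((D.k : ℂ) - 2) + D.μ / w)
    + 1 / (2 * b * w) * ((w - D.ν) - (w ^ 2 - 1) / (2 * w))

theorem coeff_one_U {b w : ℂ} (hb : b ≠ 0) (hw : w ≠ 0) (hw1 : w ^ 2 - 1 ≠ 0) :
    (w ^ 2 - 1) * coeff 1 (D.U b w) = D.subleading b w := by
  rw [coeff_U b le_rfl, Finset.sum_range_succ, Finset.sum_range_one]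
  simp only [Multiset.replicate_zero, Multiset.replicate_one, Nat.sub_zero, Nat.sub_self, W_one,
    W_two,
    half, two, subleading]
  norm_num
  field_simp
  ring

theorem differentiableAt_coeff_U (hk : 2 ≤ D.k) (hc : D.c ≠ 0) (b : ℂ) {j : ℕ} (hj : 2 ≤ j) {w : ℂ}
    (hw : w ≠ 0) : DifferentiableAt ℂ (fun t => coeff j (D.U b t)) w := by
  simp only [coeff_U b (show 1 ≤ j by omega)]
  refine DifferentiableAt.fun_sum fun m hm => DifferentiableAt.div_const ?_ _
  have hm := Finset.mem_range.1 hm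
  have h1 := (reg_W hk hc (j - m) (replicate m (.divisor ()) : Multiset (Slot Unit))
    (by simp; omega)).eval ()
  have h2 : Adm false fun _ : Unit => w := ⟨fun _ _ => by simpa [← two_mul] using hw, by simp⟩
  have h3 : DifferentiableAt ℂ (fun (t : ℂ) (_ : Unit) => t) w :=
    differentiableAt_pi.2 fun _ => differentiableAt_id
  have h4 := DifferentiableAt.comp (f := fun (t : ℂ) (_ : Unit) => t) w (Reg.differentiableAt h1
    h2) h3
  simpa [Function.comp_def] using h4

variable (D) in
/-- `2 b ħ` times the derivative of `log ψ` with respect to `x`. -/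
def u (κ b w : ℂ) : PowerSeries ℂ := C (2 * (w ^ 2 - 1) ^ 2 / κ) * D.U b w

variable (D) in
/-- The derivative of `u` with respect to `x`. -/
def u1 (κ b w : ℂ) : PowerSeries ℂ :=
  C (2 * ((w ^ 2 - 1) ^ 2 / κ) ^ 2) * D.U1 b w + C (4 * (w ^ 2 - 1) ^ 3 / κ ^ 2) * D.U b w

end LoopData

/-- The derivative of `x = const - κ / (w ^ 2 - 1)` with respect to `w`. -/
def dxdw (κ w : ℂ) : ℂ := 2 * w * κ / (w ^ 2 - 1) ^ 2

namespace LoopData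

variable {D : LoopData}

theorem hasD_u (hk : 2 ≤ D.k) (hc : D.c ≠ 0) {κ : ℂ} (hκ : κ ≠ 0) (b : ℂ) {w : ℂ} (hw : w ≠ 0)
    (hw1 : w ^ 2 - 1 ≠ 0) : HasD (D.u κ b) (C (dxdw κ w) * D.u1 κ b w) w := by
  have h1 : HasD (D.U b) (C (2 * w) * D.U1 b w) w := fun j => by
    simpa only [coeff_C_mul] using hasDerivAt_coeff_U hk hc b j hw hw1
  have h2 : HasDerivAt (fun t : ℂ => 2 * (t ^ 2 - 1) ^ 2 / κ) (8 * w * (w ^ 2 - 1) / κ) w :=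
    (((((hasDerivAt_pow 2 w).sub_const 1).fun_pow 2).const_mul 2).div_const κ).congr_deriv (by
      norm_num
      ring)
  refine ((HasD.scalar h2).mul h1).congr_deriv ?_
  have e1 : dxdw κ w * (2 * ((w ^ 2 - 1) ^ 2 / κ) ^ 2) = 2 * (w ^ 2 - 1) ^ 2 / κ * (2 * w) := by
    rw [dxdw]; field_simp
  have e2 : dxdw κ w * (4 * (w ^ 2 - 1) ^ 3 / κ ^ 2) = 8 * w * (w ^ 2 - 1) / κ := by
    rw [dxdw]; field_simp; ring
  have e1' : (C (dxdw κ w) * C (2 * ((w ^ 2 - 1) ^ 2 / κ) ^ 2) : PowerSeries ℂ) =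
      C (2 * (w ^ 2 - 1) ^ 2 / κ) * C (2 * w) := by rw [← map_mul, e1, map_mul]
  have e2' : (C (dxdw κ w) * C (4 * (w ^ 2 - 1) ^ 3 / κ ^ 2) : PowerSeries ℂ) =
      C (8 * w * (w ^ 2 - 1) / κ) := by rw [← map_mul, e2]
  rw [u1]
  linear_combination -(D.U1 b w) * e1' - D.U b w * e2'

/-- The Riccati equation with respect to `x`. -/
theorem riccati_u (hk : 2 ≤ D.k) (hc : D.c ≠ 0) {κ b : ℂ} (hκ : κ ≠ 0) (hb : b ≠ 0)
    (hQ : D.Q = b - b⁻¹) {w : ℂ} (hw : w ≠ 0) (hw1 : w ^ 2 - 1 ≠ 0) :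
    D.u κ b w ^ 2 + X * (C (2 * b) * D.u1 κ b w +
      C (2 * (D.k - 3) * (w ^ 2 - 1) / (b * κ)) * D.u κ b w) =
    C ((2 * (w ^ 2 - 1) ^ 2 / κ) ^ 2 * (D.c ^ 2 * w ^ 2 / (4 * D.P w ^ 2))) +
      X * C ((2 * (w ^ 2 - 1) ^ 2 / κ) ^ 2 *
        (D.c * ((D.Q * D.μ - D.ν / b) / 2) / (D.P w * (w ^ 2 - 1)))) := by
  have h := riccati hk hc hb hQ hw hw1
  rw [map_mul C ((2 * (w ^ 2 - 1) ^ 2 / κ) ^ 2) (D.c ^ 2 * w ^ 2 / (4 * D.P w ^ 2)),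
    map_mul C ((2 * (w ^ 2 - 1) ^ 2 / κ) ^ 2) (_ / _), u, u1]
  have e : (2 * (w ^ 2 - 1) ^ 2 / κ) ^ 2 * ((2 * b ^ 2 + D.k - 3) / b / (w ^ 2 - 1)) =
      2 * b * (4 * (w ^ 2 - 1) ^ 3 / κ ^ 2) +
        2 * (D.k - 3) * (w ^ 2 - 1) / (b * κ) * (2 * (w ^ 2 - 1) ^ 2 / κ) := by
    field_simp
    ring
  have e2 : (2 * (w ^ 2 - 1) ^ 2 / κ) ^ 2 * b = 2 * b * (2 * ((w ^ 2 - 1) ^ 2 / κ) ^ 2) := by ring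
  have e' := congrArg (C : ℂ → PowerSeries ℂ) e
  have e2' := congrArg (C : ℂ → PowerSeries ℂ) e2
  rw [map_add, map_mul, map_mul, map_mul C _ (2 * (w ^ 2 - 1) ^ 2 / κ), map_pow] at e'
  rw [map_mul, map_mul C (2 * b), map_pow] at e2'
  rw [map_pow]
  linear_combination C (2 * (w ^ 2 - 1) ^ 2 / κ) ^ 2 * h - X * D.U b w * e' - X * D.U1 b w * e2'

end LoopData

theorem jac_inv {z : ℂ} (h0 : z ≠ 0) (h1 : z ≠ 1) : jac z⁻¹ = -z ^ 2 * jac z := by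
  have e1 : 1 - z ≠ 0 := sub_ne_zero.2 h1.symm
  have e2 : 1 - z⁻¹ = -(1 - z) / z := by field_simp; ring
  rw [jac, jac, xi_inv h0 h1, e2]
  field_simp

variable {S : SpectralCurve} {D D' : LoopData} {κ b : ℂ}

/-- The form `T_odd`, divided by `d(w ^ 2)`. -/
def oddU (D : LoopData) (b : ℂ) (k : ℕ) (w : ℂ) : ℂ :=
  (2 * b)⁻¹ * (coeff (k + 1) (D.U b w) - coeff (k + 1) (D.U b (-w)))

theorem oddPart_eq (hS : Uniformised S D κ) (hQ : D.Q = refinement b) {k : ℕ}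
    (hk1 : 1 ≤ k) {z : ℂ} (hz : z.im ≠ 0) : S.oddPart b D.ν k z = oddU D b k (xi z) * jac z := by
  have hz0 : z ≠ 0 := by simpa using ne_ofReal hz 0
  have hz1 : z ≠ 1 := by simpa using ne_ofReal hz 1
  have hzi : z⁻¹.im ≠ 0 := by
    rw [Complex.inv_im]
    exact div_ne_zero (neg_ne_zero.2 hz) (by simpa using hz0)
  rw [SpectralCurve.oddPart, logDerivPsi_eq hS hQ hk1 hz, logDerivPsi_eq hS hQ hk1 hzi,
    jac_inv hz0 hz1, xi_inv hz0 hz1, oddU, mul_inv]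
  field_simp

theorem xi_ray_ne {z : ℂ} (hz : z.im ≠ 0) {t : ℝ} (ht : 0 < t) :
    xi (t * z) ≠ 0 ∧ xi (t * z) ^ 2 - 1 ≠ 0 := by
  have h := mul_im_ne_zero hz ht
  have h0 : (t : ℂ) * z ≠ 0 := by simpa using ne_ofReal h 0
  have h1 : (t : ℂ) * z ≠ 1 := by simpa using ne_ofReal h 1
  have h2 : (t : ℂ) * z ≠ -1 := by simpa using ne_ofReal h (-1)
  exact ⟨xi_ne_zero h1 h2, xi_sq_sub_one_ne_zero h0 h1⟩

theorem continuousAt_oddU (hk : 2 ≤ D.k) (hc : D.c ≠ 0) {k : ℕ} (hk1 : 1 ≤ k) {w : ℂ} (hw : w ≠ 0) :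
    ContinuousAt (oddU D b k) w := by
  have h1 := fun v hv => (LoopData.differentiableAt_coeff_U hk hc b (j := k + 1) (w := v)
    (by omega) hv).continuousAt
  exact continuousAt_const.mul ((h1 w hw).sub (ContinuousAt.comp (f := Neg.neg)
    (h1 (-w) (neg_ne_zero.2 hw)) continuousAt_neg))

theorem integrableOn_oddU (hk : 2 ≤ D.k) (hc : D.c ≠ 0) {k : ℕ} (hk1 : 1 ≤ k) {z : ℂ}
    (hz : z.im ≠ 0) :
    IntegrableOn (fun t : ℝ => oddU D b k (xi (t * z)) * jac (t * z) * z) (Set.Ioi 0) :=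
  integrableOn_xi_ray hz (continuousAt_oddU hk hc hk1 one_ne_zero)
    (continuousAt_oddU hk hc hk1 (neg_ne_zero.2 one_ne_zero))
    fun _ ht => continuousAt_oddU hk hc hk1 (xi_ray_ne hz ht).1

/-- The odd part of each coefficient is regular at `∞₊` and `∞₋`. -/
theorem vorosConverges (hS : Uniformised S D κ) (hQ : D.Q = refinement b) {z : ℂ}
    (hz : z.im ≠ 0) : S.VorosConverges z b D.ν := by
  have hk := hS.two_le
  refine fun k hk1 => (integrableOn_oddU (b := b) hk hS.c_ne hk1 hz).congr_fun (fun t ht => ?_)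
    measurableSet_Ioi
  beta_reduce
  rw [oddPart_eq hS hQ hk1 (mul_im_ne_zero hz ht)]

theorem coeff_voros (hS : Uniformised S D κ) (hQ : D.Q = refinement b) {k : ℕ}
    (hk1 : 1 ≤ k) {z : ℂ} (hz : z.im ≠ 0) : coeff k (S.voros z b D.ν) =
      -∫ t in Set.Ioi (0 : ℝ), oddU D b k (xi (t * z)) * jac (t * z) * z := by
  rw [SpectralCurve.voros, coeff_mk, if_neg (by omega)]
  congr 1
  refine setIntegral_congr_fun measurableSet_Ioi fun t ht => ?_
  rw [oddPart_eq hS hQ hk1 (mul_im_ne_zero hz ht)]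

/-- If two solutions of the Riccati equation differ by the logarithmic derivative of `A`, then the
difference of the Voros coefficients is the difference of the values of `log A` at `∞₊` and `∞₋`,
after normalising `A` to be regular and invertible there. -/
theorem voros_sub (hS : Uniformised S D κ) (hS' : Uniformised S D' κ)
    (hQ : D.Q = refinement b) (hQ' : D'.Q = refinement b) (hb : b ≠ 0)
    {A A' At : ℂ → PowerSeries ℂ}
    (hA : ∀ w, w ≠ 0 → w ^ 2 - 1 ≠ 0 → HasD A (C (dxdw κ w) * A' w) w)
    (hA0 : ∀ w, w ≠ 0 → w ^ 2 - 1 ≠ 0 → coeff 0 (A w) ≠ 0)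
    (hu : ∀ w, w ≠ 0 → w ^ 2 - 1 ≠ 0 → D'.u κ b w = D.u κ b w + X * (C (2 * b) * (A' w * (A w)⁻¹)))
    (hAt : ∀ w, w ≠ 0 → ∀ j, DifferentiableAt ℂ (fun t => coeff j (At t)) w)
    (hAt0 : ∀ w, w ≠ 0 → coeff 0 (At w) ≠ 0)
    (hL : ∀ w, w ≠ 0 → w ^ 2 - 1 ≠ 0 → logD (At w) = logD (A w)) {k : ℕ} (hk1 : 1 ≤ k) {z : ℂ}
    (hz : z.im ≠ 0) : (k : ℂ) * (coeff k (S.voros z b D'.ν) - coeff k (S.voros z b D.ν)) =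
      coeff k (logD (At 1)) - coeff k (logD (At (-1))) := by
  have hk := hS.two_le
  have hk' := hS'.two_le
  have hk0 : (k : ℂ) ≠ 0 := by exact_mod_cast (show k ≠ 0 by omega)
  -- `ℓ` is the coefficient of `ħ ^ k` in `log At`
  set ℓ : ℂ → ℂ := fun w => coeff k (logD (At w)) / k with hℓ
  have dℓ : ∀ w, w ≠ 0 → w ^ 2 - 1 ≠ 0 →
      HasDerivAt ℓ (dxdw κ w * coeff k (A' w * (A w)⁻¹)) w := by
    intro w hw hw1
    have h1 := ((hA w hw hw1).logD (hA0 w hw hw1) k).div_const (k : ℂ)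
    have h2 : ∀ᶠ t in 𝓝 w, t ≠ 0 ∧ t ^ 2 - 1 ≠ 0 := (eventually_ne_nhds hw).and
      ((by fun_prop : ContinuousAt (fun t : ℂ => t ^ 2 - 1) w).eventually_ne hw1)
    refine (h1.congr_of_eventuallyEq (h2.mono fun t ht => ?_)).congr_deriv ?_
    · simp only [hℓ, hL t ht.1 ht.2]
    · rw [coeff_theta, mul_assoc, coeff_C_mul, mul_div_cancel_left₀ _ hk0]
  have cℓ : ∀ w, w ≠ 0 → ContinuousAt ℓ w := by
    intro w hw
    obtain ⟨F, hF⟩ := exists_hasD (hAt w hw)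
    exact ((hF.logD (hAt0 w hw)) k).continuousAt.div_const _
  -- the odd part of `ℓ` is a primitive of the difference of the two integrands
  set Φ : ℂ → ℂ := fun w => (ℓ w - ℓ (-w)) / 2 with hΦ
  have cΦ : ∀ w, w ≠ 0 → ContinuousAt Φ w := fun w hw => ((cℓ w hw).sub (ContinuousAt.comp
    (f := Neg.neg) (cℓ (-w) (neg_ne_zero.2 hw)) continuousAt_neg)).div_const 2
  have hU : ∀ w, w ≠ 0 → w ^ 2 - 1 ≠ 0 → coeff (k + 1) (D'.U b w) - coeff (k + 1) (D.U b w) =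
      κ / (w ^ 2 - 1) ^ 2 * (b * coeff k (A' w * (A w)⁻¹)) := by
    intro w hw hw1
    have h1 := congrArg (coeff (k + 1)) (hu w hw hw1)
    rw [LoopData.u, LoopData.u, map_add, coeff_C_mul, coeff_C_mul, coeff_succ_X_mul,
      coeff_C_mul] at h1
    have hκ := hS.κ_ne
    field_simp
    field_simp at h1
    linear_combination h1
  have dΦ : ∀ w, w ≠ 0 → w ^ 2 - 1 ≠ 0 → HasDerivAt Φ (2 * w *
    (oddU D' b k w - oddU D b k w)) w := by
    intro w hw hw1
    have hw' : -w ≠ 0 := neg_ne_zero.2 hw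
    have hw1' : (-w) ^ 2 - 1 ≠ 0 := by rwa [neg_sq]
    have h1 := ((dℓ w hw hw1).sub (HasDerivAt.comp w (dℓ (-w) hw' hw1') (hasDerivAt_neg
      w))).div_const 2
    refine h1.congr_deriv ?_
    have e1 := hU w hw hw1
    have e2 := hU (-w) hw' hw1'
    rw [neg_sq] at e2
    have e3 : oddU D' b k w - oddU D b k w = (2 * b)⁻¹ *
        ((coeff (k + 1) (D'.U b w) - coeff (k + 1) (D.U b w)) -
          (coeff (k + 1) (D'.U b (-w)) - coeff (k + 1) (D.U b (-w)))) := by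
      rw [oddU, oddU]; ring
    rw [e3, e1, e2, dxdw, dxdw, neg_sq]
    field_simp
  have key := integral_xi_ray hz (Φ := Φ) (g := fun w => oddU D' b k w - oddU D b k w)
    (fun t ht => dΦ _ (xi_ray_ne hz ht).1 (xi_ray_ne hz ht).2) (cΦ 1 one_ne_zero)
    (cΦ (-1) (neg_ne_zero.2 one_ne_zero))
    ((continuousAt_oddU hk' hS'.c_ne hk1 one_ne_zero).sub
      (continuousAt_oddU hk hS.c_ne hk1 one_ne_zero))
    ((continuousAt_oddU hk' hS'.c_ne hk1 (neg_ne_zero.2 one_ne_zero)).sub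
      (continuousAt_oddU hk hS.c_ne hk1 (neg_ne_zero.2 one_ne_zero)))
    fun t ht => (continuousAt_oddU hk' hS'.c_ne hk1 (xi_ray_ne hz ht).1).sub
      (continuousAt_oddU hk hS.c_ne hk1 (xi_ray_ne hz ht).1)
  have hdisj : Disjoint (Set.Ioc (0 : ℝ) 1) (Set.Ioi 1) := Set.disjoint_left.2 fun t h h' =>
    not_lt.2 h.2 h'
  have htot : ∫ t in Set.Ioi (0 : ℝ), (oddU D' b k (xi (t * z)) - oddU D b k (xi (t * z))) *
      jac (t * z) * z = Φ (-1) - Φ 1 := by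
    rw [← Set.Ioc_union_Ioi_eq_Ioi zero_le_one, setIntegral_union hdisj measurableSet_Ioi
      (key.1.mono_set Set.Ioc_subset_Ioi_self) (key.1.mono_set (Set.Ioi_subset_Ioi zero_le_one)),
      key.2.1, key.2.2]
    ring
  have hsub : ∫ t in Set.Ioi (0 : ℝ), (oddU D' b k (xi (t * z)) - oddU D b k (xi (t * z))) *
      jac (t * z) * z = (∫ t in Set.Ioi (0 : ℝ), oddU D' b k (xi (t * z)) * jac (t * z) * z) -
        ∫ t in Set.Ioi (0 : ℝ), oddU D b k (xi (t * z)) * jac (t * z) * z := by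
    rw [← integral_sub (integrableOn_oddU hk' hS'.c_ne hk1 hz)
      (integrableOn_oddU hk hS.c_ne hk1 hz)]
    exact integral_congr_ae (Eventually.of_forall fun t => by ring)
  rw [coeff_voros hS hQ hk1 hz, coeff_voros hS' hQ' hk1 hz]
  have h1 : (k : ℂ) * (Φ 1 - Φ (-1)) = coeff k (logD (At 1)) - coeff k (logD (At (-1))) := by
    simp only [hΦ, hℓ, neg_neg]
    field_simp
    ring
  rw [← h1]
  linear_combination (k : ℂ) * (hsub - htot)

end

/-! ### The shift of `ν` on the Weber curve -/

section

open PowerSeries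

namespace LoopData

variable {D D' : LoopData}

theorem coeff_zero_u (κ b w : ℂ) :
    coeff 0 (D.u κ b w) = 2 * (w ^ 2 - 1) ^ 2 / κ * (D.c * w / (2 * D.P w)) := by
  rw [u, coeff_C_mul, coeff_zero_U]

/-- A formal solution of the Riccati equation of `D'` with the leading term of `D.u` is `D'.u`. -/
theorem u_eq_of_riccati (hk : 2 ≤ D'.k) (hc : D'.c ≠ 0) {κ b : ℂ} (hκ : κ ≠ 0) (hb : b ≠ 0)
    (hQ : D'.Q = b - b⁻¹) (hkk : D.k = D'.k) (hcc : D.c = D'.c) {g g1 : ℂ → PowerSeries ℂ}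
    (hg : ∀ w, w ≠ 0 → w ^ 2 - 1 ≠ 0 → HasD g (C (dxdw κ w) * g1 w) w)
    (eg : ∀ w, w ≠ 0 → w ^ 2 - 1 ≠ 0 → g w ^ 2 + X * (C (2 * b) * g1 w +
      C (2 * (D'.k - 3) * (w ^ 2 - 1) / (b * κ)) * g w) =
      C ((2 * (w ^ 2 - 1) ^ 2 / κ) ^ 2 * (D'.c ^ 2 * w ^ 2 / (4 * D'.P w ^ 2))) +
      X * C ((2 * (w ^ 2 - 1) ^ 2 / κ) ^ 2 *
        (D'.c * ((D'.Q * D'.μ - D'.ν / b) / 2) / (D'.P w * (w ^ 2 - 1)))))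
    (h0 : ∀ w, w ≠ 0 → w ^ 2 - 1 ≠ 0 → coeff 0 (g w) = coeff 0 (D.u κ b w)) {w : ℂ} (hw : w ≠ 0)
    (hw1 : w ^ 2 - 1 ≠ 0) : D'.u κ b w = g w := by
  have h0' : ∀ w, w ≠ 0 → w ^ 2 - 1 ≠ 0 → coeff 0 (g w) = coeff 0 (D'.u κ b w) := by
    intro w hw hw1
    rw [h0 w hw hw1, coeff_zero_u, coeff_zero_u, hcc, P, P, hkk]
  have hΩ : IsOpen {w : ℂ | w ≠ 0 ∧ w ^ 2 - 1 ≠ 0} :=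
    (isOpen_ne_fun continuous_id continuous_const).inter
      (isOpen_ne_fun (by fun_prop) continuous_const)
  refine riccati_unique hΩ (2 * b) (ω := dxdw κ) (fun w h => ?_)
    (fun w h => hasD_u hk hc hκ b h.1 h.2) (fun w h => hg w h.1 h.2)
    (fun w h => riccati_u hk hc hκ hb hQ h.1 h.2) (fun w h => eg w h.1 h.2)
    (fun w h => (h0' w h.1 h.2).symm) (fun w h => ?_) w ⟨hw, hw1⟩
  · exact div_ne_zero (mul_ne_zero (mul_ne_zero two_ne_zero h.1) hκ) (pow_ne_zero 2 h.2)
  · rw [h0' w h.1 h.2, coeff_zero_u]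
    exact mul_ne_zero (div_ne_zero (mul_ne_zero two_ne_zero (pow_ne_zero 2 h.2)) hκ)
      (div_ne_zero (mul_ne_zero hc h.1) (mul_ne_zero two_ne_zero (D'.P_ne_zero h.2)))

variable (D) in
/-- The series `1 + p₁ ħ + p₂ (U₂ ħ² + U₃ ħ³ + ⋯)`. -/
def normalForm (b : ℂ) (p1 p2 : ℂ → ℂ) (w : ℂ) : PowerSeries ℂ :=
  PowerSeries.mk fun j => if j = 0 then 1 else if j = 1 then p1 w else p2 w * coeff j (D.U b w)

variable {b : ℂ} {p1 p2 : ℂ → ℂ} {w : ℂ}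

theorem coeff_zero_normalForm : coeff 0 (D.normalForm b p1 p2 w) = 1 := by
  rw [normalForm, coeff_mk, if_pos rfl]

theorem normalForm_eq (hb : b ≠ 0) (hw : w ≠ 0) (hw1 : w ^ 2 - 1 ≠ 0) {φ α x0 x1 : ℂ}
    (h0 : φ * (α * (D.c * w / (2 * D.P w)) + x0) = 1)
    (h1 : φ * (α * (D.subleading b w / (w ^ 2 - 1)) + x1) = p1 w) (h2 : φ * α = p2 w) :
    D.normalForm b p1 p2 w = C φ * (C α * D.U b w + C x0 + X * C x1) := by
  ext j
  rw [normalForm, coeff_mk, coeff_C_mul, map_add, map_add, coeff_C_mul, coeff_C]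
  rcases j with _ | _ | j
  · rw [if_pos rfl, coeff_zero_U, if_pos rfl, coeff_zero_X_mul, add_zero, h0]
  · have h := coeff_one_U hb hw hw1 (D := D)
    rw [if_neg (by omega), if_pos rfl, if_neg (by omega), coeff_succ_X_mul, coeff_C, if_pos rfl,
      ← h1, ← h]
    simp only [zero_add, add_zero]
    field_simp
  · rw [if_neg (by omega), if_neg (by omega), if_neg (by omega), coeff_succ_X_mul, coeff_C,
      if_neg (by omega), ← h2]
    ring

theorem differentiableAt_normalForm (hk : 2 ≤ D.k) (hc : D.c ≠ 0) (hw : w ≠ 0)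
    (h1 : DifferentiableAt ℂ p1 w) (h2 : DifferentiableAt ℂ p2 w) (j : ℕ) :
    DifferentiableAt ℂ (fun t => coeff j (D.normalForm b p1 p2 t)) w := by
  simp only [normalForm, coeff_mk]
  rcases j with _ | _ | j
  · simp
  · simpa using h1
  · simpa using h2.fun_mul (differentiableAt_coeff_U hk hc b (by omega) hw)

theorem normalForm_of_eq_zero (h : p2 w = 0) : D.normalForm b p1 p2 w = 1 + C (p1 w) * X := by
  ext j
  rw [normalForm, coeff_mk, map_add, coeff_C_mul, coeff_one, coeff_X, h]
  rcases j with _ | _ | j <;> simp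

end LoopData

theorem sq_sub_one_ne {w : ℂ} (hw1 : w ^ 2 - 1 ≠ 0) : w - 1 ≠ 0 ∧ w + 1 ≠ 0 := by
  rw [← mul_ne_zero_iff]
  convert hw1 using 1
  ring

theorem hasDerivAt_inv_sq_sub_one {w : ℂ} (hw1 : w ^ 2 - 1 ≠ 0) :
    HasDerivAt (fun t : ℂ => (t ^ 2 - 1)⁻¹) (-(2 * w) / (w ^ 2 - 1) ^ 2) w := by
  simpa using ((hasDerivAt_pow 2 w).sub_const 1).fun_inv hw1

section Weber

/-- The loop data of the Weber curve. -/
abbrev weberData (s μ b ν : ℂ) : LoopData := ⟨3, -16 * s ^ 2, refinement b, μ, ν⟩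

/-- The function `x` on the Weber curve, in terms of `w`. -/
def weberX (s w : ℂ) : ℂ := 2 * s * (w ^ 2 + 1) / (w ^ 2 - 1)

variable {s μ b ν w : ℂ}

theorem hasDerivAt_weberX (hw1 : w ^ 2 - 1 ≠ 0) :
    HasDerivAt (weberX s) (dxdw (-4 * s) w) w := by
  have h := ((hasDerivAt_inv_sq_sub_one hw1).const_mul (4 * s)).const_add (2 * s)
  have h2 : ∀ᶠ t in 𝓝 w, t ^ 2 - 1 ≠ 0 :=
    (by fun_prop : ContinuousAt (fun t : ℂ => t ^ 2 - 1) w).eventually_ne hw1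
  refine (h.congr_of_eventuallyEq (h2.mono fun t ht => ?_)).congr_deriv ?_
  · simp only [weberX]
    field_simp
    ring
  · rw [dxdw]
    ring

theorem weber_rhs (hs : s ≠ 0) (hw1 : w ^ 2 - 1 ≠ 0) (q : ℂ) :
    C ((2 * (w ^ 2 - 1) ^ 2 / (-4 * s)) ^ 2 *
      ((weberData s μ b ν).c ^ 2 * w ^ 2 / (4 * (weberData s μ b ν).P w ^ 2))) +
      X * C ((2 * (w ^ 2 - 1) ^ 2 / (-4 * s)) ^ 2 * ((weberData s μ b ν).c * (q / 2) /
        ((weberData s μ b ν).P w * (w ^ 2 - 1)))) =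
    C (weberX s w) ^ 2 - 4 * (C (s ^ 2) + X * C (q / 2)) := by
  have e1 : (2 * (w ^ 2 - 1) ^ 2 / (-4 * s)) ^ 2 *
      ((weberData s μ b ν).c ^ 2 * w ^ 2 / (4 * (weberData s μ b ν).P w ^ 2)) =
      weberX s w ^ 2 - 4 * s ^ 2 := by
    simp only [LoopData.P, weberX]
    field_simp
    ring
  have e2 : (2 * (w ^ 2 - 1) ^ 2 / (-4 * s)) ^ 2 * ((weberData s μ b ν).c * (q / 2) /
        ((weberData s μ b ν).P w * (w ^ 2 - 1))) = -4 * (q / 2) := by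
    simp only [LoopData.P]
    field_simp
    ring
  rw [e1, e2, map_sub, map_pow, map_mul, map_mul, map_neg, map_ofNat]
  ring

theorem weber_riccati (hs : s ≠ 0) (hb : b ≠ 0) (hw : w ≠ 0) (hw1 : w ^ 2 - 1 ≠ 0) :
    (weberData s μ b ν).u (-4 * s) b w ^ 2 + X * (C (2 * b) * (weberData s μ b ν).u1 (-4 * s) b w) =
      C (weberX s w) ^ 2 - 4 * (C (s ^ 2) +
        X * C ((refinement b * μ - ν / b) / 2)) := by
  have h := LoopData.riccati_u (D := weberData s μ b ν) (κ := -4 * s) (b := b) (by norm_num)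
    (by simpa using hs) (by simpa using hs) hb rfl hw hw1
  rw [weber_rhs hs hw1] at h
  rw [← h]
  norm_num

/-- The operator `2 b ħ ∂ + x` that shifts `ν` by `2 β` multiplies the wave function of the Weber
curve by this factor, as `u` is `2 b ħ` times a logarithmic derivative. -/
def weberShift (s μ b ν w : ℂ) : PowerSeries ℂ :=
  (weberData s μ b ν).u (-4 * s) b w + C (weberX s w)

theorem hasD_weberShift (hs : s ≠ 0) (hw : w ≠ 0) (hw1 : w ^ 2 - 1 ≠ 0) :
    HasD (weberShift s μ b ν)
      (C (dxdw (-4 * s) w) * ((weberData s μ b ν).u1 (-4 * s) b w + 1)) w :=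
  ((LoopData.hasD_u (by norm_num) (by simpa using hs) (by simpa using hs) b hw hw1).add
    (HasD.scalar (hasDerivAt_weberX hw1))).congr_deriv (by ring)

theorem coeff_zero_weberShift (hs : s ≠ 0) (hw1 : w ^ 2 - 1 ≠ 0) :
    coeff 0 (weberShift s μ b ν w) ≠ 0 := by
  have e : coeff 0 (weberShift s μ b ν w) = 2 * s * (w + 1) / (w - 1) := by
    have h := sq_sub_one_ne hw1
    have h1 := h.1
    have e2 : w ^ 2 - 1 = (w - 1) * (w + 1) := by ring
    have h2 := h.2
    rw [weberShift, map_add, LoopData.coeff_zero_u, coeff_C, if_pos rfl, LoopData.P, weberX]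
    simp only
    rw [e2]
    field_simp
    ring
  rw [e]
  have h := sq_sub_one_ne hw1
  exact div_ne_zero (mul_ne_zero (mul_ne_zero two_ne_zero hs) h.2) h.1

/-- The logarithmic derivative of the shifted wave function. The right side equals `x + q / A` with
a constant `q`, and in this form it is seen to satisfy the Riccati equation for `ν + 2 β`. -/
theorem weber_shift_u (hs : s ≠ 0) (hb : b ≠ 0) (hw : w ≠ 0) (hw1 : w ^ 2 - 1 ≠ 0) :
    (weberData s μ b (ν + 2 * b ^ 2)).u (-4 * s) b w = (weberData s μ b ν).u (-4 * s) b w +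
      X * (C (2 * b) * (((weberData s μ b ν).u1 (-4 * s) b w + 1) * (weberShift s μ b ν w)⁻¹)) := by
  set v := (weberData s μ b ν).u (-4 * s) b with hv
  set v1 := (weberData s μ b ν).u1 (-4 * s) b with hv1
  set A := weberShift s μ b ν with hA
  set q : PowerSeries ℂ := X * C (2 * b) - 4 * (C (s ^ 2) +
    X * C ((refinement b * μ - ν / b) / 2)) with hq
  have hAi : ∀ w, w ^ 2 - 1 ≠ 0 → A w * (A w)⁻¹ = 1 := fun w h =>
    mul_inv_cancel_of_coeff (coeff_zero_weberShift hs h)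
  have hAv : ∀ w, A w = v w + C (weberX s w) := fun w => rfl
  have e1 : ∀ w, w ≠ 0 → w ^ 2 - 1 ≠ 0 →
      v w + X * (C (2 * b) * ((v1 w + 1) * (A w)⁻¹)) = C (weberX s w) + q * (A w)⁻¹ := by
    intro w hw hw1
    have R := weber_riccati (μ := μ) (ν := ν) hs hb hw hw1
    have h := hAi w hw1
    rw [hAv] at h ⊢
    rw [hq]
    linear_combination (v w + C (weberX s w))⁻¹ * R - (v w - C (weberX s w)) * h
  rw [e1 w hw hw1]
  refine LoopData.u_eq_of_riccati (D := weberData s μ b ν) (D' := weberData s μ b (ν + 2 * b ^ 2))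
    (g := fun w => C (weberX s w) + q * (A w)⁻¹)
    (g1 := fun w => 1 - q * ((v1 w + 1) * (A w)⁻¹ * (A w)⁻¹)) (by norm_num) (by simpa using hs)
    (by simpa using hs) hb rfl rfl rfl (fun w hw hw1 => ?_) (fun w hw hw1 => ?_)
    (fun w hw hw1 => ?_) hw hw1
  · refine ((HasD.scalar (hasDerivAt_weberX hw1)).add ((hasD_const q).mul
      ((hasD_weberShift hs hw hw1).inv (coeff_zero_weberShift hs hw1)))).congr_deriv ?_
    ring
  · rw [weber_rhs hs hw1]
    have R := weber_riccati (μ := μ) (ν := ν) hs hb hw hw1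
    have h := hAi w hw1
    have e : C ((refinement b * μ - (ν + 2 * b ^ 2) / b) / 2) =
        C ((refinement b * μ - ν / b) / 2) - (C b : PowerSeries ℂ) := by
      rw [← map_sub]
      congr 1
      field_simp
      ring
    have e2 : (C (2 * b) : PowerSeries ℂ) = 2 * C b := by rw [map_mul, map_ofNat]
    have e3 : (C (2 * ((3 : ℕ) - 3) * (w ^ 2 - 1) / (b * (-4 * s))) : PowerSeries ℂ) = 0 := by
      norm_num
    rw [e3, e, e2]
    rw [e2] at R
    simp only [hAv, hq, e2] at h ⊢
    linear_combination (-(X * (2 * C b) - 4 * (C (s ^ 2) +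
      X * C ((refinement b * μ - ν / b) / 2))) *
        (v w + C (weberX s w))⁻¹ ^ 2) * R + (X * (2 * C b) - 4 * (C (s ^ 2) +
      X * C ((refinement b * μ - ν / b) / 2))) *
      ((v w + C (weberX s w))⁻¹ * (v w - C (weberX s w)) + 1) * h
  · rw [← e1 w hw hw1, map_add, coeff_zero_X_mul, add_zero]

/-- The coefficient of `V(ν + 2β) - V(ν)` on the Weber curve. -/
theorem weber_voros_sub (hs : s ≠ 0) (hb : b ≠ 0) {z : ℂ} (hz : z.im ≠ 0) {k : ℕ} (hk1 : 1 ≤ k) :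
    (k : ℂ) * (coeff k ((weber s μ).voros z b (ν + 2 * b ^ 2)) - coeff k
    ((weber s μ).voros z b ν)) =
      -((-1) ^ (k + 1) *
        (((refinement b * μ - ν / b) / 2 - b / 2) / s ^ 2) ^ k) := by
  set D := weberData s μ b ν with hD
  set p1 : ℂ → ℂ := fun w => -(w - 1) ^ 2 * D.subleading b w / (4 * s ^ 2) with hp1
  set p2 : ℂ → ℂ := fun w => -(w - 1) ^ 3 * (w + 1) / (4 * s ^ 2) with hp2
  have hs2 : (-4 * s) ≠ 0 := by simpa using hs
  have hc : D.c ≠ 0 := by simpa [hD] using hs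
  have h := voros_sub (uniformised_weber s μ (refinement b) ν hs)
    (uniformised_weber s μ (refinement b) (ν + 2 * b ^ 2) hs) rfl rfl hb
    (A := weberShift s μ b ν) (A' := fun w => D.u1 (-4 * s) b w + 1)
    (At := D.normalForm b p1 p2) (fun w hw hw1 => hasD_weberShift hs hw hw1)
    (fun w _ hw1 => coeff_zero_weberShift hs hw1) (fun w hw hw1 => weber_shift_u hs hb hw hw1)
    (fun w hw j => LoopData.differentiableAt_normalForm (by norm_num) hc hw ?_
      (by simp only [hp2]; fun_prop) j)
    (fun w hw => by rw [LoopData.coeff_zero_normalForm]; exact one_ne_zero)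
    (fun w hw hw1 => ?_) hk1 hz
  · rw [h, LoopData.normalForm_of_eq_zero
    (by simp [hp2]), LoopData.normalForm_of_eq_zero (by simp [hp2]),
      coeff_logD_linear _ hk1, coeff_logD_linear _ hk1]
    have e1 : p1 1 = 0 := by simp [hp1]
    have e2 : p1 (-1) = ((refinement b * μ - ν / b) / 2 - b / 2) / s ^ 2 := by
      simp only [hp1, hD, LoopData.subleading, refinement]
      field_simp
      ring
    rw [e1, e2, zero_pow (by omega)]
    ring
  · simp only [hp1, LoopData.subleading]
    fun_prop (disch := simp [hw, hb])
  · obtain ⟨h1, h2⟩ := sq_sub_one_ne hw1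
    have e2 : w ^ 2 - 1 = (w - 1) * (w + 1) := by ring
    rw [LoopData.normalForm_eq (φ := (w - 1) / (2 * s * (w + 1)))
      (α := 2 * (w ^ 2 - 1) ^ 2 / (-4 * s))
      (x0 := weberX s w) (x1 := 0) hb hw hw1, logD_C_mul, weberShift, LoopData.u]
    · rw [map_zero, mul_zero, add_zero]
    · exact div_ne_zero h1 (mul_ne_zero (mul_ne_zero two_ne_zero hs) h2)
    · simp only [hD, LoopData.P, weberX, e2]
      field_simp
      ring
    · simp only [hp1, e2]
      field_simp
      ring
    · simp only [hp2, e2]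
      field_simp

end Weber

end

/-! ### The shift of `ν` on the Whittaker curve -/

section

open PowerSeries

section Algebra

variable {R : Type*} [CommRing R] {x y v v1 A A' i G Γ κ l : R}

/-- The Riccati equation for the shift factor `A`, deduced from that for `v`. -/
theorem whittaker_shift_riccati (hxy : x * y = 1)
    (h : v ^ 2 + κ * v1 + 2 * l * y * v = 1 + 2 * y * (Γ - l)) (hA : A = x * v + x + Γ)
    (hA' : A' = v + x * v1 + 1) (hG : G = Γ + κ - 2 * l) :
    κ * x * A' = -A ^ 2 + A * (2 * x + Γ + G) - Γ * G := by
  subst hA hA' hG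
  linear_combination x ^ 2 * h + (2 * x * (Γ - l) - 2 * l * x * v) * hxy

/-- The shifted logarithmic derivative is rational in `A`, of degree one. -/
theorem whittaker_shift_eq (hxy : x * y = 1)
    (h : κ * x * A' = -A ^ 2 + A * (2 * x + Γ + G) - Γ * G) (hA : A = x * v + x + Γ)
    (hi : A * i = 1) : v + κ * (A' * i) = 1 + y * (G - Γ * G * i) := by
  subst hA
  linear_combination y * i * h + (-y * (x * v + x + Γ) + y * (2 * x + Γ + G)) * hi +
    (-κ * A' * i - v + 1) * hxy

/-- The shifted logarithmic derivative satisfies the Riccati equation with `Γ` replaced by `Γ + κ`.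
-/
theorem whittaker_shift_solves (hxy : x * y = 1)
    (h : κ * x * A' = -A ^ 2 + A * (2 * x + Γ + G) - Γ * G) (hG : G = Γ + κ - 2 * l)
    (hi : A * i = 1) :
    (1 + y * (G - Γ * G * i)) ^ 2 + κ * (-y ^ 2 * (G - Γ * G * i) + y * (Γ * G) * (A' * i * i)) +
      2 * l * y * (1 + y * (G - Γ * G * i)) = 1 + 2 * y * (Γ - l + κ) := by
  subst hG
  linear_combination y ^ 2 * (Γ * (Γ + κ - 2 * l)) * i ^ 2 * h +
    (-y ^ 2 * (Γ * (Γ + κ - 2 * l)) * (A * i + 1) +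
      y ^ 2 * (Γ * (Γ + κ - 2 * l)) * i * (2 * x + 2 * Γ + κ - 2 * l)) * hi +
    (-κ * y * (Γ * (Γ + κ - 2 * l)) * A' * i ^ 2 + 2 * y * (Γ * (Γ + κ - 2 * l)) * i) * hxy

end Algebra

theorem HasD.eq_of_eventually_eq {f : ℂ → PowerSeries ℂ} {f' a : PowerSeries ℂ} {w : ℂ}
    (h : HasD f f' w) (he : ∀ᶠ t in 𝓝[≠] w, f t = a) : f w = a := by
  ext j
  exact tendsto_nhds_unique ((h j).continuousAt.tendsto.mono_left nhdsWithin_le_nhds)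
    (tendsto_const_nhds.congr' (he.mono fun t ht => by simp only [ht]))

section Whittaker

/-- The loop data of the Whittaker curve. -/
abbrev whittakerData (m μ b ν : ℂ) : LoopData :=
  ⟨2, 4 * m, refinement b, μ, ν⟩

/-- The function `x` on the Whittaker curve, in terms of `w`. -/
def whittakerX (m w : ℂ) : ℂ := 4 * m * (w ^ 2 - 1)⁻¹

/-- The function `1 / x` on the Whittaker curve, in terms of `w`. -/
def whittakerY (m w : ℂ) : ℂ := (w ^ 2 - 1) / (4 * m)

/-- `2 (m + a ħ)`, where `a` is one of the two shifts of `m` in the difference equation. -/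
def gammaA (m μ b ν : ℂ) : PowerSeries ℂ :=
  C (2 * m) + X * C ((refinement b * μ - ν / b) + b⁻¹)

/-- `2 (m + a ħ)`, where `a` is the other of the two shifts of `m` in the difference equation. -/
def gammaB (m μ b ν : ℂ) : PowerSeries ℂ :=
  gammaA m μ b ν + X * C (2 * b) - 2 * (X * C b⁻¹)

variable {m μ b ν w : ℂ}

theorem whittakerX_mul_Y (hm : m ≠ 0) (hw1 : w ^ 2 - 1 ≠ 0) :
    (C (whittakerX m w) * C (whittakerY m w) : PowerSeries ℂ) = 1 := by
  rw [← map_mul, ← map_one C]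
  congr 1
  rw [whittakerX, whittakerY]
  field_simp

theorem hasDerivAt_whittakerX (hw1 : w ^ 2 - 1 ≠ 0) :
    HasDerivAt (whittakerX m) (dxdw (-4 * m) w) w :=
  ((hasDerivAt_inv_sq_sub_one hw1).const_mul (4 * m)).congr_deriv (by rw [dxdw]; ring)

theorem hasDerivAt_whittakerY (hm : m ≠ 0) (hw1 : w ^ 2 - 1 ≠ 0) :
    HasDerivAt (whittakerY m) (dxdw (-4 * m) w * -whittakerY m w ^ 2) w :=
  (((hasDerivAt_pow 2 w).sub_const 1).div_const (4 * m)).congr_deriv (by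
    rw [dxdw, whittakerY]
    field_simp
    norm_num)

theorem whittaker_rhs (hm : m ≠ 0) (hw1 : w ^ 2 - 1 ≠ 0) (q : ℂ) :
    C ((2 * (w ^ 2 - 1) ^ 2 / (-4 * m)) ^ 2 *
      ((whittakerData m μ b ν).c ^ 2 * w ^ 2 / (4 * (whittakerData m μ b ν).P w ^ 2))) +
      X * C ((2 * (w ^ 2 - 1) ^ 2 / (-4 * m)) ^ 2 * ((whittakerData m μ b ν).c * (q / 2) /
        ((whittakerData m μ b ν).P w * (w ^ 2 - 1)))) =
    1 + 2 * C (whittakerY m w) * (C (2 * m) + X * C q) := by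
  have e1 : (2 * (w ^ 2 - 1) ^ 2 / (-4 * m)) ^ 2 *
      ((whittakerData m μ b ν).c ^ 2 * w ^ 2 / (4 * (whittakerData m μ b ν).P w ^ 2)) =
      1 + 2 * whittakerY m w * (2 * m) := by
    simp only [LoopData.P, whittakerY]
    field_simp
    ring
  have e2 : (2 * (w ^ 2 - 1) ^ 2 / (-4 * m)) ^ 2 * ((whittakerData m μ b ν).c * (q / 2) /
        ((whittakerData m μ b ν).P w * (w ^ 2 - 1))) = 2 * whittakerY m w * q := by
    simp only [LoopData.P, whittakerY]
    field_simp
  rw [e1, e2]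
  simp only [map_add, map_mul, map_one, map_ofNat]
  ring

theorem whittaker_linear (hm : m ≠ 0) (hb : b ≠ 0) :
    (C (2 * ((2 : ℕ) - 3) * (w ^ 2 - 1) / (b * (-4 * m))) : PowerSeries ℂ) =
      2 * C b⁻¹ * C (whittakerY m w) := by
  rw [← map_ofNat C, ← map_mul, ← map_mul]
  congr 1
  rw [whittakerY]
  field_simp
  norm_num

theorem whittaker_riccati (hm : m ≠ 0) (hb : b ≠ 0) (hw : w ≠ 0) (hw1 : w ^ 2 - 1 ≠ 0) :
    (whittakerData m μ b ν).u (-4 * m) b w ^ 2 +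
      X * C (2 * b) * (whittakerData m μ b ν).u1 (-4 * m) b w +
      2 * (X * C b⁻¹) * C (whittakerY m w) * (whittakerData m μ b ν).u (-4 * m) b w =
      1 + 2 * C (whittakerY m w) * (gammaA m μ b ν - X * C b⁻¹) := by
  have h := LoopData.riccati_u (D := whittakerData m μ b ν) (κ := -4 * m) (b := b) (by norm_num)
    (by simpa using hm) (by simpa using hm) hb rfl hw hw1
  rw [whittaker_rhs hm hw1, whittaker_linear hm hb] at h
  rw [gammaA, map_add]
  linear_combination h

/-- The operator `2 b ħ x ∂ + x + γ`, with `γ = gammaA`, that shifts `ν` by `-2 β` multiplies the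
wave function of the Whittaker curve by this factor. -/
def whittakerShift (m μ b ν w : ℂ) : PowerSeries ℂ :=
  C (whittakerX m w) * (whittakerData m μ b ν).u (-4 * m) b w + C (whittakerX m w) + gammaA m μ b ν

/-- The derivative of `whittakerShift` with respect to `x`. -/
def whittakerShift1 (m μ b ν w : ℂ) : PowerSeries ℂ :=
  (whittakerData m μ b ν).u (-4 * m) b w +
    C (whittakerX m w) * (whittakerData m μ b ν).u1 (-4 * m) b w + 1

theorem hasD_whittakerShift (hm : m ≠ 0) (hw : w ≠ 0) (hw1 : w ^ 2 - 1 ≠ 0) :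
    HasD (whittakerShift m μ b ν) (C (dxdw (-4 * m) w) * whittakerShift1 m μ b ν w) w := by
  have h := HasD.scalar (hasDerivAt_whittakerX (m := m) hw1)
  refine (((h.mul (LoopData.hasD_u (D := whittakerData m μ b ν) (by norm_num) (by simpa using hm)
    (by simpa using hm) b hw hw1)).add h).add (hasD_const (gammaA m μ b ν))).congr_deriv ?_
  rw [whittakerShift1]
  ring

theorem coeff_zero_gammaA : coeff 0 (gammaA m μ b ν) = 2 * m := by simp [gammaA]

theorem coeff_zero_whittakerShift (hm : m ≠ 0) (hw1 : w ^ 2 - 1 ≠ 0) :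
    coeff 0 (whittakerShift m μ b ν w) ≠ 0 := by
  have h := sq_sub_one_ne hw1
  have e : coeff 0 (whittakerShift m μ b ν w) = 2 * m * (w - 1) / (w + 1) := by
    have h1 := h.1
    have h2 := h.2
    have e2 : w ^ 2 - 1 = (w - 1) * (w + 1) := by ring
    rw [whittakerShift, map_add, map_add, coeff_C_mul, LoopData.coeff_zero_u, coeff_C, if_pos rfl,
      coeff_zero_gammaA, LoopData.P, whittakerX]
    simp only
    rw [e2]
    field_simp
    ring
  rw [e]
  exact div_ne_zero (mul_ne_zero (mul_ne_zero two_ne_zero hm) h.1) h.2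

theorem whittakerShift_riccati (hm : m ≠ 0) (hb : b ≠ 0) (hw : w ≠ 0) (hw1 : w ^ 2 - 1 ≠ 0) :
    X * C (2 * b) * C (whittakerX m w) * whittakerShift1 m μ b ν w = -whittakerShift m μ b ν w ^ 2 +
      whittakerShift m μ b ν w * (2 * C (whittakerX m w) + gammaA m μ b ν + gammaB m μ b ν) -
      gammaA m μ b ν * gammaB m μ b ν :=
  whittaker_shift_riccati (whittakerX_mul_Y hm hw1) (whittaker_riccati hm hb hw hw1) rfl rfl rfl

theorem whittaker_shift_u (hm : m ≠ 0) (hb : b ≠ 0) (hw : w ≠ 0) (hw1 : w ^ 2 - 1 ≠ 0) :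
    (whittakerData m μ b (ν - 2 * b ^ 2)).u (-4 * m) b w = (whittakerData m μ b ν).u (-4 * m) b w +
      X * (C (2 * b) * (whittakerShift1 m μ b ν w * (whittakerShift m μ b ν w)⁻¹)) := by
  set A := whittakerShift m μ b ν with hA
  set A' := whittakerShift1 m μ b ν with hA'
  set Γ := gammaA m μ b ν with hΓ
  set G := gammaB m μ b ν with hG
  have hAi : ∀ w, w ^ 2 - 1 ≠ 0 → A w * (A w)⁻¹ = 1 := fun w h =>
    mul_inv_cancel_of_coeff (coeff_zero_whittakerShift hm h)
  have e1 : ∀ w, w ≠ 0 → w ^ 2 - 1 ≠ 0 → (whittakerData m μ b ν).u (-4 * m) b w +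
      X * (C (2 * b) * (A' w * (A w)⁻¹)) = 1 + C (whittakerY m w) * (G - Γ * G * (A w)⁻¹) := by
    intro w hw hw1
    rw [← whittaker_shift_eq (whittakerX_mul_Y hm hw1) (whittakerShift_riccati hm hb hw hw1) rfl
      (hAi w hw1)]
    ring
  rw [e1 w hw hw1]
  refine LoopData.u_eq_of_riccati (D := whittakerData m μ b ν)
    (D' := whittakerData m μ b (ν - 2 * b ^ 2))
    (g := fun w => 1 + C (whittakerY m w) * (G - Γ * G * (A w)⁻¹))
    (g1 := fun w => -C (whittakerY m w) ^ 2 * (G - Γ * G * (A w)⁻¹) +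
      C (whittakerY m w) * (Γ * G) * (A' w * (A w)⁻¹ * (A w)⁻¹)) (by norm_num) (by simpa using hm)
    (by simpa using hm) hb rfl rfl rfl (fun w hw hw1 => ?_) (fun w hw hw1 => ?_)
    (fun w hw hw1 => ?_) hw hw1
  · have h := (hasD_const 1).add ((HasD.scalar (hasDerivAt_whittakerY hm hw1)).mul
    ((hasD_const G).add
      ((hasD_const (-(Γ * G))).mul ((hasD_whittakerShift (μ := μ) (b := b) (ν := ν) hm hw hw1).inv
        (coeff_zero_whittakerShift hm hw1)))))
    refine (h.congr (Eventually.of_forall fun t => ?_)).congr_deriv ?_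
    · simp only [hA]
      ring
    · rw [map_mul, map_neg, map_pow]
      ring
  · rw [whittaker_rhs hm hw1, whittaker_linear hm hb]
    have h := whittaker_shift_solves (whittakerX_mul_Y hm hw1)
      (whittakerShift_riccati (μ := μ) (ν := ν) hm hb hw hw1) rfl (hAi w hw1)
    have e : C (refinement b * μ - (ν - 2 * b ^ 2) / b) =
        C (refinement b * μ - ν / b) + (C (2 * b) : PowerSeries ℂ) := by
      rw [← map_add]
      congr 1
      field_simp
      ring
    have e2 : Γ = C (2 * m) + X * (C (refinement b * μ - ν / b) + C b⁻¹) := by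
      rw [hΓ, gammaA, map_add]
    rw [e]
    linear_combination h + 2 * C (whittakerY m w) * e2
  · rw [← e1 w hw hw1, map_add, coeff_zero_X_mul, add_zero]

variable (m μ b ν) in
/-- The shift factor, normalised to be regular and invertible at both points at infinity. -/
def whittakerNormal : ℂ → PowerSeries ℂ :=
  (whittakerData m μ b ν).normalForm b
    (fun w => (w + 1) / m * (b * (w + 1) / (4 * w ^ 2) +
      (refinement b * μ - ν / b) / 2 / w)) (fun w => -(w + 1) ^ 2 / m)

theorem whittakerNormal_eq (hm : m ≠ 0) (hb : b ≠ 0) (hw : w ≠ 0) (hw1 : w ^ 2 - 1 ≠ 0) :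
    whittakerNormal m μ b ν w = C ((w + 1) / (2 * m * (w - 1))) * whittakerShift m μ b ν w := by
  obtain ⟨h1, h2⟩ := sq_sub_one_ne hw1
  have e2 : w ^ 2 - 1 = (w - 1) * (w + 1) := by ring
  rw [whittakerNormal, LoopData.normalForm_eq (φ := (w + 1) / (2 * m * (w - 1)))
    (α := whittakerX m w * (2 * (w ^ 2 - 1) ^ 2 / (-4 * m))) (x0 := whittakerX m w + 2 * m)
    (x1 := (refinement b * μ - ν / b) + b⁻¹) hb hw hw1]
  · rw [whittakerShift, LoopData.u, gammaA, map_mul, map_add]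
    ring
  · simp only [LoopData.P, whittakerX, e2]
    field_simp
    ring
  · simp only [whittakerX, LoopData.subleading, refinement, e2]
    field_simp
    ring
  · simp only [whittakerX, e2]
    field_simp

theorem differentiableAt_whittakerNormal (hm : m ≠ 0) (hw : w ≠ 0) (j : ℕ) :
    DifferentiableAt ℂ (fun t => coeff j (whittakerNormal m μ b ν t)) w := by
  refine LoopData.differentiableAt_normalForm (by norm_num) (by simpa using hm) hw ?_ (by fun_prop) j
  fun_prop (disch := simp [hw])

/-- The value at `∞₊` follows from the Riccati equation for the shift factor, in which the terms
with a derivative vanish in the limit `w → 1`. -/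
theorem whittakerNormal_one (hm : m ≠ 0) (hb : b ≠ 0) :
    C (4 * m ^ 2) * whittakerNormal m μ b ν 1 = gammaA m μ b ν * gammaB m μ b ν := by
  set At := whittakerNormal m μ b ν with hAt
  set F : ℂ → PowerSeries ℂ := fun w => PowerSeries.mk fun j => deriv (fun t => coeff j
    (At t)) w with hF
  have hd : ∀ w, w ≠ 0 → HasD At (F w) w := fun w hw j => by
    simpa only [hF, coeff_mk] using (differentiableAt_whittakerNormal hm hw j).hasDerivAt
  obtain ⟨F', hF'⟩ : ∃ F', HasD F F' 1 := exists_hasD fun j => by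
    simp only [hF, coeff_mk]
    refine (DifferentiableOn.deriv (s := {w : ℂ | w ≠ 0}) (fun w hw =>
      (differentiableAt_whittakerNormal hm hw j).differentiableWithinAt) isOpen_ne).differentiableAt
      (isOpen_ne.mem_nhds one_ne_zero)
  have dsc : ∀ {s : ℂ → ℂ}, DifferentiableAt ℂ s 1 → HasD (fun t => C (s t)) (C (deriv s 1)) 1 :=
    fun h => HasD.scalar h.hasDerivAt
  have h11 : (1 : ℂ) + 1 ≠ 0 := by norm_num
  -- the left side of the Riccati equation in terms of `At`, which extends continuously to `w = 1`
  have key := ((((dsc (s := fun w => -(2 * m * (w - 1) / (w + 1)) ^ 2)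
      (by fun_prop (disch := exact h11))).mul (hd 1 one_ne_zero)).mul (hd 1 one_ne_zero)).add
    (((dsc (s := fun w => 16 * m ^ 2 / (w + 1) ^ 2)
      (by fun_prop (disch := exact pow_ne_zero 2 h11))).mul (hd 1 one_ne_zero)).add
    (((dsc (s := fun w => 2 * m * (w - 1) / (w + 1)) (by fun_prop (disch := exact h11))).mul
      ((hd 1 one_ne_zero))).mul (hasD_const (gammaA m μ b ν + gammaB m μ b ν))))).add
    ((hasD_const (X * C (2 * b))).mul (((dsc (s := fun w => 2 * m * (w - 1) / (w * (w + 1)))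
      (by fun_prop (disch := norm_num))).mul (hd 1 one_ne_zero)).add
      ((dsc (s := fun w => m * (w - 1) ^ 2 / w) (by fun_prop (disch := norm_num))).mul hF')))
  have hAeq : ∀ w, w ≠ 0 → w - 1 ≠ 0 → w + 1 ≠ 0 → w ^ 2 - 1 ≠ 0 →
      whittakerShift m μ b ν w = C (2 * m * (w - 1) / (w + 1)) * At w := by
    intro w hw h1 h2 hw1
    rw [hAt, whittakerNormal_eq hm hb hw hw1, ← mul_assoc, ← map_mul]
    have : 2 * m * (w - 1) / (w + 1) * ((w + 1) / (2 * m * (w - 1))) = 1 := by field_simp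
    rw [this, map_one, one_mul]
  have h := key.eq_of_eventually_eq (a := gammaA m μ b ν * gammaB m μ b ν) ?_
  · have e : (16 * m ^ 2 / (1 + 1) ^ 2 : ℂ) = 4 * m ^ 2 := by ring
    rw [← h, ← e]
    simp
  · have h0 : ∀ᶠ w : ℂ in 𝓝[≠] 1, w ≠ 0 ∧ w + 1 ≠ 0 :=
      nhdsWithin_le_nhds ((eventually_ne_nhds one_ne_zero).and
        ((by fun_prop : ContinuousAt (fun t : ℂ => t + 1) 1).eventually_ne h11))
    filter_upwards [h0, self_mem_nhdsWithin] with w ⟨hw, h2⟩ hne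
    have h1 : w - 1 ≠ 0 := sub_ne_zero.2 hne
    have e2 : w ^ 2 - 1 = (w - 1) * (w + 1) := by ring
    have hw1 : w ^ 2 - 1 ≠ 0 := by rw [e2]; exact mul_ne_zero h1 h2
    have E := whittakerShift_riccati (μ := μ) (ν := ν) hm hb hw hw1
    -- The derivative of the shift factor in `w`, computed before and after the normalisation.
    have e4 : C (dxdw (-4 * m) w) * whittakerShift1 m μ b ν w =
        C (4 * m / (w + 1) ^ 2) * At w + C (2 * m * (w - 1) / (w + 1)) * F w := by
      have d1 : HasDerivAt (fun t : ℂ => 2 * m * (t - 1) / (t + 1)) (4 * m / (w + 1) ^ 2) w :=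
        ((((hasDerivAt_id w).sub_const 1).const_mul (2 * m)).fun_div
          ((hasDerivAt_id w).add_const 1) h2).congr_deriv (by simp; ring)
      refine (hasD_whittakerShift hm hw hw1).unique (((HasD.scalar d1).mul (hd w hw)).congr ?_)
      have hn : ∀ᶠ t : ℂ in 𝓝 w, t ≠ 0 ∧ t - 1 ≠ 0 ∧ t + 1 ≠ 0 := (eventually_ne_nhds hw).and
        (((by fun_prop : ContinuousAt (fun t : ℂ => t - 1) w).eventually_ne h1).and
        ((by fun_prop : ContinuousAt (fun t : ℂ => t + 1) w).eventually_ne h2))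
      refine hn.mono fun t ⟨ht, ht1, ht2⟩ => ?_
      have ht3 : t ^ 2 - 1 ≠ 0 := by
        rw [show t ^ 2 - 1 = (t - 1) * (t + 1) by ring]
        exact mul_ne_zero ht1 ht2
      exact hAeq t ht ht1 ht2 ht3
    have e5 : C (whittakerX m w) * whittakerShift1 m μ b ν w =
        -(C (2 * m * (w - 1) / (w * (w + 1))) * At w + C (m * (w - 1) ^ 2 / w) * F w) := by
      have c1 : (-(w ^ 2 - 1) / (2 * w)) * dxdw (-4 * m) w = whittakerX m w := by
        rw [dxdw, whittakerX]
        field_simp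
      have c2 : (-(w ^ 2 - 1) / (2 * w)) * (4 * m / (w + 1) ^ 2) =
          -(2 * m * (w - 1) / (w * (w + 1))) := by
        rw [e2]
        field_simp
        ring
      have c3 : (-(w ^ 2 - 1) / (2 * w)) * (2 * m * (w - 1) / (w + 1)) = -(m * (w - 1) ^ 2 /
        w) := by
        rw [e2]
        field_simp
      have c1' := congrArg (C : ℂ → PowerSeries ℂ) c1
      have c2' := congrArg (C : ℂ → PowerSeries ℂ) c2
      have c3' := congrArg (C : ℂ → PowerSeries ℂ) c3
      rw [map_mul] at c1' c2' c3'
      rw [map_neg] at c2' c3'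
      linear_combination C (-(w ^ 2 - 1) / (2 * w)) * e4 - whittakerShift1 m μ b ν w * c1' +
        At w * c2' + F w * c3'
    have e6 : (C (16 * m ^ 2 / (w + 1) ^ 2) : PowerSeries ℂ) =
        2 * C (2 * m * (w - 1) / (w + 1)) * C (whittakerX m w) := by
      rw [← map_ofNat C, ← map_mul, ← map_mul]
      congr 1
      rw [whittakerX, e2]
      field_simp
      ring
    rw [hAeq w hw h1 h2 hw1] at E
    rw [map_neg, map_pow]
    linear_combination -E + At w * e6 + X * C (2 * b) * e5

/-- The coefficient of `V(ν - 2β) - V(ν)` on the Whittaker curve. -/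
theorem whittaker_voros_sub (hm : m ≠ 0) (hb : b ≠ 0) {z : ℂ} (hz : z.im ≠ 0) {k : ℕ}
    (hk1 : 1 ≤ k) :
    (k : ℂ) * (coeff k ((whittaker m μ).voros z b (ν - 2 * b ^ 2)) -
      coeff k ((whittaker m μ).voros z b ν)) =
      (-1) ^ (k + 1) * (((refinement b * μ - ν / b + b⁻¹) / 2) / m) ^ k +
      (-1) ^ (k + 1) *
        (((refinement b * μ - ν / b + 2 * b - b⁻¹) / 2) / m) ^ k := by
  have h := voros_sub (uniformised_whittaker m μ (refinement b) ν hm)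
    (uniformised_whittaker m μ (refinement b) (ν - 2 * b ^ 2) hm) rfl rfl hb
    (A := whittakerShift m μ b ν) (A' := whittakerShift1 m μ b ν)
    (At := whittakerNormal m μ b ν) (fun w hw hw1 => hasD_whittakerShift hm hw hw1)
    (fun w _ hw1 => coeff_zero_whittakerShift hm hw1)
    (fun w hw hw1 => whittaker_shift_u hm hb hw hw1)
    (fun w hw j => differentiableAt_whittakerNormal hm hw j)
    (fun w hw => by rw [whittakerNormal, LoopData.coeff_zero_normalForm]; exact one_ne_zero)
    (fun w hw hw1 => ?_) hk1 hz
  · have h1 : ∀ a, (C (2 * m) + X * C a : PowerSeries ℂ) = C (2 * m) * (1 + C (a / 2 / m) * X) := by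
      intro a
      have e : a = 2 * m * (a / 2 / m) := by field_simp
      have e' := congrArg (C : ℂ → PowerSeries ℂ) e
      rw [map_mul] at e'
      linear_combination X * e'
    have hB : gammaB m μ b ν =
        C (2 * m) + X * C (refinement b * μ - ν / b + 2 * b - b⁻¹) := by
      rw [gammaB, gammaA]
      simp only [map_add, map_sub]
      ring
    have hm1 : 4 * m ^ 2 ≠ 0 := by simpa using hm
    have hm2 : 2 * m ≠ 0 := mul_ne_zero two_ne_zero hm
    rw [h, ← logD_C_mul hm1 (whittakerNormal m μ b ν 1), whittakerNormal_one hm hb, hB, gammaA, h1,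
      h1,
      logD_mul (by simpa using hm) (by simpa using hm), logD_C_mul hm2, logD_C_mul hm2, map_add,
      coeff_logD_linear _ hk1, coeff_logD_linear _ hk1, whittakerNormal,
      LoopData.normalForm_of_eq_zero (by simp), coeff_logD_linear _ hk1]
    simp [show k ≠ 0 by omega]
  · obtain ⟨h1, h2⟩ := sq_sub_one_ne hw1
    rw [whittakerNormal_eq hm hb hw hw1, logD_C_mul]
    exact div_ne_zero h2 (mul_ne_zero (mul_ne_zero two_ne_zero hm) h1)

end Whittaker

end

/-! ### The difference equations -/

section

open PowerSeries

variable {b m μ u : ℂ}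

theorem weber_voros (hb : b ≠ 0) (hm : m ≠ 0) (hu : u.im ≠ 0) {s : ℂ} (hs : s ^ 2 = m) (ν : ℂ) :
    (weber s μ).voros u b (ν + 2 * b ^ 2) - (weber s μ).voros u b ν =
      -logSeries m ((refinement b * μ - ν / b) / 2 - b / 2) + C (Complex.log m) := by
  have hs0 : s ≠ 0 := by
    rintro rfl
    exact hm (by rw [← hs]; ring)
  ext k
  rcases Nat.eq_zero_or_pos k with rfl | hk
  · simp [SpectralCurve.voros, logSeries]
  · have h := weber_voros_sub (μ := μ) (ν := ν) hs0 hb hu hk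
    have hk0 : (k : ℂ) ≠ 0 := by exact_mod_cast hk.ne'
    rw [hs] at h
    rw [map_sub, map_add, map_neg, logSeries, coeff_mk, if_neg hk.ne', coeff_C, if_neg hk.ne',
      add_zero, ← neg_div, eq_div_iff hk0, ← h, mul_comm]

theorem whittaker_voros (hb : b ≠ 0) (hm : m ≠ 0) (hu : u.im ≠ 0) (ν : ℂ) :
    (whittaker m μ).voros u b (ν - 2 * b ^ 2) - (whittaker m μ).voros u b ν =
      logSeries m ((refinement b * μ - ν / b + 2 * b - b⁻¹) / 2)
        + logSeries m ((refinement b * μ - ν / b + b⁻¹) / 2)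
        - 2 * C (Complex.log m) := by
  have e2 : (2 * C (Complex.log m) : PowerSeries ℂ) = C (2 * Complex.log m) := by
    rw [map_mul, map_ofNat]
  rw [e2]
  ext k
  rcases Nat.eq_zero_or_pos k with rfl | hk
  · simp [SpectralCurve.voros, logSeries]
    ring
  · have h := whittaker_voros_sub (μ := μ) (ν := ν) hm hb hu hk
    have hk0 : (k : ℂ) ≠ 0 := by exact_mod_cast hk.ne'
    rw [map_sub, map_sub, map_add, logSeries, logSeries, coeff_mk, coeff_mk, if_neg hk.ne',
      if_neg hk.ne', coeff_C, if_neg hk.ne', sub_zero, ← add_div, eq_div_iff hk0, mul_comm, h, add_comm]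

end

end

end RefinedTR

open RefinedTR RefinedTR.SpectralCurve in
theorem mainTheorem5 (b m μ u : ℂ) (hb : b ≠ 0) (hm : m ≠ 0) (hu : u.im ≠ 0) :
    -- the Weber curve
    (∀ s : ℂ, s ^ 2 = m →
      (∀ ν : ℂ, (RefinedTR.weber s μ).VorosConverges u b ν) ∧
      (∀ ν : ℂ,
        (RefinedTR.weber s μ).voros u b (ν + 2 * b ^ 2) - (RefinedTR.weber s μ).voros u b ν =
          -RefinedTR.logSeries m
              (RefinedTR.SpectralCurve.refinement b * μ / 2 + RefinedTR.eps₂ b / 2 * ν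
                - RefinedTR.eps₁ b / 2)
            + PowerSeries.C (Complex.log m)) ∧
      (RefinedTR.weber s μ).voros u b (b ^ 2) - (RefinedTR.weber s μ).voros u b (-b ^ 2) =
        -RefinedTR.logSeries m (RefinedTR.SpectralCurve.refinement b * μ / 2)
          + PowerSeries.C (Complex.log m)) ∧
    -- the Whittaker curve
    ((∀ ν : ℂ, (RefinedTR.whittaker m μ).VorosConverges u b ν) ∧
      (∀ ν : ℂ,
        (RefinedTR.whittaker m μ).voros u b (ν - 2 * b ^ 2) - (RefinedTR.whittaker m μ).voros u b ν =
          RefinedTR.logSeries m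
              (RefinedTR.SpectralCurve.refinement b * μ / 2 + RefinedTR.eps₂ b / 2 * ν
                + RefinedTR.eps₁ b / 2 + (RefinedTR.eps₁ b + RefinedTR.eps₂ b) / 2)
            + RefinedTR.logSeries m
              (RefinedTR.SpectralCurve.refinement b * μ / 2 + RefinedTR.eps₂ b / 2 * ν
                + RefinedTR.eps₁ b / 2 - (RefinedTR.eps₁ b + RefinedTR.eps₂ b) / 2)
            - 2 * PowerSeries.C (Complex.log m)) ∧
      (RefinedTR.whittaker m μ).voros u b (b ^ 2) - (RefinedTR.whittaker m μ).voros u b (-b ^ 2) =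
        -RefinedTR.logSeries m
            (RefinedTR.SpectralCurve.refinement b * μ / 2 + RefinedTR.SpectralCurve.refinement b / 2)
          - RefinedTR.logSeries m
            (RefinedTR.SpectralCurve.refinement b * μ / 2 - RefinedTR.SpectralCurve.refinement b / 2)
          + 2 * PowerSeries.C (Complex.log m)) := by
  refine ⟨fun s hs => ⟨fun ν => ?_, fun ν => ?_, ?_⟩, fun ν => ?_, fun ν => ?_, ?_⟩
  · have hs0 : s ≠ 0 := by
      rintro rfl
      exact hm (by rw [← hs]; ring)
    exact vorosConverges (uniformised_weber s μ (refinement b) ν hs0) rfl hu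
  · rw [weber_voros hb hm hu hs]
    congr 3
    rw [eps₁, eps₂]
    ring
  · have h := weber_voros (μ := μ) hb hm hu hs (-b ^ 2)
    rw [show -b ^ 2 + 2 * b ^ 2 = b ^ 2 by ring] at h
    rw [h]
    congr 3
    field_simp
    ring
  · exact vorosConverges (uniformised_whittaker m μ (refinement b) ν hm) rfl hu
  · rw [whittaker_voros hb hm hu]
    congr 3 <;> rw [eps₁, eps₂] <;> ring
  · have h := whittaker_voros (μ := μ) hb hm hu (b ^ 2)
    rw [show b ^ 2 - 2 * b ^ 2 = -b ^ 2 by ring] at h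
    have e1 : (refinement b * μ - b ^ 2 / b + 2 * b - b⁻¹) / 2 =
        refinement b * μ / 2 + refinement b / 2 := by
      rw [refinement]
      field_simp
      ring
    have e2 : (refinement b * μ - b ^ 2 / b + b⁻¹) / 2 =
        refinement b * μ / 2 - refinement b / 2 := by
      rw [refinement]
      field_simp
      ring
    rw [e1, e2] at h
    linear_combination -h
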